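/- **Theorem (two-phase thin film Muskat system with surface tension).** Let $\rho_\pm,\mu_\pm,G,\gamma_f,\gamma_h>0$ and put $$b=\rho_+,\quad b_\mu=\tfrac{\mu_-}{\mu_+}b,\quad b_\rho=\tfrac{\rho_-}{\rho_+}b,\qquad A=\tfrac{\gamma_h}{G},\quad A_\mu=\tfrac{\mu_-}{\mu_+}A,\quad A_\gamma=\tfrac{\gamma_f+\gamma_h}{\gamma_h}A .$$ Let $\mathbb T=[-\pi,\pi]$ with periodic boundary conditions, $\langle u\rangle=\frac1{2\pi}\int_{\mathbb T}u\,dx$, $\hat u(k)=\frac1{2\pi}\int_{\mathbb T}u(x)e^{-ikx}dx$, and let $\dot A^s(\mathbb T)$ be the space of zero-mean $u\in L^1(\mathbb T)$ with $\|u\|_{\dot A^s}=\sum_{k\in\mathbb Z}|k|^s|\hat u(k)|<\infty$; write $\dot A=\dot A^0$ and $\mathcal E_0(u,v)=\|u\|_{\dot A^0}+\|v\|_{\dot A^0}$. Let $f_0,g_0\in L^1(\mathbb T)$ be real functions such that $\bar f_0=f_0-\langle f_0\rangle$ and $\bar g_0=g_0-\langle g_0\rangle$ belong to $\dot A(\mathbb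 T)$, and put $E_0=\mathcal E_0(\bar f_0,\bar g_0)$ and $$\sigma_{1,A}=\langle f_0\rangle A_\gamma-\langle g_0\rangle A_\mu-(A_\mu+2A_\gamma+2A)E_0,\qquad \sigma_{2,A}=\langle g_0\rangle A_\mu-\langle f_0\rangle A-(A_\mu+2A_\gamma+2A)E_0,$$ $$\sigma_{1,b}=\langle f_0\rangle b_\rho-\langle g_0\rangle b_\mu-(2b_\rho+2b+4b_\mu)E_0,\qquad \sigma_{2,b}=\langle g_0\rangle b_\mu-\langle f_0\rangle b-(2b_\rho+2b+4b_\mu)E_0 .$$ Assume $E_0<\min\{\langle f_0\rangle,\langle g_0\rangle\}$ and $\min\{\sigma_{1,A},\sigma_{2,A},\sigma_{1,b},\sigma_{2,b}\}>0$, and set $\delta_A=\min\{\sigma_{1,A},\sigma_{2,A}\}$, $\delta_b=\min\{\sigma_{1,b},\sigma_{2,b}\}$. Consider the system $$\partial_t\bar f=-\partial_x\big[(\bar f+\langle f_0\rangle)(A_\gamma\partial_x^3\bar f+A\partial_x^3\bar g-b_\rho\partial_x\bar f-b\,\partial_x\bar g)\big],$$ $$\partial_t\bar g=-\partial_x\big[(\bar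 g+\langle g_0\rangle)(A_\mu\partial_x^3\bar f+A_\mu\partial_x^3\bar g-b_\mu\partial_x\bar f-b_\mu\partial_x\bar g)\big]$$ with initial datum $(\bar f_0,\bar g_0)$. A weak solution on $(0,T)$ is a pair of zero-mean functions $(\bar f,\bar g)\in L^1(0,T;W^{3,1}(\mathbb T))^2$ for which the two fluxes (in square brackets), denoted $J$ and $K$, are integrable on $(0,T)\times\mathbb T$, with $$-\int_{\mathbb T}\bar f_0\phi(0)\,dx-\int_0^T\!\!\int_{\mathbb T}\bar f\,\partial_t\phi\,dx\,dt=\int_0^T\!\!\int_{\mathbb T}J\,\partial_x\phi\,dx\,dt,\qquad -\int_{\mathbb T}\bar g_0\psi(0)\,dx-\int_0^T\!\!\int_{\mathbb T}\bar g\,\partial_t\psi\,dx\,dt=\int_0^T\!\!\int_{\mathbb T}K\,\partial_x\psi\,dx\,dt$$ for all $\phi,\psi\in C^1_c([0,T)\times\mathbb T)$. Then: a) (Existence) There is a pair $(\bar f,\bar g)$ of functions on $[0,\infty)\times\mathbb T$ that for every $T>0$ is a weak solution on $(0,T)$ and satisfies, for every $\alpha\in[0,\frac12)$, $$(\bar f,\bar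 g)\in\Big(L^\infty([0,T]\times\mathbb T)\cap L^{4/3}(0,T;W^{3,\infty}(\mathbb T))\cap L^1(0,T;C^{3+\alpha}(\mathbb T))\cap\mathcal M(0,T;W^{4,\infty}(\mathbb T))\cap L^2(0,T;\dot H^2(\mathbb T))\Big)^2,$$ where $\mathcal M(0,T;X)$ is the space of $X$-valued Radon measures (of finite variation) on $[0,T]$, a function $u$ being identified with the measure $u\,dt$, and $\dot H^2$ is the space of zero-mean functions in $H^2$. b) (Exponential decay) This solution satisfies, for all $T\ge 0$ (for a suitable choice of its representative), $$\|\bar f(T)\|_{L^\infty}+\|\bar g(T)\|_{L^\infty}\le\mathcal E_0(\bar f_0,\bar g_0)\,e^{-(\delta_A+\delta_b)T}.$$ c) (Uniqueness) For every $T>0$, any two weak solutions on $(0,T)$ with initial datum $(\bar f_0,\bar g_0)$ that both belong to $L^1(0,T;\dot A^4(\mathbb T))^2$ coincide almost everywhere on $(0,T)\times\mathbb T$. -/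

import Mathlib

open MeasureTheory Set Filter
open scoped ENNReal NNReal ContDiff Topology

noncomputable section

namespace ThinFilm

/-! ### Functions on the torus

A function on the torus `𝕋 = [-π, π]` is represented by its values on `(-π, π]`; periodicity enters
through the test functions, the Fourier coefficients and the smooth representatives. -/

/-- Lebesgue measure on the torus `(-π, π]`. -/
def torus : Measure ℝ := volume.restrict (Ioc (-Real.pi) Real.pi)

/-- Lebesgue measure on `(0, T) × 𝕋`. -/
def cylinder (T : ℝ) : Measure (ℝ × ℝ) := (volume.restrict (Ioc 0 T)).prod torus

/-- The mean `⟨u⟩ = (1 / 2π) ∫ u`. -/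
def mean (u : ℝ → ℝ) : ℝ := (1 / (2 * Real.pi)) * ∫ x, u x ∂torus

/-- The zero-mean part `u - ⟨u⟩`. -/
def fluct (u : ℝ → ℝ) : ℝ → ℝ := fun x => u x - mean u

/-- The Fourier coefficient `(1 / 2π) ∫ u(x) e^{-ikx} dx` over `[-π, π]`. -/
def fourierC (u : ℝ → ℝ) (k : ℤ) : ℂ :=
  fourierCoeffOn (neg_lt_self Real.pi_pos) (fun x => (u x : ℂ)) k

/-- `v` is the `n`-th weak derivative of `u` on the torus (both integrable). -/
def IsWeakDeriv (n : ℕ) (u v : ℝ → ℝ) : Prop :=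
  Integrable u torus ∧ Integrable v torus ∧
    ∀ φ : ℝ → ℝ, ContDiff ℝ ∞ φ → Function.Periodic φ (2 * Real.pi) →
      ∫ x, u x * iteratedDeriv n φ x ∂torus = (-1) ^ n * ∫ x, v x * φ x ∂torus

/-! ### Norms of the function spaces

Each norm takes values in `[0, ∞]`, and the space consists of the functions of finite norm. -/

/-- The norm of `W^{n,p}(𝕋)`: `‖u‖_{L^p} + ‖∂ₓⁿ u‖_{L^p}`. The weak derivative is unique almost
everywhere, so the infimum picks out its value, and is `∞` if there is none. -/
def sobolevNorm (n : ℕ) (p : ℝ≥0∞) (u : ℝ → ℝ) : ℝ≥0∞ :=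
  ⨅ (v : ℝ → ℝ) (_ : IsWeakDeriv n u v), eLpNorm u p torus + eLpNorm v p torus

/-- The norm of `C^{k+α}(𝕋)`: the sum of the sup norms of the derivatives up to order `k` and of the
`α`-Hölder seminorm of the `k`-th one, for the `2π`-periodic `C^k` representative of `u` (unique if
there is one; the value is `∞` if there is none). -/
def holderNorm (k : ℕ) (α : ℝ≥0) (u : ℝ → ℝ) : ℝ≥0∞ :=
  ⨅ (w : ℝ → ℝ) (_ : ContDiff ℝ k w ∧ Function.Periodic w (2 * Real.pi) ∧ u =ᵐ[torus] w),
    (∑ j ∈ Finset.range (k + 1), ⨆ x : ℝ, ‖iteratedDeriv j w x‖ₑ)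
      + eHolderNorm α (iteratedDeriv k w)

open Classical in
/-- The norm `∑ₖ |k|^s |û(k)|` of the space `Ȧ^s(𝕋)` of integrable functions of zero mean; it is `∞`
for functions that are not integrable or not of zero mean. -/
def wienerNorm (s : ℝ) (u : ℝ → ℝ) : ℝ≥0∞ :=
  if Integrable u torus ∧ mean u = 0 then
    ∑' k : ℤ, (k.natAbs : ℝ≥0∞) ^ s * ‖fourierC u k‖ₑ
  else ⊤

/-! ### Spaces of functions of time with values in a space of functions on the torus -/

/-- `f ∈ L^p(0,T;X)` (Bochner), where `X` is the space with norm `N`: `f` is almost everywhere the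
limit in `X` of `X`-valued simple functions, and `∫₀ᵀ ‖f(t)‖_X^p dt < ⊤`. -/
def MemBochner (p : ℝ) (T : ℝ) (N : (ℝ → ℝ) → ℝ≥0∞) (f : ℝ → ℝ → ℝ) : Prop :=
  (∃ s : ℕ → SimpleFunc ℝ (ℝ → ℝ), (∀ n t, N (s n t) < ⊤) ∧
    ∀ᵐ t ∂(volume.restrict (Ioc 0 T)),
      Tendsto (fun n => N (fun x => f t x - s n t x)) atTop (𝓝 0)) ∧
  ∫⁻ t in Ioc 0 T, N (f t) ^ p < ⊤

/-- `f ∈ 𝓜(0,T;X)`, where `X` is the space with norm `N`: the set function `B ↦ ∫_B f(t) dt` on the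
Borel subsets of `[0,T]` is an `X`-valued measure of finite total variation. (For the complete spaces
used here, countable additivity in `X` follows from the finite total variation.) -/
def MemMeasures (T : ℝ) (N : (ℝ → ℝ) → ℝ≥0∞) (f : ℝ → ℝ → ℝ) : Prop :=
  ∃ C : ℝ≥0, ∀ (n : ℕ) (B : Fin n → Set ℝ), (∀ i, MeasurableSet (B i)) →
    (∀ i, B i ⊆ Icc 0 T) → Pairwise (fun i j => Disjoint (B i) (B j)) →
    ∑ i, N (fun x => ∫ t in B i, f t x) ≤ C

/-- `F = ∂ₓⁿ f` on `(0,T) × 𝕋` in the weak sense, with `F` integrable on `(0,T) × 𝕋`. -/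
def IsSpaceDeriv (T : ℝ) (n : ℕ) (f F : ℝ → ℝ → ℝ) : Prop :=
  Integrable (fun p : ℝ × ℝ => F p.1 p.2) (cylinder T) ∧
    ∀ᵐ t ∂(volume.restrict (Ioc 0 T)), IsWeakDeriv n (f t) (F t)

/-! ### The two-phase thin film Muskat system -/

/-- The physical parameters: densities `ρ₋, ρ₊`, viscosities `μ₋, μ₊`, gravity `G` and the surface
tension coefficients `γ_f, γ_h`. The index `m` stands for `-` and `p` for `+`. -/
structure Params where
  ρm : ℝ
  ρp : ℝ
  μm : ℝ
  μp : ℝ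
  G : ℝ
  γf : ℝ
  γh : ℝ

/-- All physical parameters are positive. -/
def Params.Pos (P : Params) : Prop :=
  0 < P.ρm ∧ 0 < P.ρp ∧ 0 < P.μm ∧ 0 < P.μp ∧ 0 < P.G ∧ 0 < P.γf ∧ 0 < P.γh

def Params.b (P : Params) : ℝ := P.ρp
def Params.bμ (P : Params) : ℝ := P.μm / P.μp * P.b
def Params.bρ (P : Params) : ℝ := P.ρm / P.ρp * P.b
def Params.A (P : Params) : ℝ := P.γh / P.G
def Params.Aμ (P : Params) : ℝ := P.μm / P.μp * P.A
def Params.Aγ (P : Params) : ℝ := (P.γf + P.γh) / P.γh * P.A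

/-- `𝓔_s(f, g) = ‖f‖_{Ȧ^s} + ‖g‖_{Ȧ^s}`, for functions in `Ȧ^s(𝕋)`. -/
def energy (s : ℝ) (f g : ℝ → ℝ) : ℝ := (wienerNorm s f).toReal + (wienerNorm s g).toReal

/-- In the four constants below, `mf, mg` are the means of the initial data and `E` is the value of
`𝓔₀` at their zero-mean parts. -/
def Params.σ1A (P : Params) (mf mg E : ℝ) : ℝ :=
  mf * P.Aγ - mg * P.Aμ - (P.Aμ + 2 * P.Aγ + 2 * P.A) * E

def Params.σ2A (P : Params) (mf mg E : ℝ) : ℝ :=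
  mg * P.Aμ - mf * P.A - (P.Aμ + 2 * P.Aγ + 2 * P.A) * E

def Params.σ1b (P : Params) (mf mg E : ℝ) : ℝ :=
  mf * P.bρ - mg * P.bμ - E * (2 * P.bρ + 2 * P.b + 4 * P.bμ)

def Params.σ2b (P : Params) (mf mg E : ℝ) : ℝ :=
  mg * P.bμ - mf * P.b - E * (2 * P.bρ + 2 * P.b + 4 * P.bμ)

/-- The capillary decay rate `δ_A`. -/
def Params.δA (P : Params) (mf mg E : ℝ) : ℝ := min (P.σ1A mf mg E) (P.σ2A mf mg E)

/-- The gravity decay rate `δ_b`. -/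
def Params.δb (P : Params) (mf mg E : ℝ) : ℝ := min (P.σ1b mf mg E) (P.σ2b mf mg E)

/-- Test functions in `C¹_c([0,T) × 𝕋)`: `C¹`, `2π`-periodic in `x`, zero for `t` near `T` and
beyond. (Values at negative times play no role.) -/
def IsTest (T : ℝ) (φ : ℝ × ℝ → ℝ) : Prop :=
  ContDiff ℝ 1 φ ∧ (∀ t x, φ (t, x + 2 * Real.pi) = φ (t, x)) ∧
    ∃ T' < T, ∀ t x, T' ≤ t → φ (t, x) = 0

/-- The integral identity that is the weak form of `∂ₜ u = -∂ₓ J`, `u(0) = u₀`, on `(0,T) × 𝕋`. -/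
def WeakIdentity (T : ℝ) (u₀ : ℝ → ℝ) (u J : ℝ → ℝ → ℝ) : Prop :=
  ∀ φ : ℝ × ℝ → ℝ, IsTest T φ →
    -(∫ x, u₀ x * φ (0, x) ∂torus)
        - ∫ p, u p.1 p.2 * deriv (fun t => φ (t, p.2)) p.1 ∂(cylinder T)
      = ∫ p, J p.1 p.2 * deriv (fun x => φ (p.1, x)) p.2 ∂(cylinder T)

/-- `(f, g)`, a pair of zero-mean functions in `L¹(0,T;W^{3,1}(𝕋))`, is a weak solution on `(0,T)` of

`∂ₜ f = -∂ₓ[(f + mf) (A_γ ∂ₓ³f + A ∂ₓ³g - b_ρ ∂ₓf - b ∂ₓg)]`,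

`∂ₜ g = -∂ₓ[(g + mg) (A_μ ∂ₓ³f + A_μ ∂ₓ³g - b_μ ∂ₓf - b_μ ∂ₓg)]`

with initial datum `(f₀, g₀)`. The functions `f₁, f₃, g₁, g₃` are the space derivatives of `f, g` of
order one and three, and the two fluxes have to be integrable. -/
def IsWeakSolution (P : Params) (mf mg : ℝ) (f₀ g₀ : ℝ → ℝ) (T : ℝ) (f g : ℝ → ℝ → ℝ) : Prop :=
  Integrable (fun p : ℝ × ℝ => f p.1 p.2) (cylinder T) ∧
  Integrable (fun p : ℝ × ℝ => g p.1 p.2) (cylinder T) ∧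
  (∀ᵐ t ∂(volume.restrict (Ioc 0 T)), mean (f t) = 0 ∧ mean (g t) = 0) ∧
  ∃ f₁ f₃ g₁ g₃ J K : ℝ → ℝ → ℝ,
    IsSpaceDeriv T 1 f f₁ ∧ IsSpaceDeriv T 3 f f₃ ∧
    IsSpaceDeriv T 1 g g₁ ∧ IsSpaceDeriv T 3 g g₃ ∧
    J = (fun t x => (f t x + mf) *
      (P.Aγ * f₃ t x + P.A * g₃ t x - P.bρ * f₁ t x - P.b * g₁ t x)) ∧
    K = (fun t x => (g t x + mg) *
      (P.Aμ * f₃ t x + P.Aμ * g₃ t x - P.bμ * f₁ t x - P.bμ * g₁ t x)) ∧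
    Integrable (fun p : ℝ × ℝ => J p.1 p.2) (cylinder T) ∧
    Integrable (fun p : ℝ × ℝ => K p.1 p.2) (cylinder T) ∧
    WeakIdentity T f₀ f J ∧ WeakIdentity T g₀ g K

/-- The regularity class on `(0,T)`: `L^∞([0,T] × 𝕋)`, `L^{4/3}(0,T;W^{3,∞})`, `L¹(0,T;C^{3+α})` for
all `α ∈ [0,1/2)`, `𝓜(0,T;W^{4,∞})` and `L²(0,T;Ḣ²)`. -/
def HasRegularity (T : ℝ) (f : ℝ → ℝ → ℝ) : Prop :=
  MemLp (fun p : ℝ × ℝ => f p.1 p.2) ⊤ (cylinder T) ∧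
  MemBochner (4 / 3) T (sobolevNorm 3 ⊤) f ∧
  (∀ α : ℝ≥0, α < 1 / 2 → MemBochner 1 T (holderNorm 3 α) f) ∧
  MemMeasures T (sobolevNorm 4 ⊤) f ∧
  (MemBochner 2 T (sobolevNorm 2 2) f ∧
    ∀ᵐ t ∂(volume.restrict (Ioc 0 T)), mean (f t) = 0)

end ThinFilm

end

/-!
The argument works with Fourier coefficients: a zero-mean function is encoded by a sequence
`a : ℤ → ℂ` with `a (-k) = conj (a k)`, and `wnorm n a = ∑ |k|ⁿ |a k|` is its norm in `Ȧⁿ`.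

*Existence and decay.* For a mode equation `z' = -λ z + r` the modulus satisfies
`|z|' ≤ -λ |z| + |r|` (`norm_add_integral_le`). In the sum over all modes the diagonal linear terms
dissipate `‖f‖ + ‖g‖` in `Ȧ⁴` and `Ȧ²`, and the bilinear estimates `sum_mul_norm_conv_three_le`,
`sum_mul_norm_conv_self_le` and `sum_mul_norm_conv_one_le` bound everything else by the same norms
with the constants that occur in `σ1A, σ2A, σ1b, σ2b` (`dissipation_le`). These estimates average
over the sign of one frequency, which is possible because the unknowns are real. Hence `𝓔₀` decays
exponentially, and `∫ 𝓔₄ ≤ E₀ / δ_A`. They are applied to a Galerkin system whose vector field is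
composed with a retraction onto the ball `𝓔₀ ≤ E₀`; there the a priori bound shows that the
retraction is inactive (`exists_galerkin`). The bounds for `𝓔₀` and `∫ 𝓔₄` give equicontinuity of
each mode in time, hence convergence of a subsequence in every mode at every time, and uniformly
negligible high frequencies in the time integrals of the nonlinearity; the limit solves the
equations mode by mode (`exists_modeSolution`). All regularity classes follow from the interpolation
`‖u‖_{Ȧᵐ} ≤ (E + 1) ‖u‖_{Ȧ⁴}^{m/4}` and the absolute convergence of the Fourier series.

*Uniqueness.* Every weak solution in `L¹(0,T;Ȧ⁴)` coincides with the constructed one, which is small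
in `Ȧ⁰` (`Transported.ae_eq`). Its Fourier coefficients satisfy the integrated mode equations by the
du Bois-Reymond lemma (`ae_eq_primitive_of_test`). Since nothing bounds the weak solution
pointwise in time, the comparison is made in `H⁻¹`, for the zero-mean primitives `U, W` in `x` of
the differences of the two unknowns: `U` is absolutely continuous in time for almost every `x`
(`Transported.ae_eq_prim`), and the primitives of both solutions are bounded, by a maximum principle
for the transport equation `∂ₜf + ∂ₓ((f + m)V) = 0` (`Transported.prim_le`). The principal part of
`d/dt ∫ (U² + W²)` is a quadratic form in `∂ₓ²U, ∂ₓ²W` whose coefficients involve only the constructed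
solution; it is positive definite as `F A < G A_μ < F A_γ` for its thicknesses `F, G`
(`coercive_pointwise`). All other terms are absorbed or bounded by an integrable function of time
times `∫ (U² + W²)` (`exists_coercive`), and Gronwall's inequality gives `U = W = 0`.
-/

open scoped ComplexConjugate

noncomputable section

namespace ThinFilm

/-- The `n`-th weighted sum `∑ |k|ⁿ |a k|` of a sequence of Fourier coefficients. -/
def wnorm (n : ℕ) (a : ℤ → ℂ) : ℝ≥0∞ := ∑' k : ℤ, (k.natAbs : ℝ≥0∞) ^ n * ‖a k‖ₑ

/-- The character `x ↦ e^{ikx}`. -/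
def expo (k : ℤ) (x : ℝ) : ℂ := Complex.exp (k * x * Complex.I)

/-- The trigonometric series with coefficients `a`. -/
def trig (a : ℤ → ℂ) (x : ℝ) : ℂ := ∑' k : ℤ, a k * expo k x

/-- The real part of a trigonometric series. -/
def retrig (a : ℤ → ℂ) (x : ℝ) : ℝ := (trig a x).re

/-- The Fourier coefficients of the `n`-th derivative. -/
def dseq (n : ℕ) (a : ℤ → ℂ) (k : ℤ) : ℂ := (Complex.I * k) ^ n * a k

/-- The symmetry of the Fourier coefficients of a real function. -/
def Herm (a : ℤ → ℂ) : Prop := ∀ k, a (-k) = conj (a k)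

instance : IsFiniteMeasure torus := by
  unfold torus; infer_instance

instance (T : ℝ) : IsFiniteMeasure (cylinder T) := by
  unfold cylinder; infer_instance

lemma expo_zero (x : ℝ) : expo 0 x = 1 := by simp [expo]

lemma expo_add (k l : ℤ) (x : ℝ) : expo (k + l) x = expo k x * expo l x := by
  simp only [expo, ← Complex.exp_add]; congr 1; push_cast; ring

lemma norm_expo (k : ℤ) (x : ℝ) : ‖expo k x‖ = 1 := by
  have : ((k : ℂ) * x * Complex.I) = ((k * x : ℝ) : ℂ) * Complex.I := by push_cast; ring
  rw [expo, this, Complex.norm_exp_ofReal_mul_I]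

lemma enorm_expo (k : ℤ) (x : ℝ) : ‖expo k x‖ₑ = 1 := by
  rw [← ofReal_norm, norm_expo]; simp

lemma conj_expo (k : ℤ) (x : ℝ) : conj (expo k x) = expo (-k) x := by
  simp only [expo, ← Complex.exp_conj]; congr 1; simp

lemma expo_periodic (k : ℤ) : Function.Periodic (expo k) (2 * Real.pi) := by
  intro x
  have h : expo k (x + 2 * Real.pi)
      = Complex.exp (k * x * Complex.I) * Complex.exp (k * (2 * Real.pi * Complex.I)) := by
    rw [← Complex.exp_add, expo]; congr 1; push_cast; ring
  rw [h, Complex.exp_int_mul_two_pi_mul_I, mul_one, expo]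

lemma hasDerivAt_expo (k : ℤ) (x : ℝ) :
    HasDerivAt (expo k) (Complex.I * k * expo k x) x := by
  have h1 : HasDerivAt (fun y : ℝ => (k : ℂ) * y * Complex.I) ((k : ℂ) * 1 * Complex.I) x :=
    ((Complex.ofRealCLM.hasDerivAt (x := x)).const_mul (k : ℂ)).mul_const Complex.I
  have h2 := h1.cexp
  refine h2.congr_deriv ?_
  simp only [expo]; ring

lemma continuous_expo (k : ℤ) : Continuous (expo k) :=
  continuous_iff_continuousAt.2 fun x => (hasDerivAt_expo k x).continuousAt

lemma integral_torus {E : Type*} [NormedAddCommGroup E] [NormedSpace ℝ E] (f : ℝ → E) :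
    ∫ x, f x ∂torus = ∫ x in (-Real.pi)..Real.pi, f x := by
  rw [intervalIntegral.integral_of_le (by linarith [Real.pi_pos]), torus]

lemma integral_expo (k : ℤ) : ∫ x, expo k x ∂torus = if k = 0 then 2 * (Real.pi : ℂ) else 0 := by
  rw [integral_torus]
  split_ifs with h
  · subst h
    simp only [expo_zero, intervalIntegral.integral_const]
    simp; ring
  · have hk : (Complex.I * k : ℂ) ≠ 0 := by simp [h]
    have hd : ∀ x ∈ uIcc (-Real.pi) Real.pi,
        HasDerivAt (fun y => (Complex.I * k)⁻¹ * expo k y) (expo k x) x := by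
      intro x _
      refine ((hasDerivAt_expo k x).const_mul _).congr_deriv ?_
      field_simp
    rw [intervalIntegral.integral_eq_sub_of_hasDerivAt hd
      ((continuous_expo k).intervalIntegrable _ _)]
    have := expo_periodic k (-Real.pi)
    rw [show -Real.pi + 2 * Real.pi = Real.pi by ring] at this
    rw [this]; simp

lemma integral_torus_const (c : ℝ) : ∫ _, c ∂torus = 2 * Real.pi * c := by
  rw [integral_torus, intervalIntegral.integral_const, smul_eq_mul]; ring

lemma fourierC_eq (u : ℝ → ℝ) (k : ℤ) :
    fourierC u k = (1 / (2 * Real.pi) : ℝ) • ∫ x, expo (-k) x * (u x : ℂ) ∂torus := by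
  rw [fourierC, fourierCoeffOn_eq_integral, integral_torus]
  congr 1
  · congr 1; ring
  · congr 1
    ext x
    rw [smul_eq_mul, fourier_coe_apply, expo]
    congr 2
    have : (Real.pi : ℂ) ≠ 0 := by exact_mod_cast Real.pi_ne_zero
    push_cast
    field_simp
    ring

lemma integrable_expo_mul {u : ℝ → ℂ} (hu : Integrable u torus) (k : ℤ) :
    Integrable (fun x => expo k x * u x) torus :=
  hu.bdd_mul (c := 1) (continuous_expo k).aestronglyMeasurable
    (Eventually.of_forall fun x => (norm_expo k x).le)

lemma fourierC_congr {u v : ℝ → ℝ} (h : u =ᵐ[torus] v) (k : ℤ) : fourierC u k = fourierC v k := by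
  rw [fourierC_eq, fourierC_eq]
  congr 1
  exact integral_congr_ae (h.mono fun x hx => by simp only [hx])

lemma fourierC_zero (u : ℝ → ℝ) : fourierC u 0 = (mean u : ℂ) := by
  rw [fourierC_eq, mean]
  simp only [neg_zero, expo_zero, one_mul, integral_complex_ofReal]
  simp

lemma herm_fourierC (u : ℝ → ℝ) : Herm (fourierC u) := by
  intro k
  rw [fourierC_eq, fourierC_eq, Complex.real_smul, Complex.real_smul, map_mul, Complex.conj_ofReal,
    ← integral_conj]
  simp [conj_expo]

lemma fourierC_sub {u v : ℝ → ℝ} (hu : Integrable u torus) (hv : Integrable v torus) (k : ℤ) :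
    fourierC (fun x => u x - v x) k = fourierC u k - fourierC v k := by
  simp only [fourierC_eq, ← smul_sub]
  have h := integral_sub (integrable_expo_mul (hu.ofReal (𝕜 := ℂ)) (-k))
    (integrable_expo_mul (hv.ofReal (𝕜 := ℂ)) (-k))
  simp only [Complex.coe_algebraMap] at h
  rw [← h]
  congr 2; ext x; push_cast; ring

/-! ### Weighted sums of Fourier coefficients -/

lemma wnorm_zero_eq (a : ℤ → ℂ) : wnorm 0 a = ∑' k, ‖a k‖ₑ := by simp [wnorm]

lemma wnorm_mono {a b : ℤ → ℂ} (n : ℕ) (h : ∀ k, ‖a k‖ ≤ ‖b k‖) : wnorm n a ≤ wnorm n b := by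
  refine ENNReal.tsum_le_tsum fun k => ?_
  gcongr
  exact enorm_le_iff_norm_le.2 (h k)

lemma wnorm_dseq (m n : ℕ) (a : ℤ → ℂ) : wnorm m (dseq n a) = wnorm (m + n) a := by
  refine tsum_congr fun k => ?_
  rw [dseq, enorm_mul, enorm_pow, enorm_mul]
  have : ‖(k : ℂ)‖ₑ = (k.natAbs : ℝ≥0∞) := by
    rw [← ofReal_norm, Complex.norm_intCast, ← Int.cast_abs, Int.abs_eq_natAbs, Int.cast_natCast,
      ENNReal.ofReal_natCast]
  rw [this, show ‖Complex.I‖ₑ = 1 by rw [← ofReal_norm]; simp]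
  ring

/-- The norms increase with their order on sequences of zero mean. -/
lemma wnorm_le_wnorm {a : ℤ → ℂ} (h0 : a 0 = 0) {m n : ℕ} (hmn : m ≤ n) :
    wnorm m a ≤ wnorm n a := by
  refine ENNReal.tsum_le_tsum fun k => ?_
  by_cases hk : k = 0
  · subst hk; simp [h0]
  · gcongr
    exact_mod_cast Int.natAbs_pos.2 hk

lemma wnorm_add_le (n : ℕ) (a b : ℤ → ℂ) : wnorm n (fun k => a k + b k) ≤ wnorm n a + wnorm n b := by
  rw [wnorm, wnorm, wnorm, ← ENNReal.tsum_add]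
  refine ENNReal.tsum_le_tsum fun k => ?_
  rw [← mul_add]; gcongr; exact enorm_add_le _ _

lemma wnorm_const_mul (n : ℕ) (c : ℂ) (a : ℤ → ℂ) :
    wnorm n (fun k => c * a k) = ‖c‖ₑ * wnorm n a := by
  rw [wnorm, wnorm, ← ENNReal.tsum_mul_left]
  refine tsum_congr fun k => ?_
  rw [enorm_mul]; ring

lemma wnorm_sub_le (n : ℕ) (a b : ℤ → ℂ) : wnorm n (fun k => a k - b k) ≤ wnorm n a + wnorm n b := by
  have h := wnorm_add_le n a (fun k => -1 * b k)
  rw [wnorm_const_mul] at h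
  simpa [sub_eq_add_neg] using h

/-- Interpolation with a free cut-off frequency `J`: low frequencies are controlled by the norm of
order `0`, high ones by the norm of order `4`. -/
lemma wnorm_interp (n : ℕ) (hn : n ≤ 4) (a : ℤ → ℂ) (J : ℝ≥0) (hJ : 0 < J) :
    wnorm n a ≤ (J : ℝ≥0∞) ^ n * wnorm 0 a + (J : ℝ≥0∞) ^ n / (J : ℝ≥0∞) ^ 4 * wnorm 4 a := by
  rw [wnorm, wnorm, wnorm, ← ENNReal.tsum_mul_left, ← ENNReal.tsum_mul_left, ← ENNReal.tsum_add]
  refine ENNReal.tsum_le_tsum fun k => ?_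
  rw [pow_zero, one_mul, ← mul_assoc, ← add_mul]
  gcongr
  have key : (k.natAbs : ℝ≥0) ^ n ≤ J ^ n + J ^ n / J ^ 4 * (k.natAbs : ℝ≥0) ^ 4 := by
    rcases le_total (k.natAbs : ℝ≥0) J with h | h
    · exact (pow_le_pow_left₀ zero_le h n).trans (le_add_of_nonneg_right zero_le)
    · refine le_trans ?_ (le_add_of_nonneg_left zero_le)
      have e : (k.natAbs : ℝ≥0) ^ 4 = (k.natAbs : ℝ≥0) ^ n * (k.natAbs : ℝ≥0) ^ (4 - n) := by
        rw [← pow_add]; congr 1; omega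
      have e' : J ^ 4 = J ^ n * J ^ (4 - n) := by rw [← pow_add]; congr 1; omega
      have hJn : J ^ n ≠ 0 := (pow_pos hJ n).ne'
      have hJ4 : J ^ (4 - n) ≠ 0 := (pow_pos hJ _).ne'
      rw [e, e']
      have : J ^ n / (J ^ n * J ^ (4 - n)) * ((k.natAbs : ℝ≥0) ^ n * (k.natAbs : ℝ≥0) ^ (4 - n))
          = (k.natAbs : ℝ≥0) ^ n * ((k.natAbs : ℝ≥0) ^ (4 - n) / J ^ (4 - n)) := by
        field_simp
      rw [this]
      refine le_mul_of_one_le_right zero_le ?_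
      rw [one_le_div (pow_pos hJ _)]
      exact pow_le_pow_left₀ zero_le h _
  have := ENNReal.coe_le_coe.2 key
  rw [ENNReal.coe_add, ENNReal.coe_mul, ENNReal.coe_div (pow_pos hJ 4).ne'] at this
  simpa using this

lemma summable_norm_of_wnorm {a : ℤ → ℂ} (h : wnorm 0 a < ⊤) : Summable (fun k => ‖a k‖) := by
  rw [wnorm_zero_eq] at h
  have := ENNReal.summable_toReal h.ne
  simpa using this

/-! ### Trigonometric series -/

lemma hasSum_trig {a : ℤ → ℂ} (h : wnorm 0 a < ⊤) (x : ℝ) :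
    HasSum (fun k => a k * expo k x) (trig a x) := by
  refine (Summable.of_norm ?_).hasSum
  simpa [norm_expo] using summable_norm_of_wnorm h

lemma enorm_trig_le (a : ℤ → ℂ) (x : ℝ) : ‖trig a x‖ₑ ≤ wnorm 0 a := by
  rw [trig, wnorm_zero_eq]
  refine enorm_tsum_le_tsum_enorm.trans (le_of_eq ?_)
  simp [enorm_mul, enorm_expo]

lemma enorm_retrig_le (a : ℤ → ℂ) (x : ℝ) : ‖retrig a x‖ₑ ≤ wnorm 0 a := by
  refine le_trans ?_ (enorm_trig_le a x)
  rw [enorm_le_iff_norm_le, Real.norm_eq_abs]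
  exact Complex.abs_re_le_norm _

lemma trig_periodic (a : ℤ → ℂ) : Function.Periodic (trig a) (2 * Real.pi) := by
  intro x
  simp only [trig, expo_periodic _ x]

lemma retrig_periodic (a : ℤ → ℂ) : Function.Periodic (retrig a) (2 * Real.pi) := by
  intro x
  simp only [retrig, trig_periodic a x]

lemma continuous_trig {a : ℤ → ℂ} (h : wnorm 0 a < ⊤) : Continuous (trig a) :=
  continuous_tsum (fun k => continuous_const.mul (continuous_expo k)) (summable_norm_of_wnorm h)
    (fun k x => by rw [norm_mul, norm_expo, mul_one])

lemma continuous_retrig {a : ℤ → ℂ} (h : wnorm 0 a < ⊤) : Continuous (retrig a) :=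
  Complex.continuous_re.comp (continuous_trig h)

lemma hasDerivAt_trig {a : ℤ → ℂ} (h0 : wnorm 0 a < ⊤) (h1 : wnorm 1 a < ⊤) (x : ℝ) :
    HasDerivAt (trig a) (trig (dseq 1 a) x) x := by
  have hs : wnorm 0 (dseq 1 a) < ⊤ := by rw [wnorm_dseq]; simpa using h1
  have := hasDerivAt_tsum (u := fun k => ‖dseq 1 a k‖) (g := fun k x => a k * expo k x)
    (g' := fun k x => dseq 1 a k * expo k x) (summable_norm_of_wnorm hs)
    (fun k y => ((hasDerivAt_expo k y).const_mul (a k)).congr_deriv (by simp only [dseq]; ring))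
    (fun k y => by rw [norm_mul, norm_expo, mul_one]) (y₀ := 0) (hasSum_trig h0 0).summable x
  exact this

lemma hasDerivAt_retrig {a : ℤ → ℂ} (h0 : wnorm 0 a < ⊤) (h1 : wnorm 1 a < ⊤) (x : ℝ) :
    HasDerivAt (retrig a) (retrig (dseq 1 a) x) x := by
  exact (Complex.reCLM.hasFDerivAt (x := trig a x)).comp_hasDerivAt x (hasDerivAt_trig h0 h1 x)

lemma dseq_dseq (m n : ℕ) (a : ℤ → ℂ) : dseq m (dseq n a) = dseq (m + n) a := by
  ext k; simp only [dseq]; ring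

lemma dseq_zero (a : ℤ → ℂ) : dseq 0 a = a := by ext k; simp [dseq]

lemma wnorm_one_lt_top {a : ℤ → ℂ} (n : ℕ) (h0 : wnorm 0 a < ⊤) (hn : wnorm (n + 1) a < ⊤)
    {m : ℕ} (hm : m ≤ n + 1) : wnorm m a < ⊤ := by
  refine lt_of_le_of_lt ?_ (ENNReal.add_lt_top.2 ⟨h0, hn⟩)
  rw [wnorm, wnorm, wnorm, ← ENNReal.tsum_add]
  refine ENNReal.tsum_le_tsum fun k => ?_
  rw [← add_mul]
  gcongr
  rcases Nat.eq_zero_or_pos k.natAbs with h | h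
  · rw [h]; rcases m with _ | m <;> simp
  · refine le_trans ?_ le_add_self
    gcongr
    exact_mod_cast h

lemma contDiff_retrig {n : ℕ} : ∀ {a : ℤ → ℂ}, wnorm 0 a < ⊤ → wnorm n a < ⊤ →
    ContDiff ℝ n (retrig a) ∧ ∀ m ≤ n, iteratedDeriv m (retrig a) = retrig (dseq m a) := by
  induction n with
  | zero =>
    intro a h0 _
    refine ⟨contDiff_zero.2 (continuous_retrig h0), ?_⟩
    intro m hm
    obtain rfl : m = 0 := by omega
    simp [dseq_zero]
  | succ n ih =>
    intro a h0 hn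
    have h1 : wnorm 1 a < ⊤ := wnorm_one_lt_top n h0 hn (by omega)
    have hd : deriv (retrig a) = retrig (dseq 1 a) :=
      funext fun x => (hasDerivAt_retrig h0 h1 x).deriv
    obtain ⟨hc, hi⟩ := ih (a := dseq 1 a) (by rw [wnorm_dseq]; simpa using h1)
      (by rw [wnorm_dseq]; exact hn)
    constructor
    · rw [Nat.cast_add, Nat.cast_one, contDiff_succ_iff_deriv]
      refine ⟨fun x => (hasDerivAt_retrig h0 h1 x).differentiableAt, by simp, ?_⟩
      rw [hd]; exact hc
    · intro m hm
      rcases m with _ | m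
      · simp [dseq_zero]
      · rw [iteratedDeriv_succ', hd, hi m (by omega), dseq_dseq]

lemma conj_trig {a : ℤ → ℂ} (ha : Herm a) (x : ℝ) : conj (trig a x) = trig a x := by
  rw [trig, Complex.conj_tsum]
  rw [← (Equiv.neg ℤ).tsum_eq]
  refine tsum_congr fun k => ?_
  simp only [Equiv.neg_apply, map_mul, conj_expo, neg_neg]
  rw [ha k, Complex.conj_conj]

lemma ofReal_retrig {a : ℤ → ℂ} (ha : Herm a) (x : ℝ) : ((retrig a x : ℝ) : ℂ) = trig a x :=
  Complex.conj_eq_iff_re.1 (conj_trig ha x)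

lemma integrable_of_continuous_torus {E : Type*} [NormedAddCommGroup E] {u : ℝ → E}
    (hu : Continuous u) : Integrable u torus := by
  rw [torus]
  exact (hu.integrableOn_Icc).mono_set Ioc_subset_Icc_self

lemma fourierC_retrig {a : ℤ → ℂ} (ha : Herm a) (h0 : wnorm 0 a < ⊤) (k : ℤ) :
    fourierC (retrig a) k = a k := by
  rw [fourierC_eq]
  have h : ∀ x, expo (-k) x * ((retrig a x : ℝ) : ℂ) = ∑' l, a l * expo (l - k) x := by
    intro x
    rw [ofReal_retrig ha, trig, ← tsum_mul_left]
    refine tsum_congr fun l => ?_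
    rw [sub_eq_add_neg, expo_add]; ring
  simp only [h]
  rw [← (hasSum_integral_of_summable_integral_norm (μ := torus)
    (F := fun l x => a l * expo (l - k) x) (fun l => integrable_of_continuous_torus
      (continuous_const.mul (continuous_expo _))) ?_).tsum_eq]
  · rw [tsum_eq_single k]
    · rw [integral_const_mul, integral_expo]
      have : (Real.pi : ℂ) ≠ 0 := by exact_mod_cast Real.pi_ne_zero
      simp; field_simp
    · intro l hl
      rw [integral_const_mul, integral_expo, if_neg (sub_ne_zero.2 hl), mul_zero]
  · simp only [norm_mul, norm_expo, mul_one, integral_torus_const]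
    exact (summable_norm_of_wnorm h0).mul_left _

/-! ### Uniqueness of Fourier coefficients, products and weak derivatives -/

/-- An integrable function is determined by its Fourier coefficients. -/
lemma ae_eq_of_fourierC_eq {u v : ℝ → ℝ} (hu : Integrable u torus) (hv : Integrable v torus)
    (h : ∀ k, fourierC u k = fourierC v k) : u =ᵐ[torus] v := by
  set w : ℝ → ℝ := fun x => u x - v x with hw
  have hwi : Integrable w torus := hu.sub hv
  have hwc : Integrable (fun x => (w x : ℂ)) torus := hwi.ofReal
  have hF : ∀ k, ∫ x, expo k x * (w x : ℂ) ∂torus = 0 := by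
    intro k
    have h1 := fourierC_sub hu hv (-k)
    rw [h, sub_self, fourierC_eq, neg_neg, smul_eq_zero] at h1
    refine h1.resolve_left ?_
    have := Real.pi_pos
    positivity
  have : Fact (0 < 2 * Real.pi) := ⟨by positivity⟩
  have hint : ∀ g : C(AddCircle (2 * Real.pi), ℂ),
      Integrable (fun x : ℝ => g (x : AddCircle (2 * Real.pi)) * (w x : ℂ)) torus := by
    intro g
    refine hwc.bdd_mul (c := ‖g‖) ?_ (Eventually.of_forall fun x => g.norm_coe_le_norm _)
    exact (g.continuous.comp (AddCircle.continuous_mk' _)).aestronglyMeasurable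
  -- The pairing with `w` is a continuous functional on `C(𝕋)` that kills all characters.
  let L : C(AddCircle (2 * Real.pi), ℂ) →L[ℂ] ℂ := LinearMap.mkContinuous
    { toFun := fun g => ∫ x, g (x : AddCircle (2 * Real.pi)) * (w x : ℂ) ∂torus
      map_add' := fun g g' => by
        rw [← integral_add (hint g) (hint g')]
        simp only [ContinuousMap.add_apply, add_mul]
      map_smul' := fun c g => by
        simp only [ContinuousMap.smul_apply, smul_eq_mul, RingHom.id_apply, mul_assoc,
          integral_const_mul] }
    (∫ x, ‖(w x : ℂ)‖ ∂torus) (fun g => by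
      refine (norm_integral_le_integral_norm _).trans ?_
      rw [mul_comm (∫ x, ‖(w x : ℂ)‖ ∂torus), ← integral_const_mul]
      refine integral_mono (hint g).norm (hwc.norm.const_mul _) fun x => ?_
      simp only [norm_mul]
      gcongr
      exact g.norm_coe_le_norm _)
  -- trigonometric polynomials are dense, so the functional vanishes
  have hL : ∀ g, L g = 0 := by
    intro g
    have hle : (⊤ : Submodule ℂ C(AddCircle (2 * Real.pi), ℂ)) ≤ LinearMap.ker L.toLinearMap := by
      rw [← span_fourier_closure_eq_top]
      refine Submodule.topologicalClosure_minimal _ ?_ L.isClosed_ker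
      rw [Submodule.span_le]
      rintro _ ⟨k, rfl⟩
      change ∫ x, fourier k (x : AddCircle (2 * Real.pi)) * (w x : ℂ) ∂torus = 0
      rw [← hF k]
      congr 1; ext x
      congr 1
      rw [fourier_coe_apply, expo]
      congr 1
      have : (Real.pi : ℂ) ≠ 0 := by exact_mod_cast Real.pi_ne_zero
      push_cast
      field_simp
    exact hle (Submodule.mem_top (x := g))
  have hz : ∀ᵐ x ∂(volume : Measure ℝ), x ∈ Ioo (-Real.pi) Real.pi → w x = 0 := by
    refine isOpen_Ioo.ae_eq_zero_of_integral_contDiff_smul_eq_zero ?_ ?_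
    · refine IntegrableOn.locallyIntegrableOn ?_
      exact IntegrableOn.mono_set hwi Ioo_subset_Ioc_self
    · intro g hg _ hgs
      have hg0 : ∀ x, x ∉ Ioo (-Real.pi) Real.pi → g x = 0 := fun x hx =>
        image_eq_zero_of_notMem_tsupport fun h' => hx (hgs h')
      have hcont : Continuous (AddCircle.liftIoc (2 * Real.pi) (-Real.pi)
          (fun x => (g x : ℂ))) := by
        refine AddCircle.liftIoc_continuous ?_ ?_
        · rw [hg0 (-Real.pi) (by simp), hg0 (-Real.pi + 2 * Real.pi) (by simp; intro; linarith)]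
        · exact (Complex.continuous_ofReal.comp hg.continuous).continuousOn
      have h1 := hL ⟨_, hcont⟩
      change ∫ x, AddCircle.liftIoc (2 * Real.pi) (-Real.pi) (fun x => (g x : ℂ))
        (x : AddCircle (2 * Real.pi)) * (w x : ℂ) ∂torus = 0 at h1
      have h2 : ∫ x, ((g x * w x : ℝ) : ℂ) ∂torus = 0 := by
        rw [← h1]
        refine integral_congr_ae ?_
        rw [torus]
        filter_upwards [ae_restrict_mem measurableSet_Ioc] with x hx
        rw [AddCircle.liftIoc_coe_apply (by
          rwa [show -Real.pi + 2 * Real.pi = Real.pi by ring])]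
        push_cast; ring
      rw [integral_complex_ofReal] at h2
      have h3 : ∫ x, g x * w x ∂torus = 0 := by exact_mod_cast h2
      rw [← h3, torus, ← integral_indicator measurableSet_Ioc]
      congr 1; ext x
      by_cases hx : x ∈ Ioc (-Real.pi) Real.pi
      · rw [indicator_of_mem hx, smul_eq_mul]
      · rw [indicator_of_notMem hx, hg0 x (fun h' => hx (Ioo_subset_Ioc_self h')), zero_smul]
  have hz' : w =ᵐ[torus] 0 := by
    rw [torus, ← restrict_Ioo_eq_restrict_Ioc]
    exact (ae_restrict_iff' measurableSet_Ioo).2 hz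
  filter_upwards [hz'] with x hx
  simpa [hw, sub_eq_zero] using hx

lemma ae_eq_retrig {u : ℝ → ℝ} (hu : Integrable u torus) {a : ℤ → ℂ} (h : ∀ k, fourierC u k = a k)
    (h0 : wnorm 0 a < ⊤) : u =ᵐ[torus] retrig a := by
  have ha : Herm a := by
    have : fourierC u = a := funext h
    rw [← this]; exact herm_fourierC u
  exact ae_eq_of_fourierC_eq hu (integrable_of_continuous_torus (continuous_retrig h0))
    fun k => by rw [h, fourierC_retrig ha h0]

/-- The convolution of two sequences of Fourier coefficients. -/
def conv (a b : ℤ → ℂ) (k : ℤ) : ℂ := ∑' j : ℤ, a (k - j) * b j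

/-- The shear `(k, j) ↦ (k - j, j)` of `ℤ × ℤ`. -/
def shear : ℤ × ℤ ≃ ℤ × ℤ where
  toFun p := (p.1 - p.2, p.2)
  invFun p := (p.1 + p.2, p.2)
  left_inv p := by simp
  right_inv p := by simp

lemma wnorm_conv_le (a b : ℤ → ℂ) : wnorm 0 (conv a b) ≤ wnorm 0 a * wnorm 0 b := by
  simp only [wnorm_zero_eq]
  calc ∑' k, ‖conv a b k‖ₑ ≤ ∑' k, ∑' j, ‖a (k - j)‖ₑ * ‖b j‖ₑ := by
        refine ENNReal.tsum_le_tsum fun k => ?_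
        refine enorm_tsum_le_tsum_enorm.trans (le_of_eq ?_)
        simp [enorm_mul]
    _ = ∑' j, ∑' k, ‖a (k - j)‖ₑ * ‖b j‖ₑ := ENNReal.tsum_comm
    _ = ∑' j, (∑' k, ‖a k‖ₑ) * ‖b j‖ₑ := by
        refine tsum_congr fun j => ?_
        rw [ENNReal.tsum_mul_right]
        congr 1
        exact (Equiv.subRight j).tsum_eq (fun k => ‖a k‖ₑ)
    _ = _ := ENNReal.tsum_mul_left

lemma trig_mul_trig {a b : ℤ → ℂ} (ha : wnorm 0 a < ⊤) (hb : wnorm 0 b < ⊤) (x : ℝ) :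
    trig a x * trig b x = trig (conv a b) x := by
  have hfa : Summable fun k => ‖a k * expo k x‖ := by
    simpa [norm_expo] using summable_norm_of_wnorm ha
  have hfb : Summable fun k => ‖b k * expo k x‖ := by
    simpa [norm_expo] using summable_norm_of_wnorm hb
  have hs := summable_mul_of_summable_norm hfa hfb
  have hs' := (shear.summable_iff).2 hs
  rw [trig, trig, tsum_mul_tsum_of_summable_norm hfa hfb, ← shear.tsum_eq, trig]
  refine hs'.tsum_prod.trans ?_
  refine tsum_congr fun k => ?_
  rw [conv, ← tsum_mul_right]
  refine tsum_congr fun j => ?_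
  simp only [Function.comp_apply, shear, Equiv.coe_fn_mk]
  have : expo k x = expo (k - j) x * expo j x := by rw [← expo_add]; simp
  rw [this]; ring

lemma herm_conv {a b : ℤ → ℂ} (ha : Herm a) (hb : Herm b) : Herm (conv a b) := by
  intro k
  rw [conv, conv, Complex.conj_tsum, ← (Equiv.neg ℤ).tsum_eq]
  refine tsum_congr fun j => ?_
  simp only [Equiv.neg_apply, map_mul]
  rw [← ha, ← hb]
  congr 2; ring

lemma retrig_mul_retrig {a b : ℤ → ℂ} (ha : wnorm 0 a < ⊤) (hb : wnorm 0 b < ⊤)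
    (hA : Herm a) (hB : Herm b) (x : ℝ) : retrig a x * retrig b x = retrig (conv a b) x := by
  have h := trig_mul_trig ha hb x
  rw [← ofReal_retrig hA, ← ofReal_retrig hB, ← ofReal_retrig (herm_conv hA hB)] at h
  exact_mod_cast h

lemma retrig_add {a b : ℤ → ℂ} (ha : wnorm 0 a < ⊤) (hb : wnorm 0 b < ⊤) (x : ℝ) :
    retrig (fun k => a k + b k) x = retrig a x + retrig b x := by
  have : trig (fun k => a k + b k) x = trig a x + trig b x := by
    rw [trig, trig, trig, ← (hasSum_trig ha x).summable.tsum_add (hasSum_trig hb x).summable]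
    simp only [add_mul]
  simp [retrig, this]

lemma retrig_const_mul (c : ℝ) (a : ℤ → ℂ) (x : ℝ) :
    retrig (fun k => c * a k) x = c * retrig a x := by
  have : trig (fun k => c * a k) x = c * trig a x := by
    rw [trig, trig, ← tsum_mul_left]; simp only [mul_assoc]
  rw [retrig, this, retrig, Complex.re_ofReal_mul]

lemma retrig_sub {a b : ℤ → ℂ} (ha : wnorm 0 a < ⊤) (hb : wnorm 0 b < ⊤) (x : ℝ) :
    retrig (fun k => a k - b k) x = retrig a x - retrig b x := by
  have : trig (fun k => a k - b k) x = trig a x - trig b x := by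
    rw [trig, trig, trig, ← (hasSum_trig ha x).summable.tsum_sub (hasSum_trig hb x).summable]
    simp only [sub_mul]
  simp [retrig, this]

lemma periodic_iteratedDeriv {φ : ℝ → ℝ} {c : ℝ} (hφ : Function.Periodic φ c) (n : ℕ) :
    Function.Periodic (iteratedDeriv n φ) c := by
  intro x
  have h := congrFun (iteratedDeriv_comp_add_const n φ c) x
  rw [show (fun z => φ (z + c)) = φ from funext hφ] at h
  exact h.symm

/-- Integration by parts for periodic functions. -/
lemma integral_torus_mul_deriv {u v u' v' : ℝ → ℝ} (hu : ∀ x, HasDerivAt u (u' x) x)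
    (hv : ∀ x, HasDerivAt v (v' x) x) (hu' : Continuous u') (hv' : Continuous v')
    (pu : Function.Periodic u (2 * Real.pi)) (pv : Function.Periodic v (2 * Real.pi)) :
    ∫ x, u x * v' x ∂torus = -∫ x, u' x * v x ∂torus := by
  rw [integral_torus, integral_torus, intervalIntegral.integral_mul_deriv_eq_deriv_mul
    (fun x _ => hu x) (fun x _ => hv x) (hu'.intervalIntegrable _ _) (hv'.intervalIntegrable _ _)]
  have h1 := pu (-Real.pi)
  have h2 := pv (-Real.pi)
  rw [show -Real.pi + 2 * Real.pi = Real.pi by ring] at h1 h2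
  rw [h1, h2]; ring

lemma isWeakDeriv_retrig (n : ℕ) : ∀ {a : ℤ → ℂ}, wnorm 0 a < ⊤ → wnorm n a < ⊤ →
    IsWeakDeriv n (retrig a) (retrig (dseq n a)) := by
  have key : ∀ {a : ℤ → ℂ}, wnorm 0 a < ⊤ → wnorm n a < ⊤ → ∀ φ : ℝ → ℝ, ContDiff ℝ ∞ φ →
      Function.Periodic φ (2 * Real.pi) → ∫ x, retrig a x * iteratedDeriv n φ x ∂torus
        = (-1) ^ n * ∫ x, retrig (dseq n a) x * φ x ∂torus := by
    induction n with
    | zero => intro a _ _ φ _ _; simp [dseq_zero]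
    | succ n ih =>
      intro a h0 hn φ hφ pφ
      have h1 : wnorm 1 a < ⊤ := wnorm_one_lt_top n h0 hn (by omega)
      have hi := ih (a := dseq 1 a) (by rw [wnorm_dseq]; simpa using h1)
        (by rw [wnorm_dseq]; exact hn) φ hφ pφ
      have hd : ∀ m x, HasDerivAt (iteratedDeriv m φ) (iteratedDeriv (m + 1) φ x) x := by
        intro m x
        rw [iteratedDeriv_succ]
        exact ((hφ.differentiable_iteratedDeriv m (by exact_mod_cast ENat.natCast_lt_top m)) x).hasDerivAt
      rw [integral_torus_mul_deriv (hasDerivAt_retrig h0 h1) (hd n)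
        (continuous_retrig (by rw [wnorm_dseq]; simpa using h1))
        (hφ.continuous_iteratedDeriv (n + 1) (by exact_mod_cast le_top))
        (retrig_periodic a) (periodic_iteratedDeriv pφ n), hi, dseq_dseq, pow_succ]
      ring
  intro a h0 hn
  refine ⟨integrable_of_continuous_torus (continuous_retrig h0),
    integrable_of_continuous_torus (continuous_retrig (by rw [wnorm_dseq]; simpa using hn)),
    key h0 hn⟩

lemma iteratedDeriv_re_expo (k : ℤ) (n : ℕ) : ∀ c : ℂ,
    iteratedDeriv n (fun x => (c * expo k x).re)
      = fun x => ((Complex.I * k) ^ n * c * expo k x).re := by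
  induction n with
  | zero => intro c; simp
  | succ n ih =>
    intro c
    have : deriv (fun x => (c * expo k x).re) = fun x => ((c * (Complex.I * k)) * expo k x).re := by
      ext x
      have h := (Complex.reCLM.hasFDerivAt (x := c * expo k x)).comp_hasDerivAt x
        ((hasDerivAt_expo k x).const_mul c)
      rw [show (fun x => (c * expo k x).re) = Complex.reCLM ∘ (fun x => c * expo k x) from rfl,
        h.deriv]
      simp only [Complex.reCLM_apply, mul_assoc]
    rw [iteratedDeriv_succ', this, ih]
    ext x; congr 1; ring

lemma contDiff_re_expo (k : ℤ) (c : ℂ) : ContDiff ℝ ∞ (fun x => (c * expo k x).re) := by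
  refine Complex.reCLM.contDiff.comp (contDiff_const.mul ?_)
  refine Complex.contDiff_exp.comp ?_
  exact (contDiff_const.mul Complex.ofRealCLM.contDiff).mul contDiff_const

lemma integral_mul_re_expo {u : ℝ → ℝ} (hu : Integrable u torus) (k : ℤ) (c : ℂ) :
    ∫ x, u x * (c * expo (-k) x).re ∂torus = 2 * Real.pi * (c * fourierC u k).re := by
  have h1 : ∀ x, u x * (c * expo (-k) x).re = (c * (expo (-k) x * (u x : ℂ))).re := by
    intro x
    rw [← mul_assoc, mul_comm (c * expo (-k) x) (u x : ℂ), Complex.re_ofReal_mul]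
  simp only [h1]
  have h2 : Integrable (fun x => c * (expo (-k) x * (u x : ℂ))) torus :=
    (integrable_expo_mul hu.ofReal (-k)).const_mul c
  have h3 := integral_re h2
  simp only [RCLike.re_eq_complex_re] at h3
  rw [h3, integral_const_mul, fourierC_eq, Complex.real_smul, mul_left_comm, Complex.re_ofReal_mul]
  have := Real.pi_pos
  field_simp

/-- Weak derivatives act on Fourier coefficients as multipliers: the real and imaginary parts of the
characters are admissible test functions. -/
lemma fourierC_of_isWeakDeriv {n : ℕ} {u v : ℝ → ℝ} (h : IsWeakDeriv n u v) (k : ℤ) :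
    fourierC v k = dseq n (fourierC u) k := by
  obtain ⟨hu, hv, hw⟩ := h
  have key : ∀ c : ℂ, (c * dseq n (fourierC u) k).re = (c * fourierC v k).re := by
    intro c
    have h1 := hw _ (contDiff_re_expo (-k) c) (fun x => by simp only [expo_periodic (-k) x])
    rw [iteratedDeriv_re_expo, integral_mul_re_expo hu, integral_mul_re_expo hv] at h1
    have h2 : (Complex.I * ((-k : ℤ) : ℂ)) ^ n * c * fourierC u k
        = (((-1) ^ n : ℝ) : ℂ) * (c * dseq n (fourierC u) k) := by
      rw [dseq]; push_cast
      rw [show Complex.I * -(k : ℂ) = (-1) * (Complex.I * k) by ring, mul_pow]; ring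
    rw [h2, Complex.re_ofReal_mul] at h1
    have hp := Real.pi_pos
    have hn : ((-1 : ℝ) ^ n) ≠ 0 := by positivity
    have h3 : (2 * Real.pi * (-1) ^ n) * (c * dseq n (fourierC u) k).re
        = (2 * Real.pi * (-1) ^ n) * (c * fourierC v k).re := by linarith
    refine mul_left_cancel₀ ?_ h3
    exact mul_ne_zero (by positivity) hn
  refine Complex.ext ?_ ?_
  · simpa using (key 1).symm
  · simpa using (key (-Complex.I)).symm

/-! ### Norms of trigonometric series -/

/-- Interpolation between `Ȧ⁰` and `Ȧ⁴` for sequences bounded in `Ȧ⁰`. -/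
lemma wnorm_rpow_interp {m : ℕ} (hm : 0 < m) (hm4 : m ≤ 4) {a : ℤ → ℂ} (h0 : a 0 = 0) {E : ℝ≥0}
    (hE : wnorm 0 a ≤ E) : wnorm m a ≤ (E + 1) * wnorm 4 a ^ ((m : ℝ) / 4) := by
  have hm' : (0 : ℝ) < (m : ℝ) / 4 := by positivity
  by_cases htop : wnorm 4 a = ⊤
  · rw [htop, ENNReal.top_rpow_of_pos hm', ENNReal.mul_top (by simp)]
    exact le_top
  by_cases hz : wnorm 4 a = 0
  · have := wnorm_le_wnorm h0 hm4
    rw [hz] at this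
    exact this.trans zero_le
  -- the optimal cut-off frequency balances the two terms of `wnorm_interp`
  set X : ℝ≥0 := (wnorm 4 a).toNNReal with hX
  have hXe : wnorm 4 a = X := (ENNReal.coe_toNNReal htop).symm
  have hX0 : 0 < X := by
    rw [pos_iff_ne_zero]; intro h; rw [h] at hXe; exact hz (by simpa using hXe)
  have hJ : 0 < X ^ ((1 : ℝ) / 4) := NNReal.rpow_pos hX0
  have hJm : ∀ n : ℕ, (X ^ ((1 : ℝ) / 4)) ^ n = X ^ ((n : ℝ) / 4) := by
    intro n
    rw [← NNReal.rpow_natCast, ← NNReal.rpow_mul]; congr 1; ring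
  refine (wnorm_interp m hm4 a _ hJ).trans ?_
  rw [hXe, ← ENNReal.coe_pow, ← ENNReal.coe_pow, hJm, hJm, ← ENNReal.coe_div
    (NNReal.rpow_pos hX0).ne', ENNReal.coe_rpow_of_nonneg _ hm'.le |>.symm]
  have h4 : X ^ ((m : ℝ) / 4) / X ^ (((4 : ℕ) : ℝ) / 4) * X = X ^ ((m : ℝ) / 4) := by
    rw [show (((4 : ℕ) : ℝ) / 4) = 1 by norm_num, NNReal.rpow_one]
    field_simp
  rw [← ENNReal.coe_mul, h4, add_mul, one_mul, mul_comm]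
  gcongr

lemma eLpNorm_retrig_le (p : ℝ≥0∞) (a : ℤ → ℂ) :
    eLpNorm (retrig a) p torus ≤ torus univ ^ p.toReal⁻¹ * wnorm 0 a := by
  have := eLpNorm_le_of_ae_enorm_bound (μ := torus) (p := p) (f := retrig a)
    (Eventually.of_forall (enorm_retrig_le a))
  rwa [smul_eq_mul, mul_comm] at this

lemma torus_rpow_ne_top (p : ℝ≥0∞) : torus univ ^ p.toReal⁻¹ ≠ ⊤ :=
  ENNReal.rpow_ne_top_of_nonneg (by positivity) (measure_ne_top _ _)

lemma sobolevNorm_retrig_le (n : ℕ) (p : ℝ≥0∞) {a : ℤ → ℂ} (h0 : a 0 = 0) (hn : wnorm n a < ⊤) :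
    sobolevNorm n p (retrig a) ≤ torus univ ^ p.toReal⁻¹ * 2 * wnorm n a := by
  have h00 : wnorm 0 a ≤ wnorm n a := wnorm_le_wnorm h0 (Nat.zero_le n)
  refine (iInf₂_le _ (isWeakDeriv_retrig n (h00.trans_lt hn) hn)).trans ?_
  refine (add_le_add (eLpNorm_retrig_le p a) (eLpNorm_retrig_le p _)).trans ?_
  rw [wnorm_dseq, zero_add, ← mul_add, mul_assoc, two_mul]
  gcongr

lemma enorm_retrig_sub_le {a : ℤ → ℂ} (h0 : wnorm 0 a < ⊤) (h1 : wnorm 1 a < ⊤) (x y : ℝ) :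
    |retrig a x - retrig a y| ≤ (wnorm 1 a).toReal * |x - y| := by
  have := Convex.norm_image_sub_le_of_norm_hasDerivWithin_le (f := retrig a)
    (f' := retrig (dseq 1 a)) (s := univ) (C := (wnorm 1 a).toReal)
    (fun z _ => (hasDerivAt_retrig h0 h1 z).hasDerivWithinAt) (fun z _ => ?_) convex_univ
    (mem_univ y) (mem_univ x)
  · simpa using this
  · have h := enorm_retrig_le (dseq 1 a) z
    rw [wnorm_dseq, zero_add] at h
    rw [← toReal_enorm]
    exact ENNReal.toReal_mono h1.ne h

lemma abs_retrig_le {a : ℤ → ℂ} (h0 : wnorm 0 a < ⊤) (x : ℝ) :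
    |retrig a x| ≤ (wnorm 0 a).toReal := by
  rw [← Real.norm_eq_abs, ← toReal_enorm]
  exact ENNReal.toReal_mono h0.ne (enorm_retrig_le a x)

/-- The Hölder seminorm of the third derivative is bounded by its Lipschitz constant at distances at
most `1`, and by twice its supremum at larger distances. -/
lemma holderNorm_retrig_le (α : ℝ≥0) (hα : α ≤ 1) {a : ℤ → ℂ} (h0 : a 0 = 0)
    (h4 : wnorm 4 a < ⊤) : holderNorm 3 α (retrig a) ≤ 6 * wnorm 4 a := by
  have hle : ∀ m ≤ 4, wnorm m a ≤ wnorm 4 a := fun m hm => wnorm_le_wnorm h0 hm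
  have hlt : ∀ m ≤ 4, wnorm m a < ⊤ := fun m hm => (hle m hm).trans_lt h4
  obtain ⟨hc, hi⟩ := contDiff_retrig (n := 3) (hlt 0 (by norm_num)) (hlt 3 (by norm_num))
  refine (iInf₂_le (retrig a) ⟨hc, retrig_periodic a, EventuallyEq.rfl⟩).trans ?_
  have hd : ∀ m ≤ 3, ∀ x, ‖iteratedDeriv m (retrig a) x‖ₑ ≤ wnorm 4 a := by
    intro m hm x
    rw [hi m hm]
    refine (enorm_retrig_le _ x).trans ?_
    rw [wnorm_dseq, zero_add]
    exact hle m (by omega)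
  have h1 : ∑ j ∈ Finset.range (3 + 1), ⨆ x : ℝ, ‖iteratedDeriv j (retrig a) x‖ₑ
      ≤ 4 * wnorm 4 a := by
    refine (Finset.sum_le_card_nsmul _ _ (wnorm 4 a) fun j hj => ?_).trans (le_of_eq ?_)
    · exact iSup_le fun x => hd j (by have := Finset.mem_range.1 hj; omega) x
    · simp
  have h2 : eHolderNorm α (iteratedDeriv 3 (retrig a)) ≤ 2 * wnorm 4 a := by
    have hh : HolderWith (2 * (wnorm 4 a).toNNReal) α (iteratedDeriv 3 (retrig a)) := by
      intro x y
      have hX : (((2 * (wnorm 4 a).toNNReal : ℝ≥0)) : ℝ≥0∞) = 2 * wnorm 4 a := by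
        rw [ENNReal.coe_mul, ENNReal.coe_toNNReal h4.ne]; simp
      rw [hX]
      rcases le_total (edist x y) 1 with h | h
      · have hl := enorm_retrig_sub_le (a := dseq 3 a)
          (by rw [wnorm_dseq]; exact hlt 3 (by norm_num)) (by rw [wnorm_dseq]; exact h4) x y
        rw [wnorm_dseq] at hl
        have hl' : edist (iteratedDeriv 3 (retrig a) x) (iteratedDeriv 3 (retrig a) y)
            ≤ wnorm 4 a * edist x y := by
          rw [hi 3 le_rfl, edist_dist, edist_dist, Real.dist_eq, Real.dist_eq,
            ← ENNReal.ofReal_toReal h4.ne, ← ENNReal.ofReal_mul ENNReal.toReal_nonneg]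
          exact ENNReal.ofReal_le_ofReal hl
        refine hl'.trans ?_
        gcongr
        · exact le_mul_of_one_le_left zero_le (by norm_num)
        · calc edist x y = edist x y ^ (1 : ℝ) := (ENNReal.rpow_one _).symm
            _ ≤ edist x y ^ (α : ℝ) :=
              ENNReal.rpow_le_rpow_of_exponent_ge h (by exact_mod_cast hα)
      · have hl' : edist (iteratedDeriv 3 (retrig a) x) (iteratedDeriv 3 (retrig a) y)
            ≤ 2 * wnorm 4 a := by
          rw [edist_eq_enorm_sub, two_mul]
          exact enorm_sub_le.trans (add_le_add (hd 3 le_rfl x) (hd 3 le_rfl y))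
        refine hl'.trans (le_mul_of_one_le_right zero_le ?_)
        simpa using ENNReal.rpow_le_rpow h α.coe_nonneg
    refine hh.eHolderNorm_le.trans (le_of_eq ?_)
    rw [ENNReal.coe_mul, ENNReal.coe_toNNReal h4.ne]; simp
  calc _ ≤ 4 * wnorm 4 a + 2 * wnorm 4 a := add_le_add h1 h2
    _ = 6 * wnorm 4 a := by rw [← add_mul]; norm_num

/-! ### Measurability of time-dependent trigonometric series -/

lemma measurable_wnorm {a : ℝ → ℤ → ℂ} (ha : ∀ k, Measurable fun t => a t k) (n : ℕ) :
    Measurable fun t => wnorm n (a t) :=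
  Measurable.tsum fun k => (ha k).enorm.const_mul _

lemma measurable_dseq {a : ℝ → ℤ → ℂ} (ha : ∀ k, Measurable fun t => a t k) (n : ℕ) (k : ℤ) :
    Measurable fun t => dseq n (a t) k := (ha k).const_mul _

lemma ae_cylinder {T : ℝ} {p : ℝ → Prop} (h : ∀ᵐ t ∂(volume.restrict (Ioc 0 T)), p t) :
    ∀ᵐ z ∂(cylinder T), p z.1 :=
  Measure.quasiMeasurePreserving_fst.ae h

lemma aestronglyMeasurable_retrig {T : ℝ} {a : ℝ → ℤ → ℂ} (ha : ∀ k, Measurable fun t => a t k)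
    (h : ∀ᵐ t ∂(volume.restrict (Ioc 0 T)), wnorm 0 (a t) < ⊤) :
    AEStronglyMeasurable (fun p : ℝ × ℝ => retrig (a p.1) p.2) (cylinder T) := by
  refine aestronglyMeasurable_of_tendsto_ae (u := (atTop : Filter (Finset ℤ)))
    (f := fun s p => ∑ k ∈ s, (a p.1 k * expo k p.2).re) (fun s => ?_) ?_
  · refine Measurable.aestronglyMeasurable (Finset.measurable_fun_sum _ fun k _ => ?_)
    exact Complex.measurable_re.comp
      (((ha k).comp measurable_fst).mul ((continuous_expo k).measurable.comp measurable_snd))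
  · filter_upwards [ae_cylinder h] with p hp
    have := Complex.hasSum_re (hasSum_trig hp p.2)
    exact this

lemma integrable_retrig {T : ℝ} {a : ℝ → ℤ → ℂ} (ha : ∀ k, Measurable fun t => a t k)
    (h : ∫⁻ t in Ioc 0 T, wnorm 0 (a t) < ⊤) :
    Integrable (fun p : ℝ × ℝ => retrig (a p.1) p.2) (cylinder T) := by
  have hm : Measurable fun t => wnorm 0 (a t) := measurable_wnorm ha 0
  refine ⟨aestronglyMeasurable_retrig ha (ae_lt_top hm h.ne), ?_⟩
  calc ∫⁻ p, ‖retrig (a p.1) p.2‖ₑ ∂(cylinder T)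
      ≤ ∫⁻ p, wnorm 0 (a p.1) ∂(cylinder T) := lintegral_mono fun p => enorm_retrig_le _ _
    _ = (∫⁻ t in Ioc 0 T, wnorm 0 (a t)) * torus univ := by
        rw [cylinder, lintegral_prod (fun p : ℝ × ℝ => wnorm 0 (a p.1))
          (hm.comp measurable_fst).aemeasurable]
        simp only [lintegral_const]
        rw [lintegral_mul_const _ hm]
    _ < ⊤ := ENNReal.mul_lt_top h (measure_lt_top _ _)

/-! ### Bochner spaces and vector measures -/

/-- Coefficientwise approximation of a sequence-valued function by simple functions: the modes
`|k| ≤ n` are replaced by simple functions dominated by `2 |a k|`, the others by `0`. -/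
lemma exists_simpleFunc_coeff {a : ℝ → ℤ → ℂ} (ha : ∀ k, Measurable fun t => a t k)
    (h0 : ∀ t, a t 0 = 0) : ∃ c : ℕ → SimpleFunc ℝ (ℤ → ℂ),
      (∀ n t, c n t 0 = 0) ∧ (∀ n t k, n < k.natAbs → c n t k = 0) ∧
      (∀ n t k, ‖c n t k‖ ≤ 2 * ‖a t k‖) ∧
      ∀ t k, Tendsto (fun n => c n t k) atTop (𝓝 (a t k)) := by
  let g : ℕ → ℤ → SimpleFunc ℝ ℂ := fun n k =>
    SimpleFunc.approxOn (fun t => a t k) (ha k) univ 0 (mem_univ _) n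
  let c : ℕ → SimpleFunc ℝ (ℤ → ℂ) := fun n =>
    ∑ k ∈ Finset.Icc (-(n : ℤ)) n, (g n k).map (fun z => Pi.single k z)
  have hc : ∀ n t k, c n t k = if k ∈ Finset.Icc (-(n : ℤ)) n then g n k t else 0 := by
    intro n t k
    have hsum : ∀ s : Finset ℤ, (∑ k ∈ s, (g n k).map (fun z => (Pi.single k z : ℤ → ℂ))) t k
        = if k ∈ s then g n k t else 0 := by
      intro s
      induction s using Finset.induction_on with
      | empty => simp
      | insert l s hl ih =>
        rw [Finset.sum_insert hl, SimpleFunc.coe_add, Pi.add_apply, Pi.add_apply, ih,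
          SimpleFunc.map_apply]
        by_cases hkl : k = l
        · subst hkl; simp [hl]
        · simp [hkl]
    exact hsum _
  have hb : ∀ n t k, ‖g n k t‖ ≤ 2 * ‖a t k‖ := by
    intro n t k
    have := SimpleFunc.norm_approxOn_zero_le (ha k) (mem_univ (0 : ℂ)) t n
    linarith
  refine ⟨c, ?_, ?_, ?_, ?_⟩
  · intro n t
    have := hb n t 0
    rw [h0, norm_zero, mul_zero] at this
    rw [hc, norm_le_zero_iff.1 this, ite_self]
  · intro n t k hk
    rw [hc, if_neg]
    rw [Finset.mem_Icc]; omega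
  · intro n t k
    rw [hc]; split_ifs
    · exact hb n t k
    · rw [norm_zero]; positivity
  · intro t k
    have h1 : Tendsto (fun n => g n k t) atTop (𝓝 (a t k)) :=
      SimpleFunc.tendsto_approxOn (ha k) (mem_univ (0 : ℂ)) (by simp)
    refine h1.congr' ?_
    filter_upwards [eventually_ge_atTop k.natAbs] with n hn
    rw [hc, if_pos]
    rw [Finset.mem_Icc]; omega

lemma wnorm_lt_top_of_support (m n : ℕ) {c : ℤ → ℂ} (h : ∀ k : ℤ, n < k.natAbs → c k = 0) :
    wnorm m c < ⊤ := by
  rw [wnorm, tsum_eq_sum (s := Finset.Icc (-(n : ℤ)) n)]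
  · refine ENNReal.sum_lt_top.2 fun k _ => ENNReal.mul_lt_top (by simp) (by simp)
  · intro k hk
    rw [h k, enorm_zero, mul_zero]
    rw [Finset.mem_Icc] at hk; omega

/-- Dominated convergence in `Ȧᵐ`. -/
lemma tendsto_wnorm_sub {c : ℕ → ℤ → ℂ} {a : ℤ → ℂ} {m : ℕ} (ha : wnorm m a < ⊤)
    (hb : ∀ n k, ‖c n k‖ ≤ 2 * ‖a k‖) (hc : ∀ k, Tendsto (fun n => c n k) atTop (𝓝 (a k))) :
    Tendsto (fun n => wnorm m (fun k => a k - c n k)) atTop (𝓝 0) := by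
  simp only [wnorm, ← lintegral_count]
  rw [show (0 : ℝ≥0∞) = ∫⁻ _ : ℤ, 0 ∂Measure.count by simp]
  refine tendsto_lintegral_of_dominated_convergence
    (fun k => 3 * ((k.natAbs : ℝ≥0∞) ^ m * ‖a k‖ₑ)) (fun n => measurable_of_countable _)
    (fun n => Eventually.of_forall fun k => ?_) ?_ (Eventually.of_forall fun k => ?_)
  · dsimp only
    rw [mul_left_comm]
    gcongr
    have h3 : ‖a k - c n k‖ ≤ 3 * ‖a k‖ := by
      have := norm_sub_le (a k) (c n k)
      have := hb n k
      linarith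
    rw [← ofReal_norm, ← ofReal_norm, show (3 : ℝ≥0∞) = ENNReal.ofReal 3 by simp,
      ← ENNReal.ofReal_mul (by norm_num)]
    exact ENNReal.ofReal_le_ofReal h3
  · rw [lintegral_const_mul _ (measurable_of_countable _), lintegral_count]
    exact ENNReal.mul_ne_top (by simp) ha.ne
  · have h1 : Tendsto (fun n => ‖a k - c n k‖ₑ) atTop (𝓝 0) := by
      have := ((tendsto_const_nhds (x := a k)).sub (hc k)).enorm
      simpa using this
    have := ENNReal.Tendsto.const_mul (a := (k.natAbs : ℝ≥0∞) ^ m) h1 (Or.inr (by simp))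
    simpa using this

/-- A path that is bounded in `Ȧ⁰` and integrable in `Ȧ⁴` belongs to `L^{4/m}(0,T;X)` for every space
`X` whose norm `N` is controlled by that of `Ȧᵐ`. -/
lemma memBochner_retrig {N : (ℝ → ℝ) → ℝ≥0∞} {K : ℝ≥0∞} {m : ℕ} {p T : ℝ} {E : ℝ≥0}
    {a : ℝ → ℤ → ℂ} (hK : K ≠ ⊤) (hm : 0 < m) (hm4 : m ≤ 4) (hp : p = 4 / m)
    (hN : ∀ c : ℤ → ℂ, c 0 = 0 → wnorm 4 c < ⊤ → N (retrig c) ≤ K * wnorm m c)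
    (ha : ∀ k, Measurable fun t => a t k) (h0 : ∀ t, a t 0 = 0)
    (hE : ∀ t ∈ Ioc 0 T, wnorm 0 (a t) ≤ E) (h4 : ∫⁻ t in Ioc 0 T, wnorm 4 (a t) < ⊤) :
    MemBochner p T N (fun t => retrig (a t)) := by
  have hfin : ∀ᵐ t ∂(volume.restrict (Ioc 0 T)), wnorm 4 (a t) < ⊤ :=
    ae_lt_top (measurable_wnorm ha 4) h4.ne
  have hm' : (0 : ℝ) < m := by exact_mod_cast hm
  have hp0 : 0 < p := by rw [hp]; positivity
  constructor
  · obtain ⟨c, c0, cs, cb, cl⟩ := exists_simpleFunc_coeff ha h0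
    refine ⟨fun n => (c n).map retrig, fun n t => ?_, ?_⟩
    · rw [SimpleFunc.map_apply]
      refine (hN _ (c0 n t) (wnorm_lt_top_of_support 4 n (cs n t))).trans_lt ?_
      exact ENNReal.mul_lt_top hK.lt_top (wnorm_lt_top_of_support m n (cs n t))
    · filter_upwards [hfin] with t ht
      have hmt : wnorm m (a t) < ⊤ := (wnorm_le_wnorm (h0 t) hm4).trans_lt ht
      have h1 := ENNReal.Tendsto.const_mul (a := K)
        (tendsto_wnorm_sub hmt (fun n k => cb n t k) (cl t)) (Or.inr hK)
      rw [mul_zero] at h1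
      refine tendsto_of_tendsto_of_tendsto_of_le_of_le tendsto_const_nhds h1
        (fun n => zero_le) fun n => ?_
      have hsub : (fun x => retrig (a t) x - (c n).map retrig t x)
          = retrig (fun k => a t k - c n t k) := by
        ext x
        rw [SimpleFunc.map_apply, retrig_sub ((wnorm_le_wnorm (h0 t) (by norm_num)).trans_lt ht)
          (wnorm_lt_top_of_support 0 n (cs n t))]
      dsimp only
      rw [hsub]
      refine hN _ (by rw [h0, c0, sub_zero]) ?_
      exact (wnorm_sub_le _ _ _).trans_lt
        (ENNReal.add_lt_top.2 ⟨ht, wnorm_lt_top_of_support 4 n (cs n t)⟩)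
  · have hb : ∀ᵐ t ∂(volume.restrict (Ioc 0 T)),
        N (retrig (a t)) ^ p ≤ (K * (E + 1)) ^ p * wnorm 4 (a t) := by
      filter_upwards [hfin, ae_restrict_mem measurableSet_Ioc] with t ht htT
      calc N (retrig (a t)) ^ p ≤ (K * ((E + 1) * wnorm 4 (a t) ^ ((m : ℝ) / 4))) ^ p := by
            gcongr
            refine (hN _ (h0 t) ht).trans ?_
            gcongr
            exact wnorm_rpow_interp hm hm4 (h0 t) (hE t htT)
        _ = (K * (E + 1)) ^ p * wnorm 4 (a t) := by
            rw [← mul_assoc, ENNReal.mul_rpow_of_nonneg _ _ hp0.le, ← ENNReal.rpow_mul, hp]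
            rw [show (m : ℝ) / 4 * (4 / m) = 1 by field_simp, ENNReal.rpow_one]
    refine (lintegral_mono_ae hb).trans_lt ?_
    rw [lintegral_const_mul _ (measurable_wnorm ha 4)]
    refine ENNReal.mul_lt_top (ENNReal.rpow_lt_top_of_nonneg hp0.le ?_) h4
    exact ENNReal.mul_ne_top hK (by simp)

lemma setIntegral_retrig {a : ℝ → ℤ → ℂ} (ha : ∀ k, Measurable fun t => a t k) {B : Set ℝ}
    (hB : ∫⁻ t in B, wnorm 0 (a t) < ⊤) (x : ℝ) :
    ∫ t in B, retrig (a t) x = retrig (fun k => ∫ t in B, a t k) x := by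
  have hF : ∀ k, AEStronglyMeasurable (fun t => a t k * expo k x) (volume.restrict B) := fun k =>
    ((ha k).mul_const _).aestronglyMeasurable
  have hF' : ∑' k, ∫⁻ t in B, ‖a t k * expo k x‖ₑ ≠ ⊤ := by
    rw [← lintegral_tsum fun k => (hF k).enorm]
    simp only [enorm_mul, enorm_expo, mul_one, ← wnorm_zero_eq]
    exact hB.ne
  have h1 : ∫ t in B, trig (a t) x = trig (fun k => ∫ t in B, a t k) x := by
    simp only [trig]
    rw [integral_tsum hF hF']
    exact tsum_congr fun k => integral_mul_const _ _
  have hint : Integrable (fun t => trig (a t) x) (volume.restrict B) := by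
    refine ⟨?_, ?_⟩
    · refine aestronglyMeasurable_of_tendsto_ae (u := (atTop : Filter (Finset ℤ)))
        (f := fun s t => ∑ k ∈ s, a t k * expo k x) (fun s => ?_) ?_
      · exact (Finset.measurable_fun_sum _ fun k _ => (ha k).mul_const _).aestronglyMeasurable
      · filter_upwards [ae_lt_top (measurable_wnorm ha 0) hB.ne] with t ht
        exact hasSum_trig ht x
    · exact (lintegral_mono fun t => enorm_trig_le (a t) x).trans_lt hB
  have h2 := integral_re hint
  simp only [RCLike.re_eq_complex_re] at h2
  simp only [retrig]
  rw [h2, h1]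

lemma wnorm_integral_le {a : ℝ → ℤ → ℂ} (ha : ∀ k, Measurable fun t => a t k) (m : ℕ)
    (B : Set ℝ) : wnorm m (fun k => ∫ t in B, a t k) ≤ ∫⁻ t in B, wnorm m (a t) := by
  simp only [wnorm]
  rw [lintegral_tsum fun k => ((ha k).enorm.const_mul _).aemeasurable]
  refine ENNReal.tsum_le_tsum fun k => ?_
  rw [lintegral_const_mul _ (ha k).enorm]
  gcongr
  exact enorm_integral_le_lintegral_enorm _

/-- A path that is integrable in `Ȧ⁴` defines a measure of finite variation with values in any space
whose norm `N` is controlled by that of `Ȧ⁴`. -/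
lemma memMeasures_retrig {N : (ℝ → ℝ) → ℝ≥0∞} {K : ℝ≥0∞} {T : ℝ} {a : ℝ → ℤ → ℂ} (hK : K ≠ ⊤)
    (hN : ∀ c : ℤ → ℂ, c 0 = 0 → wnorm 4 c < ⊤ → N (retrig c) ≤ K * wnorm 4 c)
    (ha : ∀ k, Measurable fun t => a t k) (h0 : ∀ t, a t 0 = 0)
    (h4 : ∫⁻ t in Icc 0 T, wnorm 4 (a t) < ⊤) : MemMeasures T N (fun t => retrig (a t)) := by
  refine ⟨(K * ∫⁻ t in Icc 0 T, wnorm 4 (a t)).toNNReal, fun n B hB hBT hd => ?_⟩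
  rw [ENNReal.coe_toNNReal (ENNReal.mul_ne_top hK h4.ne)]
  have hBi : ∀ i, ∫⁻ t in B i, wnorm 4 (a t) < ⊤ := fun i =>
    (lintegral_mono_set (hBT i)).trans_lt h4
  have h1 : ∀ i, N (fun x => ∫ t in B i, retrig (a t) x) ≤ K * ∫⁻ t in B i, wnorm 4 (a t) := by
    intro i
    have hz : ∫⁻ t in B i, wnorm 0 (a t) < ⊤ :=
      (lintegral_mono fun t => wnorm_le_wnorm (h0 t) (by norm_num)).trans_lt (hBi i)
    rw [show (fun x => ∫ t in B i, retrig (a t) x) = retrig (fun k => ∫ t in B i, a t k) from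
      funext fun x => setIntegral_retrig ha hz x]
    have hw := wnorm_integral_le ha 4 (B i)
    refine (hN _ (by simp [h0]) (hw.trans_lt (hBi i))).trans ?_
    gcongr
  calc ∑ i, N (fun x => ∫ t in B i, retrig (a t) x)
      ≤ ∑ i, K * ∫⁻ t in B i, wnorm 4 (a t) := Finset.sum_le_sum fun i _ => h1 i
    _ = K * ∫⁻ t in ⋃ i, B i, wnorm 4 (a t) := by
        rw [← Finset.mul_sum, lintegral_iUnion hB hd, tsum_fintype]
    _ ≤ _ := by
        gcongr
        exact iUnion_subset hBT

/-! ### A differential inequality for a single mode -/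

/-- The modulus of a solution of `z' = -λ z + r` satisfies `|z|' ≤ -λ |z| + |r|` in integrated form.
The modulus is smoothed to `√(|z|² + ε²)`. -/
lemma norm_add_integral_le {z r : ℝ → ℂ} {lam : ℝ → ℝ} {T : ℝ} (hT : 0 ≤ T)
    (hz : ∀ t ∈ Icc 0 T, HasDerivAt z (-(lam t : ℂ) * z t + r t) t)
    (hlam : ContinuousOn lam (Icc 0 T)) (hr : ContinuousOn r (Icc 0 T)) :
    ‖z T‖ + ∫ t in (0 : ℝ)..T, (lam t * ‖z t‖ - ‖r t‖) ≤ ‖z 0‖ := by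
  have hzc : ContinuousOn z (Icc 0 T) := fun t ht => (hz t ht).continuousAt.continuousWithinAt
  have hu : uIcc 0 T = Icc 0 T := uIcc_of_le hT
  have hlami : IntervalIntegrable lam volume 0 T := (hu ▸ hlam).intervalIntegrable
  have hgc : ContinuousOn (fun t => lam t * ‖z t‖ - ‖r t‖) (Icc 0 T) :=
    (hlam.mul hzc.norm).sub hr.norm
  have hgi : IntervalIntegrable (fun t => lam t * ‖z t‖ - ‖r t‖) volume 0 T :=
    (hu ▸ hgc).intervalIntegrable
  have key : ∀ ε > 0, ‖z T‖ + ∫ t in (0 : ℝ)..T, (lam t * ‖z t‖ - ‖r t‖)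
      ≤ ‖z 0‖ + ε + ε * ∫ t in (0 : ℝ)..T, |lam t| := by
    intro ε hε
    set h : ℝ → ℝ := fun t => √(‖z t‖ ^ 2 + ε ^ 2) with hh
    have hpos : ∀ t, 0 < ‖z t‖ ^ 2 + ε ^ 2 := fun t => by positivity
    have hhpos : ∀ t, 0 < h t := fun t => Real.sqrt_pos.2 (hpos t)
    have hsq : ∀ t, h t ^ 2 = ‖z t‖ ^ 2 + ε ^ 2 := fun t => Real.sq_sqrt (hpos t).le
    set d : ℝ → ℝ := fun t => inner ℝ (z t) (-(lam t : ℂ) * z t + r t) / h t with hd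
    have hder : ∀ t ∈ Icc 0 T, HasDerivAt h (d t) t := by
      intro t ht
      have h1 := ((hz t ht).norm_sq.add_const (ε ^ 2)).sqrt (hpos t).ne'
      refine h1.congr_deriv ?_
      simp only [hd, hh]
      field_simp
    have hhc : ContinuousOn h (Icc 0 T) := fun t ht =>
      (hder t ht).continuousAt.continuousWithinAt
    have hdc : ContinuousOn d (Icc 0 T) := by
      refine ContinuousOn.div ?_ hhc fun t _ => (hhpos t).ne'
      refine hzc.inner ?_
      exact (((Complex.continuous_ofReal.comp_continuousOn hlam).neg).mul hzc).add hr
    have hint := intervalIntegral.integral_eq_sub_of_hasDerivAt (a := 0) (b := T)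
      (fun t ht => hder t (hu ▸ ht)) (hu ▸ hdc).intervalIntegrable
    have hle : ∀ t ∈ Icc 0 T, d t ≤ -(lam t * ‖z t‖ - ‖r t‖) + ε * |lam t| := by
      intro t _
      have hzh : ‖z t‖ ≤ h t := Real.le_sqrt_of_sq_le (by nlinarith [sq_nonneg ε])
      have hhz : h t ≤ ‖z t‖ + ε := by
        rw [hh]; refine Real.sqrt_le_iff.2 ⟨by positivity, ?_⟩
        nlinarith [norm_nonneg (z t)]
      have e1 : inner ℝ (z t) (-(lam t : ℂ) * z t + r t)
          = -lam t * ‖z t‖ ^ 2 + inner ℝ (z t) (r t) := by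
        rw [inner_add_right, show -(lam t : ℂ) * z t = (-lam t) • z t by
          rw [Complex.real_smul]; push_cast; ring, inner_smul_right, real_inner_self_eq_norm_sq]
      have e2 : inner ℝ (z t) (r t) ≤ ‖z t‖ * ‖r t‖ := real_inner_le_norm _ _
      rw [hd]; dsimp only
      rw [e1, div_le_iff₀ (hhpos t)]
      have hl1 := le_abs_self (lam t)
      have hl2 := neg_abs_le (lam t)
      have e3 : ‖z t‖ * ‖r t‖ ≤ ‖r t‖ * h t := by
        rw [mul_comm]; gcongr
      have e4 : lam t * (‖z t‖ * (h t - ‖z t‖)) ≤ |lam t| * (ε * h t) := by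
        have p1 : 0 ≤ ‖z t‖ * (h t - ‖z t‖) := mul_nonneg (norm_nonneg _) (by linarith)
        have p2 : ‖z t‖ * (h t - ‖z t‖) ≤ ε * h t := by
          nlinarith [norm_nonneg (z t)]
        calc lam t * (‖z t‖ * (h t - ‖z t‖)) ≤ |lam t| * (‖z t‖ * (h t - ‖z t‖)) := by gcongr
          _ ≤ _ := by gcongr
      nlinarith
    have hmono := intervalIntegral.integral_mono_on hT (hu ▸ hdc).intervalIntegrable
      (hgi.neg.add (hlami.abs.const_mul ε)) hle
    rw [hint, intervalIntegral.integral_add hgi.neg (hlami.abs.const_mul ε),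
      intervalIntegral.integral_const_mul] at hmono
    simp only [Pi.neg_apply] at hmono
    rw [intervalIntegral.integral_neg] at hmono
    have hT1 : ‖z T‖ ≤ h T := Real.le_sqrt_of_sq_le (by nlinarith [sq_nonneg ε])
    have h01 : h 0 ≤ ‖z 0‖ + ε := by
      rw [hh]; refine Real.sqrt_le_iff.2 ⟨by positivity, ?_⟩
      nlinarith [norm_nonneg (z 0)]
    linarith
  have hlim : Tendsto (fun ε : ℝ => ‖z 0‖ + ε + ε * ∫ t in (0 : ℝ)..T, |lam t|) (𝓝[>] 0)
      (𝓝 (‖z 0‖ + 0 + 0 * ∫ t in (0 : ℝ)..T, |lam t|)) := by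
    refine tendsto_nhdsWithin_of_tendsto_nhds ?_
    exact ((continuous_const.add continuous_id).add (continuous_id.mul continuous_const)).tendsto 0
  have := ge_of_tendsto hlim (by filter_upwards [self_mem_nhdsWithin] with ε hε using key ε hε)
  simpa using this

/-! ### Bilinear estimates for trigonometric polynomials -/

/-- The frequencies `|k| ≤ N`. -/
def modes (N : ℕ) : Finset ℤ := Finset.Icc (-(N : ℤ)) N

/-- The sum `∑ |k|ⁿ |a k|` over the frequencies `|k| ≤ N`. -/
def fnorm (N n : ℕ) (a : ℤ → ℂ) : ℝ := ∑ k ∈ modes N, |(k : ℝ)| ^ n * ‖a k‖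

/-- All coefficients of frequency above `N` vanish. -/
def Band (N : ℕ) (a : ℤ → ℂ) : Prop := ∀ k, k ∉ modes N → a k = 0

/-- The coefficients multiplied by `kⁿ`. -/
def mulpow (n : ℕ) (a : ℤ → ℂ) (k : ℤ) : ℂ := (k : ℂ) ^ n * a k

lemma fnorm_nonneg (N n : ℕ) (a : ℤ → ℂ) : 0 ≤ fnorm N n a :=
  Finset.sum_nonneg fun k _ => by positivity

lemma Band.mulpow {N : ℕ} {a : ℤ → ℂ} (ha : Band N a) (n : ℕ) : Band N (mulpow n a) := by
  intro k hk; rw [ThinFilm.mulpow, ha k hk, mul_zero]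

lemma norm_mulpow (n : ℕ) (a : ℤ → ℂ) (k : ℤ) : ‖mulpow n a k‖ = |(k : ℝ)| ^ n * ‖a k‖ := by
  rw [mulpow, norm_mul, norm_pow, Complex.norm_intCast]

lemma Herm.norm_neg {a : ℤ → ℂ} (ha : Herm a) (k : ℤ) : ‖a (-k)‖ = ‖a k‖ := by
  rw [ha k, RCLike.norm_conj]

lemma sum_modes_neg {M : Type*} [AddCommMonoid M] (N : ℕ) (f : ℤ → M) :
    ∑ k ∈ modes N, f (-k) = ∑ k ∈ modes N, f k := by
  refine Finset.sum_equiv (Equiv.neg ℤ) (fun k => ?_) fun k _ => rfl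
  simp only [modes, Finset.mem_Icc, Equiv.neg_apply]; omega

lemma conv_eq_sum {N : ℕ} {b : ℤ → ℂ} (a : ℤ → ℂ) (hb : Band N b) (k : ℤ) :
    conv a b k = ∑ j ∈ modes N, a (k - j) * b j :=
  tsum_eq_sum fun j hj => by rw [hb j hj, mul_zero]

/-- A bilinear form with kernel `h` in the frequencies `l = k - j` and `j` is bounded through the average
of `h` over the sign of `l`, because `‖a (-l)‖ = ‖a l‖`. -/
lemma sum_kernel_le {N : ℕ} {a b : ℤ → ℂ} (hA : Herm a) (ha : Band N a) {h : ℤ → ℤ → ℝ} {c d : ℝ}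
    {m : ℕ} (h0 : ∀ l j, 0 ≤ h l j)
    (hle : ∀ l j : ℤ, h l j + h (-l) j ≤ 2 * (c * |(j : ℝ)| ^ m + d * |(l : ℝ)| ^ m)) :
    ∑ k ∈ modes N, ∑ j ∈ modes N, h (k - j) j * (‖a (k - j)‖ * ‖b j‖)
      ≤ c * (fnorm N 0 a * fnorm N m b) + d * (fnorm N m a * fnorm N 0 b) := by
  set T : ℝ := ∑ j ∈ modes N, ∑ l ∈ modes N, h l j * (‖a l‖ * ‖b j‖) with hT
  have h1 : ∑ k ∈ modes N, ∑ j ∈ modes N, h (k - j) j * (‖a (k - j)‖ * ‖b j‖) ≤ T := by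
    rw [Finset.sum_comm, hT]
    refine Finset.sum_le_sum fun j _ => ?_
    rw [← Finset.sum_image (s := modes N) (g := fun k => k - j)
      (f := fun l => h l j * (‖a l‖ * ‖b j‖)) (by intro x _ y _ hxy; simpa using hxy)]
    rw [← Finset.sum_subset Finset.inter_subset_left (s₁ := (modes N).image (· - j) ∩ modes N)]
    · exact Finset.sum_le_sum_of_subset_of_nonneg Finset.inter_subset_right
        fun l _ _ => mul_nonneg (h0 l j) (by positivity)
    · intro l hl hlN
      rw [ha l fun h' => hlN (Finset.mem_inter.2 ⟨hl, h'⟩)]; simp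
  -- realness allows the substitution `l ↦ -l`
  have h2 : T = ∑ j ∈ modes N, ∑ l ∈ modes N, h (-l) j * (‖a l‖ * ‖b j‖) := by
    rw [hT]
    refine Finset.sum_congr rfl fun j _ => ?_
    rw [← sum_modes_neg]
    simp only [hA.norm_neg]
  have h3 : T + T ≤ ∑ j ∈ modes N, ∑ l ∈ modes N,
      2 * (c * |(j : ℝ)| ^ m + d * |(l : ℝ)| ^ m) * (‖a l‖ * ‖b j‖) := by
    nth_rewrite 2 [h2]
    rw [hT, ← Finset.sum_add_distrib]
    refine Finset.sum_le_sum fun j _ => ?_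
    rw [← Finset.sum_add_distrib]
    refine Finset.sum_le_sum fun l _ => ?_
    rw [← add_mul]
    exact mul_le_mul_of_nonneg_right (hle l j) (by positivity)
  have h4 : ∑ j ∈ modes N, ∑ l ∈ modes N,
      2 * (c * |(j : ℝ)| ^ m + d * |(l : ℝ)| ^ m) * (‖a l‖ * ‖b j‖)
      = 2 * (c * (fnorm N 0 a * fnorm N m b) + d * (fnorm N m a * fnorm N 0 b)) := by
    simp only [fnorm]
    rw [Finset.sum_mul_sum, Finset.sum_mul_sum, Finset.sum_comm]
    simp only [Finset.mul_sum, ← Finset.sum_add_distrib]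
    refine Finset.sum_congr rfl fun l _ => Finset.sum_congr rfl fun j _ => ?_
    ring
  linarith

/-- The norm of `∂ₓ(f ∂ₓ³g)` in `Ȧ⁰`. The average of `|l + j|` over the sign of `l` is
`max |l| |j|`, and `max |l| |j| * |j|³ ≤ j⁴ + l⁴`. -/
lemma sum_mul_norm_conv_three_le {N : ℕ} {a b : ℤ → ℂ} (hA : Herm a) (ha : Band N a)
    (hb : Band N b) : ∑ k ∈ modes N, |(k : ℝ)| * ‖conv a (mulpow 3 b) k‖
      ≤ fnorm N 0 a * fnorm N 4 b + fnorm N 4 a * fnorm N 0 b := by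
  have h1 := sum_kernel_le (b := b) hA ha (h := fun l j => |(l : ℝ) + j| * |(j : ℝ)| ^ 3) (c := 1)
    (d := 1) (m := 4) (fun l j => by positivity) (fun l j => ?_)
  · rw [one_mul, one_mul] at h1
    refine le_trans (Finset.sum_le_sum fun k _ => ?_) h1
    rw [conv_eq_sum a (hb.mulpow 3)]
    calc |(k : ℝ)| * ‖∑ j ∈ modes N, a (k - j) * mulpow 3 b j‖
        ≤ |(k : ℝ)| * ∑ j ∈ modes N, ‖a (k - j) * mulpow 3 b j‖ := by
          gcongr; exact norm_sum_le _ _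
      _ = _ := by
          rw [Finset.mul_sum]
          refine Finset.sum_congr rfl fun j _ => ?_
          rw [norm_mul, norm_mulpow]
          push_cast
          rw [sub_add_cancel]; ring
  · push_cast
    have e : |(l : ℝ) + j| + |-(l : ℝ) + j| ≤ 2 * max |(l : ℝ)| |(j : ℝ)| := by
      have := abs_add_le (l : ℝ) j
      rcases le_total |(l : ℝ)| |(j : ℝ)| with h | h
      · rw [max_eq_right h]
        rcases abs_cases (l : ℝ) with ⟨_, _⟩ | ⟨_, _⟩ <;> rcases abs_cases (j : ℝ) with ⟨_, _⟩ | ⟨_, _⟩ <;>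
        rcases abs_cases ((l : ℝ) + j) with ⟨_, _⟩ | ⟨_, _⟩ <;>
        rcases abs_cases (-(l : ℝ) + j) with ⟨_, _⟩ | ⟨_, _⟩ <;> linarith
      · rw [max_eq_left h]
        rcases abs_cases (l : ℝ) with ⟨_, _⟩ | ⟨_, _⟩ <;> rcases abs_cases (j : ℝ) with ⟨_, _⟩ | ⟨_, _⟩ <;>
        rcases abs_cases ((l : ℝ) + j) with ⟨_, _⟩ | ⟨_, _⟩ <;>
        rcases abs_cases (-(l : ℝ) + j) with ⟨_, _⟩ | ⟨_, _⟩ <;> linarith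
    have e2 : max |(l : ℝ)| |(j : ℝ)| * |(j : ℝ)| ^ 3 ≤ |(j : ℝ)| ^ 4 + |(l : ℝ)| ^ 4 := by
      rcases le_total |(l : ℝ)| |(j : ℝ)| with h | h
      · rw [max_eq_right h]
        have : 0 ≤ |(l : ℝ)| ^ 4 := by positivity
        nlinarith
      · rw [max_eq_left h]
        have h3 : |(j : ℝ)| ^ 3 ≤ |(l : ℝ)| ^ 3 := by gcongr
        have : 0 ≤ |(j : ℝ)| ^ 4 := by positivity
        nlinarith [abs_nonneg (l : ℝ)]
    calc |(l : ℝ) + j| * |(j : ℝ)| ^ 3 + |-(l : ℝ) + j| * |(j : ℝ)| ^ 3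
        = (|(l : ℝ) + j| + |-(l : ℝ) + j|) * |(j : ℝ)| ^ 3 := by ring
      _ ≤ (2 * max |(l : ℝ)| |(j : ℝ)|) * |(j : ℝ)| ^ 3 := by gcongr
      _ ≤ _ := by linarith

/-- For equal factors the constant of `sum_mul_norm_conv_three_le` improves from `2` to `1`: after
symmetrization the symbol of `∂ₓ(g ∂ₓ³g)` is `(j+l)² (j² - jl + l²) / 2`, whose average over the
sign of `l` is `(j⁴ + l⁴) / 2`. -/
lemma sum_mul_norm_conv_self_le {N : ℕ} {a : ℤ → ℂ} (hA : Herm a) (ha : Band N a) :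
    ∑ k ∈ modes N, |(k : ℝ)| * ‖conv a (mulpow 3 a) k‖ ≤ fnorm N 0 a * fnorm N 4 a := by
  have h1 := sum_kernel_le (b := a) hA ha
    (h := fun l j => ((l : ℝ) + j) ^ 2 * (j ^ 2 - j * l + l ^ 2)) (c := 1)
    (d := 1) (m := 4)
    (fun l j => mul_nonneg (sq_nonneg _)
      (by nlinarith [sq_nonneg ((l : ℝ) - j), sq_nonneg ((l : ℝ) + j)]))
    (fun l j => ?_)
  swap
  · have e : ∀ x : ℝ, |x| ^ 4 = x ^ 4 := fun x => by
      rw [show 4 = 2 * 2 by norm_num, pow_mul, pow_mul, sq_abs]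
    rw [e, e]
    push_cast
    apply le_of_eq
    ring
  have hsym : ∀ k, 2 * conv a (mulpow 3 a) k
      = ∑ j ∈ modes N, (a (k - j) * mulpow 3 a j + mulpow 3 a (k - j) * a j) := by
    intro k
    have e1 : conv a (mulpow 3 a) k = conv (mulpow 3 a) a k := by
      rw [conv, ← (Equiv.subLeft k).tsum_eq]
      refine tsum_congr fun j => ?_
      simp only [Equiv.subLeft_apply, sub_sub_cancel]; ring
    rw [Finset.sum_add_distrib, ← conv_eq_sum a (ha.mulpow 3), ← conv_eq_sum _ ha, ← e1]; ring
  have h2 : 2 * ∑ k ∈ modes N, |(k : ℝ)| * ‖conv a (mulpow 3 a) k‖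
      ≤ ∑ k ∈ modes N, ∑ j ∈ modes N, (fun l j : ℤ => ((l : ℝ) + j) ^ 2 * (j ^ 2 - j * l + l ^ 2))
        (k - j) j * (‖a (k - j)‖ * ‖a j‖) := by
    rw [Finset.mul_sum]
    refine Finset.sum_le_sum fun k _ => ?_
    have e2 : 2 * (|(k : ℝ)| * ‖conv a (mulpow 3 a) k‖)
        = |(k : ℝ)| * ‖2 * conv a (mulpow 3 a) k‖ := by
      rw [norm_mul]; simp; ring
    rw [e2, hsym]
    calc _ ≤ |(k : ℝ)| * ∑ j ∈ modes N, ‖a (k - j) * mulpow 3 a j + mulpow 3 a (k - j) * a j‖ := by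
          gcongr; exact norm_sum_le _ _
      _ = _ := by
          rw [Finset.mul_sum]
          refine Finset.sum_congr rfl fun j _ => ?_
          have e3 : a (k - j) * mulpow 3 a j + mulpow 3 a (k - j) * a j
              = ((k * (j ^ 2 - j * (k - j) + (k - j) ^ 2) : ℝ) : ℂ) * (a (k - j) * a j) := by
            simp only [mulpow]; push_cast; ring
          have e4 : 0 ≤ (j : ℝ) ^ 2 - j * (k - j) + (k - j) ^ 2 := by
            nlinarith [sq_nonneg ((k : ℝ) - j - j), sq_nonneg ((k : ℝ) - j), sq_nonneg (j : ℝ),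
              sq_nonneg ((k : ℝ))]
          rw [e3, norm_mul, norm_mul, Complex.norm_real, Real.norm_eq_abs, abs_mul,
            abs_of_nonneg e4]
          have e5 : |(k : ℝ)| * |(k : ℝ)| = (k : ℝ) ^ 2 := by rw [abs_mul_abs_self, sq]
          push_cast
          rw [sub_add_cancel, ← e5]; ring
  linarith

/-- The norm of `∂ₓ(f ∂ₓg)` in `Ȧ⁰`. -/
lemma sum_mul_norm_conv_one_le {N : ℕ} {a b : ℤ → ℂ} (hA : Herm a) (ha : Band N a)
    (hb : Band N b) : ∑ k ∈ modes N, |(k : ℝ)| * ‖conv a (mulpow 1 b) k‖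
      ≤ 3 / 2 * (fnorm N 0 a * fnorm N 2 b) + 1 / 2 * (fnorm N 2 a * fnorm N 0 b) := by
  have h1 := sum_kernel_le (b := b) hA ha (h := fun l j => |(l : ℝ) + j| * |(j : ℝ)|) (c := 3 / 2)
    (d := 1 / 2) (m := 2) (fun l j => by positivity) (fun l j => ?_)
  · refine le_trans (Finset.sum_le_sum fun k _ => ?_) h1
    rw [conv_eq_sum a (hb.mulpow 1)]
    calc |(k : ℝ)| * ‖∑ j ∈ modes N, a (k - j) * mulpow 1 b j‖
        ≤ |(k : ℝ)| * ∑ j ∈ modes N, ‖a (k - j) * mulpow 1 b j‖ := by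
          gcongr; exact norm_sum_le _ _
      _ = _ := by
          rw [Finset.mul_sum]
          refine Finset.sum_congr rfl fun j _ => ?_
          rw [norm_mul, norm_mulpow]
          push_cast
          rw [sub_add_cancel]; ring
  · push_cast
    have e1 := abs_add_le (l : ℝ) j
    have e2 := abs_add_le (-(l : ℝ)) j
    rw [abs_neg] at e2
    nlinarith [abs_nonneg (l : ℝ), abs_nonneg (j : ℝ), sq_nonneg (|(l : ℝ)| - |(j : ℝ)|),
      mul_le_mul_of_nonneg_right e1 (abs_nonneg (j : ℝ)),
      mul_le_mul_of_nonneg_right e2 (abs_nonneg (j : ℝ))]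

/-! ### The system in Fourier variables -/

/-- Fourier coefficients of `i (α ∂ₓ³f + β ∂ₓ³g - γ ∂ₓf - δ ∂ₓg)`, in terms of those of `f, g`. -/
def sym (α β γ δ : ℝ) (a b : ℤ → ℂ) (k : ℤ) : ℂ :=
  α * mulpow 3 a k + β * mulpow 3 b k + γ * mulpow 1 a k + δ * mulpow 1 b k

/-- Fourier coefficients of `-∂ₓ[(p + m) (α ∂ₓ³f + β ∂ₓ³g - γ ∂ₓf - δ ∂ₓg)]`. -/
def rhs (m α β γ δ : ℝ) (p a b : ℤ → ℂ) (k : ℤ) : ℂ :=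
  -(k : ℂ) * (m * sym α β γ δ a b k + conv p (sym α β γ δ a b) k)

lemma Band.sym {N : ℕ} {a b : ℤ → ℂ} (ha : Band N a) (hb : Band N b) (α β γ δ : ℝ) :
    Band N (sym α β γ δ a b) := by
  intro k hk
  simp only [ThinFilm.sym, ThinFilm.mulpow, ha k hk, hb k hk, mul_zero, add_zero]

lemma sum_mul_norm_conv_sym_le {N : ℕ} (p : ℤ → ℂ) {a b : ℤ → ℂ} (ha : Band N a) (hb : Band N b)
    {α β γ δ : ℝ} (hα : 0 ≤ α) (hβ : 0 ≤ β) (hγ : 0 ≤ γ) (hδ : 0 ≤ δ) :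
    ∑ k ∈ modes N, |(k : ℝ)| * ‖conv p (sym α β γ δ a b) k‖
      ≤ α * ∑ k ∈ modes N, |(k : ℝ)| * ‖conv p (mulpow 3 a) k‖
        + β * ∑ k ∈ modes N, |(k : ℝ)| * ‖conv p (mulpow 3 b) k‖
        + γ * ∑ k ∈ modes N, |(k : ℝ)| * ‖conv p (mulpow 1 a) k‖
        + δ * ∑ k ∈ modes N, |(k : ℝ)| * ‖conv p (mulpow 1 b) k‖ := by
  simp only [Finset.mul_sum, ← Finset.sum_add_distrib]
  refine Finset.sum_le_sum fun k _ => ?_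
  have e : conv p (sym α β γ δ a b) k = α * conv p (mulpow 3 a) k + β * conv p (mulpow 3 b) k
      + γ * conv p (mulpow 1 a) k + δ * conv p (mulpow 1 b) k := by
    rw [conv_eq_sum p (ha.sym hb α β γ δ), conv_eq_sum p (ha.mulpow 3), conv_eq_sum p (hb.mulpow 3),
      conv_eq_sum p (ha.mulpow 1), conv_eq_sum p (hb.mulpow 1)]
    simp only [Finset.mul_sum, ← Finset.sum_add_distrib]
    refine Finset.sum_congr rfl fun j _ => ?_
    simp only [sym]; ring
  have n : ∀ (c : ℝ) (z : ℂ), 0 ≤ c → ‖(c : ℂ) * z‖ = c * ‖z‖ := fun c z hc => by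
    rw [norm_mul, Complex.norm_real, Real.norm_of_nonneg hc]
  rw [e]
  calc |(k : ℝ)| * ‖_‖ ≤ |(k : ℝ)| * (‖(α : ℂ) * conv p (mulpow 3 a) k‖
        + ‖(β : ℂ) * conv p (mulpow 3 b) k‖
        + ‖(γ : ℂ) * conv p (mulpow 1 a) k‖ + ‖(δ : ℂ) * conv p (mulpow 1 b) k‖) := by
        gcongr
        exact norm_add₄_le
    _ = _ := by rw [n _ _ hα, n _ _ hβ, n _ _ hγ, n _ _ hδ]; ring

/-- The part of the mode equation that is not the diagonal linear term, for the first equation at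
the scaled state `θ (a, b)`. -/
def offF (θ m α β γ δ : ℝ) (a b : ℤ → ℂ) (k : ℤ) : ℂ :=
  -(k : ℂ) * (θ * m * (β * mulpow 3 b k + δ * mulpow 1 b k)
    + θ ^ 2 * conv a (sym α β γ δ a b) k)

/-- The same as `offF` for the second equation. -/
def offG (θ m α β γ δ : ℝ) (a b : ℤ → ℂ) (k : ℤ) : ℂ :=
  -(k : ℂ) * (θ * m * (α * mulpow 3 a k + γ * mulpow 1 a k)
    + θ ^ 2 * conv b (sym α β γ δ a b) k)

lemma sum_norm_off_le {N : ℕ} {θ m β δ : ℝ} (hθ : 0 ≤ θ) (hm : 0 ≤ m) (hβ : 0 ≤ β) (hδ : 0 ≤ δ)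
    (b c : ℤ → ℂ) : ∑ k ∈ modes N, ‖-(k : ℂ) * (θ * m * (β * mulpow 3 b k + δ * mulpow 1 b k)
      + θ ^ 2 * c k)‖ ≤ θ * m * (β * fnorm N 4 b + δ * fnorm N 2 b)
        + θ ^ 2 * ∑ k ∈ modes N, |(k : ℝ)| * ‖c k‖ := by
  simp only [fnorm, Finset.mul_sum, ← Finset.sum_add_distrib]
  refine Finset.sum_le_sum fun k _ => ?_
  have n : ∀ (c : ℝ) (z : ℂ), 0 ≤ c → ‖(c : ℂ) * z‖ = c * ‖z‖ := fun c z hc => by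
    rw [norm_mul, Complex.norm_real, Real.norm_of_nonneg hc]
  rw [norm_mul, norm_neg, Complex.norm_intCast]
  have h1 : ‖(θ : ℂ) * m * (β * mulpow 3 b k + δ * mulpow 1 b k) + θ ^ 2 * c k‖
      ≤ θ * m * (β * (|(k : ℝ)| ^ 3 * ‖b k‖) + δ * (|(k : ℝ)| ^ 1 * ‖b k‖)) + θ ^ 2 * ‖c k‖ := by
    refine (norm_add_le _ _).trans (add_le_add ?_ ?_)
    · rw [mul_assoc, n _ _ hθ, n _ _ hm, mul_assoc]
      gcongr
      refine (norm_add_le _ _).trans (le_of_eq ?_)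
      rw [n _ _ hβ, n _ _ hδ, norm_mulpow, norm_mulpow]
    · rw [norm_mul, norm_pow, Complex.norm_real, Real.norm_of_nonneg hθ]
  calc _ ≤ |(k : ℝ)| * (θ * m * (β * (|(k : ℝ)| ^ 3 * ‖b k‖) + δ * (|(k : ℝ)| ^ 1 * ‖b k‖))
        + θ ^ 2 * ‖c k‖) := by gcongr
    _ = _ := by ring

lemma rhs_smul_eq_offF (a b : ℤ → ℂ) (θ m α β γ δ : ℝ) (k : ℤ) :
    rhs m α β γ δ (fun k => θ * a k) (fun k => θ * a k) (fun k => θ * b k) k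
      = -((θ * (m * (α * k ^ 4 + γ * k ^ 2)) : ℝ) : ℂ) * a k + offF θ m α β γ δ a b k := by
  have e : conv (fun k => θ * a k) (sym α β γ δ (fun k => θ * a k) (fun k => θ * b k)) k
      = θ ^ 2 * conv a (sym α β γ δ a b) k := by
    rw [conv, conv, ← tsum_mul_left]
    refine tsum_congr fun j => ?_
    simp only [sym, mulpow]; ring
  rw [rhs, e, offF]
  simp only [sym, mulpow]; push_cast; ring

lemma rhs_smul_eq_offG (a b : ℤ → ℂ) (θ m α β γ δ : ℝ) (k : ℤ) :
    rhs m α β γ δ (fun k => θ * b k) (fun k => θ * a k) (fun k => θ * b k) k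
      = -((θ * (m * (β * k ^ 4 + δ * k ^ 2)) : ℝ) : ℂ) * b k + offG θ m α β γ δ a b k := by
  have e : conv (fun k => θ * b k) (sym α β γ δ (fun k => θ * a k) (fun k => θ * b k)) k
      = θ ^ 2 * conv b (sym α β γ δ a b) k := by
    rw [conv, conv, ← tsum_mul_left]
    refine tsum_congr fun j => ?_
    simp only [sym, mulpow]; ring
  rw [rhs, e, offG]
  simp only [sym, mulpow]; push_cast; ring

/-- The numerical part of the dissipation estimate: `x₀, x₂, x₄` and `y₀, y₂, y₄` stand for the
norms of the two unknowns in `Ȧ⁰, Ȧ², Ȧ⁴`. -/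
lemma dissipation_arith (P : Params) (hP : P.Pos) {mf mg E θ x0 x2 x4 y0 y2 y4 : ℝ}
    (hθ : 0 ≤ θ) (hx0 : 0 ≤ x0) (hx2 : 0 ≤ x2) (hx4 : 0 ≤ x4) (hy0 : 0 ≤ y0)
    (hy2 : 0 ≤ y2) (hy4 : 0 ≤ y4) (hE : θ * (x0 + y0) ≤ E) :
    θ * (P.σ1A mf mg E * x4 + P.σ2A mf mg E * y4 + P.σ1b mf mg E * x2 + P.σ2b mf mg E * y2)
      ≤ θ * (mf * (P.Aγ * x4 + P.bρ * x2)) + θ * (mg * (P.Aμ * y4 + P.bμ * y2))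
        - (θ * mf * (P.A * y4 + P.b * y2) + θ ^ 2 * (P.Aγ * (2 * (x0 * x4))
          + P.A * (x0 * y4 + x4 * y0) + P.bρ * (2 * (x0 * x2))
          + P.b * (3 / 2 * (x0 * y2) + 1 / 2 * (x2 * y0))))
        - (θ * mg * (P.Aμ * x4 + P.bμ * x2) + θ ^ 2 * (P.Aμ * (y0 * x4 + y4 * x0)
          + P.Aμ * (y0 * y4) + P.bμ * (3 / 2 * (y0 * x2) + 1 / 2 * (y2 * x0))
          + P.bμ * (2 * (y0 * y2)))) := by
  obtain ⟨h1, h2, h3, h4, h5, h6, h7⟩ := hP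
  have pA : 0 < P.A := by unfold Params.A; positivity
  have pAμ : 0 < P.Aμ := by unfold Params.Aμ; positivity
  have pAγ : 0 < P.Aγ := by unfold Params.Aγ; positivity
  have pb : 0 < P.b := by unfold Params.b; positivity
  have pbμ : 0 < P.bμ := by unfold Params.bμ; positivity
  have pbρ : 0 < P.bρ := by unfold Params.bρ; positivity
  have hu : 0 ≤ θ * x0 := by positivity
  have hv : 0 ≤ θ * y0 := by positivity
  have hE0 : 0 ≤ E - θ * x0 - θ * y0 := by linarith
  set w := E - θ * x0 - θ * y0 with hw
  have hEw : E = w + θ * x0 + θ * y0 := by rw [hw]; ring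
  rw [← sub_nonneg]
  have key : 0 ≤ θ * (x4 * ((P.Aμ + 2 * P.Aγ + 2 * P.A) * w + (P.Aμ + 2 * P.A) * (θ * x0)
        + (2 * P.Aγ + P.A) * (θ * y0))
      + y4 * ((P.Aμ + 2 * P.Aγ + 2 * P.A) * w + (2 * P.Aγ + P.A) * (θ * x0)
        + (2 * P.Aγ + 2 * P.A) * (θ * y0))
      + x2 * ((2 * P.bρ + 2 * P.b + 4 * P.bμ) * w + (2 * P.b + 4 * P.bμ) * (θ * x0)
        + (2 * P.bρ + 3 / 2 * P.b + 5 / 2 * P.bμ) * (θ * y0))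
      + y2 * ((2 * P.bρ + 2 * P.b + 4 * P.bμ) * w
        + (2 * P.bρ + 1 / 2 * P.b + 7 / 2 * P.bμ) * (θ * x0)
        + (2 * P.bρ + 2 * P.b + 2 * P.bμ) * (θ * y0))) := by positivity
  refine key.trans (le_of_eq ?_)
  simp only [Params.σ1A, Params.σ2A, Params.σ1b, Params.σ2b]
  rw [hEw]
  ring

/-- The dissipation estimate for trigonometric polynomials: in the system at the scaled state
`θ (a, b)`, with `θ (‖a‖ + ‖b‖) ≤ E`, the diagonal linear terms dominate everything else. -/
lemma dissipation_le (P : Params) (hP : P.Pos) {mf mg E θ : ℝ} (hmf : 0 ≤ mf) (hmg : 0 ≤ mg)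
    (hθ : 0 ≤ θ) {N : ℕ} {a b : ℤ → ℂ} (hA : Herm a) (hB : Herm b) (ha : Band N a) (hb : Band N b)
    (hE : θ * (fnorm N 0 a + fnorm N 0 b) ≤ E) :
    θ * (P.σ1A mf mg E * fnorm N 4 a + P.σ2A mf mg E * fnorm N 4 b
        + P.σ1b mf mg E * fnorm N 2 a + P.σ2b mf mg E * fnorm N 2 b)
      ≤ ∑ k ∈ modes N, (θ * (mf * (P.Aγ * k ^ 4 + P.bρ * k ^ 2)) * ‖a k‖
          - ‖offF θ mf P.Aγ P.A P.bρ P.b a b k‖)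
        + ∑ k ∈ modes N, (θ * (mg * (P.Aμ * k ^ 4 + P.bμ * k ^ 2)) * ‖b k‖
          - ‖offG θ mg P.Aμ P.Aμ P.bμ P.bμ a b k‖) := by
  obtain ⟨h1, h2, h3, h4, h5, h6, h7⟩ := id hP
  have pA : 0 ≤ P.A := by unfold Params.A; positivity
  have pAμ : 0 ≤ P.Aμ := by unfold Params.Aμ Params.A; positivity
  have pAγ : 0 ≤ P.Aγ := by unfold Params.Aγ Params.A; positivity
  have pb : 0 ≤ P.b := by unfold Params.b; positivity
  have pbμ : 0 ≤ P.bμ := by unfold Params.bμ Params.b; positivity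
  have pbρ : 0 ≤ P.bρ := by unfold Params.bρ Params.b; positivity
  have hdiag : ∀ (m α γ : ℝ) (c : ℤ → ℂ), ∑ k ∈ modes N, θ * (m * (α * (k : ℝ) ^ 4 + γ * k ^ 2)) * ‖c k‖
      = θ * (m * (α * fnorm N 4 c + γ * fnorm N 2 c)) := by
    intro m α γ c
    have e4 : ∀ x : ℝ, |x| ^ 4 = x ^ 4 := fun x => by
      rw [show 4 = 2 * 2 by norm_num, pow_mul, pow_mul, sq_abs]
    simp only [fnorm, Finset.mul_sum, ← Finset.sum_add_distrib, sq_abs, e4]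
    refine Finset.sum_congr rfl fun k _ => ?_
    ring
  rw [Finset.sum_sub_distrib, Finset.sum_sub_distrib, hdiag, hdiag]
  have hF := sum_norm_off_le (N := N) hθ hmf pA pb b (conv a (sym P.Aγ P.A P.bρ P.b a b))
  have hG := sum_norm_off_le (N := N) hθ hmg pAμ pbμ a (conv b (sym P.Aμ P.Aμ P.bμ P.bμ a b))
  have hF2 := sum_mul_norm_conv_sym_le a ha hb pAγ pA pbρ pb
  have hG2 := sum_mul_norm_conv_sym_le b ha hb pAμ pAμ pbμ pbμ
  have aa3 := sum_mul_norm_conv_three_le hA ha ha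
  have ab3 := sum_mul_norm_conv_three_le hA ha hb
  have ba3 := sum_mul_norm_conv_three_le hB hb ha
  have bb3 := sum_mul_norm_conv_self_le hB hb
  have aa1 := sum_mul_norm_conv_one_le hA ha ha
  have ab1 := sum_mul_norm_conv_one_le hA ha hb
  have ba1 := sum_mul_norm_conv_one_le hB hb ha
  have bb1 := sum_mul_norm_conv_one_le hB hb hb
  have key := dissipation_arith P hP (mf := mf) (mg := mg) hθ (fnorm_nonneg N 0 a)
    (fnorm_nonneg N 2 a) (fnorm_nonneg N 4 a) (fnorm_nonneg N 0 b) (fnorm_nonneg N 2 b)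
    (fnorm_nonneg N 4 b) hE
  have hF3 : ∑ k ∈ modes N, |(k : ℝ)| * ‖conv a (sym P.Aγ P.A P.bρ P.b a b) k‖
      ≤ P.Aγ * (2 * (fnorm N 0 a * fnorm N 4 a))
        + P.A * (fnorm N 0 a * fnorm N 4 b + fnorm N 4 a * fnorm N 0 b)
        + P.bρ * (2 * (fnorm N 0 a * fnorm N 2 a))
        + P.b * (3 / 2 * (fnorm N 0 a * fnorm N 2 b) + 1 / 2 * (fnorm N 2 a * fnorm N 0 b)) := by
    refine hF2.trans ?_
    gcongr <;> linarith
  have hG3 : ∑ k ∈ modes N, |(k : ℝ)| * ‖conv b (sym P.Aμ P.Aμ P.bμ P.bμ a b) k‖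
      ≤ P.Aμ * (fnorm N 0 b * fnorm N 4 a + fnorm N 4 b * fnorm N 0 a)
        + P.Aμ * (fnorm N 0 b * fnorm N 4 b)
        + P.bμ * (3 / 2 * (fnorm N 0 b * fnorm N 2 a) + 1 / 2 * (fnorm N 2 b * fnorm N 0 a))
        + P.bμ * (2 * (fnorm N 0 b * fnorm N 2 b)) := by
    refine hG2.trans ?_
    gcongr; linarith
  have hF4 := mul_le_mul_of_nonneg_left hF3 (sq_nonneg θ)
  have hG4 := mul_le_mul_of_nonneg_left hG3 (sq_nonneg θ)
  simp only [offF, offG]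
  linarith

/-! ### The Galerkin system -/

/-- The Hermitian sequence with prescribed coefficients `c i` at the frequencies `1, …, N`, and zero
mean. -/
def ext (N : ℕ) : (Fin N → ℂ) →ₗ[ℝ] (ℤ → ℂ) where
  toFun c k := ∑ i : Fin N, ((if k = i + 1 then c i else 0) + if k = -(i + 1) then conj (c i) else 0)
  map_add' c d := by
    ext k
    simp only [Pi.add_apply, ← Finset.sum_add_distrib]
    refine Finset.sum_congr rfl fun i _ => ?_
    split_ifs <;> simp <;> ring
  map_smul' r c := by
    ext k
    simp only [Pi.smul_apply, Finset.smul_sum, RingHom.id_apply]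
    refine Finset.sum_congr rfl fun i _ => ?_
    split_ifs <;> simp

lemma ext_apply {N : ℕ} (c : Fin N → ℂ) (k : ℤ) : ext N c k
    = ∑ i : Fin N, ((if k = i + 1 then c i else 0) + if k = -(i + 1) then conj (c i) else 0) := rfl

lemma herm_ext {N : ℕ} (c : Fin N → ℂ) : Herm (ext N c) := by
  intro k
  rw [ext_apply, ext_apply, map_sum]
  refine Finset.sum_congr rfl fun i _ => ?_
  have e1 : (-k = (i : ℤ) + 1) ↔ (k = -((i : ℤ) + 1)) := by omega
  have e2 : (-k = -((i : ℤ) + 1)) ↔ (k = (i : ℤ) + 1) := by omega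
  simp only [e1, e2]
  split_ifs <;> simp [add_comm]

lemma band_ext {N : ℕ} (c : Fin N → ℂ) : Band N (ext N c) := by
  intro k hk
  rw [modes, Finset.mem_Icc] at hk
  rw [ext_apply]
  refine Finset.sum_eq_zero fun i _ => ?_
  have := i.2
  rw [if_neg (by omega), if_neg (by omega), add_zero]

lemma ext_zero_mode {N : ℕ} (c : Fin N → ℂ) : ext N c 0 = 0 := by
  rw [ext_apply]
  refine Finset.sum_eq_zero fun i _ => ?_
  rw [if_neg (by omega), if_neg (by omega), add_zero]

lemma ext_pos {N : ℕ} (c : Fin N → ℂ) (i : Fin N) : ext N c (i + 1) = c i := by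
  rw [ext_apply, Finset.sum_eq_single i]
  · rw [if_pos rfl, if_neg (by omega), add_zero]
  · intro j _ hj
    have : (j : ℕ) ≠ i := fun h => hj (Fin.ext h)
    rw [if_neg (by omega), if_neg (by omega), add_zero]
  · simp

lemma ext_eq_of_herm {N : ℕ} {a : ℤ → ℂ} (ha : Herm a) (h0 : a 0 = 0) {k : ℤ} (hk : k ∈ modes N) :
    ext N (fun i => a (i + 1)) k = a k := by
  rw [modes, Finset.mem_Icc] at hk
  have hpos : ∀ k : ℤ, 0 < k → k ≤ N → ext N (fun i => a (i + 1)) k = a k := by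
    intro k h1 h2
    have e : k = (((⟨(k - 1).toNat, by omega⟩ : Fin N) : ℕ) : ℤ) + 1 := by
      simp only [Int.toNat_of_nonneg (show 0 ≤ k - 1 by omega)]; ring
    conv_lhs => rw [e]
    rw [ext_pos]
    congr 1
    exact e.symm
  rcases lt_trichotomy k 0 with h | h | h
  · have := hpos (-k) (by omega) (by omega)
    rw [herm_ext, ha] at this
    exact (starRingEnd ℂ).injective this
  · rw [h, ext_zero_mode, h0]
  · exact hpos k h hk.2

lemma herm_sym {a b : ℤ → ℂ} (hA : Herm a) (hB : Herm b) (α β γ δ : ℝ) (k : ℤ) :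
    sym α β γ δ a b (-k) = -conj (sym α β γ δ a b k) := by
  simp only [sym, mulpow, hA k, hB k, map_add, map_mul, map_pow, Complex.conj_ofReal]
  push_cast
  simp only [map_intCast]
  ring

lemma herm_rhs {p a b : ℤ → ℂ} (hp : Herm p) (hA : Herm a) (hB : Herm b) (m α β γ δ : ℝ) :
    Herm (rhs m α β γ δ p a b) := by
  intro k
  have h : conv p (sym α β γ δ a b) (-k) = -conj (conv p (sym α β γ δ a b) k) := by
    rw [conv, conv, Complex.conj_tsum, ← (Equiv.neg ℤ).tsum_eq, ← tsum_neg]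
    refine tsum_congr fun j => ?_
    rw [Equiv.neg_apply, herm_sym hA hB, map_mul, ← hp]
    rw [show -k - -j = -(k - j) by ring]
    ring
  rw [rhs, rhs, h, herm_sym hA hB]
  simp only [map_mul, map_neg, map_add, Complex.conj_ofReal]
  push_cast
  simp only [map_intCast]
  ring

/-- The phase space of the Galerkin system: the coefficients at the frequencies `1, …, N`. -/
abbrev GState (N : ℕ) : Type := (Fin N → ℂ) × (Fin N → ℂ)

/-- The vector field of the Galerkin system. -/
def gfield (P : Params) (mf mg : ℝ) (N : ℕ) (c : GState N) : GState N :=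
  (fun i => rhs mf P.Aγ P.A P.bρ P.b (ext N c.1) (ext N c.1) (ext N c.2) (i + 1),
   fun i => rhs mg P.Aμ P.Aμ P.bμ P.bμ (ext N c.2) (ext N c.1) (ext N c.2) (i + 1))

/-- The `ℓ¹` energy of a state. -/
def genergy (N : ℕ) (c : GState N) : ℝ := fnorm N 0 (ext N c.1) + fnorm N 0 (ext N c.2)

lemma fnorm_zero_ext_add_le {N : ℕ} (c d : Fin N → ℂ) :
    fnorm N 0 (ext N (c + d)) ≤ fnorm N 0 (ext N c) + fnorm N 0 (ext N d) := by
  simp only [fnorm, ← Finset.sum_add_distrib, map_add, pow_zero, one_mul]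
  exact Finset.sum_le_sum fun k _ => norm_add_le _ _

lemma fnorm_zero_ext_smul {N : ℕ} {r : ℝ} (hr : 0 ≤ r) (c : Fin N → ℂ) :
    fnorm N 0 (ext N (r • c)) = r * fnorm N 0 (ext N c) := by
  simp only [fnorm, Finset.mul_sum, map_smul, pow_zero, one_mul, Pi.smul_apply, norm_smul,
    Real.norm_of_nonneg hr]

lemma genergy_smul {N : ℕ} {r : ℝ} (hr : 0 ≤ r) (c : GState N) :
    genergy N (r • c) = r * genergy N c := by
  rw [genergy, genergy, Prod.smul_fst, Prod.smul_snd, fnorm_zero_ext_smul hr,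
    fnorm_zero_ext_smul hr]; ring

lemma locallyLipschitz_genergy (N : ℕ) : LocallyLipschitz (genergy N) := by
  refine ConvexOn.locallyLipschitz ⟨convex_univ, fun c _ d _ r s hr hs _ => ?_⟩
  have h1 := fnorm_zero_ext_add_le (r • c.1) (s • d.1)
  have h2 := fnorm_zero_ext_add_le (r • c.2) (s • d.2)
  rw [fnorm_zero_ext_smul hr, fnorm_zero_ext_smul hs] at h1 h2
  simp only [genergy, Prod.fst_add, Prod.snd_add, Prod.smul_fst, Prod.smul_snd, smul_eq_mul]
  linarith

lemma norm_le_genergy {N : ℕ} (c : GState N) : ‖c‖ ≤ genergy N c := by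
  have h : ∀ d : Fin N → ℂ, ‖d‖ ≤ fnorm N 0 (ext N d) := by
    intro d
    refine (pi_norm_le_iff_of_nonneg (fnorm_nonneg _ _ _)).2 fun i => ?_
    have hi : ((i : ℤ) + 1) ∈ modes N := by
      rw [modes, Finset.mem_Icc]; have := i.2; omega
    have := Finset.single_le_sum (f := fun k : ℤ => |(k : ℝ)| ^ 0 * ‖ext N d k‖)
      (fun k _ => by positivity) hi
    simp only [pow_zero, one_mul] at this
    rw [ext_pos] at this
    refine this.trans (le_of_eq ?_)
    simp [fnorm]
  rw [Prod.norm_def, genergy]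
  refine max_le ((h c.1).trans ?_) ((h c.2).trans ?_)
  · exact le_add_of_nonneg_right (fnorm_nonneg _ _ _)
  · exact le_add_of_nonneg_left (fnorm_nonneg _ _ _)

lemma contDiff_ext_apply (N : ℕ) (k : ℤ) : ContDiff ℝ 1 fun c : Fin N → ℂ => ext N c k := by
  simp only [ext_apply]
  refine ContDiff.sum fun i _ => ContDiff.add ?_ ?_
  · split_ifs
    · exact contDiff_apply ℝ ℂ i
    · exact contDiff_const
  · split_ifs
    · exact Complex.conjCLE.contDiff.comp (contDiff_apply ℝ ℂ i)
    · exact contDiff_const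

lemma contDiff_rhs (N : ℕ) (m α β γ δ : ℝ) {p : GState N → ℤ → ℂ}
    (hp : ∀ k, ContDiff ℝ 1 fun c => p c k) (k : ℤ) :
    ContDiff ℝ 1 fun c : GState N => rhs m α β γ δ (p c) (ext N c.1) (ext N c.2) k := by
  have h1 : ∀ k, ContDiff ℝ 1 fun c : GState N => ext N c.1 k := fun k =>
    (contDiff_ext_apply N k).comp contDiff_fst
  have h2 : ∀ k, ContDiff ℝ 1 fun c : GState N => ext N c.2 k := fun k =>
    (contDiff_ext_apply N k).comp contDiff_snd
  have hs : ∀ k, ContDiff ℝ 1 fun c : GState N => sym α β γ δ (ext N c.1) (ext N c.2) k := by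
    intro k
    simp only [sym, mulpow]
    exact (((contDiff_const.mul (contDiff_const.mul (h1 k))).add
      (contDiff_const.mul (contDiff_const.mul (h2 k)))).add
      (contDiff_const.mul (contDiff_const.mul (h1 k)))).add
      (contDiff_const.mul (contDiff_const.mul (h2 k)))
  simp only [rhs]
  refine contDiff_const.mul ((contDiff_const.mul (hs k)).add ?_)
  have e : ∀ c : GState N, conv (p c) (sym α β γ δ (ext N c.1) (ext N c.2)) k
      = ∑ j ∈ modes N, p c (k - j) * sym α β γ δ (ext N c.1) (ext N c.2) j := fun c =>
    conv_eq_sum _ ((band_ext c.1).sym (band_ext c.2) α β γ δ) k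
  simp only [e]
  exact ContDiff.sum fun j _ => (hp _).mul (hs j)

lemma contDiff_gfield (P : Params) (mf mg : ℝ) (N : ℕ) : ContDiff ℝ 1 (gfield P mf mg N) := by
  refine ContDiff.prodMk ?_ ?_
  · exact contDiff_pi.2 fun i => contDiff_rhs N _ _ _ _ _
      (fun k => (contDiff_ext_apply N k).comp contDiff_fst) _
  · exact contDiff_pi.2 fun i => contDiff_rhs N _ _ _ _ _
      (fun k => (contDiff_ext_apply N k).comp contDiff_snd) _

/-- The factor of the radial retraction onto the ball of radius `R`. -/
def retr (R s : ℝ) : ℝ := R / max R s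

lemma retr_nonneg {R s : ℝ} (hR : 0 ≤ R) : 0 ≤ retr R s := div_nonneg hR (hR.trans (le_max_left _ _))

lemma retr_mul_le {R s : ℝ} (hR : 0 ≤ R) : retr R s * s ≤ R := by
  rcases hR.eq_or_lt with rfl | hR'
  · simp [retr]
  · have : 0 < max R s := lt_max_of_lt_left hR'
    rw [retr, div_mul_eq_mul_div, div_le_iff₀ this]
    gcongr; exact le_max_right _ _

lemma locallyLipschitz_retr {R : ℝ} (hR : 0 ≤ R) : LocallyLipschitz (retr R) := by
  rcases hR.eq_or_lt with rfl | hR'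
  · have : retr 0 = fun _ => 0 := by ext s; simp [retr]
    rw [this]; exact LocallyLipschitz.const 0
  · refine (LipschitzWith.of_dist_le_mul (K := (1 / R).toNNReal) fun s t => ?_).locallyLipschitz
    have hs : R ≤ max R s := le_max_left _ _
    have ht : R ≤ max R t := le_max_left _ _
    have hs' : 0 < max R s := hR'.trans_le hs
    have ht' : 0 < max R t := hR'.trans_le ht
    rw [Real.coe_toNNReal _ (by positivity), Real.dist_eq, Real.dist_eq, retr, retr]
    have e : R / max R s - R / max R t = R * (max R t - max R s) / (max R s * max R t) := by
      field_simp
    have hm : |max R t - max R s| ≤ |s - t| := by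
      rw [abs_sub_comm s t]
      have := abs_max_sub_max_le_abs t s R
      rwa [max_comm t R, max_comm s R] at this
    rw [e, abs_div, abs_mul, abs_of_pos hR', abs_of_pos (mul_pos hs' ht')]
    calc R * |max R t - max R s| / (max R s * max R t) ≤ R * |s - t| / (R * R) := by gcongr
      _ = 1 / R * |s - t| := by field_simp

lemma locallyLipschitz_comp_smul {E : Type*} [NormedAddCommGroup E] [NormedSpace ℝ E] {F : E → E}
    {θ : E → ℝ} (hF : LocallyLipschitz F) (hθ : LocallyLipschitz θ) :
    LocallyLipschitz fun c => F (θ c • c) := by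
  have h1 : LocallyLipschitz fun c => (θ c, c) := hθ.prodMk LocallyLipschitz.id
  have h2 : ContDiff ℝ 1 fun q : ℝ × E => q.1 • q.2 := contDiff_fst.smul contDiff_snd
  exact hF.comp (h2.locallyLipschitz.comp h1)

/-- The Galerkin vector field composed with the retraction onto the energy ball has global
solutions, being bounded and locally Lipschitz. -/
lemma exists_retracted_solution (P : Params) (mf mg : ℝ) (N : ℕ) {R : ℝ} (hR : 0 ≤ R) {T : ℝ}
    (hT : 0 ≤ T) (c₀ : GState N) : ∃ c : ℝ → GState N, c 0 = c₀ ∧ ∀ t ∈ Icc 0 T,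
      HasDerivAt c (gfield P mf mg N (retr R (genergy N (c t)) • c t)) t := by
  set G : GState N → GState N := fun c => gfield P mf mg N (retr R (genergy N c) • c) with hG
  have hGl : LocallyLipschitz G := 
    locallyLipschitz_comp_smul (contDiff_gfield P mf mg N).locallyLipschitz
      ((locallyLipschitz_retr hR).comp (locallyLipschitz_genergy N))
  obtain ⟨L, hL⟩ : ∃ L, ∀ c : GState N, ‖G c‖ ≤ L := by
    obtain ⟨L, hL⟩ := (isCompact_closedBall (0 : GState N) R).exists_bound_of_continuousOn
      (contDiff_gfield P mf mg N).continuous.continuousOn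
    refine ⟨L, fun c => hL _ ?_⟩
    rw [mem_closedBall_zero_iff]
    refine (norm_le_genergy _).trans ?_
    rw [genergy_smul (retr_nonneg hR)]
    exact retr_mul_le hR
  have hL0 : 0 ≤ L := (norm_nonneg _).trans (hL c₀)
  obtain ⟨K, hK⟩ := (hGl.locallyLipschitzOn (s := Metric.closedBall c₀ (L * (T + 1))))
    |>.exists_lipschitzOnWith_of_compact (isCompact_closedBall _ _)
  have h0 : (0 : ℝ) ∈ Icc (-1) (T + 1) := ⟨by norm_num, by linarith⟩
  have hPL : IsPicardLindelof (fun _ => G) (⟨0, h0⟩ : Icc (-1 : ℝ) (T + 1)) c₀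
      (L * (T + 1)).toNNReal 0 L.toNNReal K := by
    refine IsPicardLindelof.of_time_independent (fun c _ => ?_) ?_ ?_
    · rw [Real.coe_toNNReal _ hL0]; exact hL c
    · rwa [Real.coe_toNNReal _ (by positivity)]
    · rw [Real.coe_toNNReal _ hL0, Real.coe_toNNReal _ (by positivity)]
      simp only [NNReal.coe_zero, sub_zero]
      gcongr
      exact max_le le_rfl (by linarith)
  obtain ⟨c, hc0, hc⟩ := hPL.exists_eq_forall_mem_Icc_hasDerivWithinAt₀
  refine ⟨c, hc0, fun t ht => ?_⟩
  exact (hc t ⟨by linarith [ht.1], by linarith [ht.2]⟩).hasDerivAt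
    (Icc_mem_nhds (by linarith [ht.1]) (by linarith [ht.2]))

/-! ### A priori estimates and global Galerkin solutions -/

lemma Params.Pos.coeff_pos {P : Params} (hP : P.Pos) :
    0 < P.A ∧ 0 < P.Aμ ∧ 0 < P.Aγ ∧ 0 < P.b ∧ 0 < P.bμ ∧ 0 < P.bρ := by
  obtain ⟨h1, h2, h3, h4, h5, h6, h7⟩ := hP
  have pA : 0 < P.A := by unfold Params.A; positivity
  have pb : 0 < P.b := by unfold Params.b; positivity
  refine ⟨pA, ?_, ?_, pb, ?_, ?_⟩
  · unfold Params.Aμ; positivity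
  · unfold Params.Aγ; positivity
  · unfold Params.bμ; positivity
  · unfold Params.bρ; positivity

lemma continuousOn_sym {s : Set ℝ} {a b : ℝ → ℤ → ℂ} (hac : ∀ k, ContinuousOn (fun t => a t k) s)
    (hbc : ∀ k, ContinuousOn (fun t => b t k) s) (α β γ δ : ℝ) (k : ℤ) :
    ContinuousOn (fun t => sym α β γ δ (a t) (b t) k) s := by
  simp only [sym, mulpow]
  exact (((continuousOn_const.mul (continuousOn_const.mul (hac k))).add
    (continuousOn_const.mul (continuousOn_const.mul (hbc k)))).add
    (continuousOn_const.mul (continuousOn_const.mul (hac k)))).add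
    (continuousOn_const.mul (continuousOn_const.mul (hbc k)))

lemma continuousOn_conv {s : Set ℝ} {N : ℕ} {p v : ℝ → ℤ → ℂ}
    (hpc : ∀ k, ContinuousOn (fun t => p t k) s) (hvc : ∀ k, ContinuousOn (fun t => v t k) s)
    (hv : ∀ t, Band N (v t)) (k : ℤ) : ContinuousOn (fun t => conv (p t) (v t) k) s := by
  have e : ∀ t, conv (p t) (v t) k = ∑ j ∈ modes N, p t (k - j) * v t j := fun t =>
    conv_eq_sum _ (hv t) k
  simp only [e]
  exact continuousOn_finsetSum _ fun j _ => (hpc _).mul (hvc j)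

lemma continuousOn_fnorm {s : Set ℝ} {a : ℝ → ℤ → ℂ} (hac : ∀ k, ContinuousOn (fun t => a t k) s)
    (N n : ℕ) : ContinuousOn (fun t => fnorm N n (a t)) s := by
  simp only [fnorm]
  exact continuousOn_finsetSum _ fun k _ => continuousOn_const.mul (hac k).norm

/-- The mode inequality with an exponential weight, summed over the modes. -/
lemma exp_mul_fnorm_add_integral_le {N : ℕ} {T κ : ℝ} (hT : 0 ≤ T) {a : ℝ → ℤ → ℂ}
    {lam : ℝ → ℤ → ℝ} {r : ℝ → ℤ → ℂ} (hlam : ∀ k, ContinuousOn (fun t => lam t k) (Icc 0 T))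
    (hr : ∀ k, ContinuousOn (fun t => r t k) (Icc 0 T))
    (h : ∀ k ∈ modes N, ∀ t ∈ Icc 0 T,
      HasDerivAt (fun t => a t k) (-(lam t k : ℂ) * a t k + r t k) t) :
    Real.exp (κ * T) * fnorm N 0 (a T) + ∫ t in (0 : ℝ)..T, Real.exp (κ * t) *
      (∑ k ∈ modes N, (lam t k * ‖a t k‖ - ‖r t k‖) - κ * fnorm N 0 (a t)) ≤ fnorm N 0 (a 0) := by
  have hu : uIcc 0 T = Icc 0 T := uIcc_of_le hT
  have hexp : ContinuousOn (fun t : ℝ => Real.exp (κ * t)) (Icc 0 T) := by fun_prop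
  have hmode : ∀ k ∈ modes N, Real.exp (κ * T) * ‖a T k‖ + ∫ t in (0 : ℝ)..T, Real.exp (κ * t) *
      (lam t k * ‖a t k‖ - ‖r t k‖ - κ * ‖a t k‖) ≤ ‖a 0 k‖ := by
    intro k hk
    have h1 := norm_add_integral_le (z := fun t => (Real.exp (κ * t) : ℂ) * a t k)
      (r := fun t => (Real.exp (κ * t) : ℂ) * r t k) (lam := fun t => lam t k - κ) hT ?_ ?_ ?_
    · simp only [norm_mul, Complex.norm_real, Real.norm_eq_abs, Real.abs_exp, mul_zero,
        Real.exp_zero, abs_one, one_mul] at h1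
      refine le_trans (le_of_eq ?_) h1
      congr 1
      refine intervalIntegral.integral_congr fun t _ => ?_
      ring
    · intro t ht
      have hE : HasDerivAt (fun t : ℝ => (Real.exp (κ * t) : ℂ))
          ((Real.exp (κ * t) * κ : ℝ) : ℂ) t := by
        have := ((hasDerivAt_id t).const_mul κ).exp
        simpa using this.ofReal_comp
      refine (hE.mul (h k hk t ht)).congr_deriv ?_
      push_cast; ring
    · exact (hlam k).sub continuousOn_const
    · exact (Complex.continuous_ofReal.comp_continuousOn hexp).mul (hr k)
  have hsum := Finset.sum_le_sum hmode
  have hac : ∀ k ∈ modes N, ContinuousOn (fun t => a t k) (Icc 0 T) := fun k hk t ht =>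
    (h k hk t ht).continuousAt.continuousWithinAt
  rw [Finset.sum_add_distrib, ← Finset.mul_sum, ← intervalIntegral.integral_finsetSum] at hsum
  · simp only [fnorm, pow_zero, one_mul]
    refine le_trans (le_of_eq ?_) hsum
    congr 1
    refine intervalIntegral.integral_congr fun t _ => ?_
    simp only [Finset.mul_sum, ← Finset.sum_sub_distrib]
  · intro k hk
    refine ContinuousOn.intervalIntegrable ?_
    rw [hu]
    exact hexp.mul ((((hlam k).mul (hac k hk).norm).sub (hr k).norm).sub
      (continuousOn_const.mul (hac k hk).norm))

/-- The energy inequality for the (scaled) Galerkin system, with an exponential weight. -/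
lemma galerkin_energy_le (P : Params) (hP : P.Pos) {mf mg E κ T : ℝ} (hmf : 0 ≤ mf) (hmg : 0 ≤ mg)
    (hT : 0 ≤ T) {N : ℕ} {a b : ℝ → ℤ → ℂ} {θ : ℝ → ℝ} (hθc : ContinuousOn θ (Icc 0 T))
    (hθ : ∀ t, 0 ≤ θ t) (hA : ∀ t, Herm (a t)) (hB : ∀ t, Herm (b t)) (ha : ∀ t, Band N (a t))
    (hb : ∀ t, Band N (b t)) (hac : ∀ k, ContinuousOn (fun t => a t k) (Icc 0 T))
    (hbc : ∀ k, ContinuousOn (fun t => b t k) (Icc 0 T))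
    (hE : ∀ t ∈ Icc 0 T, θ t * (fnorm N 0 (a t) + fnorm N 0 (b t)) ≤ E)
    (hda : ∀ k ∈ modes N, ∀ t ∈ Icc 0 T, HasDerivAt (fun t => a t k)
      (rhs mf P.Aγ P.A P.bρ P.b (fun k => θ t * a t k) (fun k => θ t * a t k)
        (fun k => θ t * b t k) k) t)
    (hdb : ∀ k ∈ modes N, ∀ t ∈ Icc 0 T, HasDerivAt (fun t => b t k)
      (rhs mg P.Aμ P.Aμ P.bμ P.bμ (fun k => θ t * b t k) (fun k => θ t * a t k)
        (fun k => θ t * b t k) k) t) :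
    Real.exp (κ * T) * (fnorm N 0 (a T) + fnorm N 0 (b T)) + ∫ t in (0 : ℝ)..T, Real.exp (κ * t) *
      (θ t * (P.σ1A mf mg E * fnorm N 4 (a t) + P.σ2A mf mg E * fnorm N 4 (b t)
        + P.σ1b mf mg E * fnorm N 2 (a t) + P.σ2b mf mg E * fnorm N 2 (b t))
        - κ * (fnorm N 0 (a t) + fnorm N 0 (b t)))
      ≤ fnorm N 0 (a 0) + fnorm N 0 (b 0) := by
  have hu : uIcc 0 T = Icc 0 T := uIcc_of_le hT
  have hθC : ContinuousOn (fun t => (θ t : ℂ)) (Icc 0 T) :=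
    Complex.continuous_ofReal.comp_continuousOn hθc
  have hexp : ContinuousOn (fun t : ℝ => Real.exp (κ * t)) (Icc 0 T) := by fun_prop
  have hlam : ∀ (m α γ : ℝ) (k : ℤ),
      ContinuousOn (fun t => θ t * (m * (α * (k : ℝ) ^ 4 + γ * k ^ 2))) (Icc 0 T) := fun m α γ k =>
    hθc.mul continuousOn_const
  have hoff : ∀ {p v c : ℝ → ℤ → ℂ} (m β δ : ℝ),
      (∀ k, ContinuousOn (fun t => p t k) (Icc 0 T)) →
      (∀ k, ContinuousOn (fun t => v t k) (Icc 0 T)) → (∀ t, Band N (v t)) →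
      (∀ k, ContinuousOn (fun t => c t k) (Icc 0 T)) → ∀ k : ℤ, ContinuousOn (fun t =>
        -(k : ℂ) * (θ t * m * (β * mulpow 3 (c t) k + δ * mulpow 1 (c t) k)
          + (θ t : ℂ) ^ 2 * conv (p t) (v t) k)) (Icc 0 T) := by
    intro p v c m β δ hp hv hvb hc k
    simp only [mulpow]
    exact continuousOn_const.mul (((hθC.mul continuousOn_const).mul
      ((continuousOn_const.mul (continuousOn_const.mul (hc k))).add
        (continuousOn_const.mul (continuousOn_const.mul (hc k))))).add
      ((hθC.pow 2).mul (continuousOn_conv hp hv hvb k)))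
  have hrF : ∀ k, ContinuousOn (fun t => offF (θ t) mf P.Aγ P.A P.bρ P.b (a t) (b t) k)
      (Icc 0 T) := fun k => hoff mf P.A P.b hac (continuousOn_sym hac hbc _ _ _ _)
    (fun t => (ha t).sym (hb t) _ _ _ _) hbc k
  have hrG : ∀ k, ContinuousOn (fun t => offG (θ t) mg P.Aμ P.Aμ P.bμ P.bμ (a t) (b t) k)
      (Icc 0 T) := fun k => hoff mg P.Aμ P.bμ hbc (continuousOn_sym hac hbc _ _ _ _)
    (fun t => (ha t).sym (hb t) _ _ _ _) hac k
  have hF := exp_mul_fnorm_add_integral_le (κ := κ) (N := N) hT (hlam mf P.Aγ P.bρ) hrF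
    (fun k hk t ht => by rw [← rhs_smul_eq_offF]; exact hda k hk t ht)
  have hG := exp_mul_fnorm_add_integral_le (κ := κ) (N := N) hT (hlam mg P.Aμ P.bμ) hrG
    (fun k hk t ht => by rw [← rhs_smul_eq_offG]; exact hdb k hk t ht)
  have hcF : ContinuousOn (fun t => Real.exp (κ * t) * (∑ k ∈ modes N,
      (θ t * (mf * (P.Aγ * (k : ℝ) ^ 4 + P.bρ * k ^ 2)) * ‖a t k‖
        - ‖offF (θ t) mf P.Aγ P.A P.bρ P.b (a t) (b t) k‖) - κ * fnorm N 0 (a t))) (Icc 0 T) :=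
    hexp.mul ((continuousOn_finsetSum _ fun k _ =>
      ((hlam mf P.Aγ P.bρ k).mul (hac k).norm).sub (hrF k).norm).sub
        (continuousOn_const.mul (continuousOn_fnorm hac N 0)))
  have hcG : ContinuousOn (fun t => Real.exp (κ * t) * (∑ k ∈ modes N,
      (θ t * (mg * (P.Aμ * (k : ℝ) ^ 4 + P.bμ * k ^ 2)) * ‖b t k‖
        - ‖offG (θ t) mg P.Aμ P.Aμ P.bμ P.bμ (a t) (b t) k‖) - κ * fnorm N 0 (b t))) (Icc 0 T) :=
    hexp.mul ((continuousOn_finsetSum _ fun k _ =>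
      ((hlam mg P.Aμ P.bμ k).mul (hbc k).norm).sub (hrG k).norm).sub
        (continuousOn_const.mul (continuousOn_fnorm hbc N 0)))
  have hcL : ContinuousOn (fun t => Real.exp (κ * t) *
      (θ t * (P.σ1A mf mg E * fnorm N 4 (a t) + P.σ2A mf mg E * fnorm N 4 (b t)
        + P.σ1b mf mg E * fnorm N 2 (a t) + P.σ2b mf mg E * fnorm N 2 (b t))
        - κ * (fnorm N 0 (a t) + fnorm N 0 (b t)))) (Icc 0 T) :=
    hexp.mul ((hθc.mul ((((continuousOn_const.mul (continuousOn_fnorm hac N 4)).add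
      (continuousOn_const.mul (continuousOn_fnorm hbc N 4))).add
      (continuousOn_const.mul (continuousOn_fnorm hac N 2))).add
      (continuousOn_const.mul (continuousOn_fnorm hbc N 2)))).sub
      (continuousOn_const.mul ((continuousOn_fnorm hac N 0).add (continuousOn_fnorm hbc N 0))))
  have hiF := (hu ▸ hcF).intervalIntegrable (μ := volume)
  have hiG := (hu ▸ hcG).intervalIntegrable (μ := volume)
  have hmono := intervalIntegral.integral_mono_on hT (hu ▸ hcL).intervalIntegrable
    (hiF.add hiG) fun t ht => by
      have hd := dissipation_le P hP hmf hmg (hθ t) (hA t) (hB t) (ha t) (hb t) (hE t ht)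
      rw [← mul_add]
      refine mul_le_mul_of_nonneg_left ?_ (Real.exp_pos _).le
      linarith
  rw [intervalIntegral.integral_add hiF hiG] at hmono
  linarith

lemma genergy_retr_smul_eq {N : ℕ} {R : ℝ} (hR : 0 ≤ R) {c : GState N} (hc : genergy N c ≤ R) :
    retr R (genergy N c) • c = c := by
  rcases hR.eq_or_lt with rfl | hR'
  · have : c = 0 := norm_le_zero_iff.1 ((norm_le_genergy c).trans hc)
    rw [this, smul_zero]
  · rw [retr, max_eq_left hc, div_self hR'.ne', one_smul]

lemma hasDerivAt_ext {N : ℕ} {c : ℝ → Fin N → ℂ} {c' : Fin N → ℂ} {t : ℝ}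
    (h : HasDerivAt c c' t) (k : ℤ) : HasDerivAt (fun t => ext N (c t) k) (ext N c' k) t := by
  let L : (Fin N → ℂ) →L[ℝ] ℂ := LinearMap.toContinuousLinearMap
    ((LinearMap.proj k : (ℤ → ℂ) →ₗ[ℝ] ℂ).comp (ext N))
  exact (L.hasFDerivAt (x := c t)).comp_hasDerivAt t h

lemma rhs_zero_mode (m α β γ δ : ℝ) (p a b : ℤ → ℂ) : rhs m α β γ δ p a b 0 = 0 := by
  simp [rhs]

/-- Global solutions of the Galerkin system, with exponential decay of the `ℓ¹` energy and an
integral bound for the norm in `Ȧ⁴`. -/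
lemma exists_galerkin (P : Params) (hP : P.Pos) {mf mg E T : ℝ} (hmf : 0 ≤ mf) (hmg : 0 ≤ mg)
    (hT : 0 ≤ T) (h1A : 0 < P.σ1A mf mg E) (h2A : 0 < P.σ2A mf mg E)
    (h1b : 0 < P.σ1b mf mg E) (h2b : 0 < P.σ2b mf mg E) (N : ℕ) {a₀ b₀ : ℤ → ℂ} (hA₀ : Herm a₀)
    (hB₀ : Herm b₀) (ha₀ : a₀ 0 = 0) (hb₀ : b₀ 0 = 0) (hE : fnorm N 0 a₀ + fnorm N 0 b₀ ≤ E) :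
    ∃ a b : ℝ → ℤ → ℂ, (∀ t, Herm (a t)) ∧ (∀ t, Herm (b t)) ∧ (∀ t, Band N (a t)) ∧
      (∀ t, Band N (b t)) ∧ (∀ t, a t 0 = 0) ∧ (∀ t, b t 0 = 0) ∧
      (∀ k ∈ modes N, a 0 k = a₀ k) ∧ (∀ k ∈ modes N, b 0 k = b₀ k) ∧
      (∀ k ∈ modes N, ∀ t ∈ Icc 0 T, HasDerivAt (fun t => a t k)
        (rhs mf P.Aγ P.A P.bρ P.b (a t) (a t) (b t) k) t) ∧
      (∀ k ∈ modes N, ∀ t ∈ Icc 0 T, HasDerivAt (fun t => b t k)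
        (rhs mg P.Aμ P.Aμ P.bμ P.bμ (b t) (a t) (b t) k) t) ∧
      (∀ t ∈ Icc 0 T, fnorm N 0 (a t) + fnorm N 0 (b t)
        ≤ E * Real.exp (-(P.δA mf mg E + P.δb mf mg E) * t)) ∧
      ∫ t in (0 : ℝ)..T, (fnorm N 4 (a t) + fnorm N 4 (b t)) ≤ E / P.δA mf mg E := by
  have hR : 0 ≤ E := le_trans (add_nonneg (fnorm_nonneg _ _ _) (fnorm_nonneg _ _ _)) hE
  obtain ⟨c, hc0, hc⟩ := exists_retracted_solution P mf mg N hR hT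
    ((fun i => a₀ (i + 1), fun i => b₀ (i + 1)) : GState N)
  set a : ℝ → ℤ → ℂ := fun t => ext N (c t).1 with ha
  set b : ℝ → ℤ → ℂ := fun t => ext N (c t).2 with hb
  set θ : ℝ → ℝ := fun t => retr E (genergy N (c t)) with hθ
  have hAt : ∀ t, Herm (a t) := fun t => herm_ext _
  have hBt : ∀ t, Herm (b t) := fun t => herm_ext _
  have hsa : ∀ t, ext N (θ t • c t).1 = fun k => (θ t : ℂ) * a t k := fun t => by
    rw [Prod.smul_fst, map_smul]; ext k; simp [ha]
  have hsb : ∀ t, ext N (θ t • c t).2 = fun k => (θ t : ℂ) * b t k := fun t => by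
    rw [Prod.smul_snd, map_smul]; ext k; simp [hb]
  have hfun : ∀ {m α β γ δ : ℝ} {p u v : ℤ → ℂ}, Herm p → Herm u → Herm v → ∀ k ∈ modes N,
      ext N (fun i => rhs m α β γ δ p u v (i + 1)) k = rhs m α β γ δ p u v k :=
    fun hp hu hv k hk => ext_eq_of_herm (herm_rhs hp hu hv _ _ _ _ _) (rhs_zero_mode _ _ _ _ _ _ _ _) hk
  have hda : ∀ k ∈ modes N, ∀ t ∈ Icc 0 T, HasDerivAt (fun t => a t k)
      (rhs mf P.Aγ P.A P.bρ P.b (fun k => θ t * a t k) (fun k => θ t * a t k)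
        (fun k => θ t * b t k) k) t := by
    intro k hk t ht
    refine (hasDerivAt_ext (hc t ht).fst k).congr_deriv ?_
    simp only [gfield]
    rw [hfun (herm_ext _) (herm_ext _) (herm_ext _) k hk, hsa, hsb]
  have hdb : ∀ k ∈ modes N, ∀ t ∈ Icc 0 T, HasDerivAt (fun t => b t k)
      (rhs mg P.Aμ P.Aμ P.bμ P.bμ (fun k => θ t * b t k) (fun k => θ t * a t k)
        (fun k => θ t * b t k) k) t := by
    intro k hk t ht
    refine (hasDerivAt_ext (hc t ht).snd k).congr_deriv ?_
    simp only [gfield]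
    rw [hfun (herm_ext _) (herm_ext _) (herm_ext _) k hk, hsa, hsb]
  have hcc : ContinuousOn c (Icc 0 T) := fun t ht => (hc t ht).continuousAt.continuousWithinAt
  have hac : ∀ k, ContinuousOn (fun t => a t k) (Icc 0 T) := fun k t ht =>
    (hasDerivAt_ext (hc t ht).fst k).continuousAt.continuousWithinAt
  have hbc : ∀ k, ContinuousOn (fun t => b t k) (Icc 0 T) := fun k t ht =>
    (hasDerivAt_ext (hc t ht).snd k).continuousAt.continuousWithinAt
  have hθc : ContinuousOn θ (Icc 0 T) :=
    ((locallyLipschitz_retr hR).continuous.comp (locallyLipschitz_genergy N).continuous).comp_continuousOn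
      hcc
  have hEθ : ∀ t, θ t * (fnorm N 0 (a t) + fnorm N 0 (b t)) ≤ E := fun t => retr_mul_le hR
  have ha0 : ∀ k ∈ modes N, a 0 k = a₀ k := fun k hk => by
    simp only [ha, hc0]; exact ext_eq_of_herm hA₀ ha₀ hk
  have hb0 : ∀ k ∈ modes N, b 0 k = b₀ k := fun k hk => by
    simp only [hb, hc0]; exact ext_eq_of_herm hB₀ hb₀ hk
  have hE0 : fnorm N 0 (a 0) + fnorm N 0 (b 0) ≤ E := by
    refine le_trans (le_of_eq ?_) hE
    simp only [fnorm]
    congr 1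
    · exact Finset.sum_congr rfl fun k hk => by rw [ha0 k hk]
    · exact Finset.sum_congr rfl fun k hk => by rw [hb0 k hk]
  have hIcc : ∀ {t}, t ∈ Icc 0 T → Icc 0 t ⊆ Icc 0 T := fun ht => Icc_subset_Icc_right ht.2
  -- The energy does not increase along the retracted flow, so the retraction is inactive.
  have hEt : ∀ t ∈ Icc 0 T, genergy N (c t) ≤ E := by
    intro t ht
    have h := galerkin_energy_le P hP (κ := 0) hmf hmg ht.1 (hθc.mono (hIcc ht))
      (fun s => retr_nonneg hR) hAt hBt (fun s => band_ext _) (fun s => band_ext _)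
      (fun k => (hac k).mono (hIcc ht)) (fun k => (hbc k).mono (hIcc ht)) (fun s _ => hEθ s)
      (fun k hk s hs => hda k hk s (hIcc ht hs)) (fun k hk s hs => hdb k hk s (hIcc ht hs))
    have hnn : 0 ≤ ∫ s in (0 : ℝ)..t, Real.exp (0 * s) *
      (θ s * (P.σ1A mf mg E * fnorm N 4 (a s) + P.σ2A mf mg E * fnorm N 4 (b s)
        + P.σ1b mf mg E * fnorm N 2 (a s) + P.σ2b mf mg E * fnorm N 2 (b s))
        - 0 * (fnorm N 0 (a s) + fnorm N 0 (b s))) := by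
      refine intervalIntegral.integral_nonneg ht.1 fun s _ => ?_
      have := fnorm_nonneg N 4 (a s)
      have := fnorm_nonneg N 4 (b s)
      have := fnorm_nonneg N 2 (a s)
      have := fnorm_nonneg N 2 (b s)
      have : 0 ≤ θ s := retr_nonneg hR
      simp only [zero_mul, sub_zero]
      positivity
    rw [zero_mul, Real.exp_zero, one_mul] at h
    exact (le_add_of_nonneg_right hnn).trans (h.trans hE0)
  have hid : ∀ t ∈ Icc 0 T, θ t • c t = c t := fun t ht => genergy_retr_smul_eq hR (hEt t ht)
  have hida : ∀ t ∈ Icc 0 T, (fun k => (θ t : ℂ) * a t k) = a t := fun t ht => by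
    rw [← hsa, hid t ht]
  have hidb : ∀ t ∈ Icc 0 T, (fun k => (θ t : ℂ) * b t k) = b t := fun t ht => by
    rw [← hsb, hid t ht]
  have hda' : ∀ k ∈ modes N, ∀ t ∈ Icc 0 T, HasDerivAt (fun t => a t k)
      (rhs mf P.Aγ P.A P.bρ P.b (a t) (a t) (b t) k) t := fun k hk t ht => by
    have := hda k hk t ht
    rwa [hida t ht, hidb t ht] at this
  have hdb' : ∀ k ∈ modes N, ∀ t ∈ Icc 0 T, HasDerivAt (fun t => b t k)
      (rhs mg P.Aμ P.Aμ P.bμ P.bμ (b t) (a t) (b t) k) t := fun k hk t ht => by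
    have := hdb k hk t ht
    rwa [hida t ht, hidb t ht] at this
  have hen := fun (κ t : ℝ) (ht : t ∈ Icc 0 T) =>
    galerkin_energy_le P hP (κ := κ) (θ := fun _ => 1) hmf hmg ht.1 continuousOn_const
      (fun s => zero_le_one) hAt hBt (fun s => band_ext _) (fun s => band_ext _)
      (fun k => (hac k).mono (hIcc ht)) (fun k => (hbc k).mono (hIcc ht))
      (fun s hs => by rw [one_mul]; exact hEt s (hIcc ht hs))
      (fun k hk s hs => by simpa using hda' k hk s (hIcc ht hs))
      (fun k hk s hs => by simpa using hdb' k hk s (hIcc ht hs))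
  simp only [one_mul] at hen
  have hmon : ∀ (n : ℕ) {d : ℤ → ℂ}, d 0 = 0 → fnorm N 0 d ≤ fnorm N n d := by
    intro n d hd
    refine Finset.sum_le_sum fun k _ => ?_
    by_cases hk : k = 0
    · subst hk; simp [hd]
    · rw [pow_zero]
      gcongr
      refine one_le_pow₀ ?_
      exact_mod_cast Int.one_le_abs hk
  have hδA : 0 < P.δA mf mg E := lt_min h1A h2A
  have hδb : 0 < P.δb mf mg E := lt_min h1b h2b
  have hdiss : ∀ s, P.δA mf mg E * (fnorm N 4 (a s) + fnorm N 4 (b s))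
      + P.δb mf mg E * (fnorm N 2 (a s) + fnorm N 2 (b s))
      ≤ P.σ1A mf mg E * fnorm N 4 (a s) + P.σ2A mf mg E * fnorm N 4 (b s)
        + P.σ1b mf mg E * fnorm N 2 (a s) + P.σ2b mf mg E * fnorm N 2 (b s) := by
    intro s
    have e1 := mul_le_mul_of_nonneg_right (min_le_left (P.σ1A mf mg E) (P.σ2A mf mg E))
      (fnorm_nonneg N 4 (a s))
    have e2 := mul_le_mul_of_nonneg_right (min_le_right (P.σ1A mf mg E) (P.σ2A mf mg E))
      (fnorm_nonneg N 4 (b s))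
    have e3 := mul_le_mul_of_nonneg_right (min_le_left (P.σ1b mf mg E) (P.σ2b mf mg E))
      (fnorm_nonneg N 2 (a s))
    have e4 := mul_le_mul_of_nonneg_right (min_le_right (P.σ1b mf mg E) (P.σ2b mf mg E))
      (fnorm_nonneg N 2 (b s))
    unfold Params.δA Params.δb
    linarith
  -- the weight `κ = δ_A + δ_b` gives the decay, the weight `κ = 0` the integral bound
  refine ⟨a, b, hAt, hBt, fun t => band_ext _, fun t => band_ext _, fun t => ext_zero_mode _,
    fun t => ext_zero_mode _, ha0, hb0, hda', hdb', fun t ht => ?_, ?_⟩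
  · have h := hen (P.δA mf mg E + P.δb mf mg E) t ht
    have hnn : 0 ≤ ∫ s in (0 : ℝ)..t, Real.exp ((P.δA mf mg E + P.δb mf mg E) * s) *
      ((P.σ1A mf mg E * fnorm N 4 (a s) + P.σ2A mf mg E * fnorm N 4 (b s)
        + P.σ1b mf mg E * fnorm N 2 (a s) + P.σ2b mf mg E * fnorm N 2 (b s))
        - (P.δA mf mg E + P.δb mf mg E) * (fnorm N 0 (a s) + fnorm N 0 (b s))) := by
      refine intervalIntegral.integral_nonneg ht.1 fun s _ => ?_
      refine mul_nonneg (Real.exp_pos _).le ?_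
      have m1 := mul_le_mul_of_nonneg_left (add_le_add (hmon 4 (ext_zero_mode (c s).1))
        (hmon 4 (ext_zero_mode (c s).2))) hδA.le
      have m2 := mul_le_mul_of_nonneg_left (add_le_add (hmon 2 (ext_zero_mode (c s).1))
        (hmon 2 (ext_zero_mode (c s).2))) hδb.le
      have := hdiss s
      simp only [ha, hb] at this ⊢
      linarith
    have h' := (le_add_of_nonneg_right hnn).trans (h.trans hE0)
    rw [neg_mul, Real.exp_neg, ← div_eq_mul_inv, le_div_iff₀ (Real.exp_pos _), mul_comm]
    exact h'
  · have h := hen 0 T ⟨hT, le_rfl⟩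
    simp only [zero_mul, Real.exp_zero, one_mul, sub_zero] at h
    have hu : uIcc 0 T = Icc 0 T := uIcc_of_le hT
    have c4 : ContinuousOn (fun t => fnorm N 4 (a t) + fnorm N 4 (b t)) (Icc 0 T) :=
      (continuousOn_fnorm hac N 4).add (continuousOn_fnorm hbc N 4)
    have cσ : ContinuousOn (fun s => P.σ1A mf mg E * fnorm N 4 (a s)
        + P.σ2A mf mg E * fnorm N 4 (b s) + P.σ1b mf mg E * fnorm N 2 (a s)
        + P.σ2b mf mg E * fnorm N 2 (b s)) (Icc 0 T) :=
      (((continuousOn_const.mul (continuousOn_fnorm hac N 4)).add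
      (continuousOn_const.mul (continuousOn_fnorm hbc N 4))).add
      (continuousOn_const.mul (continuousOn_fnorm hac N 2))).add
      (continuousOn_const.mul (continuousOn_fnorm hbc N 2))
    have hmono := intervalIntegral.integral_mono_on hT
      (((hu ▸ c4).intervalIntegrable (μ := volume)).const_mul (P.δA mf mg E))
      ((hu ▸ cσ).intervalIntegrable (μ := volume)) fun s _ => by
        have h2 : 0 ≤ P.δb mf mg E * (fnorm N 2 (a s) + fnorm N 2 (b s)) :=
          mul_nonneg hδb.le (add_nonneg (fnorm_nonneg _ _ _) (fnorm_nonneg _ _ _))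
        linarith [hdiss s]
    rw [intervalIntegral.integral_const_mul] at hmono
    rw [le_div_iff₀ hδA, mul_comm]
    have e1 := fnorm_nonneg N 0 (a T)
    have e2 := fnorm_nonneg N 0 (b T)
    linarith

/-! ### Passage to the limit in the Galerkin approximations -/

lemma ofReal_abs_intCast (k : ℤ) : ENNReal.ofReal |(k : ℝ)| = k.natAbs := by
  rw [← Int.cast_abs, ← Nat.cast_natAbs, ENNReal.ofReal_natCast]

lemma Band.wnorm_eq {N : ℕ} {a : ℤ → ℂ} (ha : Band N a) (n : ℕ) :
    wnorm n a = ENNReal.ofReal (fnorm N n a) := by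
  rw [wnorm, tsum_eq_sum (s := modes N) fun k hk => by rw [ha k hk]; simp, fnorm,
    ENNReal.ofReal_sum_of_nonneg fun k _ => by positivity]
  refine Finset.sum_congr rfl fun k _ => ?_
  rw [ENNReal.ofReal_mul (by positivity), ENNReal.ofReal_pow (abs_nonneg _), ofReal_norm]
  rw [ofReal_abs_intCast]

/-- A bounded and uniformly equicontinuous sequence of functions with countably many components has
a subsequence that converges at every time in every component. -/
lemma exists_subseq_tendsto {ι : Type*} [Countable ι] {z : ℕ → ℝ → ι → ℂ} {R : ι → ℝ}
    (hR : ∀ n t i, ‖z n t i‖ ≤ R i)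
    (hz : ∀ i, ∀ ε > 0, ∃ η > 0, ∀ n s t, |t - s| < η → ‖z n t i - z n s i‖ ≤ ε) :
    ∃ φ : ℕ → ℕ, StrictMono φ ∧ ∃ w : ℝ → ι → ℂ, ∀ t i,
      Tendsto (fun n => z (φ n) t i) atTop (𝓝 (w t i)) := by
  -- convergence at rational times by compactness, at all other times by equicontinuity
  have hc : IsCompact (Set.pi univ fun q : ℚ × ι => Metric.closedBall (0 : ℂ) (R q.2)) :=
    isCompact_univ_pi fun q => isCompact_closedBall _ _
  obtain ⟨y, -, φ, hφ, hy⟩ := hc.isSeqCompact (x := fun n q => z n (q.1 : ℝ) q.2) fun n => by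
    simpa [Set.mem_pi] using fun _ i => hR n _ i
  rw [tendsto_pi_nhds] at hy
  refine ⟨φ, hφ, ?_⟩
  have hconv : ∀ t i, ∃ w, Tendsto (fun n => z (φ n) t i) atTop (𝓝 w) := by
    intro t i
    refine cauchySeq_tendsto_of_complete ?_
    rw [Metric.cauchySeq_iff']
    intro ε hε
    obtain ⟨η, hη, h⟩ := hz i (ε / 4) (by positivity)
    obtain ⟨q, hq1, hq2⟩ := exists_rat_btwn (show t < t + η by linarith)
    have hq : |t - q| < η := by rw [abs_lt]; constructor <;> linarith
    obtain ⟨M, hM⟩ := (Metric.cauchySeq_iff'.1 (hy (q, i)).cauchySeq) (ε / 4) (by positivity)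
    refine ⟨M, fun n hn => ?_⟩
    have h1 := h (φ n) q t hq
    have h2 := h (φ M) q t hq
    have h3 : ‖z (φ n) q i - z (φ M) q i‖ < ε / 4 := by simpa [dist_eq_norm] using hM n hn
    rw [dist_eq_norm]
    have : z (φ n) t i - z (φ M) t i = (z (φ n) t i - z (φ n) q i)
        + (z (φ n) q i - z (φ M) q i) - (z (φ M) t i - z (φ M) q i) := by ring
    rw [this]
    have h4 := norm_sub_le ((z (φ n) t i - z (φ n) q i) + (z (φ n) q i - z (φ M) q i))
      (z (φ M) t i - z (φ M) q i)
    have h5 := norm_add_le (z (φ n) t i - z (φ n) q i) (z (φ n) q i - z (φ M) q i)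
    linarith
  choose w hw using hconv
  exact ⟨w, hw⟩

/-- Fatou's lemma for the weighted `ℓ¹` norms of a pair of sequences. -/
lemma wnorm_add_wnorm_le_liminf {a b : ℕ → ℤ → ℂ} {c d : ℤ → ℂ} (m : ℕ)
    (ha : ∀ k, Tendsto (fun n => a n k) atTop (𝓝 (c k)))
    (hb : ∀ k, Tendsto (fun n => b n k) atTop (𝓝 (d k))) :
    wnorm m c + wnorm m d ≤ liminf (fun n => wnorm m (a n) + wnorm m (b n)) atTop := by
  have heq : ∀ u v : ℤ → ℂ, wnorm m u + wnorm m v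
      = ∫⁻ k : ℤ, (k.natAbs : ℝ≥0∞) ^ m * (‖u k‖ₑ + ‖v k‖ₑ) ∂Measure.count := fun u v => by
    rw [lintegral_count, wnorm, wnorm, ← ENNReal.tsum_add]
    simp only [mul_add]
  simp only [heq]
  refine le_trans (lintegral_mono fun k => ?_) (lintegral_liminf_le fun n => measurable_of_countable _)
  refine le_of_eq (Tendsto.liminf_eq ?_).symm
  refine ENNReal.Tendsto.const_mul ?_ (Or.inr (by finiteness))
  exact ((ha k).enorm).add ((hb k).enorm)

/-- Fourier coefficients of `(p + m) v`. -/
def flux (m : ℝ) (p v : ℤ → ℂ) (k : ℤ) : ℂ := m * v k + conv p v k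

lemma enorm_conv_le (p v : ℤ → ℂ) (k : ℤ) : ‖conv p v k‖ₑ ≤ wnorm 0 p * wnorm 0 v := by
  refine le_trans ?_ (wnorm_conv_le p v)
  rw [wnorm_zero_eq]
  exact ENNReal.le_tsum k

lemma enorm_le_wnorm_zero (v : ℤ → ℂ) (k : ℤ) : ‖v k‖ₑ ≤ wnorm 0 v := by
  rw [wnorm_zero_eq]
  exact ENNReal.le_tsum k

lemma enorm_flux_le (m : ℝ) (p v : ℤ → ℂ) (k : ℤ) :
    ‖flux m p v k‖ₑ ≤ (‖m‖ₑ + wnorm 0 p) * wnorm 0 v := by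
  rw [flux, add_mul]
  refine (enorm_add_le _ _).trans (add_le_add ?_ (enorm_conv_le p v k))
  rw [enorm_mul]
  gcongr
  · simp [enorm_eq_nnnorm]
  · exact enorm_le_wnorm_zero v k

lemma summable_conv {p v : ℤ → ℂ} (hp : wnorm 0 p < ⊤) (hv : wnorm 0 v < ⊤) (k : ℤ) :
    Summable fun j => p (k - j) * v j := by
  refine Summable.of_enorm (ne_top_of_le_ne_top (ENNReal.mul_lt_top hp hv).ne ?_)
  simp only [enorm_mul]
  rw [wnorm_zero_eq v, ← ENNReal.tsum_mul_left]
  gcongr with j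
  exact enorm_le_wnorm_zero p _

lemma flux_sub (m : ℝ) {p v w : ℤ → ℂ} (hp : wnorm 0 p < ⊤) (hv : wnorm 0 v < ⊤)
    (hw : wnorm 0 w < ⊤) (k : ℤ) :
    flux m p v k - flux m p w k = flux m p (fun k => v k - w k) k := by
  simp only [flux, conv, mul_sub]
  rw [(summable_conv hp hv k).tsum_sub (summable_conv hp hw k)]
  ring

/-- The low-frequency part. -/
def trunc (J : ℕ) (v : ℤ → ℂ) (k : ℤ) : ℂ := if k ∈ modes J then v k else 0

lemma band_trunc (J : ℕ) (v : ℤ → ℂ) : Band J (trunc J v) := fun _ hk => if_neg hk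

lemma wnorm_sub_trunc_le {J : ℕ} (hJ : 0 < J) (v : ℤ → ℂ) :
    wnorm 0 (fun k => v k - trunc J v k) ≤ (J : ℝ≥0∞)⁻¹ * wnorm 1 v := by
  rw [wnorm_zero_eq, wnorm, ← ENNReal.tsum_mul_left]
  gcongr with k
  rw [trunc]
  split_ifs with h
  · simp
  · have hk : J ≤ k.natAbs := by
      simp only [modes, Finset.mem_Icc] at h; omega
    rw [sub_zero, ← mul_assoc, pow_one]
    refine le_mul_of_one_le_left zero_le ?_
    rw [mul_comm, ← div_eq_mul_inv, ENNReal.le_div_iff_mul_le (by simp [hJ.ne']) (by simp), one_mul]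
    exact_mod_cast hk

lemma wnorm_mulpow (m n : ℕ) (a : ℤ → ℂ) : wnorm m (mulpow n a) = wnorm (m + n) a := by
  simp only [wnorm]
  refine tsum_congr fun k => ?_
  rw [mulpow, enorm_mul, enorm_pow, pow_add, mul_assoc]
  congr 3
  rw [← ofReal_norm, Complex.norm_intCast, ofReal_abs_intCast]

/-- The constant in the bound of `sym` by its arguments. -/
def symC (α β γ δ : ℝ) : ℝ≥0∞ := ‖α‖ₑ + ‖β‖ₑ + ‖γ‖ₑ + ‖δ‖ₑ

lemma symC_ne_top (α β γ δ : ℝ) : symC α β γ δ ≠ ⊤ := by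
  unfold symC; finiteness

lemma wnorm_sym_le (m : ℕ) (α β γ δ : ℝ) {a b : ℤ → ℂ} (ha : a 0 = 0) (hb : b 0 = 0) :
    wnorm m (sym α β γ δ a b) ≤ symC α β γ δ * (wnorm (m + 3) a + wnorm (m + 3) b) := by
  have h : ∀ (r : ℝ) (n : ℕ) (c : ℤ → ℂ), n ≤ 3 → c 0 = 0 →
      wnorm m (fun k => (r : ℂ) * mulpow n c k) ≤ ‖r‖ₑ * wnorm (m + 3) c := by
    intro r n c hn hc
    rw [wnorm_const_mul, wnorm_mulpow]
    gcongr
    · simp [enorm_eq_nnnorm]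
    · exact wnorm_le_wnorm hc (by omega)
  have h1 := wnorm_add_le m (fun k => α * mulpow 3 a k + β * mulpow 3 b k + γ * mulpow 1 a k)
    (fun k => δ * mulpow 1 b k)
  have h2 := wnorm_add_le m (fun k => α * mulpow 3 a k + β * mulpow 3 b k)
    (fun k => γ * mulpow 1 a k)
  have h3 := wnorm_add_le m (fun k => α * mulpow 3 a k) (fun k => β * mulpow 3 b k)
  set X := wnorm (m + 3) a
  set Y := wnorm (m + 3) b
  calc wnorm m (sym α β γ δ a b) ≤ ‖α‖ₑ * X + ‖β‖ₑ * Y + ‖γ‖ₑ * X + ‖δ‖ₑ * Y := by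
        refine h1.trans (add_le_add (h2.trans (add_le_add (h3.trans (add_le_add ?_ ?_)) ?_)) ?_)
        · exact h α 3 a le_rfl ha
        · exact h β 3 b le_rfl hb
        · exact h γ 1 a (by norm_num) ha
        · exact h δ 1 b (by norm_num) hb
    _ ≤ ‖α‖ₑ * (X + Y) + ‖β‖ₑ * (X + Y) + ‖γ‖ₑ * (X + Y) + ‖δ‖ₑ * (X + Y) := by
        gcongr <;> simp
    _ = symC α β γ δ * (X + Y) := by rw [symC]; ring

lemma rhs_eq_flux (m α β γ δ : ℝ) (p a b : ℤ → ℂ) (k : ℤ) :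
    rhs m α β γ δ p a b k = -(k : ℂ) * flux m p (sym α β γ δ a b) k := rfl

lemma enorm_rhs_le (m α β γ δ : ℝ) {p a b : ℤ → ℂ} (ha : a 0 = 0) (hb : b 0 = 0) (k : ℤ) :
    ‖rhs m α β γ δ p a b k‖ₑ ≤ ‖(k : ℂ)‖ₑ * ((‖m‖ₑ + wnorm 0 p) * symC α β γ δ)
      * (wnorm 3 a + wnorm 3 b) := by
  rw [rhs_eq_flux, enorm_mul, enorm_neg, mul_assoc]
  gcongr
  refine (enorm_flux_le _ _ _ _).trans ?_
  rw [mul_assoc]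
  gcongr
  simpa using wnorm_sym_le 0 α β γ δ ha hb

lemma wnorm_trunc_le (n J : ℕ) (a : ℤ → ℂ) : wnorm n (trunc J a) ≤ (J : ℝ≥0∞) ^ n * wnorm 0 a := by
  rw [wnorm_zero_eq, wnorm, ← ENNReal.tsum_mul_left]
  refine ENNReal.tsum_le_tsum fun k => ?_
  rw [trunc]
  split_ifs with h
  · have hk : k.natAbs ≤ J := by
      simp only [modes, Finset.mem_Icc] at h; omega
    gcongr
  · simp

lemma trunc_sym (J : ℕ) (α β γ δ : ℝ) (a b : ℤ → ℂ) :
    trunc J (sym α β γ δ a b) = sym α β γ δ (trunc J a) (trunc J b) := by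
  ext k
  simp only [trunc, sym, mulpow]
  split_ifs <;> simp

lemma measurable_sym {a b : ℝ → ℤ → ℂ} (ha : ∀ k, Measurable fun t => a t k)
    (hb : ∀ k, Measurable fun t => b t k) (α β γ δ : ℝ) (k : ℤ) :
    Measurable fun t => sym α β γ δ (a t) (b t) k := by
  simp only [sym, mulpow]
  have := ha k
  have := hb k
  fun_prop

lemma measurable_trunc {v : ℝ → ℤ → ℂ} (hv : ∀ k, Measurable fun t => v t k) (J : ℕ) (k : ℤ) :
    Measurable fun t => trunc J (v t) k := by
  simp only [trunc]
  split_ifs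
  · exact hv k
  · exact measurable_const

lemma measurable_conv {p v : ℝ → ℤ → ℂ} (hp : ∀ k, Measurable fun t => p t k)
    (hv : ∀ k, Measurable fun t => v t k) (k : ℤ) : Measurable fun t => conv (p t) (v t) k :=
  Measurable.tsum fun j => (hp _).mul (hv j)

lemma measurable_flux {p v : ℝ → ℤ → ℂ} (hp : ∀ k, Measurable fun t => p t k)
    (hv : ∀ k, Measurable fun t => v t k) (m : ℝ) (k : ℤ) :
    Measurable fun t => flux m (p t) (v t) k :=
  ((hv k).const_mul _).add (measurable_conv hp hv k)

/-- Convergence of a sequence that is approximated, uniformly from some index on, by convergent ones. -/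
lemma tendsto_of_approx {x : ℕ → ℂ} {l : ℂ} {y : ℕ → ℕ → ℂ} {l' : ℕ → ℂ} {C : ℝ≥0∞} (hC : C ≠ ⊤)
    (h1 : ∀ J > 0, ∀ᶠ n in atTop, ‖x n - y J n‖ₑ ≤ (J : ℝ≥0∞)⁻¹ * C)
    (h2 : ∀ J > 0, ‖l - l' J‖ₑ ≤ (J : ℝ≥0∞)⁻¹ * C)
    (h3 : ∀ J > 0, Tendsto (y J) atTop (𝓝 (l' J))) : Tendsto x atTop (𝓝 l) := by
  have hreal : ∀ (z : ℂ) (J : ℕ), J > 0 → ‖z‖ₑ ≤ (J : ℝ≥0∞)⁻¹ * C → ‖z‖ ≤ C.toReal / J := by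
    intro z J hJ h
    have hne : (J : ℝ≥0∞)⁻¹ ≠ ⊤ := by simp [hJ.ne']
    have := ENNReal.toReal_mono (ENNReal.mul_ne_top hne hC) h
    rw [toReal_enorm, ENNReal.toReal_mul, ENNReal.toReal_inv, ENNReal.toReal_natCast] at this
    rw [div_eq_inv_mul]; exact this
  rw [Metric.tendsto_nhds]
  intro ε hε
  obtain ⟨J, hJ⟩ := exists_nat_gt (3 * C.toReal / ε)
  have hJ0 : (0 : ℝ) < J := lt_of_le_of_lt (by positivity) hJ
  have hJ' : J > 0 := by exact_mod_cast hJ0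
  have hCJ : C.toReal / J < ε / 3 := by
    rw [div_lt_iff₀ hε] at hJ
    rw [div_lt_iff₀ hJ0]; linarith
  filter_upwards [h1 J hJ', (Metric.tendsto_nhds.1 (h3 J hJ')) (ε / 3) (by positivity)] with n hn hy
  have a1 := hreal _ J hJ' hn
  have a2 := hreal _ J hJ' (h2 J hJ')
  rw [dist_eq_norm] at hy ⊢
  have : x n - l = (x n - y J n) + (y J n - l' J) - (l - l' J) := by ring
  rw [this]
  have h4 := norm_sub_le ((x n - y J n) + (y J n - l' J)) (l - l' J)
  have h5 := norm_add_le (x n - y J n) (y J n - l' J)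
  linarith

/-- The error made in the flux by discarding the high frequencies. -/
lemma enorm_flux_sub_trunc_le (m α β γ δ : ℝ) {p a b : ℤ → ℂ} {E : ℝ≥0} (hp : wnorm 0 p ≤ E)
    (ha : a 0 = 0) (hb : b 0 = 0) (h4 : wnorm 4 a + wnorm 4 b < ⊤) {J : ℕ} (hJ : 0 < J) (k : ℤ) :
    ‖flux m p (sym α β γ δ a b) k - flux m p (trunc J (sym α β γ δ a b)) k‖ₑ
      ≤ (J : ℝ≥0∞)⁻¹ * ((‖m‖ₑ + E) * symC α β γ δ * (wnorm 4 a + wnorm 4 b)) := by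
  have hs : ∀ n ≤ 1, wnorm n (sym α β γ δ a b) ≤ symC α β γ δ * (wnorm 4 a + wnorm 4 b) := by
    intro n hn
    refine (wnorm_sym_le n α β γ δ ha hb).trans ?_
    gcongr
    · exact wnorm_le_wnorm ha (by omega)
    · exact wnorm_le_wnorm hb (by omega)
  have hfin : symC α β γ δ * (wnorm 4 a + wnorm 4 b) < ⊤ :=
    ENNReal.mul_lt_top (symC_ne_top _ _ _ _).lt_top h4
  have hv := (hs 0 (by norm_num)).trans_lt hfin
  rw [flux_sub m (hp.trans_lt ENNReal.coe_lt_top) hv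
    (lt_of_le_of_lt (wnorm_mono 0 fun k => by rw [trunc]; split_ifs <;> simp) hv)]
  refine (enorm_flux_le _ _ _ _).trans ?_
  calc _ ≤ (‖m‖ₑ + E) * ((J : ℝ≥0∞)⁻¹ * (symC α β γ δ * (wnorm 4 a + wnorm 4 b))) := by
        gcongr
        exact (wnorm_sub_trunc_le hJ _).trans (by gcongr; exact hs 1 le_rfl)
    _ = _ := by ring

/-- The error made in the time integral of the flux by discarding the high frequencies. -/
lemma integral_flux_sub_trunc_le (m α β γ δ : ℝ) {p a b : ℝ → ℤ → ℂ} {E : ℝ≥0} {D : ℝ≥0∞}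
    (hD : D ≠ ⊤) {S : Set ℝ}
    (hpm : ∀ k, Measurable fun t => p t k) (ham : ∀ k, Measurable fun t => a t k)
    (hbm : ∀ k, Measurable fun t => b t k)
    (hp : ∀ t, wnorm 0 (p t) ≤ E) (ha : ∀ t, a t 0 = 0) (hb : ∀ t, b t 0 = 0)
    (h4 : ∫⁻ t in S, (wnorm 4 (a t) + wnorm 4 (b t)) ≤ D) (k : ℤ) :
    IntegrableOn (fun t => flux m (p t) (sym α β γ δ (a t) (b t)) k) S ∧
    ∀ J > 0, IntegrableOn (fun t => flux m (p t) (trunc J (sym α β γ δ (a t) (b t))) k) S →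
    ‖(∫ t in S, flux m (p t) (sym α β γ δ (a t) (b t)) k)
      - ∫ t in S, flux m (p t) (trunc J (sym α β γ δ (a t) (b t))) k‖ₑ
      ≤ (J : ℝ≥0∞)⁻¹ * ((‖m‖ₑ + E) * symC α β γ δ * D) := by
  have hsm := measurable_sym ham hbm α β γ δ
  have hCne : (‖m‖ₑ + E) * symC α β γ δ ≠ ⊤ := ENNReal.mul_ne_top (by finiteness) (symC_ne_top _ _ _ _)
  have hwm : Measurable fun t => wnorm 4 (a t) + wnorm 4 (b t) :=
    (measurable_wnorm ham 4).add (measurable_wnorm hbm 4)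
  have hint : IntegrableOn (fun t => flux m (p t) (sym α β γ δ (a t) (b t)) k) S := by
    refine ⟨(measurable_flux hpm hsm m k).aestronglyMeasurable, ?_⟩
    refine lt_of_le_of_lt (b := (‖m‖ₑ + E) * symC α β γ δ * D) ?_
      (ENNReal.mul_lt_top hCne.lt_top hD.lt_top)
    refine le_trans ?_ (mul_le_mul_right h4 _)
    rw [← lintegral_const_mul _ hwm]
    refine lintegral_mono fun t => (enorm_flux_le _ _ _ _).trans ?_
    rw [mul_assoc]
    gcongr
    · exact hp t
    · refine (wnorm_sym_le 0 α β γ δ (ha t) (hb t)).trans ?_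
      gcongr
      · exact wnorm_le_wnorm (ha t) (by omega)
      · exact wnorm_le_wnorm (hb t) (by omega)
  refine ⟨hint, fun J hJ hJint => ?_⟩
  rw [← integral_sub hint hJint]
  refine (enorm_integral_le_lintegral_enorm _).trans ?_
  have hae : ∀ᵐ t ∂(volume.restrict S), wnorm 4 (a t) + wnorm 4 (b t) < ⊤ :=
    ae_lt_top hwm (ne_top_of_le_ne_top hD h4)
  calc _ ≤ ∫⁻ t in S, (J : ℝ≥0∞)⁻¹ * ((‖m‖ₑ + E) * symC α β γ δ * (wnorm 4 (a t) + wnorm 4 (b t))) :=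
        lintegral_mono_ae (hae.mono fun t ht =>
          enorm_flux_sub_trunc_le m α β γ δ (hp t) (ha t) (hb t) ht hJ k)
    _ ≤ _ := by
        rw [lintegral_const_mul _ (hwm.const_mul _), lintegral_const_mul _ hwm]
        gcongr

/-- The time integrals of the quadratic nonlinearity converge along a bounded sequence that
converges in every mode: high frequencies are uniformly negligible by the bound on the
`L¹(0,T;Ȧ⁴)` norms, and the low ones are treated by dominated convergence. -/
lemma tendsto_integral_flux (m α β γ δ : ℝ) {p a b : ℕ → ℝ → ℤ → ℂ} {p' a' b' : ℝ → ℤ → ℂ}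
    {E : ℝ≥0} {D : ℝ≥0∞} (hD : D ≠ ⊤) {T : ℝ}
    (hpm : ∀ n k, Measurable fun t => p n t k) (ham : ∀ n k, Measurable fun t => a n t k)
    (hbm : ∀ n k, Measurable fun t => b n t k) (hpm' : ∀ k, Measurable fun t => p' t k)
    (ham' : ∀ k, Measurable fun t => a' t k) (hbm' : ∀ k, Measurable fun t => b' t k)
    (hp : ∀ n t, wnorm 0 (p n t) ≤ E) (hp' : ∀ t, wnorm 0 (p' t) ≤ E)
    (hA : ∀ n t, wnorm 0 (a n t) ≤ E) (hB : ∀ n t, wnorm 0 (b n t) ≤ E)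
    (hA' : ∀ t, wnorm 0 (a' t) ≤ E) (hB' : ∀ t, wnorm 0 (b' t) ≤ E)
    (ha : ∀ n t, a n t 0 = 0) (hb : ∀ n t, b n t 0 = 0)
    (ha' : ∀ t, a' t 0 = 0) (hb' : ∀ t, b' t 0 = 0)
    (h4 : ∀ᶠ n in atTop, ∫⁻ t in Ioc 0 T, (wnorm 4 (a n t) + wnorm 4 (b n t)) ≤ D)
    (h4' : ∫⁻ t in Ioc 0 T, (wnorm 4 (a' t) + wnorm 4 (b' t)) ≤ D)
    (hpl : ∀ t k, Tendsto (fun n => p n t k) atTop (𝓝 (p' t k)))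
    (hal : ∀ t k, Tendsto (fun n => a n t k) atTop (𝓝 (a' t k)))
    (hbl : ∀ t k, Tendsto (fun n => b n t k) atTop (𝓝 (b' t k))) (k : ℤ) :
    Tendsto (fun n => ∫ t in Ioc 0 T, flux m (p n t) (sym α β γ δ (a n t) (b n t)) k) atTop
      (𝓝 (∫ t in Ioc 0 T, flux m (p' t) (sym α β γ δ (a' t) (b' t)) k)) := by
  have hCne : (‖m‖ₑ + E) * symC α β γ δ ≠ ⊤ := ENNReal.mul_ne_top (by finiteness) (symC_ne_top _ _ _ _)
  have hbd : ∀ (J : ℕ) (p a b : ℤ → ℂ), wnorm 0 p ≤ E → wnorm 0 a ≤ E → wnorm 0 b ≤ E →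
      a 0 = 0 → b 0 = 0 → ‖flux m p (trunc J (sym α β γ δ a b)) k‖ₑ
        ≤ (‖m‖ₑ + E) * (symC α β γ δ * ((J : ℝ≥0∞) ^ 3 * E + (J : ℝ≥0∞) ^ 3 * E)) := by
    intro J p a b hp hA hB ha hb
    refine (enorm_flux_le _ _ _ _).trans ?_
    gcongr
    rw [trunc_sym]
    refine (wnorm_sym_le 0 α β γ δ (by simp [trunc, ha]) (by simp [trunc, hb])).trans ?_
    gcongr <;> exact (wnorm_trunc_le _ _ _).trans (by simpa using by gcongr)
  have hfin : ∀ J : ℕ,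
      (‖m‖ₑ + E) * (symC α β γ δ * ((J : ℝ≥0∞) ^ 3 * E + (J : ℝ≥0∞) ^ 3 * E)) ≠ ⊤ := fun J => by
    have := symC_ne_top α β γ δ
    finiteness
  have hbd' : ∀ (J : ℕ) (p a b : ℤ → ℂ), wnorm 0 p ≤ E → wnorm 0 a ≤ E → wnorm 0 b ≤ E →
      a 0 = 0 → b 0 = 0 → ‖flux m p (trunc J (sym α β γ δ a b)) k‖
        ≤ ((‖m‖ₑ + E) * (symC α β γ δ * ((J : ℝ≥0∞) ^ 3 * E + (J : ℝ≥0∞) ^ 3 * E))).toReal := by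
    intro J p a b hp hA hB ha hb
    have := ENNReal.toReal_mono (hfin J) (hbd J p a b hp hA hB ha hb)
    rwa [toReal_enorm] at this
  have hmeas : ∀ (J : ℕ) {p a b : ℝ → ℤ → ℂ}, (∀ k, Measurable fun t => p t k) →
      (∀ k, Measurable fun t => a t k) → (∀ k, Measurable fun t => b t k) →
      Measurable fun t => flux m (p t) (trunc J (sym α β γ δ (a t) (b t))) k :=
    fun J p a b hp ha hb => measurable_flux hp (measurable_trunc (measurable_sym ha hb α β γ δ) J) m k
  have hint : ∀ (J : ℕ) {p a b : ℝ → ℤ → ℂ}, (∀ k, Measurable fun t => p t k) →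
      (∀ k, Measurable fun t => a t k) → (∀ k, Measurable fun t => b t k) →
      (∀ t, wnorm 0 (p t) ≤ E) → (∀ t, wnorm 0 (a t) ≤ E) → (∀ t, wnorm 0 (b t) ≤ E) →
      (∀ t, a t 0 = 0) → (∀ t, b t 0 = 0) →
      IntegrableOn (fun t => flux m (p t) (trunc J (sym α β γ δ (a t) (b t))) k) (Ioc 0 T) := by
    intro J p a b hpm ham hbm hp hA hB ha hb
    exact Measure.integrableOn_of_bounded (by simp) (hmeas J hpm ham hbm).aestronglyMeasurable
      (ae_of_all _ fun t => hbd' J _ _ _ (hp t) (hA t) (hB t) (ha t) (hb t))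
  refine tendsto_of_approx (C := (‖m‖ₑ + E) * symC α β γ δ * D) (ENNReal.mul_ne_top hCne hD)
    (y := fun J n => ∫ t in Ioc 0 T, flux m (p n t) (trunc J (sym α β γ δ (a n t) (b n t))) k)
    (l' := fun J => ∫ t in Ioc 0 T, flux m (p' t) (trunc J (sym α β γ δ (a' t) (b' t))) k) ?_ ?_ ?_
  · intro J hJ
    filter_upwards [h4] with n hn
    exact (integral_flux_sub_trunc_le m α β γ δ hD (hpm n) (ham n) (hbm n) (hp n) (ha n) (hb n) hn
      k).2 J hJ (hint J (hpm n) (ham n) (hbm n) (hp n) (hA n) (hB n) (ha n) (hb n))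
  · intro J hJ
    exact (integral_flux_sub_trunc_le m α β γ δ hD hpm' ham' hbm' hp' ha' hb' h4'
      k).2 J hJ (hint J hpm' ham' hbm' hp' hA' hB' ha' hb')
  · intro J hJ
    refine tendsto_integral_of_dominated_convergence (fun _ =>
      ((‖m‖ₑ + E) * (symC α β γ δ * ((J : ℝ≥0∞) ^ 3 * E + (J : ℝ≥0∞) ^ 3 * E))).toReal)
      (fun n => (hmeas J (hpm n) (ham n) (hbm n)).aestronglyMeasurable) (integrable_const _)
      (fun n => ae_of_all _ fun t => hbd' J _ _ _ (hp n t) (hA n t) (hB n t) (ha n t) (hb n t))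
      (ae_of_all _ fun t => ?_)
    have hv : ∀ j, Tendsto (fun n => trunc J (sym α β γ δ (a n t) (b n t)) j) atTop
        (𝓝 (trunc J (sym α β γ δ (a' t) (b' t)) j)) := by
      intro j
      simp only [trunc]
      split_ifs
      · simp only [sym, mulpow]
        exact (((((hal t j).const_mul _).const_mul _).add (((hbl t j).const_mul _).const_mul _)).add
          (((hal t j).const_mul _).const_mul _)).add (((hbl t j).const_mul _).const_mul _)
      · exact tendsto_const_nhds
    simp only [flux, conv_eq_sum _ (band_trunc J _)]
    exact ((hv k).const_mul _).add (tendsto_finsetSum _ fun j _ => (hpl t _).mul (hv j))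

/-- The pair `(a, b)` solves the Galerkin system of order `N` on `[0, N]` with initial datum
`(a₀, b₀)`, is constant outside this interval, and obeys the a priori bounds. -/
structure Approx (P : Params) (mf mg E : ℝ) (a₀ b₀ : ℤ → ℂ) (N : ℕ) (a b : ℝ → ℤ → ℂ) : Prop where
  hermA : ∀ t, Herm (a t)
  hermB : ∀ t, Herm (b t)
  zeroA : ∀ t, a t 0 = 0
  zeroB : ∀ t, b t 0 = 0
  contA : ∀ k, Continuous fun t => a t k
  contB : ∀ k, Continuous fun t => b t k
  bandA : ∀ t, Band N (a t)
  bandB : ∀ t, Band N (b t)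
  initA : ∀ k ∈ modes N, a 0 k = a₀ k
  initB : ∀ k ∈ modes N, b 0 k = b₀ k
  clampA : ∀ t, a t = a (max 0 (min t N))
  clampB : ∀ t, b t = b (max 0 (min t N))
  bound : ∀ t, wnorm 0 (a t) + wnorm 0 (b t) ≤ ENNReal.ofReal E
  decay : ∀ t ∈ Icc (0 : ℝ) N, wnorm 0 (a t) + wnorm 0 (b t)
    ≤ ENNReal.ofReal (E * Real.exp (-(P.δA mf mg E + P.δb mf mg E) * t))
  dissipation : ∫⁻ t in Ioc (0 : ℝ) N, (wnorm 4 (a t) + wnorm 4 (b t))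
    ≤ ENNReal.ofReal (E / P.δA mf mg E)
  eqA : ∀ k ∈ modes N, ∀ t ∈ Icc (0 : ℝ) N, ∀ s ∈ Icc 0 t, a t k - a s k
    = ∫ u in Ioc s t, rhs mf P.Aγ P.A P.bρ P.b (a u) (a u) (b u) k
  eqB : ∀ k ∈ modes N, ∀ t ∈ Icc (0 : ℝ) N, ∀ s ∈ Icc 0 t, b t k - b s k
    = ∫ u in Ioc s t, rhs mg P.Aμ P.Aμ P.bμ P.bμ (b u) (a u) (b u) k

lemma continuousOn_rhs {s : Set ℝ} {N : ℕ} {p a b : ℝ → ℤ → ℂ}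
    (hpc : ∀ k, ContinuousOn (fun t => p t k) s) (hac : ∀ k, ContinuousOn (fun t => a t k) s)
    (hbc : ∀ k, ContinuousOn (fun t => b t k) s) (ha : ∀ t, Band N (a t)) (hb : ∀ t, Band N (b t))
    (m α β γ δ : ℝ) (k : ℤ) : ContinuousOn (fun t => rhs m α β γ δ (p t) (a t) (b t) k) s := by
  unfold rhs
  exact continuousOn_const.mul ((continuousOn_const.mul (continuousOn_sym hac hbc _ _ _ _ k)).add
    (continuousOn_conv hpc (continuousOn_sym hac hbc _ _ _ _)
      (fun t => (ha t).sym (hb t) _ _ _ _) k))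

/-- The Galerkin solution on `[0, N]`, extended by constants to all times. -/
lemma exists_approx (P : Params) (hP : P.Pos) {mf mg E : ℝ} (hmf : 0 ≤ mf) (hmg : 0 ≤ mg)
    (h1A : 0 < P.σ1A mf mg E) (h2A : 0 < P.σ2A mf mg E)
    (h1b : 0 < P.σ1b mf mg E) (h2b : 0 < P.σ2b mf mg E) {a₀ b₀ : ℤ → ℂ} (hA₀ : Herm a₀)
    (hB₀ : Herm b₀) (ha₀ : a₀ 0 = 0) (hb₀ : b₀ 0 = 0)
    (hE0 : 0 ≤ E) (hE : wnorm 0 a₀ + wnorm 0 b₀ ≤ ENNReal.ofReal E) (N : ℕ) :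
    ∃ a b : ℝ → ℤ → ℂ, Approx P mf mg E a₀ b₀ N a b := by
  have hfn : fnorm N 0 a₀ + fnorm N 0 b₀ ≤ E := by
    have key : ∀ c : ℤ → ℂ, ENNReal.ofReal (fnorm N 0 c) ≤ wnorm 0 c := fun c => by
      rw [fnorm, ENNReal.ofReal_sum_of_nonneg fun k _ => by positivity, wnorm_zero_eq]
      simp only [pow_zero, one_mul, ofReal_norm]
      exact ENNReal.sum_le_tsum _
    rw [← ENNReal.ofReal_le_ofReal_iff hE0, ENNReal.ofReal_add (fnorm_nonneg _ _ _)
      (fnorm_nonneg _ _ _)]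
    exact (add_le_add (key a₀) (key b₀)).trans hE
  have hN : (0 : ℝ) ≤ N := Nat.cast_nonneg N
  obtain ⟨a, b, hA, hB, ha, hb, ha0, hb0, hai, hbi, hda, hdb, hdec, hdis⟩ :=
    exists_galerkin P hP hmf hmg hN h1A h2A h1b h2b N hA₀ hB₀ ha₀ hb₀ hfn
  have hac : ∀ k, ContinuousOn (fun t => a t k) (Icc (0 : ℝ) N) := fun k => by
    by_cases hk : k ∈ modes N
    · exact fun t ht => (hda k hk t ht).continuousAt.continuousWithinAt
    · exact continuousOn_const.congr fun t _ => ha t k hk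
  have hbc : ∀ k, ContinuousOn (fun t => b t k) (Icc (0 : ℝ) N) := fun k => by
    by_cases hk : k ∈ modes N
    · exact fun t ht => (hdb k hk t ht).continuousAt.continuousWithinAt
    · exact continuousOn_const.congr fun t _ => hb t k hk
  set κ : ℝ → ℝ := fun t => max 0 (min t N) with hκ
  have hκc : Continuous κ := by fun_prop
  have hκm : ∀ t, κ t ∈ Icc (0 : ℝ) N := fun t => ⟨le_max_left _ _, max_le hN (min_le_right _ _)⟩
  have hκi : ∀ t ∈ Icc (0 : ℝ) N, κ t = t := fun t ht => by
    simp only [hκ, min_eq_left ht.2, max_eq_right ht.1]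
  have hw : ∀ n t, wnorm n (a t) + wnorm n (b t)
      = ENNReal.ofReal (fnorm N n (a t) + fnorm N n (b t)) := fun n t => by
    rw [(ha t).wnorm_eq, (hb t).wnorm_eq, ENNReal.ofReal_add (fnorm_nonneg _ _ _)
      (fnorm_nonneg _ _ _)]
  have hdec' : ∀ t ∈ Icc (0 : ℝ) N, wnorm 0 (a t) + wnorm 0 (b t)
      ≤ ENNReal.ofReal (E * Real.exp (-(P.δA mf mg E + P.δb mf mg E) * t)) := fun t ht => by
    rw [hw]; exact ENNReal.ofReal_le_ofReal (hdec t ht)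
  have hδ : 0 < P.δA mf mg E + P.δb mf mg E :=
    add_pos (lt_min h1A h2A) (lt_min h1b h2b)
  have hint : ∀ (x : ℝ → ℂ) (g : ℝ → ℂ), (∀ t ∈ Icc (0 : ℝ) N, HasDerivAt x (g t) t) →
      ContinuousOn g (Icc (0 : ℝ) N) → ∀ t ∈ Icc (0 : ℝ) N, ∀ s ∈ Icc 0 t,
      x t - x s = ∫ u in Ioc s t, g u := by
    intro x g hx hg t ht s hs
    have hsub : uIcc s t ⊆ Icc (0 : ℝ) N := by
      rw [uIcc_of_le hs.2]; exact Icc_subset_Icc hs.1 ht.2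
    rw [← intervalIntegral.integral_of_le hs.2]
    exact (intervalIntegral.integral_eq_sub_of_hasDerivAt (fun u hu => hx u (hsub hu))
      ((hg.mono hsub).intervalIntegrable)).symm
  refine ⟨fun t => a (κ t), fun t => b (κ t), ⟨fun t => hA _, fun t => hB _, fun t => ha0 _,
    fun t => hb0 _, fun k => (hac k).comp_continuous hκc hκm,
    fun k => (hbc k).comp_continuous hκc hκm, fun t => ha _, fun t => hb _, ?_, ?_, ?_, ?_, ?_, ?_,
    ?_, ?_, ?_⟩⟩
  · intro k hk
    rw [hκi 0 ⟨le_rfl, hN⟩]; exact hai k hk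
  · intro k hk
    rw [hκi 0 ⟨le_rfl, hN⟩]; exact hbi k hk
  · intro t
    exact congrArg a (hκi _ (hκm t)).symm
  · intro t
    exact congrArg b (hκi _ (hκm t)).symm
  · intro t
    refine (hdec' _ (hκm t)).trans (ENNReal.ofReal_le_ofReal ?_)
    refine mul_le_of_le_one_right hE0 (Real.exp_le_one_iff.2 ?_)
    have := mul_nonneg hδ.le (hκm t).1
    linarith
  · intro t ht
    rw [hκi t ht]; exact hdec' t ht
  · have h1 : ∫⁻ t in Ioc (0 : ℝ) N, (wnorm 4 (a (κ t)) + wnorm 4 (b (κ t)))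
        = ∫⁻ t in Ioc (0 : ℝ) N, ENNReal.ofReal (fnorm N 4 (a t) + fnorm N 4 (b t)) := by
      refine setLIntegral_congr_fun measurableSet_Ioc fun t ht => ?_
      rw [hκi t (Ioc_subset_Icc_self ht), hw]
    have hc : ContinuousOn (fun t => fnorm N 4 (a t) + fnorm N 4 (b t)) (Icc (0 : ℝ) N) :=
      (continuousOn_fnorm hac N 4).add (continuousOn_fnorm hbc N 4)
    rw [h1, ← ofReal_integral_eq_lintegral_ofReal
      ((hc.integrableOn_compact isCompact_Icc).mono_set Ioc_subset_Icc_self)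
      (ae_of_all _ fun t => add_nonneg (fnorm_nonneg _ _ _) (fnorm_nonneg _ _ _)),
      ← intervalIntegral.integral_of_le hN]
    exact ENNReal.ofReal_le_ofReal hdis
  · intro k hk t ht s hs
    rw [hκi t ht, hκi s ⟨hs.1, hs.2.trans ht.2⟩, hint _ _ (hda k hk)
      (continuousOn_rhs hac hac hbc ha hb _ _ _ _ _ k) t ht s hs]
    refine setIntegral_congr_fun measurableSet_Ioc fun u hu => ?_
    rw [hκi u ⟨hs.1.trans hu.1.le, hu.2.trans ht.2⟩]
  · intro k hk t ht s hs
    rw [hκi t ht, hκi s ⟨hs.1, hs.2.trans ht.2⟩, hint _ _ (hdb k hk)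
      (continuousOn_rhs hbc hac hbc ha hb _ _ _ _ _ k) t ht s hs]
    refine setIntegral_congr_fun measurableSet_Ioc fun u hu => ?_
    rw [hκi u ⟨hs.1.trans hu.1.le, hu.2.trans ht.2⟩]

/-- Time increments of one mode: the nonlinearity is controlled by the `Ȧ³` norms, which are small
on short intervals by interpolation between `L^∞(Ȧ⁰)` and `L¹(Ȧ⁴)`. -/
lemma norm_integral_rhs_le (m α β γ δ : ℝ) {p a b : ℝ → ℤ → ℂ} {E D : ℝ≥0} {s t : ℝ} (hst : s ≤ t)
    (ham : ∀ k, Measurable fun t => a t k) (hbm : ∀ k, Measurable fun t => b t k)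
    (hp : ∀ t, wnorm 0 (p t) ≤ E)
    (hab : ∀ t, wnorm 0 (a t) + wnorm 0 (b t) ≤ E) (ha : ∀ t, a t 0 = 0) (hb : ∀ t, b t 0 = 0)
    (h4 : ∫⁻ t in Ioc s t, (wnorm 4 (a t) + wnorm 4 (b t)) ≤ D) (k : ℤ) (J : ℝ≥0) (hJ : 0 < J) :
    ‖∫ u in Ioc s t, rhs m α β γ δ (p u) (a u) (b u) k‖
      ≤ (‖(k : ℂ)‖ₑ * ((‖m‖ₑ + E) * symC α β γ δ)).toReal
        * (J ^ 3 * E * (t - s) + J ^ 3 / J ^ 4 * D) := by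
  have hCne : ‖(k : ℂ)‖ₑ * ((‖m‖ₑ + E) * symC α β γ δ) ≠ ⊤ := by
    have := symC_ne_top α β γ δ
    finiteness
  have hwm : Measurable fun t => wnorm 4 (a t) + wnorm 4 (b t) :=
    (measurable_wnorm ham 4).add (measurable_wnorm hbm 4)
  have hw3 : ∀ u, wnorm 3 (a u) + wnorm 3 (b u) ≤ (J : ℝ≥0∞) ^ 3 * E
      + (J : ℝ≥0∞) ^ 3 / (J : ℝ≥0∞) ^ 4 * (wnorm 4 (a u) + wnorm 4 (b u)) := by
    intro u
    calc _ ≤ _ := add_le_add (wnorm_interp 3 (by norm_num) (a u) J hJ)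
          (wnorm_interp 3 (by norm_num) (b u) J hJ)
      _ = (J : ℝ≥0∞) ^ 3 * (wnorm 0 (a u) + wnorm 0 (b u))
          + (J : ℝ≥0∞) ^ 3 / (J : ℝ≥0∞) ^ 4 * (wnorm 4 (a u) + wnorm 4 (b u)) := by ring
      _ ≤ _ := by gcongr; exact hab u
  have hmain : ‖∫ u in Ioc s t, rhs m α β γ δ (p u) (a u) (b u) k‖ₑ
      ≤ ‖(k : ℂ)‖ₑ * ((‖m‖ₑ + E) * symC α β γ δ)
        * ((J : ℝ≥0∞) ^ 3 * E * ENNReal.ofReal (t - s) + (J : ℝ≥0∞) ^ 3 / (J : ℝ≥0∞) ^ 4 * D) := by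
    refine (enorm_integral_le_lintegral_enorm _).trans ?_
    calc _ ≤ ∫⁻ u in Ioc s t, ‖(k : ℂ)‖ₑ * ((‖m‖ₑ + E) * symC α β γ δ) * ((J : ℝ≥0∞) ^ 3 * E
          + (J : ℝ≥0∞) ^ 3 / (J : ℝ≥0∞) ^ 4 * (wnorm 4 (a u) + wnorm 4 (b u))) := by
          refine lintegral_mono fun u => (enorm_rhs_le m α β γ δ (ha u) (hb u) k).trans ?_
          refine mul_le_mul' ?_ (hw3 u)
          gcongr
          exact hp u
      _ ≤ _ := by
          rw [lintegral_const_mul _ (by fun_prop), lintegral_add_left measurable_const,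
            lintegral_const_mul _ hwm, lintegral_const, Measure.restrict_apply_univ, Real.volume_Ioc]
          gcongr
  have hne : (J : ℝ≥0∞) ^ 3 / (J : ℝ≥0∞) ^ 4 ≠ ⊤ :=
    ENNReal.div_ne_top (by finiteness) (by positivity)
  have hfin : ‖(k : ℂ)‖ₑ * ((‖m‖ₑ + E) * symC α β γ δ)
        * ((J : ℝ≥0∞) ^ 3 * E * ENNReal.ofReal (t - s) + (J : ℝ≥0∞) ^ 3 / (J : ℝ≥0∞) ^ 4 * D) ≠ ⊤ := by
    finiteness
  have := ENNReal.toReal_mono hfin hmain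
  rw [toReal_enorm] at this
  refine this.trans (le_of_eq ?_)
  rw [ENNReal.toReal_mul, ENNReal.toReal_add (by finiteness) (by finiteness)]
  simp [ENNReal.toReal_ofReal (sub_nonneg.2 hst)]

/-- A modulus of continuity from the increment bound with free cut-off frequency `J`: `J` is chosen
large to make the second term small, and then the time step small. -/
lemma exists_modulus {f : ℕ → ℝ → ℂ} {K E D : ℝ} (hK : 0 ≤ K) (hE : 0 ≤ E) (hD : 0 ≤ D)
    (h : ∀ n s t, s ≤ t → ∀ J : ℝ≥0, 0 < J →
      ‖f n t - f n s‖ ≤ K * (J ^ 3 * E * (t - s) + J ^ 3 / J ^ 4 * D)) :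
    ∀ ε > 0, ∃ η > 0, ∀ n s t, |t - s| < η → ‖f n t - f n s‖ ≤ ε := by
  intro ε hε
  obtain ⟨J, hJ⟩ := exists_nat_gt (2 * K * D / ε)
  have hJ0 : (0 : ℝ) < J := lt_of_le_of_lt (by positivity) hJ
  have hJ1 : K * D / J ≤ ε / 2 := by
    rw [div_lt_iff₀ hε] at hJ
    rw [div_le_iff₀ hJ0]; linarith
  have hpos : 0 < 2 * (K * (J ^ 3 * E) + 1) := by positivity
  have key : ∀ n s t, s ≤ t → |t - s| < ε / (2 * (K * (J ^ 3 * E) + 1)) →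
      ‖f n t - f n s‖ ≤ ε := by
    intro n s t hst ht
    have h1 := h n s t hst J (by exact_mod_cast hJ0)
    rw [abs_of_nonneg (sub_nonneg.2 hst), lt_div_iff₀ hpos] at ht
    have h2 : ((J : ℝ≥0) : ℝ) ^ 3 / ((J : ℝ≥0) : ℝ) ^ 4 * D = D / J := by
      push_cast; field_simp
    rw [h2] at h1
    push_cast at h1
    have h3 : K * (J ^ 3 * E * (t - s) + D / J) = (t - s) * (K * (J ^ 3 * E)) + K * D / J := by ring
    rw [h3] at h1
    nlinarith [sub_nonneg.2 hst]
  refine ⟨_, div_pos hε hpos, fun n s t hst => ?_⟩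
  rcases le_total s t with hle | hle
  · exact key n s t hle hst
  · rw [norm_sub_rev]
    exact key n t s hle (by rwa [abs_sub_comm])

lemma clamp_mem {N : ℝ} (hN : 0 ≤ N) (t : ℝ) : max 0 (min t N) ∈ Icc 0 N :=
  ⟨le_max_left _ _, max_le hN (min_le_right _ _)⟩

lemma clamp_mono {N s t : ℝ} (hst : s ≤ t) : max 0 (min s N) ≤ max 0 (min t N) := by gcongr

lemma clamp_sub_le {N s t : ℝ} (hst : s ≤ t) : max 0 (min t N) - max 0 (min s N) ≤ t - s := by
  rcases max_cases 0 (min t N) with h | h <;> rcases max_cases 0 (min s N) with h' | h' <;>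
    rcases min_cases t N with h'' | h'' <;> rcases min_cases s N with h''' | h''' <;> linarith

section

variable {P : Params} {mf mg : ℝ} {E : ℝ≥0} {a₀ b₀ : ℤ → ℂ} {N : ℕ} {a b : ℝ → ℤ → ℂ}

lemma Approx.norm_sub_leA (h : Approx P mf mg E a₀ b₀ N a b) (k : ℤ) {s t : ℝ} (hst : s ≤ t)
    (J : ℝ≥0) (hJ : 0 < J) : ‖a t k - a s k‖
      ≤ (‖(k : ℂ)‖ₑ * ((‖mf‖ₑ + E) * symC P.Aγ P.A P.bρ P.b)).toReal
        * (J ^ 3 * E * (t - s) + J ^ 3 / J ^ 4 * ((E / P.δA mf mg E).toNNReal : ℝ≥0)) := by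
  by_cases hk : k ∈ modes N
  · have hN : (0 : ℝ) ≤ N := Nat.cast_nonneg N
    have hs := clamp_mem hN s
    have ht := clamp_mem hN t
    have hb' : ∀ t, wnorm 0 (a t) + wnorm 0 (b t) ≤ E := fun t => by
      simpa using h.bound t
    rw [h.clampA t, h.clampA s, h.eqA k hk _ ht _ ⟨hs.1, clamp_mono hst⟩]
    refine (norm_integral_rhs_le mf P.Aγ P.A P.bρ P.b (clamp_mono hst)
      (fun k => (h.contA k).measurable) (fun k => (h.contB k).measurable)
      (fun t => le_self_add.trans (hb' t)) hb' h.zeroA h.zeroB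
      ((lintegral_mono_set (Ioc_subset_Ioc hs.1 ht.2)).trans h.dissipation) k J hJ).trans ?_
    have := clamp_sub_le (N := N) hst
    gcongr
  · rw [h.bandA t k hk, h.bandA s k hk, sub_zero, norm_zero]
    have := sub_nonneg.2 hst
    positivity

lemma Approx.norm_sub_leB (h : Approx P mf mg E a₀ b₀ N a b) (k : ℤ) {s t : ℝ} (hst : s ≤ t)
    (J : ℝ≥0) (hJ : 0 < J) : ‖b t k - b s k‖
      ≤ (‖(k : ℂ)‖ₑ * ((‖mg‖ₑ + E) * symC P.Aμ P.Aμ P.bμ P.bμ)).toReal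
        * (J ^ 3 * E * (t - s) + J ^ 3 / J ^ 4 * ((E / P.δA mf mg E).toNNReal : ℝ≥0)) := by
  by_cases hk : k ∈ modes N
  · have hN : (0 : ℝ) ≤ N := Nat.cast_nonneg N
    have hs := clamp_mem hN s
    have ht := clamp_mem hN t
    have hb' : ∀ t, wnorm 0 (a t) + wnorm 0 (b t) ≤ E := fun t => by
      simpa using h.bound t
    rw [h.clampB t, h.clampB s, h.eqB k hk _ ht _ ⟨hs.1, clamp_mono hst⟩]
    refine (norm_integral_rhs_le mg P.Aμ P.Aμ P.bμ P.bμ (clamp_mono hst)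
      (fun k => (h.contA k).measurable) (fun k => (h.contB k).measurable)
      (fun t => le_add_self.trans (hb' t)) hb' h.zeroA h.zeroB
      ((lintegral_mono_set (Ioc_subset_Ioc hs.1 ht.2)).trans h.dissipation) k J hJ).trans ?_
    have := clamp_sub_le (N := N) hst
    gcongr
  · rw [h.bandB t k hk, h.bandB s k hk, sub_zero, norm_zero]
    have := sub_nonneg.2 hst
    positivity

end

/-- The Fourier coefficients `(a, b)` solve the system mode by mode, integrated in time, with
initial datum `(a₀, b₀)`, and obey the decay and dissipation bounds. -/
structure ModeSolution (P : Params) (mf mg E : ℝ) (a₀ b₀ : ℤ → ℂ) (a b : ℝ → ℤ → ℂ) : Prop where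
  hermA : ∀ t, Herm (a t)
  hermB : ∀ t, Herm (b t)
  zeroA : ∀ t, a t 0 = 0
  zeroB : ∀ t, b t 0 = 0
  measA : ∀ k, Measurable fun t => a t k
  measB : ∀ k, Measurable fun t => b t k
  bound : ∀ t, wnorm 0 (a t) + wnorm 0 (b t) ≤ ENNReal.ofReal E
  decay : ∀ t, 0 ≤ t → wnorm 0 (a t) + wnorm 0 (b t)
    ≤ ENNReal.ofReal (E * Real.exp (-(P.δA mf mg E + P.δb mf mg E) * t))
  dissipation : ∀ T, ∫⁻ t in Ioc (0 : ℝ) T, (wnorm 4 (a t) + wnorm 4 (b t))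
    ≤ ENNReal.ofReal (E / P.δA mf mg E)
  eqA : ∀ k t, 0 ≤ t → a t k
    = a₀ k + ∫ u in Ioc 0 t, rhs mf P.Aγ P.A P.bρ P.b (a u) (a u) (b u) k
  eqB : ∀ k t, 0 ≤ t → b t k
    = b₀ k + ∫ u in Ioc 0 t, rhs mg P.Aμ P.Aμ P.bμ P.bμ (b u) (a u) (b u) k

/-- The Galerkin solutions converge, along a subsequence, to a solution of the full system. -/
lemma exists_modeSolution (P : Params) (hP : P.Pos) {mf mg E : ℝ} (hmf : 0 ≤ mf) (hmg : 0 ≤ mg)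
    (h1A : 0 < P.σ1A mf mg E) (h2A : 0 < P.σ2A mf mg E)
    (h1b : 0 < P.σ1b mf mg E) (h2b : 0 < P.σ2b mf mg E) {a₀ b₀ : ℤ → ℂ} (hA₀ : Herm a₀)
    (hB₀ : Herm b₀) (ha₀ : a₀ 0 = 0) (hb₀ : b₀ 0 = 0)
    (hE0 : 0 ≤ E) (hE : wnorm 0 a₀ + wnorm 0 b₀ ≤ ENNReal.ofReal E) :
    ∃ a b : ℝ → ℤ → ℂ, ModeSolution P mf mg E a₀ b₀ a b := by
  lift E to ℝ≥0 using hE0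
  choose a b hab using
    exists_approx P hP hmf hmg h1A h2A h1b h2b hA₀ hB₀ ha₀ hb₀ E.coe_nonneg hE
  have hbE : ∀ n t, wnorm 0 (a n t) + wnorm 0 (b n t) ≤ E := fun n t => by
    simpa using (hab n).bound t
  have hnorm : ∀ (c : ℤ → ℂ) k, wnorm 0 c ≤ E → ‖c k‖ ≤ E := fun c k h => by
    have := ENNReal.toReal_mono ENNReal.coe_ne_top ((enorm_le_wnorm_zero c k).trans h)
    simpa using this
  set z : ℕ → ℝ → Bool × ℤ → ℂ := fun n t i => cond i.1 (a n t i.2) (b n t i.2) with hz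
  obtain ⟨φ, hφ, w, hw⟩ := exists_subseq_tendsto (z := z) (R := fun _ => E) (by
    rintro n t ⟨_ | _, k⟩
    · exact hnorm _ k (le_add_self.trans (hbE n t))
    · exact hnorm _ k (le_self_add.trans (hbE n t))) (by
    rintro ⟨_ | _, k⟩
    · exact exists_modulus (f := fun n t => b n t k) ENNReal.toReal_nonneg E.coe_nonneg
        NNReal.zero_le_coe fun n s t hst J hJ => (hab n).norm_sub_leB k hst J hJ
    · exact exists_modulus (f := fun n t => a n t k) ENNReal.toReal_nonneg E.coe_nonneg
        NNReal.zero_le_coe fun n s t hst J hJ => (hab n).norm_sub_leA k hst J hJ)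
  set α : ℝ → ℤ → ℂ := fun t k => w t (true, k) with hα
  set β : ℝ → ℤ → ℂ := fun t k => w t (false, k) with hβ
  have hal : ∀ t k, Tendsto (fun n => a (φ n) t k) atTop (𝓝 (α t k)) := fun t k => hw t (true, k)
  have hbl : ∀ t k, Tendsto (fun n => b (φ n) t k) atTop (𝓝 (β t k)) := fun t k => hw t (false, k)
  have hφt := hφ.tendsto_atTop
  have hge : ∀ r : ℝ, ∀ᶠ n in atTop, r ≤ (φ n : ℝ) := fun r =>
    (tendsto_natCast_atTop_atTop.comp hφt).eventually_ge_atTop r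
  have hmodes : ∀ k, ∀ᶠ n in atTop, k ∈ modes (φ n) := fun k => by
    filter_upwards [hφt.eventually_ge_atTop k.natAbs] with n hn
    simp only [modes, Finset.mem_Icc]; omega
  have hherm : ∀ {x : ℕ → ℝ → ℤ → ℂ} {y : ℝ → ℤ → ℂ}, (∀ n t, Herm (x n t)) →
      (∀ t k, Tendsto (fun n => x n t k) atTop (𝓝 (y t k))) → ∀ t, Herm (y t) := by
    intro x y hx hy t k
    refine tendsto_nhds_unique (hy t (-k)) ?_
    simp only [hx _ t k]
    exact (Complex.continuous_conj.tendsto _).comp (hy t k)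
  have hzero : ∀ {x : ℕ → ℝ → ℤ → ℂ} {y : ℝ → ℤ → ℂ}, (∀ n t, x n t 0 = 0) →
      (∀ t k, Tendsto (fun n => x n t k) atTop (𝓝 (y t k))) → ∀ t, y t 0 = 0 := by
    intro x y hx hy t
    refine tendsto_nhds_unique (hy t 0) ?_
    simp only [hx]
    exact tendsto_const_nhds
  have hfatou : ∀ t (C : ℝ≥0∞), (∀ᶠ n in atTop, wnorm 0 (a (φ n) t) + wnorm 0 (b (φ n) t) ≤ C) →
      wnorm 0 (α t) + wnorm 0 (β t) ≤ C := fun t C h =>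
    (wnorm_add_wnorm_le_liminf 0 (hal t) (hbl t)).trans
      (liminf_le_of_frequently_le' h.frequently)
  have hbE' : ∀ t, wnorm 0 (α t) + wnorm 0 (β t) ≤ E := fun t =>
    hfatou t E (Eventually.of_forall fun n => hbE _ t)
  have hmA : ∀ k, Measurable fun t => α t k := fun k =>
    measurable_of_tendsto_metrizable (fun n => ((hab (φ n)).contA k).measurable)
      (tendsto_pi_nhds.2 fun t => hal t k)
  have hmB : ∀ k, Measurable fun t => β t k := fun k =>
    measurable_of_tendsto_metrizable (fun n => ((hab (φ n)).contB k).measurable)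
      (tendsto_pi_nhds.2 fun t => hbl t k)
  have hzA := hzero (fun n => (hab (φ n)).zeroA) hal
  have hzB := hzero (fun n => (hab (φ n)).zeroB) hbl
  have hdn : ∀ T : ℝ, ∀ᶠ n in atTop, ∫⁻ t in Ioc 0 T, (wnorm 4 (a (φ n) t) + wnorm 4 (b (φ n) t))
      ≤ ENNReal.ofReal (E / P.δA mf mg E) := fun T => by
    filter_upwards [hge T] with n hn
    exact (lintegral_mono_set (Ioc_subset_Ioc_right hn)).trans (hab (φ n)).dissipation
  have hdis : ∀ T : ℝ, ∫⁻ t in Ioc 0 T, (wnorm 4 (α t) + wnorm 4 (β t))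
      ≤ ENNReal.ofReal (E / P.δA mf mg E) := fun T => by
    refine (lintegral_mono fun t => wnorm_add_wnorm_le_liminf 4 (hal t) (hbl t)).trans ?_
    refine (lintegral_liminf_le fun n =>
      (measurable_wnorm (fun k => ((hab (φ n)).contA k).measurable) 4).add
      (measurable_wnorm (fun k => ((hab (φ n)).contB k).measurable) 4)).trans ?_
    exact liminf_le_of_frequently_le' (hdn T).frequently
  refine ⟨α, β, ⟨hherm (fun n => (hab (φ n)).hermA) hal, hherm (fun n => (hab (φ n)).hermB) hbl,
    hzA, hzB, hmA, hmB, fun t => by simpa using hbE' t, fun t ht => ?_, hdis, fun k t ht => ?_,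
    fun k t ht => ?_⟩⟩
  · refine hfatou t _ ?_
    filter_upwards [hge t] with n hn
    exact (hab (φ n)).decay t ⟨ht, hn⟩
  · have hlim := tendsto_integral_flux mf P.Aγ P.A P.bρ P.b (E := E) (T := t)
      (ENNReal.ofReal_ne_top (r := E / P.δA mf mg E))
      (fun n k => ((hab (φ n)).contA k).measurable) (fun n k => ((hab (φ n)).contA k).measurable)
      (fun n k => ((hab (φ n)).contB k).measurable) hmA hmA hmB
      (fun n t => le_self_add.trans (hbE _ t)) (fun t => le_self_add.trans (hbE' t))
      (fun n t => le_self_add.trans (hbE _ t)) (fun n t => le_add_self.trans (hbE _ t))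
      (fun t => le_self_add.trans (hbE' t)) (fun t => le_add_self.trans (hbE' t))
      (fun n => (hab (φ n)).zeroA) (fun n => (hab (φ n)).zeroB) hzA hzB (hdn t) (hdis t)
      hal hal hbl k
    refine tendsto_nhds_unique (hal t k) ?_
    simp only [rhs_eq_flux, integral_const_mul]
    refine Tendsto.congr' ?_ (tendsto_const_nhds.add (hlim.const_mul (-(k : ℂ))))
    filter_upwards [hge t, hmodes k] with n hn hk
    have := (hab (φ n)).eqA k hk t ⟨ht, hn⟩ 0 ⟨le_rfl, ht⟩
    simp only [rhs_eq_flux, integral_const_mul] at this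
    rw [← (hab (φ n)).initA k hk, ← this]; ring
  · have hlim := tendsto_integral_flux mg P.Aμ P.Aμ P.bμ P.bμ (E := E) (T := t)
      (ENNReal.ofReal_ne_top (r := E / P.δA mf mg E))
      (fun n k => ((hab (φ n)).contB k).measurable) (fun n k => ((hab (φ n)).contA k).measurable)
      (fun n k => ((hab (φ n)).contB k).measurable) hmB hmA hmB
      (fun n t => le_add_self.trans (hbE _ t)) (fun t => le_add_self.trans (hbE' t))
      (fun n t => le_self_add.trans (hbE _ t)) (fun n t => le_add_self.trans (hbE _ t))
      (fun t => le_self_add.trans (hbE' t)) (fun t => le_add_self.trans (hbE' t))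
      (fun n => (hab (φ n)).zeroA) (fun n => (hab (φ n)).zeroB) hzA hzB (hdn t) (hdis t)
      hbl hal hbl k
    refine tendsto_nhds_unique (hbl t k) ?_
    simp only [rhs_eq_flux, integral_const_mul]
    refine Tendsto.congr' ?_ (tendsto_const_nhds.add (hlim.const_mul (-(k : ℂ))))
    filter_upwards [hge t, hmodes k] with n hn hk
    have := (hab (φ n)).eqB k hk t ⟨ht, hn⟩ 0 ⟨le_rfl, ht⟩
    simp only [rhs_eq_flux, integral_const_mul] at this
    rw [← (hab (φ n)).initB k hk, ← this]; ring

/-! ### The weak formulation in Fourier variables -/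

lemma hasDerivAt_fst {φ : ℝ × ℝ → ℝ} (hφ : ContDiff ℝ 1 φ) (t x : ℝ) :
    HasDerivAt (fun t => φ (t, x)) (fderiv ℝ φ (t, x) (1, 0)) t := by
  have h1 := (hφ.differentiable one_ne_zero (t, x)).hasFDerivAt
  have h2 : HasDerivAt (fun t : ℝ => (t, x)) ((1 : ℝ), (0 : ℝ)) t :=
    (hasDerivAt_id t).prodMk (hasDerivAt_const t x)
  exact h1.comp_hasDerivAt t h2

lemma hasDerivAt_snd {φ : ℝ × ℝ → ℝ} (hφ : ContDiff ℝ 1 φ) (t x : ℝ) :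
    HasDerivAt (fun x => φ (t, x)) (fderiv ℝ φ (t, x) (0, 1)) x := by
  have h1 := (hφ.differentiable one_ne_zero (t, x)).hasFDerivAt
  have h2 : HasDerivAt (fun x : ℝ => (t, x)) ((0 : ℝ), (1 : ℝ)) x :=
    (hasDerivAt_const x t).prodMk (hasDerivAt_id x)
  exact h1.comp_hasDerivAt x h2

lemma continuous_fderiv_apply {φ : ℝ × ℝ → ℝ} (hφ : ContDiff ℝ 1 φ) (v : ℝ × ℝ) :
    Continuous fun p => fderiv ℝ φ p v :=
  (hφ.continuous_fderiv one_ne_zero).clm_apply continuous_const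

lemma exists_bound_cylinder {ψ : ℝ × ℝ → ℝ} (hψ : Continuous ψ) (T : ℝ) :
    ∃ M : ℝ≥0, ∀ᵐ p ∂(cylinder T), ‖ψ p‖ₑ ≤ M := by
  obtain ⟨M, hM⟩ := ((isCompact_Icc (a := (0 : ℝ)) (b := T)).prod
    (isCompact_Icc (a := -Real.pi) (b := Real.pi))).exists_bound_of_continuousOn hψ.continuousOn
  refine ⟨M.toNNReal, ?_⟩
  have : cylinder T = (volume.prod volume).restrict (Ioc 0 T ×ˢ Ioc (-Real.pi) Real.pi) := by
    rw [cylinder, torus, Measure.prod_restrict]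
  rw [this]
  filter_upwards [ae_restrict_mem (measurableSet_Ioc.prod measurableSet_Ioc)] with p hp
  have h := hM p ⟨Ioc_subset_Icc_self hp.1, Ioc_subset_Icc_self hp.2⟩
  rw [← ofReal_norm]
  exact ENNReal.ofReal_le_ofReal h

lemma lintegral_cylinder_fst {T : ℝ} {F : ℝ → ℝ≥0∞} (hF : Measurable F) :
    ∫⁻ p, F p.1 ∂(cylinder T) = torus univ * ∫⁻ t in Ioc 0 T, F t := by
  rw [cylinder, lintegral_prod _ (by fun_prop)]
  simp only [lintegral_const]
  rw [lintegral_mul_const _ hF, mul_comm]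

lemma integrable_mode_mul {T : ℝ} {c : ℝ → ℂ} (hc : IntegrableOn c (Ioc 0 T))
    {ψ : ℝ × ℝ → ℝ} (hψ : Continuous ψ) (k : ℤ) :
    Integrable (fun p : ℝ × ℝ => c p.1 * expo k p.2 * (ψ p : ℂ)) (cylinder T) := by
  obtain ⟨M, hM⟩ := exists_bound_cylinder hψ T
  have h1 : Integrable (fun p : ℝ × ℝ => c p.1 * expo k p.2) (cylinder T) :=
    hc.integrable.mul_prod (integrable_of_continuous_torus (continuous_expo k))
  refine h1.mul_bdd (c := M) (Complex.continuous_ofReal.comp hψ).aestronglyMeasurable ?_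
  filter_upwards [hM] with p hp
  rw [Complex.norm_real]
  exact_mod_cast hp

/-- The integral of a space-time trigonometric series against a continuous function may be computed
term by term. -/
lemma hasSum_integral_trig_mul {T : ℝ} {c : ℝ → ℤ → ℂ} (hc : ∀ k, Measurable fun t => c t k)
    (h : ∫⁻ t in Ioc 0 T, wnorm 0 (c t) < ⊤) {ψ : ℝ × ℝ → ℝ} (hψ : Continuous ψ) :
    HasSum (fun k => ∫ p, c p.1 k * expo k p.2 * (ψ p : ℂ) ∂(cylinder T))
      (∫ p, trig (c p.1) p.2 * (ψ p : ℂ) ∂(cylinder T)) := by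
  obtain ⟨M, hM⟩ := exists_bound_cylinder hψ T
  have hle : ∀ k, ∫⁻ t in Ioc 0 T, ‖c t k‖ₑ ≤ ∫⁻ t in Ioc 0 T, wnorm 0 (c t) := fun k =>
    lintegral_mono fun t => enorm_le_wnorm_zero (c t) k
  have hF : ∀ k, Integrable (fun p : ℝ × ℝ => c p.1 k * expo k p.2 * (ψ p : ℂ)) (cylinder T) :=
    fun k => integrable_mode_mul ⟨(hc k).aestronglyMeasurable, (hle k).trans_lt h⟩ hψ k
  have hbd : ∀ k, ∫⁻ p, ‖c p.1 k * expo k p.2 * (ψ p : ℂ)‖ₑ ∂(cylinder T)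
      ≤ M * torus univ * ∫⁻ t in Ioc 0 T, ‖c t k‖ₑ := by
    intro k
    rw [mul_assoc, ← lintegral_cylinder_fst (hc k).enorm,
      ← lintegral_const_mul _ (show Measurable fun p : ℝ × ℝ => ‖c p.1 k‖ₑ from
        (hc k).enorm.comp measurable_fst)]
    refine lintegral_mono_ae ?_
    filter_upwards [hM] with p hp
    rw [enorm_mul, enorm_mul, enorm_expo, mul_one, mul_comm]
    gcongr
    simpa [enorm_eq_nnnorm] using hp
  have hsum : ∑' k, ∫⁻ p, ‖c p.1 k * expo k p.2 * (ψ p : ℂ)‖ₑ ∂(cylinder T) ≠ ⊤ := by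
    refine ne_top_of_le_ne_top ?_ (ENNReal.tsum_le_tsum hbd)
    rw [ENNReal.tsum_mul_left, ← lintegral_tsum fun k => (hc k).enorm.aemeasurable]
    simp only [wnorm_zero_eq] at h
    exact ENNReal.mul_ne_top (ENNReal.mul_ne_top ENNReal.coe_ne_top (measure_ne_top _ _)) h.ne
  have := hasSum_integral_of_summable_integral_norm hF (by
    simp only [integral_norm_eq_lintegral_enorm (hF _).aestronglyMeasurable]
    exact ENNReal.summable_toReal hsum)
  simpa only [trig, tsum_mul_right] using this

/-- Integration by parts in time, for a primitive of an integrable function. -/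
lemma integral_primitive_mul_deriv {T : ℝ} {r φ φ' : ℝ → ℂ} (hr : IntegrableOn r (Ioc 0 T))
    (hφ : ∀ t, HasDerivAt φ (φ' t) t) (hφ' : Continuous φ') :
    ∫ t in Ioc 0 T, (∫ s in Ioc 0 t, r s) * φ' t = ∫ s in Ioc 0 T, r s * (φ T - φ s) := by
  have hint : Integrable (fun p : ℝ × ℝ => (if p.2 ≤ p.1 then φ' p.1 * r p.2 else 0))
      ((volume.restrict (Ioc 0 T)).prod (volume.restrict (Ioc 0 T))) := by
    have h1 : Integrable (fun p : ℝ × ℝ => φ' p.1 * r p.2)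
        ((volume.restrict (Ioc 0 T)).prod (volume.restrict (Ioc 0 T))) :=
      ((hφ'.continuousOn.integrableOn_compact isCompact_Icc).mono_set Ioc_subset_Icc_self
        |>.integrable).mul_prod hr.integrable
    exact h1.indicator (measurableSet_le measurable_snd measurable_fst)
  have hswap := integral_integral_swap (f := fun t s => if s ≤ t then φ' t * r s else 0) hint
  have hl : ∫ t in Ioc 0 T, ∫ s in Ioc 0 T, (if s ≤ t then φ' t * r s else 0)
      = ∫ t in Ioc 0 T, (∫ s in Ioc 0 t, r s) * φ' t := by
    refine setIntegral_congr_fun measurableSet_Ioc fun t ht => ?_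
    have : ∀ s, (if s ≤ t then φ' t * r s else 0) = (Iic t).indicator (fun s => φ' t * r s) s :=
      fun s => by simp [indicator]
    simp only [this]
    rw [integral_indicator measurableSet_Iic, Measure.restrict_restrict measurableSet_Iic,
      integral_const_mul, mul_comm]
    congr 3
    ext s; simp only [mem_inter_iff, mem_Iic, mem_Ioc]
    exact ⟨fun h => ⟨h.2.1, h.1⟩, fun h => ⟨h.2, h.1, h.2.trans ht.2⟩⟩
  have hr' : ∫ s in Ioc 0 T, ∫ t in Ioc 0 T, (if s ≤ t then φ' t * r s else 0)
      = ∫ s in Ioc 0 T, r s * (φ T - φ s) := by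
    refine setIntegral_congr_fun measurableSet_Ioc fun s hs => ?_
    have : ∀ t, (if s ≤ t then φ' t * r s else 0) = (Ici s).indicator (fun t => φ' t * r s) t :=
      fun s => by simp [indicator]
    simp only [this]
    have hset : Ici s ∩ Ioc 0 T = Icc s T := by
      ext t; simp only [mem_inter_iff, mem_Ici, mem_Ioc, mem_Icc]
      exact ⟨fun h => ⟨h.1, h.2.2⟩, fun h => ⟨h.1, hs.1.trans_le h.1, h.2⟩⟩
    rw [integral_indicator measurableSet_Ici, Measure.restrict_restrict measurableSet_Ici, hset,
      integral_mul_const, integral_Icc_eq_integral_Ioc, ← intervalIntegral.integral_of_le hs.2,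
      intervalIntegral.integral_eq_sub_of_hasDerivAt (fun t _ => hφ t)
        (hφ'.intervalIntegrable _ _), mul_comm]
  rw [← hl, hswap, hr']

lemma integral_torus_expo_mul_deriv {φ φ' : ℝ → ℝ} (hφ : ∀ x, HasDerivAt φ (φ' x) x)
    (hφ' : Continuous φ') (hp : Function.Periodic φ (2 * Real.pi)) (k : ℤ) :
    ∫ x, expo k x * (φ' x : ℂ) ∂torus = -(Complex.I * k) * ∫ x, expo k x * (φ x : ℂ) ∂torus := by
  rw [integral_torus, integral_torus]
  have h := intervalIntegral.integral_mul_deriv_eq_deriv_mul (a := -Real.pi) (b := Real.pi)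
    (u := expo k) (v := fun x => (φ x : ℂ)) (u' := fun x => Complex.I * k * expo k x)
    (v' := fun x => (φ' x : ℂ)) (fun x _ => hasDerivAt_expo k x)
    (fun x _ => (hφ x).ofReal_comp)
    ((continuous_const.mul (continuous_expo k)).intervalIntegrable _ _)
    ((Complex.continuous_ofReal.comp hφ').intervalIntegrable _ _)
  have e1 : expo k Real.pi = expo k (-Real.pi) := by
    rw [← expo_periodic k (-Real.pi)]; congr 1; ring
  have e2 : φ Real.pi = φ (-Real.pi) := by
    rw [← hp (-Real.pi)]; congr 1; ring
  rw [h, e1, e2, sub_self, zero_sub, ← intervalIntegral.integral_const_mul,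
    ← intervalIntegral.integral_neg]
  refine intervalIntegral.integral_congr fun x _ => ?_
  ring

/-- The weak formulation for a trigonometric series whose coefficients satisfy
`∂ₜ a = -ik j` in integrated form. -/
lemma weakIdentity_retrig {T : ℝ} (hT : 0 ≤ T) {u₀ : ℝ → ℝ} {a₀ : ℤ → ℂ} (ha₀ : wnorm 0 a₀ < ⊤)
    (hA₀ : Herm a₀) (hu₀ : u₀ =ᵐ[torus] retrig a₀) {a j : ℝ → ℤ → ℂ}
    (ham : ∀ k, Measurable fun t => a t k) (hjm : ∀ k, Measurable fun t => j t k)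
    (hA : ∀ t, Herm (a t)) (hJ : ∀ t, Herm (j t))
    (ha : ∫⁻ t in Ioc 0 T, wnorm 0 (a t) < ⊤) (hj : ∫⁻ t in Ioc 0 T, wnorm 0 (j t) < ⊤)
    (h : ∀ k, ∀ t ∈ Ioc 0 T, a t k = a₀ k + ∫ s in Ioc 0 t, -(Complex.I * k) * j s k) :
    WeakIdentity T u₀ (fun t => retrig (a t)) (fun t => retrig (j t)) := by
  rintro φ ⟨hφ, hper, T', hT', hφ0⟩
  have hφT : ∀ x, φ (T, x) = 0 := fun x => hφ0 T x hT'.le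
  simp only [(hasDerivAt_fst hφ _ _).deriv, (hasDerivAt_snd hφ _ _).deriv, Prod.mk.eta]
  have hφc := hφ.continuous
  have s1 := hasSum_integral_trig_mul ham ha (continuous_fderiv_apply hφ (1, 0))
  have s2 := hasSum_integral_trig_mul hjm hj (continuous_fderiv_apply hφ (0, 1))
  have hjint : ∀ k, IntegrableOn (fun t => j t k) (Ioc 0 T) := fun k =>
    ⟨(hjm k).aestronglyMeasurable,
      (lintegral_mono fun t => enorm_le_wnorm_zero (j t) k).trans_lt hj⟩
  have haint : ∀ k, IntegrableOn (fun t => a t k) (Ioc 0 T) := fun k =>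
    ⟨(ham k).aestronglyMeasurable,
      (lintegral_mono fun t => enorm_le_wnorm_zero (a t) k).trans_lt ha⟩
  -- the initial term
  have s0 : HasSum (fun k => ∫ x, a₀ k * expo k x * (φ (0, x) : ℂ) ∂torus)
      (∫ x, trig a₀ x * (φ (0, x) : ℂ) ∂torus) := by
    have hc0 : Continuous fun x => (φ (0, x) : ℂ) := by fun_prop
    obtain ⟨M, hM⟩ := (isCompact_Icc (a := -Real.pi) (b := Real.pi)).exists_bound_of_continuousOn
      hc0.continuousOn
    have hM' : ∀ᵐ x ∂torus, ‖(φ (0, x) : ℂ)‖ ≤ M := by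
      rw [torus]
      filter_upwards [ae_restrict_mem measurableSet_Ioc] with x hx using hM x (Ioc_subset_Icc_self hx)
    have := hasSum_integral_of_dominated_convergence (μ := torus)
      (F := fun k x => a₀ k * expo k x * (φ (0, x) : ℂ))
      (f := fun x => trig a₀ x * (φ (0, x) : ℂ)) (fun k _ => ‖a₀ k‖ * M)
      (fun k => ((continuous_const.mul (continuous_expo k)).mul hc0).aestronglyMeasurable)
      (fun k => by
        filter_upwards [hM'] with x hx
        rw [norm_mul, norm_mul, norm_expo, mul_one]
        gcongr)
      (ae_of_all _ fun x => (summable_norm_of_wnorm ha₀).mul_right M)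
      (integrable_const _)
      (ae_of_all _ fun x => (hasSum_trig ha₀ x).mul_right _)
    exact this
  -- the identity for one mode
  have hmode : ∀ k, -(∫ x, a₀ k * expo k x * (φ (0, x) : ℂ) ∂torus)
      - ∫ p, a p.1 k * expo k p.2 * (fderiv ℝ φ p (1, 0) : ℂ) ∂(cylinder T)
      = ∫ p, j p.1 k * expo k p.2 * (fderiv ℝ φ p (0, 1) : ℂ) ∂(cylinder T) := by
    intro k
    have i1 := integrable_mode_mul (haint k) (continuous_fderiv_apply hφ (1, 0)) k
    have i2 := integrable_mode_mul (hjint k) (continuous_fderiv_apply hφ (0, 1)) k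
    have i3 := integrable_mode_mul ((hjint k).const_mul (-(Complex.I * k))) hφc k
    have e2 : ∫ p, j p.1 k * expo k p.2 * (fderiv ℝ φ p (0, 1) : ℂ) ∂(cylinder T)
        = ∫ p, -(Complex.I * k) * j p.1 k * expo k p.2 * (φ p : ℂ) ∂(cylinder T) := by
      rw [cylinder, integral_prod _ i2, integral_prod _ i3]
      refine integral_congr_ae (ae_of_all _ fun t => ?_)
      simp only [mul_assoc, integral_const_mul]
      rw [integral_torus_expo_mul_deriv (φ := fun x => φ (t, x)) (fun x => hasDerivAt_snd hφ t x)
        ((continuous_fderiv_apply hφ (0, 1)).comp (by fun_prop)) (hper t)]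
      ring
    have e1 : ∫ p, a p.1 k * expo k p.2 * (fderiv ℝ φ p (1, 0) : ℂ) ∂(cylinder T)
        = ∫ x, (-(a₀ k * expo k x * (φ (0, x) : ℂ))
          - ∫ t in Ioc 0 T, -(Complex.I * k) * j t k * expo k x * (φ (t, x) : ℂ)) ∂torus := by
      rw [cylinder, integral_prod_symm _ i1]
      refine integral_congr_ae (ae_of_all _ fun x => ?_)
      have hd : ∀ t, HasDerivAt (fun t => (φ (t, x) : ℂ)) (fderiv ℝ φ (t, x) (1, 0) : ℂ) t :=
        fun t => (hasDerivAt_fst hφ t x).ofReal_comp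
      have hdc : Continuous fun t => (fderiv ℝ φ (t, x) (1, 0) : ℂ) :=
        Complex.continuous_ofReal.comp ((continuous_fderiv_apply hφ (1, 0)).comp (by fun_prop))
      have hri : IntegrableOn (fun s => -(Complex.I * k) * j s k) (Ioc 0 T) :=
        (hjint k).const_mul _
      have hpr := integral_primitive_mul_deriv hri hd hdc
      have hdi : IntegrableOn (fun t => (fderiv ℝ φ (t, x) (1, 0) : ℂ)) (Ioc 0 T) :=
        (hdc.continuousOn.integrableOn_compact isCompact_Icc).mono_set Ioc_subset_Icc_self
      have hprim : ∀ t ∈ Ioc 0 T, a t k * expo k x * (fderiv ℝ φ (t, x) (1, 0) : ℂ)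
          = expo k x * (a₀ k * (fderiv ℝ φ (t, x) (1, 0) : ℂ))
            + expo k x * ((∫ s in Ioc 0 t, -(Complex.I * k) * j s k)
              * (fderiv ℝ φ (t, x) (1, 0) : ℂ)) := fun t ht => by
        rw [h k t ht]; ring
      have hai : IntegrableOn (fun t => (∫ s in Ioc 0 t, -(Complex.I * k) * j s k)
              * (fderiv ℝ φ (t, x) (1, 0) : ℂ)) (Ioc 0 T) := by
        obtain ⟨M, hM⟩ := (isCompact_Icc (a := (0 : ℝ)) (b := T)).exists_bound_of_continuousOn
          hdc.continuousOn
        have h1 : IntegrableOn (fun t => (a t k - a₀ k) * (fderiv ℝ φ (t, x) (1, 0) : ℂ))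
            (Ioc 0 T) :=
          ((haint k).sub (integrableOn_const (by simp))).mul_bdd (c := M)
            hdc.aestronglyMeasurable (by
              filter_upwards [ae_restrict_mem measurableSet_Ioc] with t ht
                using hM t (Ioc_subset_Icc_self ht))
        refine h1.congr_fun (fun t ht => ?_) measurableSet_Ioc
        simp only [h k t ht]; ring
      dsimp only
      rw [setIntegral_congr_fun measurableSet_Ioc hprim, integral_add
        ((hdi.const_mul _).const_mul _) (hai.const_mul _), integral_const_mul, integral_const_mul,
        integral_const_mul, hpr, ← intervalIntegral.integral_of_le hT,
        intervalIntegral.integral_eq_sub_of_hasDerivAt (fun t _ => hd t)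
          (hdc.intervalIntegrable _ _), hφT x]
      simp only [Complex.ofReal_zero, zero_sub, mul_neg, integral_neg, ← integral_const_mul]
      rw [← sub_eq_add_neg]
      congr 1
      · ring
      · refine setIntegral_congr_fun measurableSet_Ioc fun t _ => ?_
        ring
    have i4 : Integrable (fun x => ∫ t in Ioc 0 T, -(Complex.I * k) * j t k * expo k x
        * (φ (t, x) : ℂ)) torus := i3.integral_prod_right
    have i5 : Integrable (fun x => -(a₀ k * expo k x * (φ (0, x) : ℂ))) torus :=
      integrable_of_continuous_torus
        ((continuous_const.mul (continuous_expo k)).mul (by fun_prop)).neg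
    rw [e1, e2, integral_sub i5 i4, integral_neg, cylinder, integral_prod_symm _ i3]
    ring
  have hfin := s2.unique (by simpa only [← hmode] using s0.neg.sub s1)
  have e0 : ∫ x, u₀ x * φ (0, x) ∂torus = ∫ x, retrig a₀ x * φ (0, x) ∂torus :=
    integral_congr_ae (by filter_upwards [hu₀] with x hx; rw [hx])
  rw [e0]
  simp only [← ofReal_retrig hA₀, ← ofReal_retrig (hA _), ← ofReal_retrig (hJ _),
    ← Complex.ofReal_mul, integral_complex_ofReal] at hfin
  exact_mod_cast hfin.symm

/-! ### The constructed solution -/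

/-- Fourier coefficients of the velocity `α ∂ₓ³f + β ∂ₓ³g - γ ∂ₓf - δ ∂ₓg`. -/
def vel (α β γ δ : ℝ) (a b : ℤ → ℂ) (k : ℤ) : ℂ := -Complex.I * sym α β γ δ a b k

lemma flux_vel (m α β γ δ : ℝ) (p a b : ℤ → ℂ) (k : ℤ) :
    flux m p (vel α β γ δ a b) k = -Complex.I * flux m p (sym α β γ δ a b) k := by
  have : conv p (vel α β γ δ a b) k = -Complex.I * conv p (sym α β γ δ a b) k := by
    rw [conv, conv, ← tsum_mul_left]
    exact tsum_congr fun j => by rw [vel]; ring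
  rw [flux, flux, this, vel]; ring

lemma rhs_eq_flux_vel (m α β γ δ : ℝ) (p a b : ℤ → ℂ) (k : ℤ) :
    rhs m α β γ δ p a b k = -(Complex.I * k) * flux m p (vel α β γ δ a b) k := by
  rw [flux_vel, rhs_eq_flux]
  linear_combination (-(k : ℂ) * flux m p (sym α β γ δ a b) k) * Complex.I_mul_I

lemma herm_vel {a b : ℤ → ℂ} (hA : Herm a) (hB : Herm b) (α β γ δ : ℝ) :
    Herm (vel α β γ δ a b) := fun k => by
  rw [vel, vel, herm_sym hA hB, map_mul, map_neg, Complex.conj_I]; ring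

lemma herm_flux {p v : ℤ → ℂ} (hp : Herm p) (hv : Herm v) (m : ℝ) : Herm (flux m p v) := fun k => by
  rw [flux, flux, hv k, herm_conv hp hv k, map_add, map_mul, Complex.conj_ofReal]

lemma wnorm_vel (n : ℕ) (α β γ δ : ℝ) (a b : ℤ → ℂ) :
    wnorm n (vel α β γ δ a b) = wnorm n (sym α β γ δ a b) := by
  have := wnorm_const_mul n (-Complex.I) (sym α β γ δ a b)
  rw [enorm_neg, ← ofReal_norm, Complex.norm_I, ENNReal.ofReal_one, one_mul] at this
  exact this

lemma wnorm_vel_lt_top {α β γ δ : ℝ} {a b : ℤ → ℂ} (ha : a 0 = 0) (hb : b 0 = 0) {n : ℕ}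
    (hn : n ≤ 1) (ha4 : wnorm 4 a < ⊤) (hb4 : wnorm 4 b < ⊤) : wnorm n (vel α β γ δ a b) < ⊤ := by
  rw [wnorm_vel]
  refine (wnorm_sym_le n α β γ δ ha hb).trans_lt (ENNReal.mul_lt_top (symC_ne_top _ _ _ _).lt_top
    (ENNReal.add_lt_top.2 ⟨(wnorm_le_wnorm ha (by omega)).trans_lt ha4,
      (wnorm_le_wnorm hb (by omega)).trans_lt hb4⟩))

lemma retrig_vel {α β γ δ : ℝ} {a b : ℤ → ℂ} (ha : a 0 = 0) (hb : b 0 = 0)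
    (ha4 : wnorm 4 a < ⊤) (hb4 : wnorm 4 b < ⊤) (x : ℝ) :
    retrig (vel α β γ δ a b) x = α * retrig (dseq 3 a) x + β * retrig (dseq 3 b) x
      - γ * retrig (dseq 1 a) x - δ * retrig (dseq 1 b) x := by
  have h : ∀ (r : ℝ) (n : ℕ) {c : ℤ → ℂ}, c 0 = 0 → wnorm 4 c < ⊤ → n ≤ 4 →
      wnorm 0 (fun k => (r : ℂ) * dseq n c k) < ⊤ := by
    intro r n c hc h4 hn
    rw [wnorm_const_mul, wnorm_dseq, zero_add]
    exact ENNReal.mul_lt_top (by simp [enorm_eq_nnnorm]) ((wnorm_le_wnorm hc hn).trans_lt h4)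
  have e : vel α β γ δ a b = fun k => (((α : ℂ) * dseq 3 a k + (β : ℂ) * dseq 3 b k)
      - (γ : ℂ) * dseq 1 a k) - (δ : ℂ) * dseq 1 b k := by
    ext k
    simp only [vel, sym, dseq, mulpow, mul_pow, Complex.I_pow_three, pow_one]
    ring
  have h1 := h α 3 ha ha4 (by norm_num)
  have h2 := h β 3 hb hb4 (by norm_num)
  have h3 := h γ 1 ha ha4 (by norm_num)
  have h4 := h δ 1 hb hb4 (by norm_num)
  have h12 := (wnorm_add_le 0 _ _).trans_lt (ENNReal.add_lt_top.2 ⟨h1, h2⟩)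
  have h123 := (wnorm_sub_le 0 _ _).trans_lt (ENNReal.add_lt_top.2 ⟨h12, h3⟩)
  rw [e, retrig_sub h123 h4, retrig_sub h12 h3, retrig_add h1 h2, retrig_const_mul,
    retrig_const_mul, retrig_const_mul, retrig_const_mul]

lemma retrig_flux {m : ℝ} {p v : ℤ → ℂ} (hP : Herm p) (hV : Herm v) (hp : wnorm 0 p < ⊤)
    (hv : wnorm 0 v < ⊤) (x : ℝ) :
    retrig (flux m p v) x = (retrig p x + m) * retrig v x := by
  have h1 : wnorm 0 (fun k => (m : ℂ) * v k) < ⊤ := by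
    rw [wnorm_const_mul]
    exact ENNReal.mul_lt_top (by simp [enorm_eq_nnnorm]) hv
  have h2 : wnorm 0 (conv p v) < ⊤ :=
    (wnorm_conv_le p v).trans_lt (ENNReal.mul_lt_top hp hv)
  have e : flux m p v = fun k => (m : ℂ) * v k + conv p v k := rfl
  rw [e, retrig_add h1 h2, retrig_const_mul, ← retrig_mul_retrig hp hv hP hV]
  ring

lemma wnorm_flux_le (m : ℝ) (p v : ℤ → ℂ) :
    wnorm 0 (flux m p v) ≤ (‖m‖ₑ + wnorm 0 p) * wnorm 0 v := by
  rw [add_mul]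
  refine (wnorm_add_le 0 (fun k => (m : ℂ) * v k) (conv p v)).trans
    (add_le_add ?_ (wnorm_conv_le p v))
  rw [wnorm_const_mul]
  gcongr
  simp [enorm_eq_nnnorm]

lemma WeakIdentity.congr {T : ℝ} {u₀ : ℝ → ℝ} {u J J' : ℝ → ℝ → ℝ} (h : WeakIdentity T u₀ u J)
    (hJ : (fun p : ℝ × ℝ => J p.1 p.2) =ᵐ[cylinder T] fun p => J' p.1 p.2) :
    WeakIdentity T u₀ u J' := by
  intro φ hφ
  rw [h φ hφ]
  refine integral_congr_ae ?_
  filter_upwards [hJ] with p hp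
  rw [hp]

lemma mean_retrig {a : ℤ → ℂ} (hA : Herm a) (ha : wnorm 0 a < ⊤) (h0 : a 0 = 0) :
    mean (retrig a) = 0 := by
  have := fourierC_zero (retrig a)
  rw [fourierC_retrig hA ha, h0] at this
  exact_mod_cast this.symm

lemma isSpaceDeriv_retrig {T : ℝ} {a : ℝ → ℤ → ℂ} (ham : ∀ k, Measurable fun t => a t k)
    (h0 : ∀ t, a t 0 = 0) (h4 : ∫⁻ t in Ioc 0 T, wnorm 4 (a t) < ⊤) {n : ℕ} (hn : n ≤ 4) :
    IsSpaceDeriv T n (fun t => retrig (a t)) (fun t => retrig (dseq n (a t))) := by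
  have hle : ∀ t, wnorm n (a t) ≤ wnorm 4 (a t) := fun t => wnorm_le_wnorm (h0 t) hn
  refine ⟨integrable_retrig (measurable_dseq ham n) ?_, ?_⟩
  · simp only [wnorm_dseq, zero_add]
    exact (lintegral_mono hle).trans_lt h4
  · filter_upwards [ae_lt_top (measurable_wnorm ham 4) h4.ne] with t ht
    exact isWeakDeriv_retrig n ((wnorm_le_wnorm (h0 t) (by norm_num)).trans_lt ht)
      ((hle t).trans_lt ht)

lemma measurable_vel {a b : ℝ → ℤ → ℂ} (ha : ∀ k, Measurable fun t => a t k)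
    (hb : ∀ k, Measurable fun t => b t k) (α β γ δ : ℝ) (k : ℤ) :
    Measurable fun t => vel α β γ δ (a t) (b t) k :=
  (measurable_sym ha hb α β γ δ k).const_mul _

/-- One equation of the system, passing from Fourier coefficients to the weak formulation. -/
lemma weakIdentity_of_modes {T : ℝ} (hT : 0 ≤ T) {u₀ : ℝ → ℝ} {c₀ : ℤ → ℂ} (hc₀ : wnorm 0 c₀ < ⊤)
    (hC₀ : Herm c₀) (hu₀ : u₀ =ᵐ[torus] retrig c₀) {p a b : ℝ → ℤ → ℂ} {m α β γ δ : ℝ} {E : ℝ≥0}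
    (hpm : ∀ k, Measurable fun t => p t k) (ham : ∀ k, Measurable fun t => a t k)
    (hbm : ∀ k, Measurable fun t => b t k) (hP : ∀ t, Herm (p t)) (hA : ∀ t, Herm (a t))
    (hB : ∀ t, Herm (b t)) (ha0 : ∀ t, a t 0 = 0) (hb0 : ∀ t, b t 0 = 0)
    (hp : ∀ t, wnorm 0 (p t) ≤ E)
    (h4 : ∫⁻ t in Ioc 0 T, (wnorm 4 (a t) + wnorm 4 (b t)) < ⊤)
    (h : ∀ k, ∀ t ∈ Ioc 0 T, p t k = c₀ k
      + ∫ s in Ioc 0 t, rhs m α β γ δ (p s) (a s) (b s) k) :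
    Integrable (fun z : ℝ × ℝ => (retrig (p z.1) z.2 + m) * (α * retrig (dseq 3 (a z.1)) z.2
      + β * retrig (dseq 3 (b z.1)) z.2 - γ * retrig (dseq 1 (a z.1)) z.2
      - δ * retrig (dseq 1 (b z.1)) z.2)) (cylinder T) ∧
    WeakIdentity T u₀ (fun t => retrig (p t)) (fun t x => (retrig (p t) x + m)
      * (α * retrig (dseq 3 (a t)) x + β * retrig (dseq 3 (b t)) x - γ * retrig (dseq 1 (a t)) x
        - δ * retrig (dseq 1 (b t)) x)) := by
  have hwm : Measurable fun t => wnorm 4 (a t) + wnorm 4 (b t) :=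
    (measurable_wnorm ham 4).add (measurable_wnorm hbm 4)
  have hjm : ∀ k, Measurable fun t => flux m (p t) (vel α β γ δ (a t) (b t)) k :=
    measurable_flux hpm (measurable_vel ham hbm α β γ δ) m
  have hj : ∫⁻ t in Ioc 0 T, wnorm 0 (flux m (p t) (vel α β γ δ (a t) (b t))) < ⊤ := by
    refine lt_of_le_of_lt (b := ∫⁻ t in Ioc 0 T, (‖m‖ₑ + E) * symC α β γ δ
      * (wnorm 4 (a t) + wnorm 4 (b t))) (lintegral_mono fun t => ?_) ?_
    · refine (wnorm_flux_le _ _ _).trans ?_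
      rw [mul_assoc, wnorm_vel]
      gcongr
      · exact hp t
      · refine (wnorm_sym_le 0 α β γ δ (ha0 t) (hb0 t)).trans ?_
        gcongr
        · exact wnorm_le_wnorm (ha0 t) (by omega)
        · exact wnorm_le_wnorm (hb0 t) (by omega)
    · rw [lintegral_const_mul _ hwm]
      exact ENNReal.mul_lt_top (ENNReal.mul_lt_top (by finiteness) (symC_ne_top _ _ _ _).lt_top) h4
  have hpi : ∫⁻ t in Ioc 0 T, wnorm 0 (p t) < ⊤ := by
    refine (lintegral_mono hp).trans_lt ?_
    rw [lintegral_const]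
    exact ENNReal.mul_lt_top ENNReal.coe_lt_top (measure_lt_top _ _)
  have hae : (fun z : ℝ × ℝ => retrig (flux m (p z.1) (vel α β γ δ (a z.1) (b z.1))) z.2)
      =ᵐ[cylinder T] fun z => (retrig (p z.1) z.2 + m) * (α * retrig (dseq 3 (a z.1)) z.2
      + β * retrig (dseq 3 (b z.1)) z.2 - γ * retrig (dseq 1 (a z.1)) z.2
      - δ * retrig (dseq 1 (b z.1)) z.2) := by
    filter_upwards [ae_cylinder (ae_lt_top hwm h4.ne)] with z hz
    obtain ⟨hza, hzb⟩ := ENNReal.add_lt_top.1 hz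
    rw [retrig_flux (hP _) (herm_vel (hA _) (hB _) _ _ _ _) ((hp _).trans_lt ENNReal.coe_lt_top)
      (wnorm_vel_lt_top (ha0 _) (hb0 _) (by norm_num) hza hzb), retrig_vel (ha0 _) (hb0 _) hza hzb]
  refine ⟨(integrable_retrig hjm hj).congr hae, ?_⟩
  refine WeakIdentity.congr (weakIdentity_retrig hT hc₀ hC₀ hu₀ hpm hjm hP
    (fun t => herm_flux (hP t) (herm_vel (hA t) (hB t) _ _ _ _) m) hpi hj fun k t ht => ?_) hae
  rw [h k t ht]
  simp only [rhs_eq_flux_vel]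

lemma hasRegularity_retrig {T : ℝ} {a : ℝ → ℤ → ℂ} {E : ℝ≥0} (hA : ∀ t, Herm (a t))
    (ham : ∀ k, Measurable fun t => a t k) (h0 : ∀ t, a t 0 = 0) (hE : ∀ t, wnorm 0 (a t) ≤ E)
    (h4 : ∫⁻ t in Ioc 0 T, wnorm 4 (a t) < ⊤) : HasRegularity T (fun t => retrig (a t)) := by
  have hlt : ∀ t, wnorm 0 (a t) < ⊤ := fun t => (hE t).trans_lt ENNReal.coe_lt_top
  have hK : ∀ p : ℝ≥0∞, torus univ ^ p.toReal⁻¹ * 2 ≠ ⊤ := fun p =>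
    ENNReal.mul_ne_top (torus_rpow_ne_top p) (by simp)
  have hsob : ∀ (n : ℕ) (p : ℝ≥0∞), n ≤ 4 → ∀ c : ℤ → ℂ, c 0 = 0 → wnorm 4 c < ⊤ →
      sobolevNorm n p (retrig c) ≤ torus univ ^ p.toReal⁻¹ * 2 * wnorm n c :=
    fun n p hn c hc h => sobolevNorm_retrig_le n p hc ((wnorm_le_wnorm hc hn).trans_lt h)
  refine ⟨?_, ?_, fun α hα => ?_, ?_, ?_, ?_⟩
  · refine memLp_top_of_bound (aestronglyMeasurable_retrig ham (ae_of_all _ hlt)) E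
      (ae_of_all _ fun p => ?_)
    rw [Real.norm_eq_abs]
    exact (abs_retrig_le (hlt _) _).trans (ENNReal.toReal_mono ENNReal.coe_ne_top (hE _))
  · exact memBochner_retrig (m := 3) (hK ⊤) (by norm_num) (by norm_num) (by norm_num)
      (hsob 3 ⊤ (by norm_num)) ham h0 (fun t _ => hE t) h4
  · exact memBochner_retrig (m := 4) (K := 6) (by simp) (by norm_num) (by norm_num) (by norm_num)
      (fun c hc h => holderNorm_retrig_le α (hα.le.trans (by
        rw [div_le_one (by norm_num)]; norm_num)) hc h) ham h0 (fun t _ => hE t) h4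
  · refine memMeasures_retrig (hK ⊤) (hsob 4 ⊤ le_rfl) ham h0 ?_
    rwa [setLIntegral_congr Ioc_ae_eq_Icc.symm]
  · exact memBochner_retrig (m := 2) (hK 2) (by norm_num) (by norm_num) (by norm_num)
      (hsob 2 2 (by norm_num)) ham h0 (fun t _ => hE t) h4
  · exact ae_of_all _ fun t => mean_retrig (hA t) (hlt t) (h0 t)

section

variable {P : Params} {mf mg : ℝ} {E : ℝ≥0} {a₀ b₀ : ℤ → ℂ} {a b : ℝ → ℤ → ℂ}

lemma ModeSolution.boundA (h : ModeSolution P mf mg E a₀ b₀ a b) (t : ℝ) : wnorm 0 (a t) ≤ E := by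
  simpa using le_self_add.trans (h.bound t)

lemma ModeSolution.boundB (h : ModeSolution P mf mg E a₀ b₀ a b) (t : ℝ) : wnorm 0 (b t) ≤ E := by
  simpa using le_add_self.trans (h.bound t)

lemma ModeSolution.isWeakSolution (h : ModeSolution P mf mg E a₀ b₀ a b) {f₀ g₀ : ℝ → ℝ}
    (ha₀ : wnorm 0 a₀ < ⊤) (hb₀ : wnorm 0 b₀ < ⊤) (hA₀ : Herm a₀) (hB₀ : Herm b₀)
    (hf₀ : f₀ =ᵐ[torus] retrig a₀) (hg₀ : g₀ =ᵐ[torus] retrig b₀) {T : ℝ} (hT : 0 < T) :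
    IsWeakSolution P mf mg f₀ g₀ T (fun t => retrig (a t)) (fun t => retrig (b t)) := by
  have h4 := (h.dissipation T).trans_lt ENNReal.ofReal_lt_top
  have h4a : ∫⁻ t in Ioc 0 T, wnorm 4 (a t) < ⊤ := (lintegral_mono fun t => le_self_add).trans_lt h4
  have h4b : ∫⁻ t in Ioc 0 T, wnorm 4 (b t) < ⊤ := (lintegral_mono fun t => le_add_self).trans_lt h4
  have hfin : ∀ c : ℝ → ℤ → ℂ, (∀ t, wnorm 0 (c t) ≤ E) → ∫⁻ t in Ioc 0 T, wnorm 0 (c t) < ⊤ := by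
    intro c hc
    refine (lintegral_mono hc).trans_lt ?_
    rw [lintegral_const]
    exact ENNReal.mul_lt_top ENNReal.coe_lt_top (measure_lt_top _ _)
  have hJ := weakIdentity_of_modes hT.le ha₀ hA₀ hf₀ h.measA h.measA h.measB h.hermA h.hermA h.hermB
    h.zeroA h.zeroB h.boundA h4 fun k t ht => h.eqA k t ht.1.le
  have hK := weakIdentity_of_modes hT.le hb₀ hB₀ hg₀ h.measB h.measA h.measB h.hermB h.hermA h.hermB
    h.zeroA h.zeroB h.boundB h4 fun k t ht => h.eqB k t ht.1.le
  refine ⟨integrable_retrig h.measA (hfin a h.boundA), integrable_retrig h.measB (hfin b h.boundB),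
    ae_of_all _ fun t => ⟨mean_retrig (h.hermA t) ((h.boundA t).trans_lt ENNReal.coe_lt_top)
      (h.zeroA t), mean_retrig (h.hermB t) ((h.boundB t).trans_lt ENNReal.coe_lt_top) (h.zeroB t)⟩,
    _, _, _, _, _, _,
    isSpaceDeriv_retrig h.measA h.zeroA h4a (n := 1) (by norm_num),
    isSpaceDeriv_retrig h.measA h.zeroA h4a (n := 3) (by norm_num),
    isSpaceDeriv_retrig h.measB h.zeroB h4b (n := 1) (by norm_num),
    isSpaceDeriv_retrig h.measB h.zeroB h4b (n := 3) (by norm_num), rfl, rfl,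
    hJ.1, hK.1, hJ.2, hK.2⟩

lemma ModeSolution.eLpNorm_le (h : ModeSolution P mf mg E a₀ b₀ a b) {T : ℝ} (hT : 0 ≤ T) :
    eLpNorm (retrig (a T)) ⊤ torus + eLpNorm (retrig (b T)) ⊤ torus
      ≤ ENNReal.ofReal (E * Real.exp (-(P.δA mf mg E + P.δb mf mg E) * T)) := by
  have key : ∀ c : ℤ → ℂ, eLpNorm (retrig c) ⊤ torus ≤ wnorm 0 c := fun c => by
    rw [eLpNorm_exponent_top]
    exact essSup_le_of_ae_le _ (ae_of_all _ fun x => enorm_retrig_le c x)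
  exact (add_le_add (key _) (key _)).trans (h.decay T hT)

end

/-! ### Chain rule and Gronwall inequality for absolutely continuous functions -/

/-- A `C¹` function is Lipschitz on the compact range of an absolutely continuous one. -/
lemma absolutelyContinuous_comp {f β β' : ℝ → ℝ} {a b : ℝ}
    (hf : AbsolutelyContinuousOnInterval f a b) (hβ : ∀ x, HasDerivAt β (β' x) x)
    (hβ' : Continuous β') : AbsolutelyContinuousOnInterval (fun t => β (f t)) a b := by
  obtain ⟨B, hB⟩ := hf.exists_bound
  obtain ⟨K, hK⟩ := (isCompact_Icc (a := -B) (b := B)).exists_bound_of_continuousOn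
    hβ'.continuousOn
  have hL : LipschitzOnWith K.toNNReal β (Icc (-B) B) :=
    (convex_Icc _ _).lipschitzOnWith_of_nnnorm_hasDerivWithin_le (f' := β')
      (fun x _ => (hβ x).hasDerivWithinAt) fun x hx => by
        rw [← NNReal.coe_le_coe, coe_nnnorm]
        exact (hK x hx).trans (Real.le_coe_toNNReal K)
  have hmem : ∀ t ∈ uIcc a b, f t ∈ Icc (-B) B := fun t ht => abs_le.1 (hB t ht)
  rw [absolutelyContinuousOnInterval_iff] at hf ⊢
  intro ε hε
  obtain ⟨η, hη, h⟩ := hf (ε / (K.toNNReal + 1)) (by positivity)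
  refine ⟨η, hη, fun I hI hIη => ?_⟩
  have h1 := h I hI hIη
  rw [lt_div_iff₀ (by positivity)] at h1
  refine lt_of_le_of_lt ?_ h1
  rw [Finset.sum_mul]
  refine Finset.sum_le_sum fun i hi => ?_
  have h2 := hL.dist_le_mul _ (hmem _ (hI.1 i hi).1) _ (hmem _ (hI.1 i hi).2)
  have h3 : 0 ≤ dist (f (I.2 i).1) (f (I.2 i).2) := dist_nonneg
  linarith

lemma absolutelyContinuous_primitive {w : ℝ → ℝ} {T : ℝ} (hT : 0 ≤ T)
    (hw : IntegrableOn w (Ioc 0 T)) (r₀ : ℝ) :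
    AbsolutelyContinuousOnInterval (fun t => r₀ + ∫ s in (0 : ℝ)..t, w s) 0 T ∧
    ∀ᵐ t, t ∈ uIcc 0 T → HasDerivAt (fun t => r₀ + ∫ s in (0 : ℝ)..t, w s) (w t) t := by
  have hi : IntervalIntegrable w volume 0 T := (intervalIntegrable_iff_integrableOn_Ioc_of_le hT).2 hw
  refine ⟨(LipschitzOnWith.absolutelyContinuousOnInterval
    ((LipschitzWith.const r₀).lipschitzOnWith)).add
    (hi.absolutelyContinuousOnInterval_intervalIntegral left_mem_uIcc), ?_⟩
  filter_upwards [hi.ae_hasDerivAt_integral] with t ht htm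
  exact (ht htm 0 left_mem_uIcc).const_add r₀

/-- The chain rule for a primitive of an integrable function. -/
lemma comp_primitive {w β β' : ℝ → ℝ} {T : ℝ} (hw : IntegrableOn w (Ioc 0 T)) (r₀ : ℝ)
    (hβ : ∀ x, HasDerivAt β (β' x) x) (hβ' : Continuous β') {t : ℝ} (ht : t ∈ Icc 0 T) :
    β (r₀ + ∫ s in Ioc 0 t, w s)
      = β r₀ + ∫ s in Ioc 0 t, β' (r₀ + ∫ u in Ioc 0 s, w u) * w s := by
  obtain ⟨hac, hd⟩ := absolutelyContinuous_primitive ht.1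
    (hw.mono_set (Ioc_subset_Ioc_right ht.2)) r₀
  have h := (absolutelyContinuous_comp hac hβ hβ').integral_deriv_eq_sub
  have hcongr : ∫ s in (0 : ℝ)..t, deriv (fun t => β (r₀ + ∫ s in (0 : ℝ)..t, w s)) s
      = ∫ s in Ioc 0 t, β' (r₀ + ∫ u in Ioc 0 s, w u) * w s := by
    rw [intervalIntegral.integral_of_le ht.1]
    refine setIntegral_congr_ae measurableSet_Ioc ?_
    filter_upwards [hd] with s hs hsm
    rw [← intervalIntegral.integral_of_le hsm.1.le]
    have hs' := hs (by rw [uIcc_of_le ht.1]; exact Ioc_subset_Icc_self hsm)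
    exact ((hβ _).comp s hs').deriv
  rw [hcongr, intervalIntegral.integral_same, add_zero, intervalIntegral.integral_of_le ht.1] at h
  linarith

/-- Gronwall's inequality with an integrable coefficient. -/
lemma gronwall_primitive {φ k y : ℝ → ℝ} {T : ℝ} (hφ : IntegrableOn φ (Ioc 0 T))
    (hk : IntegrableOn k (Ioc 0 T)) (hy : ∀ t ∈ Icc 0 T, y t = ∫ s in Ioc 0 t, φ s)
    (h : ∀ᵐ s ∂(volume.restrict (Ioc 0 T)), φ s ≤ k s * y s) :
    ∀ t ∈ Icc 0 T, y t ≤ 0 := by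
  intro t ht
  obtain ⟨hyac, hyd⟩ := absolutelyContinuous_primitive ht.1
    (hφ.mono_set (Ioc_subset_Ioc_right ht.2)) 0
  obtain ⟨hkac, hkd⟩ := absolutelyContinuous_primitive ht.1
    (hk.mono_set (Ioc_subset_Ioc_right ht.2)) 0
  have heac := absolutelyContinuous_comp hkac (β := fun x => Real.exp (-x))
    (β' := fun x => -Real.exp (-x)) (fun x => by simpa using (hasDerivAt_neg x).exp)
    (by fun_prop)
  -- `y exp(-∫ k)` is absolutely continuous with nonpositive derivative
  have hF := (hyac.mul heac).integral_deriv_eq_sub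
  have hle : ∫ s in (0 : ℝ)..t, deriv ((fun t => 0 + ∫ s in (0 : ℝ)..t, φ s)
      * fun t => Real.exp (-(0 + ∫ s in (0 : ℝ)..t, k s))) s ≤ 0 := by
    rw [intervalIntegral.integral_of_le ht.1]
    refine setIntegral_nonpos_of_ae_restrict ?_
    have hsub : ∀ᵐ s ∂(volume.restrict (Ioc 0 t)), φ s ≤ k s * y s :=
      ae_restrict_of_ae_restrict_of_subset (Ioc_subset_Ioc_right ht.2) h
    filter_upwards [hsub, ae_restrict_of_ae hyd, ae_restrict_of_ae hkd,
      ae_restrict_mem measurableSet_Ioc] with s hs hys hks hsm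
    have hsm' : s ∈ uIcc 0 t := by rw [uIcc_of_le ht.1]; exact Ioc_subset_Icc_self hsm
    have hd := (hys hsm').mul ((hks hsm').neg.exp)
    have e : y s = 0 + ∫ u in (0 : ℝ)..s, φ u := by
      rw [zero_add, intervalIntegral.integral_of_le hsm.1.le, hy s ⟨hsm.1.le, hsm.2.trans ht.2⟩]
    have hd' := hd.deriv
    rw [← e] at hd'
    refine le_trans (le_of_eq hd') ?_
    have hexp := Real.exp_pos (-(0 + ∫ u in (0 : ℝ)..s, k u))
    have := mul_nonneg (sub_nonneg.2 hs) hexp.le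
    simp only [Pi.zero_apply, Pi.neg_apply]
    linarith
  rw [hF] at hle
  simp only [Pi.mul_apply, intervalIntegral.integral_same, zero_add, zero_mul, sub_zero] at hle
  rw [hy t ht, ← intervalIntegral.integral_of_le ht.1]
  by_contra hpos
  push Not at hpos
  exact absurd hle (not_le.2 (mul_pos hpos (Real.exp_pos _)))

lemma cylinder_mono {s t : ℝ} (h : s ≤ t) : cylinder s ≤ cylinder t := by
  rw [cylinder, cylinder]
  exact Measure.prod_mono (Measure.restrict_mono (Ioc_subset_Ioc_right h) le_rfl) le_rfl

/-- The chain rule of `comp_primitive`, integrated over the torus. -/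
lemma integral_comp_primitive {T : ℝ} {w : ℝ → ℝ → ℝ} {R₀ β β' : ℝ → ℝ}
    (hw : Integrable (fun p : ℝ × ℝ => w p.1 p.2) (cylinder T))
    (hβ : ∀ x, HasDerivAt β (β' x) x) (hβ' : Continuous β')
    (hβ0 : Integrable (fun x => β (R₀ x)) torus)
    (hβw : Integrable (fun p : ℝ × ℝ => β' (R₀ p.2 + ∫ u in Ioc 0 p.1, w u p.2) * w p.1 p.2)
      (cylinder T)) {t : ℝ} (ht : t ∈ Icc 0 T) :
    Integrable (fun x => β (R₀ x + ∫ u in Ioc 0 t, w u x)) torus ∧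
    ∫ x, β (R₀ x + ∫ u in Ioc 0 t, w u x) ∂torus = ∫ x, β (R₀ x) ∂torus
      + ∫ s in Ioc 0 t, ∫ x, β' (R₀ x + ∫ u in Ioc 0 s, w u x) * w s x ∂torus := by
  have hwx : ∀ᵐ x ∂torus, IntegrableOn (fun s => w s x) (Ioc 0 T) := hw.prod_left_ae
  have hint := hβw.mono_measure (cylinder_mono ht.2)
  have hae : (fun x => β (R₀ x + ∫ u in Ioc 0 t, w u x)) =ᵐ[torus] fun x => β (R₀ x)
      + ∫ s in Ioc 0 t, β' (R₀ x + ∫ u in Ioc 0 s, w u x) * w s x := by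
    filter_upwards [hwx] with x hx
    exact comp_primitive hx (R₀ x) hβ hβ' ht
  have hI : Integrable (fun x => ∫ s in Ioc 0 t, β' (R₀ x + ∫ u in Ioc 0 s, w u x) * w s x) torus :=
    hint.integral_prod_right
  refine ⟨(hβ0.add hI).congr hae.symm, ?_⟩
  rw [integral_congr_ae hae, integral_add hβ0 hI]
  congr 1
  rw [cylinder] at hint
  exact (integral_integral_swap hint).symm

/-! ### The primitive of a transported density -/

lemma fourierC_add {u v : ℝ → ℝ} (hu : Integrable u torus) (hv : Integrable v torus) (k : ℤ) :
    fourierC (fun x => u x + v x) k = fourierC u k + fourierC v k := by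
  have h := fourierC_sub (hu.add hv) hv k
  simp only [Pi.add_apply, add_sub_cancel_right] at h
  rw [h]
  exact (sub_add_cancel _ _).symm

lemma fourierC_const {k : ℤ} (hk : k ≠ 0) (c : ℝ) : fourierC (fun _ => c) k = 0 := by
  rw [fourierC_eq, integral_mul_const, integral_expo, if_neg (neg_ne_zero.2 hk), zero_mul, smul_zero]

lemma mean_fluct {u : ℝ → ℝ} (hu : Integrable u torus) : mean (fluct u) = 0 := by
  have hpi := Real.pi_pos
  unfold fluct
  rw [mean, integral_sub hu (integrable_const _), integral_torus_const]
  simp only [mean]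
  field_simp
  ring

lemma fourierC_fluct {u : ℝ → ℝ} (hu : Integrable u torus) {k : ℤ} (hk : k ≠ 0) :
    fourierC (fluct u) k = fourierC u k := by
  unfold fluct
  rw [fourierC_sub hu (integrable_const _), fourierC_const hk, sub_zero]

lemma fourierC_integral {t : ℝ} {w : ℝ → ℝ → ℝ}
    (hw : Integrable (fun p : ℝ × ℝ => w p.1 p.2) (cylinder t)) (k : ℤ) :
    fourierC (fun x => ∫ s in Ioc 0 t, w s x) k = ∫ s in Ioc 0 t, fourierC (w s) k := by
  simp only [fourierC_eq, ← integral_complex_ofReal, ← integral_const_mul]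
  rw [integral_smul]
  congr 1
  have hi : Integrable (fun p : ℝ × ℝ => expo (-k) p.2 * (w p.1 p.2 : ℂ)) (cylinder t) := by
    refine Integrable.bdd_mul (c := 1) hw.ofReal
      ((continuous_expo (-k)).comp continuous_snd).aestronglyMeasurable ?_
    exact ae_of_all _ fun p => (norm_expo _ _).le
  exact (integral_integral_swap hi).symm

/-- Joint measurability of the primitive in time, as a parametric integral of a product with the
indicator of `{u ≤ t}`. -/
lemma aestronglyMeasurable_primitive {T : ℝ} {w : ℝ → ℝ → ℝ}
    (hw : Integrable (fun p : ℝ × ℝ => w p.1 p.2) (cylinder T)) :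
    AEStronglyMeasurable (fun p : ℝ × ℝ => ∫ u in Ioc 0 p.1, w u p.2) (cylinder T) := by
  have hq : Measure.QuasiMeasurePreserving (fun q : (ℝ × ℝ) × ℝ => (q.2, q.1.2))
      ((cylinder T).prod (volume.restrict (Ioc 0 T))) (cylinder T) := by
    have h1 : Measure.QuasiMeasurePreserving (fun q : (ℝ × ℝ) × ℝ => (q.1.1, (q.1.2, q.2)))
        ((cylinder T).prod (volume.restrict (Ioc 0 T)))
        ((volume.restrict (Ioc 0 T)).prod (torus.prod (volume.restrict (Ioc 0 T)))) :=
      (measurePreserving_prodAssoc _ _ _).quasiMeasurePreserving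
    have h2 := (Measure.quasiMeasurePreserving_snd
      (μ := volume.restrict (Ioc 0 T)) (ν := torus.prod (volume.restrict (Ioc 0 T)))).comp h1
    exact (Measure.measurePreserving_swap
      (μ := torus) (ν := volume.restrict (Ioc 0 T))).quasiMeasurePreserving.comp h2
  have hF := hw.aestronglyMeasurable.comp_quasiMeasurePreserving hq
  have hset : MeasurableSet {q : (ℝ × ℝ) × ℝ | q.2 ≤ q.1.1} :=
    measurableSet_le measurable_snd (measurable_fst.comp measurable_fst)
  have hG := (hF.indicator hset).integral_prod_right'
  refine hG.congr ?_
  filter_upwards [ae_cylinder (ae_restrict_mem (measurableSet_Ioc (a := (0 : ℝ)) (b := T)))] with p hp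
  have : ∀ u, {q : (ℝ × ℝ) × ℝ | q.2 ≤ q.1.1}.indicator
      ((fun p : ℝ × ℝ => w p.1 p.2) ∘ fun q : (ℝ × ℝ) × ℝ => (q.2, q.1.2)) (p, u)
      = (Iic p.1).indicator (fun u => w u p.2) u := fun u => by
    simp [indicator]
  simp only [this]
  rw [integral_indicator measurableSet_Iic, Measure.restrict_restrict measurableSet_Iic]
  congr 2
  ext u; simp only [mem_inter_iff, mem_Iic, mem_Ioc]
  exact ⟨fun h => ⟨h.2.1, h.1⟩, fun h => ⟨h.2, h.1, h.2.trans hp.2⟩⟩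

/-- Fourier coefficients of the zero-mean primitive. -/
def prim (a : ℤ → ℂ) (k : ℤ) : ℂ := a k / (Complex.I * k)

lemma herm_prim {a : ℤ → ℂ} (hA : Herm a) : Herm (prim a) := fun k => by
  simp [prim, hA k, div_neg]

lemma dseq_prim {a : ℤ → ℂ} (h0 : a 0 = 0) : dseq 1 (prim a) = a := by
  ext k
  rcases eq_or_ne k 0 with rfl | hk
  · simp [dseq, h0]
  · have : (k : ℂ) ≠ 0 := by exact_mod_cast hk
    rw [dseq, prim, pow_one, mul_div_cancel₀ _ (mul_ne_zero Complex.I_ne_zero this)]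

lemma prim_zero (a : ℤ → ℂ) : prim a 0 = 0 := by simp [prim]

lemma wnorm_prim {a : ℤ → ℂ} (h0 : a 0 = 0) (n : ℕ) : wnorm (n + 1) (prim a) = wnorm n a := by
  rw [← wnorm_dseq, dseq_prim h0]

lemma wnorm_zero_prim_le {a : ℤ → ℂ} (h0 : a 0 = 0) : wnorm 0 (prim a) ≤ wnorm 0 a := by
  rw [← wnorm_prim h0 0]
  exact wnorm_le_wnorm (prim_zero a) (Nat.zero_le _)

lemma hasDerivAt_retrig_prim {a : ℤ → ℂ} (h0 : a 0 = 0) (ha : wnorm 0 a < ⊤) (x : ℝ) :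
    HasDerivAt (retrig (prim a)) (retrig a x) x := by
  have := hasDerivAt_retrig ((wnorm_zero_prim_le h0).trans_lt ha)
    (by rwa [wnorm_prim h0 0]) x
  rwa [dseq_prim h0] at this

/-- The series with coefficients `a` is a distributional solution of `∂ₜ f + ∂ₓ((f + m) V) = 0` on
`(0,T)`, with initial datum `a₀`, where `V` is the series with coefficients `v`. The equation is
stated for the Fourier coefficients, integrated in time. -/
structure Transported (T m : ℝ) (a₀ : ℤ → ℂ) (a v : ℝ → ℤ → ℂ) : Prop where
  herm_init : Herm a₀
  zero_init : a₀ 0 = 0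
  fin_init : wnorm 0 a₀ < ⊤
  herm : ∀ t, Herm (a t)
  zero : ∀ t, a t 0 = 0
  meas : ∀ k, Measurable fun t => a t k
  vel_meas : ∀ k, Measurable fun t => v t k
  fin : ∫⁻ t in Ioc 0 T, wnorm 1 (a t) < ⊤
  vel_fin : ∫⁻ t in Ioc 0 T, wnorm 0 (v t) < ⊤
  vel_fin_one : ∫⁻ t in Ioc 0 T, wnorm 1 (v t) < ⊤
  flux_int : Integrable (fun p : ℝ × ℝ => (retrig (a p.1) p.2 + m) * retrig (v p.1) p.2) (cylinder T)
  eq : ∀ k, ∀ᵐ t ∂(volume.restrict (Ioc 0 T)), a t k = a₀ k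
    - (Complex.I * k) * ∫ s in Ioc 0 t, fourierC (fun x => (retrig (a s) x + m) * retrig (v s) x) k

/-- The zero-mean part of the flux. -/
def fluxDev (m : ℝ) (a v : ℝ → ℤ → ℂ) (s : ℝ) : ℝ → ℝ :=
  fluct fun x => (retrig (a s) x + m) * retrig (v s) x

section

variable {T m : ℝ} {a₀ : ℤ → ℂ} {a v : ℝ → ℤ → ℂ}

lemma Transported.integrable_mean (h : Transported T m a₀ a v) :
    IntegrableOn (fun s => mean fun x => (retrig (a s) x + m) * retrig (v s) x) (Ioc 0 T) :=
  (h.flux_int.integral_prod_left).const_mul _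

lemma Transported.integrable_fluxDev (h : Transported T m a₀ a v) :
    Integrable (fun p : ℝ × ℝ => fluxDev m a v p.1 p.2) (cylinder T) :=
  h.flux_int.sub (h.integrable_mean.integrable.comp_fst torus)

lemma Transported.ae_fin (h : Transported T m a₀ a v) :
    ∀ᵐ t ∂(volume.restrict (Ioc 0 T)), wnorm 0 (a t) < ⊤ ∧ wnorm 1 (a t) < ⊤
      ∧ wnorm 0 (v t) < ⊤ ∧ wnorm 1 (v t) < ⊤ := by
  filter_upwards [ae_lt_top (measurable_wnorm h.meas 1) h.fin.ne,
    ae_lt_top (measurable_wnorm h.vel_meas 0) h.vel_fin.ne,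
    ae_lt_top (measurable_wnorm h.vel_meas 1) h.vel_fin_one.ne] with t h1 h2 h3
  exact ⟨(wnorm_le_wnorm (h.zero t) (by norm_num)).trans_lt h1, h1, h2, h3⟩

/-- The primitive in space is, at almost every time, a primitive in time of the flux. -/
lemma Transported.ae_eq_prim (h : Transported T m a₀ a v) :
    ∀ᵐ t ∂(volume.restrict (Ioc 0 T)), (fun x => retrig (prim a₀) x
      + ∫ s in Ioc 0 t, -fluxDev m a v s x) =ᵐ[torus] retrig (prim (a t)) := by
  filter_upwards [h.ae_fin, ae_all_iff.2 h.eq, ae_restrict_mem measurableSet_Ioc]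
    with t hfin ht htm
  have hP0 : wnorm 0 (prim a₀) < ⊤ := (wnorm_zero_prim_le h.zero_init).trans_lt h.fin_init
  have hint : Integrable (fun p : ℝ × ℝ => -fluxDev m a v p.1 p.2) (cylinder t) :=
    h.integrable_fluxDev.neg.mono_measure (cylinder_mono htm.2)
  have hfl : Integrable (fun p : ℝ × ℝ => (retrig (a p.1) p.2 + m) * retrig (v p.1) p.2)
      (cylinder t) := h.flux_int.mono_measure (cylinder_mono htm.2)
  have hI0 : Integrable (retrig (prim a₀)) torus :=
    integrable_of_continuous_torus (continuous_retrig hP0)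
  have hI1 : Integrable (fun x => ∫ s in Ioc 0 t, -fluxDev m a v s x) torus :=
    hint.integral_prod_right
  refine ae_eq_retrig (hI0.add hI1) (fun k => ?_)
    ((wnorm_zero_prim_le (h.zero t)).trans_lt hfin.1)
  have hadd := fourierC_add hI0 hI1 k
  refine hadd.trans ?_
  rw [fourierC_integral hint, fourierC_retrig (herm_prim h.herm_init) hP0]
  have hs : ∀ᵐ s ∂(volume.restrict (Ioc 0 t)), Integrable
      (fun x => (retrig (a s) x + m) * retrig (v s) x) torus := hfl.prod_right_ae
  have hneg : ∀ (u : ℝ → ℝ), fourierC (fun x => -u x) k = -fourierC u k := fun u => by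
    simp only [fourierC_eq, Complex.ofReal_neg, mul_neg, integral_neg, smul_neg]
  rcases eq_or_ne k 0 with rfl | hk
  · rw [prim_zero, prim_zero, zero_add]
    refine integral_eq_zero_of_ae ?_
    filter_upwards [hs] with s hs
    simp only [hneg, fourierC_zero, fluxDev, mean_fluct hs]
    simp
  · have hk' : Complex.I * (k : ℂ) ≠ 0 :=
      mul_ne_zero Complex.I_ne_zero (by exact_mod_cast hk)
    have e : ∫ s in Ioc 0 t, fourierC (fun x => -fluxDev m a v s x) k
        = -∫ s in Ioc 0 t, fourierC (fun x => (retrig (a s) x + m) * retrig (v s) x) k := by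
      rw [← integral_neg]
      refine integral_congr_ae ?_
      filter_upwards [hs] with s hs
      rw [hneg, fluxDev, fourierC_fluct hs hk]
    rw [e, prim, prim, ht k]
    field_simp
    ring

end

/-! ### A maximum principle for the primitive -/

/-- A `C¹` function that vanishes exactly on the nonpositive reals and has a derivative with values
in `[0, 1]`. -/
def ramp (x : ℝ) : ℝ := ∫ s in (0 : ℝ)..x, min 1 (max s 0)

lemma continuous_ramp' : Continuous fun x : ℝ => min 1 (max x 0) := by fun_prop

lemma hasDerivAt_ramp (x : ℝ) : HasDerivAt ramp (min 1 (max x 0)) x :=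
  intervalIntegral.integral_hasDerivAt_right (continuous_ramp'.intervalIntegrable _ _)
    continuous_ramp'.stronglyMeasurable.stronglyMeasurableAtFilter continuous_ramp'.continuousAt

lemma ramp'_nonneg (x : ℝ) : 0 ≤ min 1 (max x 0) := le_min zero_le_one (le_max_right _ _)

lemma ramp_of_nonpos {x : ℝ} (hx : x ≤ 0) : ramp x = 0 := by
  rw [ramp]
  refine intervalIntegral.integral_zero_ae (ae_of_all _ fun _ hs => ?_)
  rw [uIoc_of_ge hx] at hs
  rw [max_eq_right hs.2]; norm_num

lemma ramp_pos {x : ℝ} (hx : 0 < x) : 0 < ramp x :=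
  intervalIntegral.intervalIntegral_pos_of_pos_on (continuous_ramp'.intervalIntegrable _ _)
    (fun _ hs => lt_min one_pos (lt_max_of_lt_left hs.1)) hx

lemma ramp_nonneg (x : ℝ) : 0 ≤ ramp x := by
  rcases le_or_gt x 0 with h | h
  · exact (ramp_of_nonpos h).ge
  · exact (ramp_pos h).le

lemma integrableOn_toReal_wnorm {T : ℝ} {a : ℝ → ℤ → ℂ} (ha : ∀ k, Measurable fun t => a t k)
    {n : ℕ} (h : ∫⁻ t in Ioc 0 T, wnorm n (a t) < ⊤) :
    IntegrableOn (fun t => (wnorm n (a t)).toReal) (Ioc 0 T) :=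
  integrable_toReal_of_lintegral_ne_top (measurable_wnorm ha n).aemeasurable h.ne

/-- Transport of a periodic function composed with a `C¹` function costs the divergence of the
velocity. -/
lemma integral_comp_mul_deriv_le {β β' W f V V' : ℝ → ℝ} {K : ℝ} (hβ : ∀ x, HasDerivAt β (β' x) x)
    (hβ' : Continuous β') (hβ0 : ∀ x, 0 ≤ β x) (hW : ∀ x, HasDerivAt W (f x) x)
    (hV : ∀ x, HasDerivAt V (V' x) x) (hf : Continuous f) (hV' : Continuous V')
    (pW : Function.Periodic W (2 * Real.pi)) (pV : Function.Periodic V (2 * Real.pi))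
    (hK : ∀ x, |V' x| ≤ K) :
    -∫ x, β' (W x) * f x * V x ∂torus ≤ K * ∫ x, β (W x) ∂torus := by
  have hWc : Continuous W := continuous_iff_continuousAt.2 fun x => (hW x).continuousAt
  have hβc : Continuous β := continuous_iff_continuousAt.2 fun x => (hβ x).continuousAt
  have h := integral_torus_mul_deriv (u := V) (v := fun x => β (W x)) hV
    (fun x => (hβ (W x)).comp x (hW x)) hV' ((hβ'.comp hWc).mul hf) pV
    (fun x => by simp only [pW x])
  have e : ∫ x, β' (W x) * f x * V x ∂torus = ∫ x, V x * (β' (W x) * f x) ∂torus :=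
    integral_congr_ae (ae_of_all _ fun x => mul_comm _ _)
  rw [e, h, neg_neg, ← integral_const_mul]
  refine integral_mono (integrable_of_continuous_torus (hV'.mul (hβc.comp hWc)))
    (integrable_of_continuous_torus (continuous_const.mul (hβc.comp hWc))) fun x => ?_
  exact mul_le_mul_of_nonneg_right ((le_abs_self _).trans (hK x)) (hβ0 _)

section

variable {T m : ℝ} {a₀ : ℤ → ℂ} {a v : ℝ → ℤ → ℂ}

/-- The one-sided bound: `σ` times the primitive stays below an explicit function of time, because
it is a subsolution of a transport equation after subtracting that function. -/
lemma Transported.prim_le (h : Transported T m a₀ a v) {σ : ℝ} (hσ : |σ| = 1) :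
    ∃ B : ℝ, ∀ᵐ t ∂(volume.restrict (Ioc 0 T)), ∀ᵐ x ∂torus,
      σ * retrig (prim (a t)) x ≤ B := by
  set c : ℝ → ℝ := fun s => mean fun x => (retrig (a s) x + m) * retrig (v s) x with hc
  -- `κ` dominates the terms without sign in the equation for `σ` times the primitive, so that
  -- `R = σ * primitive - B₀ - ∫ κ` stays nonpositive; this is seen from `∫ ramp R = 0`
  set κ : ℝ → ℝ := fun s => |c s| + |m| * (wnorm 0 (v s)).toReal with hκ
  set B₀ : ℝ := (wnorm 0 (prim a₀)).toReal with hB₀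
  set R₀ : ℝ → ℝ := fun x => σ * retrig (prim a₀) x - B₀ with hR₀
  set w : ℝ → ℝ → ℝ := fun s x => -σ * fluxDev m a v s x - κ s with hw
  set R : ℝ → ℝ → ℝ := fun t x => R₀ x + ∫ u in Ioc 0 t, w u x with hR
  have hP0 : wnorm 0 (prim a₀) < ⊤ := (wnorm_zero_prim_le h.zero_init).trans_lt h.fin_init
  have hκi : IntegrableOn κ (Ioc 0 T) :=
    h.integrable_mean.abs.add ((integrableOn_toReal_wnorm h.vel_meas h.vel_fin).const_mul _)
  have hκ0 : ∀ s, 0 ≤ κ s := fun s => by positivity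
  have hwi : Integrable (fun p : ℝ × ℝ => w p.1 p.2) (cylinder T) :=
    (h.integrable_fluxDev.const_mul _).sub (hκi.integrable.comp_fst torus)
  have hR₀c : Continuous R₀ := (continuous_const.mul (continuous_retrig hP0)).sub continuous_const
  have hR₀n : ∀ x, R₀ x ≤ 0 := fun x => by
    have h1 := abs_retrig_le hP0 x
    have h2 : σ * retrig (prim a₀) x ≤ |retrig (prim a₀) x| := by
      refine (le_abs_self _).trans ?_
      rw [abs_mul, hσ, one_mul]
    simp only [hR₀, hB₀]; linarith
  have hRm : AEStronglyMeasurable (fun p : ℝ × ℝ => R p.1 p.2) (cylinder T) :=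
    (hR₀c.comp continuous_snd).aestronglyMeasurable.add (aestronglyMeasurable_primitive hwi)
  have hβw : Integrable (fun p : ℝ × ℝ => min 1 (max (R p.1 p.2) 0) * w p.1 p.2) (cylinder T) := by
    refine hwi.bdd_mul (c := 1) (continuous_ramp'.comp_aestronglyMeasurable hRm) ?_
    refine ae_of_all _ fun p => ?_
    rw [Real.norm_eq_abs, abs_of_nonneg (ramp'_nonneg _)]
    exact min_le_left _ _
  have hβ0 : Integrable (fun x => ramp (R₀ x)) torus := by
    simp only [ramp_of_nonpos (hR₀n _)]
    exact integrable_const _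
  have hen := fun t (ht : t ∈ Icc 0 T) =>
    integral_comp_primitive hwi hasDerivAt_ramp continuous_ramp' hβ0 hβw ht
  have hzero : ∫ x, ramp (R₀ x) ∂torus = 0 := by
    simp [ramp_of_nonpos (hR₀n _)]
  -- the spatial form of the evolving function
  have hRU : ∀ᵐ t ∂(volume.restrict (Ioc 0 T)), (fun x => R t x) =ᵐ[torus]
      fun x => σ * retrig (prim (a t)) x - (B₀ + ∫ s in Ioc 0 t, κ s) := by
    filter_upwards [h.ae_eq_prim, ae_restrict_mem measurableSet_Ioc] with t ht htm
    have hfx : ∀ᵐ x ∂torus, IntegrableOn (fun s => fluxDev m a v s x) (Ioc 0 t) :=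
      (h.integrable_fluxDev.mono_measure (cylinder_mono htm.2)).prod_left_ae
    filter_upwards [ht, hfx] with x hx hfx
    rw [← hx]
    simp only [hR, hw, hR₀]
    rw [integral_sub (hfx.const_mul _) (hκi.mono_set (Ioc_subset_Ioc_right htm.2)),
      integral_const_mul, integral_neg]
    ring
  have hgr := gronwall_primitive (φ := fun s => ∫ x, min 1 (max (R s x) 0) * w s x ∂torus)
    (k := fun s => (wnorm 1 (v s)).toReal) (y := fun t => ∫ x, ramp (R t x) ∂torus) (T := T)
    hβw.integral_prod_left (integrableOn_toReal_wnorm h.vel_meas h.vel_fin_one)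
    (fun t ht => by rw [(hen t ht).2, hzero, zero_add]) (by
      filter_upwards [hRU, h.ae_fin, hwi.prod_right_ae, hβw.prod_right_ae]
        with s hs hfin hws hβs
      set M := B₀ + ∫ u in Ioc 0 s, κ u with hM
      set W : ℝ → ℝ := fun x => σ * retrig (prim (a s)) x - M with hW
      have hWd : ∀ x, HasDerivAt W (σ * retrig (a s) x) x := fun x =>
        ((hasDerivAt_retrig_prim (h.zero s) hfin.1 x).const_mul σ).sub_const M
      have hWc : Continuous W := continuous_iff_continuousAt.2 fun x => (hWd x).continuousAt
      have hVd := hasDerivAt_retrig hfin.2.2.1 hfin.2.2.2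
      have hfc := continuous_retrig hfin.1
      have hVc := continuous_retrig hfin.2.2.1
      have hV1 : wnorm 0 (dseq 1 (v s)) < ⊤ := by rw [wnorm_dseq]; exact hfin.2.2.2
      have h1 := integral_comp_mul_deriv_le (W := W) (f := fun x => σ * retrig (a s) x)
        (V := retrig (v s)) (K := (wnorm 1 (v s)).toReal) hasDerivAt_ramp continuous_ramp' ramp_nonneg
        hWd hVd (continuous_const.mul hfc) (continuous_retrig hV1)
        (fun x => by simp only [hW, retrig_periodic (prim (a s)) x]) (retrig_periodic _)
        (fun x => by have := abs_retrig_le hV1 x; rwa [wnorm_dseq] at this)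
      have h2 : ∫ x, ramp (R s x) ∂torus = ∫ x, ramp (W x) ∂torus :=
        integral_congr_ae (by filter_upwards [hs] with x hx; rw [hx])
      rw [h2]
      refine le_trans ?_ h1
      rw [← integral_neg]
      refine integral_mono_ae hβs (integrable_of_continuous_torus
        (((continuous_ramp'.comp hWc).mul (continuous_const.mul hfc)).mul hVc).neg) ?_
      filter_upwards [hs] with x hx
      rw [hx]
      have hb := ramp'_nonneg (W x)
      have hle : w s x ≤ -(σ * retrig (a s) x * retrig (v s) x) := by
        have e : w s x = -(σ * retrig (a s) x * retrig (v s) x) - σ * (m * retrig (v s) x)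
            + σ * c s - κ s := by
          simp only [hw, fluxDev, fluct, hc]; ring
        have h3 : -(σ * (m * retrig (v s) x)) ≤ |m| * (wnorm 0 (v s)).toReal := by
          refine (neg_le_abs _).trans ?_
          rw [abs_mul, hσ, one_mul, abs_mul]
          exact mul_le_mul_of_nonneg_left (abs_retrig_le hfin.2.2.1 x) (abs_nonneg _)
        have h4 : σ * c s ≤ |c s| := by
          refine (le_abs_self _).trans ?_
          rw [abs_mul, hσ, one_mul]
        rw [e]; simp only [hκ]; linarith
      have := mul_le_mul_of_nonneg_left hle hb
      linarith)
  refine ⟨B₀ + ∫ s in Ioc 0 T, κ s, ?_⟩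
  filter_upwards [hRU, h.ae_fin, ae_restrict_mem measurableSet_Ioc] with t ht hfin htm
  have htm' := Ioc_subset_Icc_self htm
  have hz : ∫ x, ramp (R t x) ∂torus = 0 :=
    le_antisymm (hgr t htm') (integral_nonneg fun x => ramp_nonneg _)
  filter_upwards [(integral_eq_zero_iff_of_nonneg (fun x => ramp_nonneg _) (hen t htm').1).1 hz,
    ht] with x hx hxt
  have hmono : ∫ s in Ioc 0 t, κ s ≤ ∫ s in Ioc 0 T, κ s :=
    setIntegral_mono_set hκi (ae_of_all _ hκ0) (Ioc_subset_Ioc_right htm.2).eventuallyLE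
  by_contra hlt
  push Not at hlt
  have hx' : ramp (R t x) = 0 := hx
  rw [hxt] at hx'
  exact absurd hx' (ramp_pos (by linarith)).ne'

lemma Transported.abs_prim_le (h : Transported T m a₀ a v) :
    ∃ B : ℝ, ∀ᵐ t ∂(volume.restrict (Ioc 0 T)), ∀ᵐ x ∂torus, |retrig (prim (a t)) x| ≤ B := by
  obtain ⟨B, hB⟩ := h.prim_le (σ := 1) (by simp)
  obtain ⟨B', hB'⟩ := h.prim_le (σ := -1) (by simp)
  refine ⟨max B B', ?_⟩
  filter_upwards [hB, hB'] with t ht ht'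
  filter_upwards [ht, ht'] with x hx hx'
  exact abs_le'.2 ⟨le_max_of_le_left (by linarith), le_max_of_le_right (by linarith)⟩

end

/-! ### Coercivity of the linearized system in `H⁻¹` -/

lemma young_le {θ x y S : ℝ} (hθ : 0 < θ) (hS : y ^ 2 ≤ S) : -(θ * S) - x ^ 2 / (4 * θ) ≤ x * y := by
  have h : x ^ 2 / (4 * θ) = θ * (x / (2 * θ)) ^ 2 := by field_simp; norm_num
  have h2 : x * y = 2 * θ * (x / (2 * θ)) * y := by field_simp
  rw [h, h2]
  nlinarith [mul_nonneg hθ.le (sq_nonneg (x / (2 * θ) + y)), mul_le_mul_of_nonneg_left hS hθ.le]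

/-- Pointwise coercivity. The principal part is a quadratic form in `(p', q')`, positive definite
because `F A < G A_μ < F A_γ`; everything else is absorbed by Young's inequality. -/
lemma coercive_pointwise {Aγ A Aμ bρ b bμ L c θ F F₁ F₂ G G₁ G₂ K₀ K₁ K₂ u w p q p₁ q₁ : ℝ}
    (hA : 0 ≤ A) (hF : 0 ≤ F) (h1 : 0 ≤ F * Aγ - G * Aμ) (h2 : 2 * c ≤ G * Aμ - F * A)
    (hc : 0 < c)
    (hθ : 16 * L ^ 2 * θ = c) (hLγ : |Aγ| ≤ L) (hLA : |A| ≤ L) (hLμ : |Aμ| ≤ L) (hLρ : |bρ| ≤ L)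
    (hLb : |b| ≤ L) (hLbμ : |bμ| ≤ L) (hF0 : |F| ≤ K₀) (hG0 : |G| ≤ K₀) (hF1 : |F₁| ≤ K₁)
    (hG1 : |G₁| ≤ K₁) (hF2 : |F₂| ≤ K₂) (hG2 : |G₂| ≤ K₂) :
    c / 4 * (p₁ ^ 2 + q₁ ^ 2) - K₁ ^ 2 / θ * (p ^ 2 + q ^ 2)
        - (K₂ ^ 2 + K₀ ^ 2) / (4 * θ) * (u ^ 2 + w ^ 2)
      ≤ (F * p₁ + 2 * F₁ * p + F₂ * u) * (Aγ * p₁ + A * q₁)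
        + (G * q₁ + 2 * G₁ * q + G₂ * w) * (Aμ * p₁ + Aμ * q₁)
        - u * F * (bρ * p₁ + b * q₁) - w * G * (bμ * p₁ + bμ * q₁) := by
  have hθ0 : 0 < θ := by
    by_contra hn
    push Not at hn
    nlinarith [mul_nonneg (sq_nonneg L) (neg_nonneg.2 hn)]
  set S := p₁ ^ 2 + q₁ ^ 2 with hS
  have hS0 : 0 ≤ S := by positivity
  have hz : ∀ α β : ℝ, |α| ≤ L → |β| ≤ L → (α * p₁ + β * q₁) ^ 2 ≤ 2 * L ^ 2 * S := by
    intro α β hα hβ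
    have ha : α ^ 2 ≤ L ^ 2 := sq_le_sq' (neg_le_of_abs_le hα) (le_of_abs_le hα)
    have hb : β ^ 2 ≤ L ^ 2 := sq_le_sq' (neg_le_of_abs_le hβ) (le_of_abs_le hβ)
    have := mul_le_mul_of_nonneg_right ha (sq_nonneg p₁)
    have := mul_le_mul_of_nonneg_right hb (sq_nonneg q₁)
    have := sq_nonneg (α * p₁ - β * q₁)
    rw [hS]
    nlinarith
  have hp : c * S ≤ F * p₁ * (Aγ * p₁ + A * q₁) + G * q₁ * (Aμ * p₁ + Aμ * q₁) := by
    have hFA := mul_nonneg hF hA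
    have hpq : -(S / 2) ≤ p₁ * q₁ := by rw [hS]; nlinarith [sq_nonneg (p₁ + q₁)]
    have h3 : 0 ≤ F * A + G * Aμ := by linarith
    have h4 := mul_le_mul_of_nonneg_left hpq h3
    have h5 := mul_le_mul_of_nonneg_right h1 (sq_nonneg p₁)
    have h6 := mul_le_mul_of_nonneg_right h2 hS0
    have e : F * p₁ * (Aγ * p₁ + A * q₁) + G * q₁ * (Aμ * p₁ + Aμ * q₁)
        = (F * Aγ - G * Aμ) * p₁ ^ 2 + G * Aμ * S + (F * A + G * Aμ) * (p₁ * q₁) := by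
      rw [hS]; ring
    rw [e]
    linarith
  have hK : ∀ {f K s : ℝ}, |f| ≤ K → (f * s) ^ 2 / (4 * θ) ≤ K ^ 2 * s ^ 2 / (4 * θ) := by
    intro f K s hf
    have hf2 : f ^ 2 ≤ K ^ 2 := sq_le_sq' (neg_le_of_abs_le hf) (le_of_abs_le hf)
    rw [mul_pow]
    gcongr
  have y1 := young_le (x := 2 * (F₁ * p)) hθ0 (hz Aγ A hLγ hLA)
  have y2 := young_le (x := F₂ * u) hθ0 (hz Aγ A hLγ hLA)
  have y3 := young_le (x := 2 * (G₁ * q)) hθ0 (hz Aμ Aμ hLμ hLμ)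
  have y4 := young_le (x := G₂ * w) hθ0 (hz Aμ Aμ hLμ hLμ)
  have y5 := young_le (x := F * -u) hθ0 (hz bρ b hLρ hLb)
  have y6 := young_le (x := G * -w) hθ0 (hz bμ bμ hLbμ hLbμ)
  have k1 := hK (s := 2 * p) hF1
  have k2 := hK (s := u) hF2
  have k3 := hK (s := 2 * q) hG1
  have k4 := hK (s := w) hG2
  have k5 := hK (s := -u) hF0
  have k6 := hK (s := -w) hG0
  have e1 : K₁ ^ 2 / θ * (p ^ 2 + q ^ 2)
      = K₁ ^ 2 * (2 * p) ^ 2 / (4 * θ) + K₁ ^ 2 * (2 * q) ^ 2 / (4 * θ) := by field_simp; ring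
  have e2 : (K₂ ^ 2 + K₀ ^ 2) / (4 * θ) * (u ^ 2 + w ^ 2)
      = K₂ ^ 2 * u ^ 2 / (4 * θ) + K₂ ^ 2 * w ^ 2 / (4 * θ)
        + (K₀ ^ 2 * (-u) ^ 2 / (4 * θ) + K₀ ^ 2 * (-w) ^ 2 / (4 * θ)) := by field_simp
  have e3 : θ * (2 * L ^ 2 * S) = c / 8 * S := by rw [← hθ]; ring
  have e4 : (2 * (F₁ * p)) ^ 2 = (F₁ * (2 * p)) ^ 2 := by ring
  have e5 : (2 * (G₁ * q)) ^ 2 = (G₁ * (2 * q)) ^ 2 := by ring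
  rw [e3] at y1 y2 y3 y4 y5 y6
  rw [e4] at y1
  rw [e5] at y3
  rw [e1, e2]
  linarith

lemma integral_torus_mul_deriv_two {Φ Φ' Φ'' z z' z'' : ℝ → ℝ} (h1 : ∀ x, HasDerivAt Φ (Φ' x) x)
    (h2 : ∀ x, HasDerivAt Φ' (Φ'' x) x) (h3 : ∀ x, HasDerivAt z (z' x) x)
    (h4 : ∀ x, HasDerivAt z' (z'' x) x) (hΦ : Continuous Φ'') (hz : Continuous z'')
    (p1 : Function.Periodic Φ (2 * Real.pi)) (p2 : Function.Periodic Φ' (2 * Real.pi))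
    (p3 : Function.Periodic z (2 * Real.pi)) (p4 : Function.Periodic z' (2 * Real.pi)) :
    ∫ x, Φ x * z'' x ∂torus = ∫ x, Φ'' x * z x ∂torus := by
  have hΦ' : Continuous Φ' := continuous_iff_continuousAt.2 fun x => (h2 x).continuousAt
  have hz' : Continuous z' := continuous_iff_continuousAt.2 fun x => (h4 x).continuousAt
  rw [integral_torus_mul_deriv h1 h4 hΦ' hz p1 p4, integral_torus_mul_deriv h2 h3 hΦ hz' p2 p3,
    neg_neg]

/-- The first `n` derivatives of a `2π`-periodic function. -/
structure PeriodicJet (n : ℕ) (D : ℕ → ℝ → ℝ) : Prop where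
  deriv : ∀ i < n, ∀ x, HasDerivAt (D i) (D (i + 1) x) x
  cont : Continuous (D n)
  per : ∀ i ≤ n, Function.Periodic (D i) (2 * Real.pi)

lemma PeriodicJet.continuous {n : ℕ} {D : ℕ → ℝ → ℝ} (h : PeriodicJet n D) {i : ℕ} (hi : i ≤ n) :
    Continuous (D i) := by
  rcases hi.lt_or_eq with hi | rfl
  · exact continuous_iff_continuousAt.2 fun x => (h.deriv i hi x).continuousAt
  · exact h.cont

/-- Coercivity in integrated form: `U, W` are jets of primitives of the differences of two
solutions, `F, G` are jets of the thicknesses of the two layers. -/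
lemma coercive_integral {Aγ A Aμ bρ b bμ L c θ K₀ K₁ K₂ : ℝ} {U W F G : ℕ → ℝ → ℝ}
    (hU : PeriodicJet 4 U) (hW : PeriodicJet 4 W) (hF : PeriodicJet 2 F) (hG : PeriodicJet 2 G)
    (hA : 0 ≤ A) (hF' : ∀ x, 0 ≤ F 0 x) (h1 : ∀ x, 0 ≤ F 0 x * Aγ - G 0 x * Aμ)
    (h2 : ∀ x, 2 * c ≤ G 0 x * Aμ - F 0 x * A) (hc : 0 < c)
    (hθ : 16 * L ^ 2 * θ = c) (hLγ : |Aγ| ≤ L) (hLA : |A| ≤ L) (hLμ : |Aμ| ≤ L) (hLρ : |bρ| ≤ L)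
    (hLb : |b| ≤ L) (hLbμ : |bμ| ≤ L) (hF0 : ∀ x, |F 0 x| ≤ K₀) (hG0 : ∀ x, |G 0 x| ≤ K₀)
    (hF1 : ∀ x, |F 1 x| ≤ K₁) (hG1 : ∀ x, |G 1 x| ≤ K₁) (hF2 : ∀ x, |F 2 x| ≤ K₂)
    (hG2 : ∀ x, |G 2 x| ≤ K₂) :
    -(∫ x, U 0 x * F 0 x * (Aγ * U 4 x + A * W 4 x - bρ * U 2 x - b * W 2 x) ∂torus)
      - ∫ x, W 0 x * G 0 x * (Aμ * U 4 x + Aμ * W 4 x - bμ * U 2 x - bμ * W 2 x) ∂torus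
      ≤ (K₁ ^ 4 / (θ ^ 2 * c) + (K₂ ^ 2 + K₀ ^ 2) / (4 * θ))
        * ∫ x, (U 0 x ^ 2 + W 0 x ^ 2) ∂torus := by
  have hθ0 : 0 < θ := by
    by_contra hn
    push Not at hn
    nlinarith [mul_nonneg (sq_nonneg L) (neg_nonneg.2 hn)]
  have cU : ∀ i ≤ 4, Continuous (U i) := fun i hi => hU.continuous hi
  have cW : ∀ i ≤ 4, Continuous (W i) := fun i hi => hW.continuous hi
  have cF : ∀ i ≤ 2, Continuous (F i) := fun i hi => hF.continuous hi
  have cG : ∀ i ≤ 2, Continuous (G i) := fun i hi => hG.continuous hi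
  have u0 := cU 0 (by norm_num)
  have u1 := cU 1 (by norm_num)
  have u2 := cU 2 (by norm_num)
  have u4 := cU 4 (by norm_num)
  have w0 := cW 0 (by norm_num)
  have w1 := cW 1 (by norm_num)
  have w2 := cW 2 (by norm_num)
  have w4 := cW 4 (by norm_num)
  have f0 := cF 0 (by norm_num)
  have f1 := cF 1 (by norm_num)
  have f2 := cF 2 (by norm_num)
  have g0 := cG 0 (by norm_num)
  have g1 := cG 1 (by norm_num)
  have g2 := cG 2 (by norm_num)
  -- two integrations by parts in each of the fourth order terms
  have key : ∀ {Y H : ℕ → ℝ → ℝ} (α β : ℝ), PeriodicJet 4 Y → PeriodicJet 2 H →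
      ∫ x, Y 0 x * H 0 x * (α * U 4 x + β * W 4 x) ∂torus
        = ∫ x, (H 0 x * Y 2 x + 2 * H 1 x * Y 1 x + H 2 x * Y 0 x)
          * (α * U 2 x + β * W 2 x) ∂torus := by
    intro Y H α β hY hH
    have y0 := hY.continuous (i := 0) (by norm_num)
    have y1 := hY.continuous (i := 1) (by norm_num)
    have y2 := hY.continuous (i := 2) (by norm_num)
    have e0 := hH.continuous (i := 0) (by norm_num)
    have e1 := hH.continuous (i := 1) (by norm_num)
    have e2 := hH.continuous (i := 2) (by norm_num)
    refine integral_torus_mul_deriv_two (Φ := fun x => Y 0 x * H 0 x)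
      (Φ' := fun x => Y 1 x * H 0 x + Y 0 x * H 1 x)
      (z := fun x => α * U 2 x + β * W 2 x) (z' := fun x => α * U 3 x + β * W 3 x)
      (fun x => (hY.deriv 0 (by norm_num) x).mul (hH.deriv 0 (by norm_num) x)) (fun x => ?_)
      (fun x => ((hU.deriv 2 (by norm_num) x).const_mul α).add
        ((hW.deriv 2 (by norm_num) x).const_mul β))
      (fun x => ((hU.deriv 3 (by norm_num) x).const_mul α).add
        ((hW.deriv 3 (by norm_num) x).const_mul β)) (by fun_prop) (by fun_prop)
      (fun x => ?_) (fun x => ?_) (fun x => ?_) (fun x => ?_)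
    · refine (((hY.deriv 1 (by norm_num) x).mul (hH.deriv 0 (by norm_num) x)).add
        ((hY.deriv 0 (by norm_num) x).mul (hH.deriv 1 (by norm_num) x))).congr_deriv ?_
      ring
    · simp only [hY.per 0 (by norm_num) x, hH.per 0 (by norm_num) x]
    · simp only [hY.per 0 (by norm_num) x, hH.per 0 (by norm_num) x, hY.per 1 (by norm_num) x,
        hH.per 1 (by norm_num) x]
    · simp only [hU.per 2 (by norm_num) x, hW.per 2 (by norm_num) x]
    · simp only [hU.per 3 (by norm_num) x, hW.per 3 (by norm_num) x]
  have sq : ∀ {Y : ℕ → ℝ → ℝ}, PeriodicJet 4 Y → 0 ≤ ∫ x, (c / 4 * Y 2 x ^ 2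
      - K₁ ^ 2 / θ * Y 1 x ^ 2 + K₁ ^ 4 / (θ ^ 2 * c) * Y 0 x ^ 2) ∂torus := by
    intro Y hY
    have y0 := hY.continuous (i := 0) (by norm_num)
    have y1 := hY.continuous (i := 1) (by norm_num)
    have y2 := hY.continuous (i := 2) (by norm_num)
    have hibp := integral_torus_mul_deriv (hY.deriv 0 (by norm_num)) (hY.deriv 1 (by norm_num))
      y1 y2 (hY.per 0 (by norm_num)) (hY.per 1 (by norm_num))
    have e : ∫ x, (c / 4 * Y 2 x ^ 2 - K₁ ^ 2 / θ * Y 1 x ^ 2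
        + K₁ ^ 4 / (θ ^ 2 * c) * Y 0 x ^ 2) ∂torus
        = ∫ x, (c / 4 * Y 2 x ^ 2 + K₁ ^ 2 / θ * (Y 0 x * Y 2 x)
          + K₁ ^ 4 / (θ ^ 2 * c) * Y 0 x ^ 2) ∂torus := by
      have i1 : Integrable (fun x => c / 4 * Y 2 x ^ 2 + K₁ ^ 4 / (θ ^ 2 * c) * Y 0 x ^ 2) torus :=
        integrable_of_continuous_torus (by fun_prop)
      have i2 : Integrable (fun x => K₁ ^ 2 / θ * (Y 1 x * Y 1 x)) torus :=
        integrable_of_continuous_torus (by fun_prop)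
      have i3 : Integrable (fun x => K₁ ^ 2 / θ * (Y 0 x * Y 2 x)) torus :=
        integrable_of_continuous_torus (by fun_prop)
      have s1 := integral_sub i1 i2
      have s2 := integral_add i1 i3
      rw [integral_const_mul] at s1 s2
      rw [hibp] at s2
      calc _ = ∫ x, (c / 4 * Y 2 x ^ 2 + K₁ ^ 4 / (θ ^ 2 * c) * Y 0 x ^ 2
            - K₁ ^ 2 / θ * (Y 1 x * Y 1 x)) ∂torus := by congr 1; ext x; ring
        _ = ∫ x, (c / 4 * Y 2 x ^ 2 + K₁ ^ 4 / (θ ^ 2 * c) * Y 0 x ^ 2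
            + K₁ ^ 2 / θ * (Y 0 x * Y 2 x)) ∂torus := by rw [s1, s2]; ring
        _ = _ := by congr 1; ext x; ring
    rw [e]
    refine integral_nonneg fun x => ?_
    have : c / 4 * Y 2 x ^ 2 + K₁ ^ 2 / θ * (Y 0 x * Y 2 x) + K₁ ^ 4 / (θ ^ 2 * c) * Y 0 x ^ 2
        = c * (Y 2 x / 2 + K₁ ^ 2 / (θ * c) * Y 0 x) ^ 2 := by field_simp; ring
    simp only [this, Pi.zero_apply]
    positivity
  have hI1 := key Aγ A hU hF
  have hI2 := key Aμ Aμ hW hG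
  have split1 : ∫ x, U 0 x * F 0 x * (Aγ * U 4 x + A * W 4 x - bρ * U 2 x - b * W 2 x) ∂torus
      = ∫ x, U 0 x * F 0 x * (Aγ * U 4 x + A * W 4 x) ∂torus
        - ∫ x, U 0 x * F 0 x * (bρ * U 2 x + b * W 2 x) ∂torus := by
    rw [← integral_sub (integrable_of_continuous_torus (by fun_prop))
      (integrable_of_continuous_torus (by fun_prop))]
    congr 1; ext x; ring
  have split2 : ∫ x, W 0 x * G 0 x * (Aμ * U 4 x + Aμ * W 4 x - bμ * U 2 x - bμ * W 2 x) ∂torus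
      = ∫ x, W 0 x * G 0 x * (Aμ * U 4 x + Aμ * W 4 x) ∂torus
        - ∫ x, W 0 x * G 0 x * (bμ * U 2 x + bμ * W 2 x) ∂torus := by
    rw [← integral_sub (integrable_of_continuous_torus (by fun_prop))
      (integrable_of_continuous_torus (by fun_prop))]
    congr 1; ext x; ring
  have hpt := integral_mono (μ := torus)
    (f := fun x => c / 4 * (U 2 x ^ 2 + W 2 x ^ 2) - K₁ ^ 2 / θ * (U 1 x ^ 2 + W 1 x ^ 2)
      - (K₂ ^ 2 + K₀ ^ 2) / (4 * θ) * (U 0 x ^ 2 + W 0 x ^ 2))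
    (g := fun x => (F 0 x * U 2 x + 2 * F 1 x * U 1 x + F 2 x * U 0 x) * (Aγ * U 2 x + A * W 2 x)
        + (G 0 x * W 2 x + 2 * G 1 x * W 1 x + G 2 x * W 0 x) * (Aμ * U 2 x + Aμ * W 2 x)
        - U 0 x * F 0 x * (bρ * U 2 x + b * W 2 x) - W 0 x * G 0 x * (bμ * U 2 x + bμ * W 2 x))
    (integrable_of_continuous_torus (by fun_prop)) (integrable_of_continuous_torus (by fun_prop))
    fun x => coercive_pointwise hA (hF' x) (h1 x) (h2 x) hc hθ hLγ hLA hLμ hLρ hLb hLbμ (hF0 x)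
      (hG0 x) (hF1 x) (hG1 x) (hF2 x) (hG2 x)
  have hsplit : ∫ x, ((F 0 x * U 2 x + 2 * F 1 x * U 1 x + F 2 x * U 0 x)
          * (Aγ * U 2 x + A * W 2 x)
        + (G 0 x * W 2 x + 2 * G 1 x * W 1 x + G 2 x * W 0 x) * (Aμ * U 2 x + Aμ * W 2 x)
        - U 0 x * F 0 x * (bρ * U 2 x + b * W 2 x)
        - W 0 x * G 0 x * (bμ * U 2 x + bμ * W 2 x)) ∂torus
      = ∫ x, U 0 x * F 0 x * (Aγ * U 4 x + A * W 4 x) ∂torus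
        + ∫ x, W 0 x * G 0 x * (Aμ * U 4 x + Aμ * W 4 x) ∂torus
        - ∫ x, U 0 x * F 0 x * (bρ * U 2 x + b * W 2 x) ∂torus
        - ∫ x, W 0 x * G 0 x * (bμ * U 2 x + bμ * W 2 x) ∂torus := by
    rw [hI1, hI2, integral_sub (integrable_of_continuous_torus (by fun_prop))
      (integrable_of_continuous_torus (by fun_prop)),
      integral_sub (integrable_of_continuous_torus (by fun_prop))
      (integrable_of_continuous_torus (by fun_prop)),
      integral_add (integrable_of_continuous_torus (by fun_prop))
      (integrable_of_continuous_torus (by fun_prop))]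
  have hlow : -((K₁ ^ 4 / (θ ^ 2 * c) + (K₂ ^ 2 + K₀ ^ 2) / (4 * θ))
        * ∫ x, (U 0 x ^ 2 + W 0 x ^ 2) ∂torus)
      ≤ ∫ x, (c / 4 * (U 2 x ^ 2 + W 2 x ^ 2) - K₁ ^ 2 / θ * (U 1 x ^ 2 + W 1 x ^ 2)
      - (K₂ ^ 2 + K₀ ^ 2) / (4 * θ) * (U 0 x ^ 2 + W 0 x ^ 2)) ∂torus := by
    have hs := add_nonneg (sq hU) (sq hW)
    rw [← integral_add (integrable_of_continuous_torus (by fun_prop))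
      (integrable_of_continuous_torus (by fun_prop))] at hs
    rw [neg_le_iff_add_nonneg', ← integral_const_mul, ← integral_add
      (integrable_of_continuous_torus (by fun_prop)) (integrable_of_continuous_torus (by fun_prop))]
    refine hs.trans (le_of_eq ?_)
    congr 1; ext x; ring
  rw [hsplit] at hpt
  rw [split1, split2]
  linarith

/-! ### Uniqueness for the transport equations -/

/-- A bound that holds in almost every time slice holds almost everywhere on the cylinder. Without
measurability of the function this fails, since the exceptional sets need not form a null set. -/
lemma ae_cylinder_bound {T B : ℝ} {g : ℝ × ℝ → ℝ} (hg : AEStronglyMeasurable g (cylinder T))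
    (h : ∀ᵐ t ∂(volume.restrict (Ioc 0 T)), ∀ᵐ x ∂torus, |g (t, x)| ≤ B) :
    ∀ᵐ p ∂(cylinder T), |g p| ≤ B := by
  have hmk : ∀ᵐ t ∂(volume.restrict (Ioc 0 T)), ∀ᵐ x ∂torus, |hg.mk g (t, x)| ≤ B := by
    filter_upwards [h, Measure.ae_ae_of_ae_prod hg.ae_eq_mk] with t ht ht'
    filter_upwards [ht, ht'] with x hx hx'
    rwa [← hx']
  have hms : MeasurableSet {p | |hg.mk g p| ≤ B} :=
    measurableSet_le hg.stronglyMeasurable_mk.measurable.abs measurable_const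
  filter_upwards [(Measure.ae_prod_iff_ae_ae hms).2 hmk, hg.ae_eq_mk] with p hp hp'
  rwa [hp']

lemma periodicJet_retrig {n : ℕ} {c : ℤ → ℂ} (h : ∀ i ≤ n, wnorm i c < ⊤) :
    PeriodicJet n fun i => retrig (dseq i c) := by
  have hw : ∀ i ≤ n, wnorm 0 (dseq i c) < ⊤ := fun i hi => by
    rw [wnorm_dseq, zero_add]; exact h i hi
  refine ⟨fun i hi x => ?_, continuous_retrig (hw n le_rfl), fun i _ => retrig_periodic _⟩
  have := hasDerivAt_retrig (hw i hi.le)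
    (by rw [wnorm_dseq, add_comm]; exact h (i + 1) hi) x
  rwa [dseq_dseq, add_comm] at this

section

variable {T m : ℝ} {a₀ : ℤ → ℂ} {a v a' v' : ℝ → ℤ → ℂ}

/-- The difference of the primitives, as a primitive in time. -/
lemma Transported.ae_eq_prim_sub (h : Transported T m a₀ a v) (h' : Transported T m a₀ a' v') :
    ∀ᵐ t ∂(volume.restrict (Ioc 0 T)),
      (fun x => 0 + ∫ s in Ioc 0 t, (fluxDev m a' v' s x - fluxDev m a v s x))
        =ᵐ[torus] retrig (prim fun k => a t k - a' t k) := by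
  filter_upwards [h.ae_eq_prim, h'.ae_eq_prim, h.ae_fin, h'.ae_fin,
    ae_restrict_mem measurableSet_Ioc] with t h1 h2 hf hf' htm
  have i1 : ∀ᵐ x ∂torus, IntegrableOn (fun s => fluxDev m a v s x) (Ioc 0 t) :=
    (h.integrable_fluxDev.mono_measure (cylinder_mono htm.2)).prod_left_ae
  have i2 : ∀ᵐ x ∂torus, IntegrableOn (fun s => fluxDev m a' v' s x) (Ioc 0 t) :=
    (h'.integrable_fluxDev.mono_measure (cylinder_mono htm.2)).prod_left_ae
  have e : (prim fun k => a t k - a' t k) = fun k => prim (a t) k - prim (a' t) k := by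
    ext k; simp only [prim, sub_div]
  filter_upwards [h1, h2, i1, i2] with x h1 h2 i1 i2
  rw [e, retrig_sub ((wnorm_zero_prim_le (h.zero t)).trans_lt hf.1)
    ((wnorm_zero_prim_le (h'.zero t)).trans_lt hf'.1), ← h1, ← h2, integral_sub i2 i1, integral_neg,
    integral_neg]
  ring

/-- The `H⁻¹` energy inequality for the difference of two solutions of one transport equation. -/
lemma Transported.exists_energy (h : Transported T m a₀ a v) (h' : Transported T m a₀ a' v') :
    ∃ y φ : ℝ → ℝ, IntegrableOn φ (Ioc 0 T) ∧ (∀ t ∈ Icc 0 T, y t = ∫ s in Ioc 0 t, φ s) ∧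
      ∀ᵐ s ∂(volume.restrict (Ioc 0 T)),
        y s = ∫ x, retrig (prim fun k => a s k - a' s k) x ^ 2 ∂torus ∧
        φ s ≤ -(2 * ∫ x, retrig (prim fun k => a s k - a' s k) x * (retrig (a' s) x + m)
            * (retrig (v s) x - retrig (v' s) x) ∂torus)
          + (wnorm 1 (v s)).toReal
            * ∫ x, retrig (prim fun k => a s k - a' s k) x ^ 2 ∂torus := by
  set w : ℝ → ℝ → ℝ := fun s x => fluxDev m a' v' s x - fluxDev m a v s x with hw
  have hwi : Integrable (fun p : ℝ × ℝ => w p.1 p.2) (cylinder T) :=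
    h'.integrable_fluxDev.sub h.integrable_fluxDev
  have hRU := h.ae_eq_prim_sub h'
  have hRm : AEStronglyMeasurable (fun p : ℝ × ℝ => 0 + ∫ u in Ioc 0 p.1, w u p.2) (cylinder T) :=
    aestronglyMeasurable_const.add (aestronglyMeasurable_primitive hwi)
  obtain ⟨B, hB⟩ := h.abs_prim_le
  obtain ⟨B', hB'⟩ := h'.abs_prim_le
  have e : ∀ t, (prim fun k => a t k - a' t k) = fun k => prim (a t) k - prim (a' t) k := fun t => by
    ext k; simp only [prim, sub_div]
  have hbd : ∀ᵐ p ∂(cylinder T), |0 + ∫ u in Ioc 0 p.1, w u p.2| ≤ B + B' := by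
    refine ae_cylinder_bound hRm ?_
    filter_upwards [hRU, hB, hB', h.ae_fin, h'.ae_fin] with t h1 h2 h3 hf hf'
    filter_upwards [h1, h2, h3] with x h1 h2 h3
    rw [h1, e, retrig_sub ((wnorm_zero_prim_le (h.zero t)).trans_lt hf.1)
      ((wnorm_zero_prim_le (h'.zero t)).trans_lt hf'.1)]
    exact (abs_sub _ _).trans (add_le_add h2 h3)
  have hβw : Integrable (fun p : ℝ × ℝ => 2 * (0 + ∫ u in Ioc 0 p.1, w u p.2) * w p.1 p.2)
      (cylinder T) := by
    refine hwi.bdd_mul (c := 2 * (B + B')) (hRm.const_mul 2) ?_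
    filter_upwards [hbd] with p hp
    rw [Real.norm_eq_abs, abs_mul, abs_two]
    exact mul_le_mul_of_nonneg_left hp (by norm_num)
  have hen := fun t (ht : t ∈ Icc 0 T) =>
    integral_comp_primitive (R₀ := fun _ => 0) (β := fun x => x ^ 2) (β' := fun x => 2 * x) hwi
      (fun x => by simpa using hasDerivAt_pow 2 x) (by fun_prop) (integrable_const _) hβw ht
  refine ⟨fun t => ∫ x, (0 + ∫ u in Ioc 0 t, w u x) ^ 2 ∂torus,
    fun s => ∫ x, 2 * (0 + ∫ u in Ioc 0 s, w u x) * w s x ∂torus, hβw.integral_prod_left,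
    fun t ht => ?_, ?_⟩
  · have := (hen t ht).2
    simp only [ne_eq, OfNat.ofNat_ne_zero, not_false_eq_true, zero_pow, integral_zero,
      zero_add] at this ⊢
    exact this
  filter_upwards [hRU, h.ae_fin, h'.ae_fin] with s hs hf hf'
  have hd0 : (fun k => a s k - a' s k) 0 = 0 := by simp [h.zero s, h'.zero s]
  have hd : wnorm 0 (fun k => a s k - a' s k) < ⊤ :=
    (wnorm_sub_le 0 _ _).trans_lt (ENNReal.add_lt_top.2 ⟨hf.1, hf'.1⟩)
  have hH : Herm (fun k => a s k - a' s k) := fun k => by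
    simp only [h.herm s k, h'.herm s k, map_sub]
  set u := retrig (prim fun k => a s k - a' s k) with hu
  have hpd : wnorm 0 (prim fun k => a s k - a' s k) < ⊤ := (wnorm_zero_prim_le hd0).trans_lt hd
  have huc : Continuous u := continuous_retrig hpd
  have hpc := continuous_retrig hd
  have hac' := continuous_retrig hf'.1
  have hac := continuous_retrig hf.1
  have hvc := continuous_retrig hf.2.2.1
  have hvc' := continuous_retrig hf'.2.2.1
  refine ⟨integral_congr_ae (by filter_upwards [hs] with x hx; rw [hx]), ?_⟩
  have hV1 : wnorm 0 (dseq 1 (v s)) < ⊤ := by rw [wnorm_dseq]; exact hf.2.2.2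
  -- the part of the flux difference that contains `a - a'` is a transport term
  have htr := integral_comp_mul_deriv_le (β := fun x => x ^ 2) (β' := fun x => 2 * x) (W := u)
    (f := retrig fun k => a s k - a' s k) (V := retrig (v s)) (V' := retrig (dseq 1 (v s)))
    (K := (wnorm 1 (v s)).toReal)
    (fun x => by simpa using hasDerivAt_pow 2 x) (by fun_prop) (fun x => sq_nonneg x)
    (hasDerivAt_retrig_prim hd0 hd) (hasDerivAt_retrig hf.2.2.1 hf.2.2.2) hpc
    (continuous_retrig hV1) (retrig_periodic _) (retrig_periodic _)
    (fun x => by have := abs_retrig_le hV1 x; rwa [wnorm_dseq] at this)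
  -- the means of the fluxes do not contribute, since `u` has zero mean
  have hu0 : ∫ x, u x ∂torus = 0 := by
    have := mean_retrig (herm_prim hH) hpd (prim_zero _)
    rw [mean] at this
    have hpi := Real.pi_pos
    simpa [hpi.ne'] using this
  set c := mean fun x => (retrig (a s) x + m) * retrig (v s) x with hc
  set c' := mean fun x => (retrig (a' s) x + m) * retrig (v' s) x with hc'
  have e1 : ∫ x, 2 * (0 + ∫ t in Ioc 0 s, w t x) * w s x ∂torus
      = ∫ x, (-(2 * (u x * (retrig (a' s) x + m) * (retrig (v s) x - retrig (v' s) x)))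
        + -(2 * u x * retrig (fun k => a s k - a' s k) x * retrig (v s) x)
        + 2 * (c - c') * u x) ∂torus := by
    refine integral_congr_ae ?_
    filter_upwards [hs] with x hx
    rw [hx, retrig_sub hf.1 hf'.1]
    simp only [hw, fluxDev, fluct, ← hc, ← hc']
    ring
  rw [e1, integral_add (integrable_of_continuous_torus (by fun_prop))
    (integrable_of_continuous_torus (by fun_prop)), integral_add
    (integrable_of_continuous_torus (by fun_prop)) (integrable_of_continuous_torus (by fun_prop)),
    integral_const_mul, hu0, integral_neg, integral_neg, integral_const_mul, mul_zero, add_zero]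
  linarith

end

/-- The jet of the thickness `retrig a + m` of a layer. -/
lemma periodicJet_thickness {n : ℕ} {c : ℤ → ℂ} (h : ∀ i ≤ n, wnorm i c < ⊤) (m : ℝ) :
    PeriodicJet n fun i x => retrig (dseq i c) x + if i = 0 then m else 0 := by
  have hj := periodicJet_retrig h
  refine ⟨fun i hi x => ?_, hj.cont.add continuous_const, fun i hi x => ?_⟩
  · simpa using (hj.deriv i hi x).add_const (if i = 0 then m else 0)
  · simp only [hj.per i hi x]

lemma abs_retrig_dseq_le {c : ℤ → ℂ} (h0 : c 0 = 0) (h4 : wnorm 4 c < ⊤) {E : ℝ≥0}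
    (hE : wnorm 0 c ≤ E) {h : ℝ} (hh : (wnorm 4 c).toReal ≤ h) {i : ℕ} (hi : 0 < i) (hi4 : i ≤ 4)
    (x : ℝ) : |retrig (dseq i c) x| ≤ (E + 1) * h ^ ((i : ℝ) / 4) := by
  have hlt : wnorm 0 (dseq i c) < ⊤ := by
    rw [wnorm_dseq, zero_add]; exact (wnorm_le_wnorm h0 hi4).trans_lt h4
  have hr : (wnorm 4 c ^ ((i : ℝ) / 4)) ≠ ⊤ := ENNReal.rpow_ne_top_of_nonneg (by positivity) h4.ne
  refine (abs_retrig_le hlt x).trans ?_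
  rw [wnorm_dseq, zero_add]
  have := ENNReal.toReal_mono (ENNReal.mul_ne_top (by simp) hr) (wnorm_rpow_interp hi hi4 h0 hE)
  rw [ENNReal.toReal_mul, ← ENNReal.toReal_rpow] at this
  refine this.trans ?_
  have e : ((E : ℝ≥0∞) + 1).toReal = (E : ℝ) + 1 := by
    rw [ENNReal.toReal_add (by simp) (by simp)]; simp
  rw [e]
  exact mul_le_mul_of_nonneg_left
    (Real.rpow_le_rpow ENNReal.toReal_nonneg hh (by positivity)) (by positivity)

/-- The difference of the two velocities is a combination of derivatives of the primitives. -/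
lemma retrig_vel_sub {α β γ δ : ℝ} {a b a' b' : ℤ → ℂ} (ha : a 0 = 0) (hb : b 0 = 0)
    (ha' : a' 0 = 0) (hb' : b' 0 = 0) (ha4 : wnorm 4 a < ⊤) (hb4 : wnorm 4 b < ⊤)
    (ha4' : wnorm 4 a' < ⊤) (hb4' : wnorm 4 b' < ⊤) (x : ℝ) :
    retrig (vel α β γ δ a b) x - retrig (vel α β γ δ a' b') x
      = α * retrig (dseq 4 (prim fun k => a k - a' k)) x
        + β * retrig (dseq 4 (prim fun k => b k - b' k)) x
        - γ * retrig (dseq 2 (prim fun k => a k - a' k)) x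
        - δ * retrig (dseq 2 (prim fun k => b k - b' k)) x := by
  have key : ∀ {c c' : ℤ → ℂ}, c 0 = 0 → c' 0 = 0 → wnorm 4 c < ⊤ → wnorm 4 c' < ⊤ →
      ∀ n ≤ 3, retrig (dseq (n + 1) (prim fun k => c k - c' k)) x
        = retrig (dseq n c) x - retrig (dseq n c') x := by
    intro c c' h h' h4 h4' n hn
    rw [← dseq_dseq n 1, dseq_prim (by simp [h, h']), ← retrig_sub]
    · congr 1; ext k; simp only [dseq, mul_sub]
    all_goals rw [wnorm_dseq, zero_add]
    · exact (wnorm_le_wnorm h (by omega)).trans_lt h4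
    · exact (wnorm_le_wnorm h' (by omega)).trans_lt h4'
  rw [retrig_vel ha hb ha4 hb4, retrig_vel ha' hb' ha4' hb4', key ha ha' ha4 ha4' 3 le_rfl,
    key hb hb' hb4 hb4' 3 le_rfl, key ha ha' ha4 ha4' 1 (by norm_num),
    key hb hb' hb4 hb4' 1 (by norm_num)]
  ring

/-- Monotonicity, up to lower order terms, of the velocities in `H⁻¹`, for a difference of two
configurations of which the second is small in the Wiener algebra. -/
lemma exists_coercive (P : Params) (hP : P.Pos) {mf mg : ℝ} {E : ℝ≥0} (hEf : E ≤ mf) (hEg : E ≤ mg)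
    (h1A : 0 < P.σ1A mf mg E) (h2A : 0 < P.σ2A mf mg E) :
    ∃ C : ℝ, 0 ≤ C ∧ ∀ {a b a' b' : ℤ → ℂ}, a 0 = 0 → b 0 = 0 → a' 0 = 0 → b' 0 = 0 →
      wnorm 4 a < ⊤ → wnorm 4 b < ⊤ → wnorm 4 a' < ⊤ → wnorm 4 b' < ⊤ →
      wnorm 0 a' ≤ E → wnorm 0 b' ≤ E →
      -(∫ x, retrig (prim fun k => a k - a' k) x * (retrig a' x + mf)
          * (retrig (vel P.Aγ P.A P.bρ P.b a b) x - retrig (vel P.Aγ P.A P.bρ P.b a' b') x) ∂torus)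
        - ∫ x, retrig (prim fun k => b k - b' k) x * (retrig b' x + mg)
          * (retrig (vel P.Aμ P.Aμ P.bμ P.bμ a b) x - retrig (vel P.Aμ P.Aμ P.bμ P.bμ a' b') x)
            ∂torus
        ≤ C * (1 + ((wnorm 4 a').toReal + (wnorm 4 b').toReal))
          * (∫ x, retrig (prim fun k => a k - a' k) x ^ 2 ∂torus
            + ∫ x, retrig (prim fun k => b k - b' k) x ^ 2 ∂torus) := by
  obtain ⟨hA, hAμ, hAγ, -⟩ := hP.coeff_pos
  have hE0 : (0 : ℝ) ≤ E := E.2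
  set L := |P.Aγ| + |P.A| + |P.Aμ| + |P.bρ| + |P.b| + |P.bμ| with hL
  have hL0 : 0 < L := by
    have := abs_pos.2 hA.ne'
    positivity
  set c := P.σ2A mf mg E / 2 with hc
  have hc0 : 0 < c := by positivity
  set θ := c / (16 * L ^ 2) with hθ
  have hθ0 : 0 < θ := by positivity
  have hθc : 16 * L ^ 2 * θ = c := by rw [hθ]; field_simp
  set K₀ := mf + mg + E with hK₀
  refine ⟨(E + 1) ^ 4 / (θ ^ 2 * c) + ((E + 1) ^ 2 + K₀ ^ 2) / (4 * θ), by positivity, ?_⟩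
  intro a b a' b' ha hb ha' hb' ha4 hb4 ha4' hb4' hEa hEb
  set h := (wnorm 4 a').toReal + (wnorm 4 b').toReal with hh
  have hh0 : 0 ≤ h := add_nonneg ENNReal.toReal_nonneg ENNReal.toReal_nonneg
  have hha : (wnorm 4 a').toReal ≤ h := le_add_of_nonneg_right ENNReal.toReal_nonneg
  have hhb : (wnorm 4 b').toReal ≤ h := le_add_of_nonneg_left ENNReal.toReal_nonneg
  have jd : ∀ {c c' : ℤ → ℂ}, c 0 = 0 → c' 0 = 0 → wnorm 4 c < ⊤ → wnorm 4 c' < ⊤ →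
      PeriodicJet 4 fun i => retrig (dseq i (prim fun k => c k - c' k)) := by
    intro c c' h h' h4 h4'
    have h0 : (fun k => c k - c' k) 0 = 0 := by simp [h, h']
    refine periodicJet_retrig fun i hi => ?_
    calc wnorm i (prim fun k => c k - c' k) ≤ wnorm (4 + 1) (prim fun k => c k - c' k) :=
          wnorm_le_wnorm (prim_zero _) (by omega)
      _ = wnorm 4 (fun k => c k - c' k) := wnorm_prim h0 4
      _ ≤ wnorm 4 c + wnorm 4 c' := wnorm_sub_le _ _ _
      _ < ⊤ := ENNReal.add_lt_top.2 ⟨h4, h4'⟩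
  have b0 : ∀ {c : ℤ → ℂ}, wnorm 0 c ≤ E → ∀ x, |retrig c x| ≤ E := by
    intro c hc x
    refine (abs_retrig_le (hc.trans_lt ENNReal.coe_lt_top) x).trans ?_
    exact ENNReal.toReal_mono ENNReal.coe_ne_top hc
  have hφ := fun x => abs_le.1 (b0 hEa x)
  have hγ := fun x => abs_le.1 (b0 hEb x)
  have sz : ∀ {c : ℤ → ℂ}, c 0 = 0 → wnorm 4 c < ⊤ → ∀ i ≤ 2, wnorm i c < ⊤ := fun h0 h4 i hi =>
    (wnorm_le_wnorm h0 (by omega)).trans_lt h4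
  have hL1 : ∀ z ∈ ([|P.Aγ|, |P.A|, |P.Aμ|, |P.bρ|, |P.b|, |P.bμ|] : List ℝ), z ≤ L := by
    have := abs_nonneg P.Aγ
    have := abs_nonneg P.A
    have := abs_nonneg P.Aμ
    have := abs_nonneg P.bρ
    have := abs_nonneg P.b
    have := abs_nonneg P.bμ
    simp only [List.mem_cons, List.not_mem_nil, or_false, forall_eq_or_imp, forall_eq]
    refine ⟨?_, ?_, ?_, ?_, ?_, ?_⟩ <;> linarith
  have key := coercive_integral (jd ha ha' ha4 ha4') (jd hb hb' hb4 hb4')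
    (periodicJet_thickness (sz ha' ha4') mf) (periodicJet_thickness (sz hb' hb4') mg) (c := c)
    (L := L) (θ := θ) (K₀ := K₀) (K₁ := (E + 1) * h ^ (((1 : ℕ) : ℝ) / 4))
    (K₂ := (E + 1) * h ^ (((2 : ℕ) : ℝ) / 4)) (Aγ := P.Aγ) (A := P.A) (Aμ := P.Aμ) (bρ := P.bρ)
    (b := P.b) (bμ := P.bμ) hA.le
    (fun x => by simp only [dseq_zero, if_true]; linarith [hφ x])
    (fun x => by
      simp only [dseq_zero, if_true]
      have e1 := mul_le_mul_of_nonneg_right (hφ x).1 hAγ.le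
      have e2 := mul_le_mul_of_nonneg_right (hγ x).2 hAμ.le
      have e3 := mul_nonneg hAγ.le hE0
      have e4 := mul_nonneg hA.le hE0
      simp only [Params.σ1A] at h1A
      linarith)
    (fun x => by
      simp only [dseq_zero, if_true]
      have e1 := mul_le_mul_of_nonneg_right (hφ x).2 hA.le
      have e2 := mul_le_mul_of_nonneg_right (hγ x).1 hAμ.le
      have e3 := mul_nonneg hAγ.le hE0
      have e4 := mul_nonneg hA.le hE0
      rw [hc]
      simp only [Params.σ2A]
      linarith) hc0 hθc
    (hL1 _ (by simp)) (hL1 _ (by simp)) (hL1 _ (by simp)) (hL1 _ (by simp)) (hL1 _ (by simp))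
    (hL1 _ (by simp))
    (fun x => by
      simp only [dseq_zero, if_true]
      rw [abs_le]; constructor <;> linarith [hφ x])
    (fun x => by
      simp only [dseq_zero, if_true]
      rw [abs_le]; constructor <;> linarith [hγ x])
    (fun x => by simpa using abs_retrig_dseq_le ha' ha4' hEa hha one_pos (by norm_num) x)
    (fun x => by simpa using abs_retrig_dseq_le hb' hb4' hEb hhb one_pos (by norm_num) x)
    (fun x => by simpa using abs_retrig_dseq_le ha' ha4' hEa hha two_pos (by norm_num) x)
    (fun x => by simpa using abs_retrig_dseq_le hb' hb4' hEb hhb two_pos (by norm_num) x)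
  simp only [dseq_zero, if_true] at key
  simp only [retrig_vel_sub ha hb ha' hb' ha4 hb4 ha4' hb4']
  refine key.trans ?_
  have i1 : Integrable (fun x => retrig (prim fun k => a k - a' k) x ^ 2) torus := by
    have := (jd ha ha' ha4 ha4').continuous (i := 0) (by norm_num)
    simp only [dseq_zero] at this
    exact integrable_of_continuous_torus (this.pow 2)
  have i2 : Integrable (fun x => retrig (prim fun k => b k - b' k) x ^ 2) torus := by
    have := (jd hb hb' hb4 hb4').continuous (i := 0) (by norm_num)
    simp only [dseq_zero] at this
    exact integrable_of_continuous_torus (this.pow 2)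
  rw [integral_add i1 i2]
  refine mul_le_mul_of_nonneg_right ?_ (add_nonneg (integral_nonneg fun x => sq_nonneg _)
    (integral_nonneg fun x => sq_nonneg _))
  -- the interpolation exponents make the coefficient linear in the `Ȧ⁴` norms
  have e1 : (h ^ (((1 : ℕ) : ℝ) / 4)) ^ 4 = h := by
    rw [← Real.rpow_natCast, ← Real.rpow_mul hh0]; norm_num
  have e2 : (h ^ (((2 : ℕ) : ℝ) / 4)) ^ 2 = h := by
    rw [← Real.rpow_natCast, ← Real.rpow_mul hh0]; norm_num
  rw [mul_pow, mul_pow, e1, e2]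
  have g1 : 0 ≤ (E + 1 : ℝ) ^ 4 / (θ ^ 2 * c) := by positivity
  have g2 : 0 ≤ K₀ ^ 2 / (4 * θ) * h := by positivity
  have g3 : 0 ≤ (E + 1 : ℝ) ^ 2 / (4 * θ) := by positivity
  have e3 : (E + 1 : ℝ) ^ 4 * h / (θ ^ 2 * c) = (E + 1 : ℝ) ^ 4 / (θ ^ 2 * c) * h := by ring
  rw [e3, add_div, add_div, mul_div_right_comm]
  linarith

/-- Weak-strong uniqueness: a solution that stays small in the Wiener algebra is the only one. -/
lemma Transported.ae_eq (P : Params) (hP : P.Pos) {T mf mg : ℝ} {E : ℝ≥0} (hEf : E ≤ mf)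
    (hEg : E ≤ mg) (h1A : 0 < P.σ1A mf mg E) (h2A : 0 < P.σ2A mf mg E) {a₀ b₀ : ℤ → ℂ}
    {a b a' b' : ℝ → ℤ → ℂ}
    (hf : Transported T mf a₀ a fun t => vel P.Aγ P.A P.bρ P.b (a t) (b t))
    (hg : Transported T mg b₀ b fun t => vel P.Aμ P.Aμ P.bμ P.bμ (a t) (b t))
    (hf' : Transported T mf a₀ a' fun t => vel P.Aγ P.A P.bρ P.b (a' t) (b' t))
    (hg' : Transported T mg b₀ b' fun t => vel P.Aμ P.Aμ P.bμ P.bμ (a' t) (b' t))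
    (h4a : ∫⁻ t in Ioc 0 T, wnorm 4 (a t) < ⊤) (h4b : ∫⁻ t in Ioc 0 T, wnorm 4 (b t) < ⊤)
    (h4a' : ∫⁻ t in Ioc 0 T, wnorm 4 (a' t) < ⊤) (h4b' : ∫⁻ t in Ioc 0 T, wnorm 4 (b' t) < ⊤)
    (hEa : ∀ t, wnorm 0 (a' t) ≤ E) (hEb : ∀ t, wnorm 0 (b' t) ≤ E) :
    ∀ᵐ t ∂(volume.restrict (Ioc 0 T)), a t = a' t ∧ b t = b' t := by
  obtain ⟨C, hC0, hC⟩ := exists_coercive P hP hEf hEg h1A h2A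
  obtain ⟨y, φ, hφ, hy, hyφ⟩ := hf.exists_energy hf'
  obtain ⟨z, ψ, hψ, hz, hzψ⟩ := hg.exists_energy hg'
  have fin : ∀ {c : ℝ → ℤ → ℂ}, (∀ k, Measurable fun t => c t k) →
      ∫⁻ t in Ioc 0 T, wnorm 4 (c t) < ⊤ →
      ∀ᵐ t ∂(volume.restrict (Ioc 0 T)), wnorm 4 (c t) < ⊤ := fun hc h =>
    ae_lt_top (measurable_wnorm hc 4) h.ne
  set k : ℝ → ℝ := fun s => 2 * (C * (1 + ((wnorm 4 (a' s)).toReal + (wnorm 4 (b' s)).toReal)))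
    + ((wnorm 1 (vel P.Aγ P.A P.bρ P.b (a s) (b s))).toReal
      + (wnorm 1 (vel P.Aμ P.Aμ P.bμ P.bμ (a s) (b s))).toReal) with hk
  have hki : IntegrableOn k (Ioc 0 T) := by
    refine Integrable.add (Integrable.const_mul (Integrable.const_mul
      (Integrable.add (integrable_const _) (Integrable.add ?_ ?_)) _) _) (Integrable.add ?_ ?_)
    · exact integrableOn_toReal_wnorm hf'.meas h4a'
    · exact integrableOn_toReal_wnorm hg'.meas h4b'
    · exact integrableOn_toReal_wnorm hf.vel_meas hf.vel_fin_one
    · exact integrableOn_toReal_wnorm hg.vel_meas hg.vel_fin_one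
  have hgr := gronwall_primitive (φ := fun s => φ s + ψ s) (k := k) (y := fun s => y s + z s)
    (hφ.add hψ) hki
    (fun t ht => by
      rw [hy t ht, hz t ht]
      exact (integral_add (hφ.mono_set (Ioc_subset_Ioc_right ht.2))
        (hψ.mono_set (Ioc_subset_Ioc_right ht.2))).symm)
    (by
      filter_upwards [hyφ, hzψ, fin hf.meas h4a, fin hg.meas h4b, fin hf'.meas h4a',
        fin hg'.meas h4b'] with s hs hs' f1 f2 f3 f4
      have key := hC (hf.zero s) (hg.zero s) (hf'.zero s) (hg'.zero s) f1 f2 f3 f4 (hEa s) (hEb s)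
      rw [← hs.1, ← hs'.1] at key
      have hy0 : 0 ≤ y s := by rw [hs.1]; exact integral_nonneg fun x => sq_nonneg _
      have hz0 : 0 ≤ z s := by rw [hs'.1]; exact integral_nonneg fun x => sq_nonneg _
      have h1 := hs.2
      have h2 := hs'.2
      rw [← hs.1] at h1
      rw [← hs'.1] at h2
      have h3 := mul_nonneg (ENNReal.toReal_nonneg
        (a := wnorm 1 (vel P.Aγ P.A P.bρ P.b (a s) (b s)))) hz0
      have h4 := mul_nonneg (ENNReal.toReal_nonneg
        (a := wnorm 1 (vel P.Aμ P.Aμ P.bμ P.bμ (a s) (b s)))) hy0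
      simp only [hk]
      linarith)
  have zero : ∀ {d : ℤ → ℂ}, Herm d → d 0 = 0 → wnorm 0 d < ⊤ →
      ∫ x, retrig (prim d) x ^ 2 ∂torus = 0 → ∀ k, d k = 0 := by
    intro d hd h0 hfin hint k
    have hp := (wnorm_zero_prim_le h0).trans_lt hfin
    have hi : Integrable (fun x => retrig (prim d) x ^ 2) torus :=
      integrable_of_continuous_torus ((continuous_retrig hp).pow 2)
    have hz := (integral_eq_zero_iff_of_nonneg (fun x => sq_nonneg _) hi).1 hint
    have hz' : retrig (prim d) =ᵐ[torus] fun _ => (0 : ℝ) := by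
      filter_upwards [hz] with x hx
      exact pow_eq_zero_iff two_ne_zero |>.1 hx
    have := fourierC_retrig (herm_prim hd) hp k
    rw [fourierC_congr hz' k] at this
    rw [← dseq_prim h0, dseq, ← this]
    simp [fourierC_eq]
  filter_upwards [hyφ, hzψ, hf.ae_fin, hg.ae_fin, hf'.ae_fin, hg'.ae_fin,
    ae_restrict_mem measurableSet_Ioc] with t ht ht' f1 f2 f3 f4 htm
  have hle := hgr t (Ioc_subset_Icc_self htm)
  have hy0 : 0 ≤ y t := by rw [ht.1]; exact integral_nonneg fun x => sq_nonneg _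
  have hz0 : 0 ≤ z t := by rw [ht'.1]; exact integral_nonneg fun x => sq_nonneg _
  have sub : ∀ {c c' : ℤ → ℂ}, Herm c → Herm c' → Herm fun k => c k - c' k := fun h h' k => by
    simp only [h k, h' k, map_sub]
  constructor
  · ext k
    exact sub_eq_zero.1 (zero (sub (hf.herm t) (hf'.herm t)) (by simp [hf.zero t, hf'.zero t])
      ((wnorm_sub_le 0 _ _).trans_lt (ENNReal.add_lt_top.2 ⟨f1.1, f3.1⟩))
      (by rw [← ht.1]; linarith) k)
  · ext k
    exact sub_eq_zero.1 (zero (sub (hg.herm t) (hg'.herm t)) (by simp [hg.zero t, hg'.zero t])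
      ((wnorm_sub_le 0 _ _).trans_lt (ENNReal.add_lt_top.2 ⟨f2.1, f4.1⟩))
      (by rw [← ht'.1]; linarith) k)

/-! ### Fourier coefficients of weak solutions -/

/-- Fourier coefficients of a real, zero-mean function in `L¹(0,T;Ȧ⁴)`. -/
structure CoeffPath (T : ℝ) (a : ℝ → ℤ → ℂ) : Prop where
  herm : ∀ t, Herm (a t)
  zero : ∀ t, a t 0 = 0
  meas : ∀ k, Measurable fun t => a t k
  fin : ∫⁻ t in Ioc 0 T, wnorm 4 (a t) < ⊤

lemma CoeffPath.ae_lt_top {T : ℝ} {a : ℝ → ℤ → ℂ} (h : CoeffPath T a) :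
    ∀ᵐ t ∂(volume.restrict (Ioc 0 T)), ∀ n ≤ 4, wnorm n (a t) < ⊤ := by
  filter_upwards [MeasureTheory.ae_lt_top (measurable_wnorm h.meas 4) h.fin.ne] with t ht n hn
  exact (wnorm_le_wnorm (h.zero t) hn).trans_lt ht

lemma CoeffPath.lintegral_lt_top {T : ℝ} {a : ℝ → ℤ → ℂ} (h : CoeffPath T a) {n : ℕ} (hn : n ≤ 4) :
    ∫⁻ t in Ioc 0 T, wnorm n (a t) < ⊤ :=
  (lintegral_mono fun t => wnorm_le_wnorm (h.zero t) hn).trans_lt h.fin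

/-- A function in `L¹(0,T;Ȧ⁴)` is given by a measurable path of Fourier coefficients. The coefficients
are computed from a jointly measurable representative, so that they depend measurably on time. -/
lemma exists_coeffPath {T : ℝ} {f : ℝ → ℝ → ℝ}
    (hf : Integrable (fun p : ℝ × ℝ => f p.1 p.2) (cylinder T))
    (hm : ∀ᵐ t ∂(volume.restrict (Ioc 0 T)), mean (f t) = 0)
    (h4 : MemBochner 1 T (wienerNorm 4) f) :
    ∃ a, CoeffPath T a ∧ ∀ᵐ t ∂(volume.restrict (Ioc 0 T)), f t =ᵐ[torus] retrig (a t) := by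
  set g := hf.aestronglyMeasurable.mk _ with hg
  have hgm : StronglyMeasurable g := hf.aestronglyMeasurable.stronglyMeasurable_mk
  set a : ℝ → ℤ → ℂ := fun t k => if k = 0 then 0 else fourierC (fun x => g (t, x)) k with ha
  have hmeas : ∀ k, Measurable fun t => a t k := fun k => by
    by_cases hk : k = 0
    · simp [ha, hk]
    simp only [ha, hk, if_false, fourierC_eq]
    have : StronglyMeasurable fun p : ℝ × ℝ => expo (-k) p.2 * (g p : ℂ) :=
      ((continuous_expo (-k)).comp continuous_snd).stronglyMeasurable.mul
        (Complex.continuous_ofReal.comp_stronglyMeasurable hgm)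
    exact (this.integral_prod_right' (ν := torus)).measurable.const_smul
      (1 / (2 * Real.pi) : ℝ)
  have hfa : ∀ᵐ t ∂(volume.restrict (Ioc 0 T)), Integrable (f t) torus ∧ mean (f t) = 0 ∧
      fourierC (f t) = a t := by
    filter_upwards [hf.prod_right_ae, hm, Measure.ae_ae_of_ae_prod hf.aestronglyMeasurable.ae_eq_mk]
      with t h1 h2 h3
    refine ⟨h1, h2, funext fun k => ?_⟩
    by_cases hk : k = 0
    · simp [ha, hk, fourierC_zero, h2]
    · simp only [ha, hk, if_false]
      exact fourierC_congr h3 k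
  have hN : ∀ᵐ t ∂(volume.restrict (Ioc 0 T)), wienerNorm 4 (f t) ^ (1 : ℝ) = wnorm 4 (a t) := by
    filter_upwards [hfa] with t ht
    rw [ENNReal.rpow_one, wienerNorm, if_pos ⟨ht.1, ht.2.1⟩, wnorm, ht.2.2]
    exact tsum_congr fun k => by norm_cast
  have hpath : CoeffPath T a := by
    refine ⟨fun t k => ?_, fun t => by simp [ha], hmeas, ?_⟩
    · by_cases hk : k = 0
      · simp [ha, hk]
      · simp only [ha, neg_eq_zero, hk, if_false]
        exact herm_fourierC _ k
    · rw [← lintegral_congr_ae hN]; exact h4.2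
  refine ⟨a, hpath, ?_⟩
  filter_upwards [hfa, hpath.ae_lt_top] with t ht hfin
  exact ae_eq_retrig ht.1 (fun k => congrFun ht.2.2 k) (hfin 0 (by norm_num))

lemma ae_cylinder_eq {T : ℝ} {F G : ℝ → ℝ → ℝ}
    (hF : AEStronglyMeasurable (fun p : ℝ × ℝ => F p.1 p.2) (cylinder T))
    (hG : AEStronglyMeasurable (fun p : ℝ × ℝ => G p.1 p.2) (cylinder T))
    (h : ∀ᵐ t ∂(volume.restrict (Ioc 0 T)), F t =ᵐ[torus] G t) :
    (fun p : ℝ × ℝ => F p.1 p.2) =ᵐ[cylinder T] fun p => G p.1 p.2 := by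
  have := ae_cylinder_bound (B := 0) (hF.sub hG) (by
    filter_upwards [h] with t ht
    filter_upwards [ht] with x hx
    simp [hx])
  filter_upwards [this] with p hp
  exact sub_eq_zero.1 (abs_nonpos_iff.1 hp)

/-- The weak derivatives of a function with known Fourier coefficients. -/
lemma IsSpaceDeriv.ae_eq {T : ℝ} {n : ℕ} (hn : n ≤ 4) {f F : ℝ → ℝ → ℝ} (h : IsSpaceDeriv T n f F)
    {a : ℝ → ℤ → ℂ} (ha : CoeffPath T a)
    (hf : ∀ᵐ t ∂(volume.restrict (Ioc 0 T)), f t =ᵐ[torus] retrig (a t)) :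
    ∀ᵐ t ∂(volume.restrict (Ioc 0 T)), F t =ᵐ[torus] retrig (dseq n (a t)) := by
  filter_upwards [h.2, hf, ha.ae_lt_top] with t ht hft hfin
  refine ae_eq_retrig ht.2.1 (fun k => ?_) (by rw [wnorm_dseq, zero_add]; exact hfin n hn)
  rw [fourierC_of_isWeakDeriv ht]
  simp only [dseq]
  rw [fourierC_congr hft, fourierC_retrig (ha.herm t) (hfin 0 (by norm_num))]

/-- Du Bois-Reymond: an integrated equation from its form tested with time-dependent functions. -/
lemma ae_eq_primitive_of_test {T : ℝ} {z r : ℝ → ℂ} {z₀ : ℂ} (hz : IntegrableOn z (Ioc 0 T))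
    (hr : IntegrableOn r (Ioc 0 T))
    (h : ∀ η : ℝ → ℝ, ContDiff ℝ 1 η → (∃ T' < T, ∀ t, T' ≤ t → η t = 0) →
      (η 0 : ℂ) * z₀ + (∫ t in Ioc 0 T, ((deriv η t : ℝ) : ℂ) * z t)
        + ∫ t in Ioc 0 T, (η t : ℂ) * r t = 0) :
    ∀ᵐ t ∂(volume.restrict (Ioc 0 T)), z t = z₀ + ∫ s in Ioc 0 t, r s := by
  set q : ℝ → ℂ := fun t => z₀ + ∫ s in Ioc 0 t, r s with hq
  rcases le_or_gt T 0 with hT | hT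
  · rw [Ioc_eq_empty (not_lt.2 hT), Measure.restrict_empty]; exact ae_zero.le (by simp)
  have hqi : IntegrableOn q (Ioc 0 T) := by
    have hc : ContinuousOn (fun t => ∫ s in Ioc 0 t, r s) (Icc 0 T) :=
      intervalIntegral.continuousOn_primitive
        ((integrableOn_Icc_iff_integrableOn_Ioc).2 hr)
    exact ((continuousOn_const.add hc).integrableOn_compact isCompact_Icc).mono_set Ioc_subset_Icc_self
  have key := isOpen_Ioo.ae_eq_zero_of_integral_contDiff_smul_eq_zero (μ := volume)
    (U := Ioo 0 T) (f := fun t => z t - q t)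
    (((hz.sub hqi).mono_set Ioo_subset_Ioc_self).locallyIntegrableOn) (fun ψ hψ hψc hψs => ?_)
  · rw [← restrict_Ioo_eq_restrict_Ioc]
    rw [ae_restrict_iff' measurableSet_Ioo]
    filter_upwards [key] with t ht htm
    exact sub_eq_zero.1 (ht htm)
  have hψ0 : ∀ t, t ∉ Ioo 0 T → ψ t = 0 := fun t ht =>
    image_eq_zero_of_notMem_tsupport fun h => ht (hψs h)
  obtain ⟨T', hT', hψT⟩ : ∃ T' < T, ∀ t, T' ≤ t → ψ t = 0 := by
    rcases (tsupport ψ).eq_empty_or_nonempty with he | hne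
    · exact ⟨T - 1, by linarith, fun t _ => image_eq_zero_of_notMem_tsupport (by simp [he])⟩
    · obtain ⟨M, hM⟩ := IsCompact.exists_isGreatest hψc hne
      refine ⟨(M + T) / 2, by linarith [(hψs hM.1).2], fun t ht => ?_⟩
      refine image_eq_zero_of_notMem_tsupport fun hts => ?_
      linarith [hM.2 hts, (hψs hM.1).2]
  -- the primitive of `ψ` vanishing near `T` is an admissible test function
  set η : ℝ → ℝ := fun t => ∫ s in T..t, ψ s with hη
  have hηd : ∀ t, HasDerivAt η (ψ t) t := fun t =>
    intervalIntegral.integral_hasDerivAt_right (hψ.continuous.intervalIntegrable _ _)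
      hψ.continuous.stronglyMeasurable.stronglyMeasurableAtFilter hψ.continuous.continuousAt
  have hηd' : deriv η = ψ := funext fun t => (hηd t).deriv
  have hηT : η T = 0 := by simp [hη]
  have hη1 : ContDiff ℝ 1 η := contDiff_one_iff_deriv.2
    ⟨fun t => (hηd t).differentiableAt, by rw [hηd']; exact hψ.continuous⟩
  have h1 := h η hη1 ⟨T', hT', fun t ht => by
    simp only [hη]
    rw [intervalIntegral.integral_congr (g := fun _ => (0 : ℝ)), intervalIntegral.integral_zero]
    intro s hs
    refine hψT s ?_
    rcases le_total T t with h | h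
    · rw [uIcc_of_le h] at hs; linarith [hs.1]
    · rw [uIcc_of_ge h] at hs; linarith [hs.1]⟩
  rw [hηd'] at h1
  have hηc : ∀ t, HasDerivAt (fun t => (η t : ℂ)) (ψ t : ℂ) t := fun t => (hηd t).ofReal_comp
  have hψcc : Continuous fun t => (ψ t : ℂ) := Complex.continuous_ofReal.comp hψ.continuous
  have h2 := integral_primitive_mul_deriv hr hηc hψcc
  rw [hηT] at h2
  have h3 : ∫ t in Ioc 0 T, (ψ t : ℂ) = -(η 0 : ℂ) := by
    rw [← intervalIntegral.integral_of_le hT.le,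
      intervalIntegral.integral_eq_sub_of_hasDerivAt (fun t _ => hηc t)
        (hψcc.intervalIntegrable _ _), hηT]
    simp
  have bdd : ∀ {w : ℝ → ℂ}, IntegrableOn w (Ioc 0 T) →
      IntegrableOn (fun t => (ψ t : ℂ) * w t) (Ioc 0 T) := by
    intro w hw
    obtain ⟨M, hM⟩ := hψc.exists_bound_of_continuous hψ.continuous
    exact Integrable.bdd_mul (c := M) hw hψcc.aestronglyMeasurable
      (ae_of_all _ fun t => by simpa using hM t)
  have hpi : IntegrableOn (fun t => ∫ s in Ioc 0 t, r s) (Ioc 0 T) := by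
    exact (hqi.integrable.sub (integrable_const z₀)).congr (ae_of_all _ fun t => by simp [hq])
  have e1 : ∫ t, ψ t • (z t - q t) = ∫ t in Ioc 0 T, (ψ t : ℂ) * (z t - q t) := by
    rw [← setIntegral_eq_integral_of_forall_compl_eq_zero (s := Ioc 0 T) fun t ht => by
      rw [hψ0 t fun h => ht (Ioo_subset_Ioc_self h), zero_smul]]
    simp only [Complex.real_smul]
  have e2 : ∫ t in Ioc 0 T, (ψ t : ℂ) * q t
      = (∫ t in Ioc 0 T, (ψ t : ℂ)) * z₀
        + ∫ t in Ioc 0 T, (∫ s in Ioc 0 t, r s) * (ψ t : ℂ) := by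
    rw [← integral_mul_const, ← integral_add]
    · refine integral_congr_ae (ae_of_all _ fun t => ?_)
      simp only [hq]; ring
    · exact bdd (integrable_const z₀)
    · exact (bdd hpi).integrable.congr (ae_of_all _ fun t => mul_comm _ _)
  have e3 : ∫ t in Ioc 0 T, r t * ((0 : ℝ) - (η t : ℂ)) = -∫ t in Ioc 0 T, (η t : ℂ) * r t := by
    rw [← integral_neg]
    refine integral_congr_ae (ae_of_all _ fun t => ?_)
    simp only [Complex.ofReal_zero]; ring
  have e4 : ∫ t in Ioc 0 T, (ψ t : ℂ) * (z t - q t)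
      = (∫ t in Ioc 0 T, (ψ t : ℂ) * z t) - ∫ t in Ioc 0 T, (ψ t : ℂ) * q t := by
    rw [← integral_sub (bdd hz) (bdd hqi)]
    simp only [mul_sub]
  rw [e1, e4, e2, h2, h3, e3]
  linear_combination h1

lemma integrable_mul_of_continuous {T : ℝ} {u : ℝ → ℝ → ℝ}
    (hu : Integrable (fun p : ℝ × ℝ => u p.1 p.2) (cylinder T)) {ψ : ℝ × ℝ → ℝ}
    (hψ : Continuous ψ) : Integrable (fun p : ℝ × ℝ => u p.1 p.2 * ψ p) (cylinder T) := by
  obtain ⟨M, hM⟩ := exists_bound_cylinder hψ T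
  refine Integrable.mul_bdd (c := M) hu hψ.aestronglyMeasurable ?_
  filter_upwards [hM] with p hp
  exact_mod_cast hp

lemma integrableOn_fourierC {T : ℝ} {u : ℝ → ℝ → ℝ}
    (hu : Integrable (fun p : ℝ × ℝ => u p.1 p.2) (cylinder T)) (k : ℤ) :
    IntegrableOn (fun t => fourierC (u t) k) (Ioc 0 T) := by
  have h1 : Integrable (fun p : ℝ × ℝ => ((u p.1 p.2 : ℝ) : ℂ) * expo (-k) p.2) (cylinder T) :=
    Integrable.mul_bdd (c := 1) hu.ofReal
      ((continuous_expo (-k)).comp continuous_snd).aestronglyMeasurable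
      (ae_of_all _ fun p => (norm_expo _ _).le)
  refine (h1.integral_prod_left.smul (1 / (2 * Real.pi) : ℝ)).congr (ae_of_all _ fun t => ?_)
  simp only [Pi.smul_apply, fourierC_eq, mul_comm]

/-- Testing with `η(t) Re(c e^{-ikx})`. -/
lemma integral_cylinder_mul_re_expo {T : ℝ} {u : ℝ → ℝ → ℝ}
    (hu : Integrable (fun p : ℝ × ℝ => u p.1 p.2) (cylinder T)) {η : ℝ → ℝ} (hη : Continuous η)
    (k : ℤ) (c : ℂ) : ∫ p, u p.1 p.2 * (η p.1 * (c * expo (-k) p.2).re) ∂(cylinder T)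
      = 2 * Real.pi * (c * ∫ t in Ioc 0 T, (η t : ℂ) * fourierC (u t) k).re := by
  have hcont : Continuous fun p : ℝ × ℝ => η p.1 * (c * expo (-k) p.2).re :=
    (hη.comp continuous_fst).mul (Complex.continuous_re.comp
      (continuous_const.mul ((continuous_expo (-k)).comp continuous_snd)))
  have hi : Integrable (fun t => (η t : ℂ) * fourierC (u t) k) (volume.restrict (Ioc 0 T)) := by
    refine (integrableOn_fourierC (u := fun t x => u t x * η t)
      (integrable_mul_of_continuous hu (hη.comp continuous_fst)) k).integrable.congr
      (ae_of_all _ fun t => ?_)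
    simp only [fourierC_eq, mul_smul_comm]
    rw [← integral_const_mul]
    congr 2; ext x; push_cast; ring
  have hre : (c * ∫ t in Ioc 0 T, (η t : ℂ) * fourierC (u t) k).re
      = ∫ t in Ioc 0 T, η t * (c * fourierC (u t) k).re := by
    rw [← integral_const_mul, ← RCLike.re_eq_complex_re, ← integral_re (hi.const_mul c)]
    refine integral_congr_ae (ae_of_all _ fun t => ?_)
    simp only [RCLike.re_eq_complex_re]
    rw [← Complex.re_ofReal_mul]; congr 1; ring
  rw [hre, ← integral_const_mul]
  have hF := integrable_mul_of_continuous hu hcont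
  rw [cylinder] at hF ⊢
  rw [integral_prod _ hF]
  refine integral_congr_ae ?_
  have hu' := hu
  rw [cylinder] at hu'
  filter_upwards [hu'.prod_right_ae] with t ht
  have := integral_mul_re_expo ht k c
  calc ∫ x, u t x * (η t * (c * expo (-k) x).re) ∂torus
      = η t * ∫ x, u t x * (c * expo (-k) x).re ∂torus := by
        rw [← integral_const_mul]; congr 1; ext x; ring
    _ = _ := by rw [this]; ring

lemma contDiff_one_re_expo (k : ℤ) (c : ℂ) : ContDiff ℝ 1 fun x => (c * expo k x).re :=
  (contDiff_re_expo k c).of_le (by exact_mod_cast le_top)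

lemma hasDerivAt_re_expo (k : ℤ) (c : ℂ) (x : ℝ) :
    HasDerivAt (fun x => (c * expo k x).re) (Complex.I * k * c * expo k x).re x := by
  have h := (contDiff_one_re_expo k c).differentiable (by norm_num) x |>.hasDerivAt
  have := congrFun (iteratedDeriv_re_expo k 1 c) x
  rw [iteratedDeriv_one, pow_one] at this
  rwa [this] at h

/-- The integrated mode equations of a weak solution, by testing with `η(t) Re(c e^{-ikx})`. -/
lemma ae_coeff_eq_of_weakIdentity {T : ℝ} {u₀ : ℝ → ℝ} (hu₀ : Integrable u₀ torus)
    {u J : ℝ → ℝ → ℝ} (hu : Integrable (fun p : ℝ × ℝ => u p.1 p.2) (cylinder T))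
    (hJ : Integrable (fun p : ℝ × ℝ => J p.1 p.2) (cylinder T)) (h : WeakIdentity T u₀ u J) (k : ℤ)
    (hz : IntegrableOn (fun t => fourierC (u t) k) (Ioc 0 T))
    (hr : IntegrableOn (fun t => fourierC (J t) k) (Ioc 0 T)) :
    ∀ᵐ t ∂(volume.restrict (Ioc 0 T)), fourierC (u t) k
      = fourierC u₀ k - (Complex.I * k) * ∫ s in Ioc 0 t, fourierC (J s) k := by
  have key := ae_eq_primitive_of_test (z₀ := fourierC u₀ k) hz (hr.const_mul (-(Complex.I * k)))
    (fun η hη hη0 => ?_)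
  · filter_upwards [key] with t ht
    rw [ht, integral_const_mul]; ring
  have hηc := hη.continuous
  have hηc' : Continuous (deriv η) := hη.continuous_deriv (by norm_num)
  have hre : ∀ c : ℂ, (c * ((η 0 : ℂ) * fourierC u₀ k
      + (∫ t in Ioc 0 T, ((deriv η t : ℝ) : ℂ) * fourierC (u t) k)
      + ∫ t in Ioc 0 T, (η t : ℂ) * (-(Complex.I * k) * fourierC (J t) k))).re = 0 := by
    intro c
    have ht := h (fun p => η p.1 * (c * expo (-k) p.2).re) ⟨?_, ?_, ?_⟩
    · have d1 : ∀ t x, deriv (fun t => η t * (c * expo (-k) x).re) t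
          = deriv η t * (c * expo (-k) x).re := fun t x =>
        ((hη.differentiable (by norm_num) t).hasDerivAt.mul_const _).deriv
      have d2 : ∀ t x, deriv (fun x => η t * (c * expo (-k) x).re) x
          = η t * (-(Complex.I * k) * c * expo (-k) x).re := fun t x => by
        rw [((hasDerivAt_re_expo (-k) c x).const_mul (η t)).deriv]
        push_cast; ring_nf
      simp only [d1, d2] at ht
      rw [integral_cylinder_mul_re_expo hu hηc', integral_cylinder_mul_re_expo hJ hηc] at ht
      have e0 : ∫ x, u₀ x * (η 0 * (c * expo (-k) x).re) ∂torus
          = 2 * Real.pi * (c * ((η 0 : ℂ) * fourierC u₀ k)).re := by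
        have := integral_mul_re_expo hu₀ k c
        calc _ = η 0 * ∫ x, u₀ x * (c * expo (-k) x).re ∂torus := by
              rw [← integral_const_mul]; congr 1; ext x; ring
          _ = _ := by
            rw [this, show c * ((η 0 : ℂ) * fourierC u₀ k) = (η 0 : ℂ) * (c * fourierC u₀ k) by ring,
              Complex.re_ofReal_mul]; ring
      rw [e0] at ht
      have e1 : ∫ t in Ioc 0 T, (η t : ℂ) * (-(Complex.I * k) * fourierC (J t) k)
          = -(Complex.I * k) * ∫ t in Ioc 0 T, (η t : ℂ) * fourierC (J t) k := by
        rw [← integral_const_mul]; congr 1; ext t; ring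
      rw [e1, mul_add, mul_add, Complex.add_re, Complex.add_re, ← mul_assoc c (-(Complex.I * k)),
        mul_comm c (-(Complex.I * k))]
      have hpi : (2 * Real.pi) ≠ 0 := by positivity
      refine (mul_eq_zero.1 (?_ : 2 * Real.pi * _ = 0)).resolve_left hpi
      linear_combination -ht
    · exact (hη.comp contDiff_fst).mul ((contDiff_one_re_expo (-k) c).comp contDiff_snd)
    · intro t x; simp only [expo_periodic (-k) x]
    · obtain ⟨T', hT', h0⟩ := hη0
      exact ⟨T', hT', fun t x ht => by simp [h0 t ht]⟩
  refine Complex.ext ?_ ?_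
  · simpa using hre 1
  · have := hre (-Complex.I)
    simpa using this

lemma CoeffPath.lintegral_vel_lt_top {T : ℝ} {a b : ℝ → ℤ → ℂ} (ha : CoeffPath T a)
    (hb : CoeffPath T b) (α β γ δ : ℝ) {n : ℕ} (hn : n ≤ 1) :
    ∫⁻ t in Ioc 0 T, wnorm n (vel α β γ δ (a t) (b t)) < ⊤ := by
  refine (lintegral_mono fun t => (wnorm_vel n α β γ δ _ _).le.trans
    (wnorm_sym_le n α β γ δ (ha.zero t) (hb.zero t))).trans_lt ?_
  rw [lintegral_const_mul' _ _ (symC_ne_top α β γ δ),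
    lintegral_add_left (measurable_wnorm ha.meas _)]
  exact ENNReal.mul_lt_top (symC_ne_top α β γ δ).lt_top (ENNReal.add_lt_top.2
    ⟨ha.lintegral_lt_top (by omega), hb.lintegral_lt_top (by omega)⟩)

/-- The weak form of one equation, in terms of Fourier coefficients. -/
lemma transported_of_weakIdentity {T m α β γ δ : ℝ} {u₀ : ℝ → ℝ} {p₀ : ℤ → ℂ} (hp₀ : Herm p₀)
    (hz₀ : p₀ 0 = 0) (hfin₀ : wnorm 0 p₀ < ⊤) (hu₀ : u₀ =ᵐ[torus] retrig p₀)
    {p a b : ℝ → ℤ → ℂ} (hp : CoeffPath T p) (ha : CoeffPath T a) (hb : CoeffPath T b)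
    {u f₁ f₃ g₁ g₃ f g : ℝ → ℝ → ℝ} (hu : Integrable (fun p : ℝ × ℝ => u p.1 p.2) (cylinder T))
    (hup : ∀ᵐ t ∂(volume.restrict (Ioc 0 T)), u t =ᵐ[torus] retrig (p t))
    (hfa : ∀ᵐ t ∂(volume.restrict (Ioc 0 T)), f t =ᵐ[torus] retrig (a t))
    (hgb : ∀ᵐ t ∂(volume.restrict (Ioc 0 T)), g t =ᵐ[torus] retrig (b t))
    (hf₁ : IsSpaceDeriv T 1 f f₁) (hf₃ : IsSpaceDeriv T 3 f f₃)
    (hg₁ : IsSpaceDeriv T 1 g g₁) (hg₃ : IsSpaceDeriv T 3 g g₃) {J : ℝ → ℝ → ℝ}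
    (hJ : J = fun t x => (u t x + m) * (α * f₃ t x + β * g₃ t x - γ * f₁ t x - δ * g₁ t x))
    (hJi : Integrable (fun p : ℝ × ℝ => J p.1 p.2) (cylinder T)) (h : WeakIdentity T u₀ u J) :
    Transported T m p₀ p fun t => vel α β γ δ (a t) (b t) := by
  have hvm := fun k => measurable_vel ha.meas hb.meas α β γ δ k
  have hv0 := ha.lintegral_vel_lt_top hb α β γ δ (n := 0) (by norm_num)
  have hJa : ∀ᵐ t ∂(volume.restrict (Ioc 0 T)),
      J t =ᵐ[torus] fun x => (retrig (p t) x + m) * retrig (vel α β γ δ (a t) (b t)) x := by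
    filter_upwards [hup, hf₁.ae_eq (by norm_num) ha hfa, hf₃.ae_eq (by norm_num) ha hfa,
      hg₁.ae_eq (by norm_num) hb hgb, hg₃.ae_eq (by norm_num) hb hgb, ha.ae_lt_top, hb.ae_lt_top]
      with t h0 h1 h2 h3 h4 hfa hfb
    filter_upwards [h0, h1, h2, h3, h4] with x h0 h1 h2 h3 h4
    rw [retrig_vel (ha.zero t) (hb.zero t) (hfa 4 le_rfl) (hfb 4 le_rfl), hJ]
    simp only [h0, h1, h2, h3, h4]
  have hprod : AEStronglyMeasurable (fun z : ℝ × ℝ => (retrig (p z.1) z.2 + m)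
      * retrig (vel α β γ δ (a z.1) (b z.1)) z.2) (cylinder T) := by
    refine AEStronglyMeasurable.mul ((aestronglyMeasurable_retrig hp.meas ?_).add_const m)
      (aestronglyMeasurable_retrig hvm ?_)
    · filter_upwards [hp.ae_lt_top] with t ht using ht 0 (by norm_num)
    · exact ae_lt_top (measurable_wnorm hvm 0) hv0.ne
  have hu₀i : Integrable u₀ torus :=
    (integrable_of_continuous_torus (continuous_retrig hfin₀)).congr hu₀.symm
  refine ⟨hp₀, hz₀, hfin₀, hp.herm, hp.zero, hp.meas, hvm, hp.lintegral_lt_top (by norm_num), hv0,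
    ha.lintegral_vel_lt_top hb α β γ δ le_rfl,
    hJi.congr (ae_cylinder_eq (G := fun t x => (retrig (p t) x + m)
      * retrig (vel α β γ δ (a t) (b t)) x) hJi.aestronglyMeasurable hprod hJa), fun k => ?_⟩
  filter_upwards [ae_coeff_eq_of_weakIdentity hu₀i hu hJi h k (integrableOn_fourierC hu k)
    (integrableOn_fourierC hJi k), hup, hp.ae_lt_top, ae_restrict_mem measurableSet_Ioc]
    with t ht hut hfin htm
  rw [fourierC_congr hut, fourierC_retrig (hp.herm t) (hfin 0 (by norm_num)), fourierC_congr hu₀,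
    fourierC_retrig hp₀ hfin₀] at ht
  rw [ht]
  congr 2
  refine setIntegral_congr_ae₀ measurableSet_Ioc.nullMeasurableSet ?_
  have := (ae_restrict_iff' measurableSet_Ioc).1 hJa
  filter_upwards [this] with s hs hsm
  exact fourierC_congr (hs ⟨hsm.1, hsm.2.trans htm.2⟩) k

lemma IsWeakSolution.transported {P : Params} {mf mg T : ℝ} {f₀ g₀ : ℝ → ℝ} {f g : ℝ → ℝ → ℝ}
    (h : IsWeakSolution P mf mg f₀ g₀ T f g) {a₀ b₀ : ℤ → ℂ} (hA₀ : Herm a₀) (hB₀ : Herm b₀)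
    (ha₀ : a₀ 0 = 0) (hb₀ : b₀ 0 = 0) (hfa₀ : wnorm 0 a₀ < ⊤) (hfb₀ : wnorm 0 b₀ < ⊤)
    (hf₀ : f₀ =ᵐ[torus] retrig a₀) (hg₀ : g₀ =ᵐ[torus] retrig b₀) {a b : ℝ → ℤ → ℂ}
    (ha : CoeffPath T a) (hb : CoeffPath T b)
    (hfa : ∀ᵐ t ∂(volume.restrict (Ioc 0 T)), f t =ᵐ[torus] retrig (a t))
    (hgb : ∀ᵐ t ∂(volume.restrict (Ioc 0 T)), g t =ᵐ[torus] retrig (b t)) :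
    (Transported T mf a₀ a fun t => vel P.Aγ P.A P.bρ P.b (a t) (b t)) ∧
      Transported T mg b₀ b fun t => vel P.Aμ P.Aμ P.bμ P.bμ (a t) (b t) := by
  obtain ⟨hf, hg, -, f₁, f₃, g₁, g₃, J, K, hf₁, hf₃, hg₁, hg₃, hJ, hK, hJi, hKi, hwJ, hwK⟩ := h
  exact ⟨transported_of_weakIdentity hA₀ ha₀ hfa₀ hf₀ ha ha hb hf hfa hfa hgb hf₁ hf₃ hg₁ hg₃ hJ
      hJi hwJ,
    transported_of_weakIdentity hB₀ hb₀ hfb₀ hg₀ hb ha hb hg hgb hfa hgb hf₁ hf₃ hg₁ hg₃ hK hKi hwK⟩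

/-- Every weak solution in `L¹(0,T;Ȧ⁴)` is given by the coefficients constructed by approximation. -/
lemma IsWeakSolution.ae_eq_modeSolution {P : Params} (hP : P.Pos) {mf mg T : ℝ} {E : ℝ≥0}
    (hT : 0 < T) (hEf : E ≤ mf) (hEg : E ≤ mg) (h1A : 0 < P.σ1A mf mg E) (h2A : 0 < P.σ2A mf mg E)
    {f₀ g₀ : ℝ → ℝ} {f g : ℝ → ℝ → ℝ} (h : IsWeakSolution P mf mg f₀ g₀ T f g)
    (hf4 : MemBochner 1 T (wienerNorm 4) f) (hg4 : MemBochner 1 T (wienerNorm 4) g)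
    {a₀ b₀ : ℤ → ℂ} (hA₀ : Herm a₀) (hB₀ : Herm b₀)
    (ha₀ : a₀ 0 = 0) (hb₀ : b₀ 0 = 0) (hfa₀ : wnorm 0 a₀ < ⊤) (hfb₀ : wnorm 0 b₀ < ⊤)
    (hf₀ : f₀ =ᵐ[torus] retrig a₀) (hg₀ : g₀ =ᵐ[torus] retrig b₀) {a' b' : ℝ → ℤ → ℂ}
    (hs : ModeSolution P mf mg E a₀ b₀ a' b') :
    (fun p : ℝ × ℝ => f p.1 p.2) =ᵐ[cylinder T] (fun p => retrig (a' p.1) p.2) ∧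
      (fun p : ℝ × ℝ => g p.1 p.2) =ᵐ[cylinder T] fun p => retrig (b' p.1) p.2 := by
  obtain ⟨a, ha, hfa⟩ := exists_coeffPath h.1 (h.2.2.1.mono fun t ht => ht.1) hf4
  obtain ⟨b, hb, hgb⟩ := exists_coeffPath h.2.1 (h.2.2.1.mono fun t ht => ht.2) hg4
  have hdis := (hs.dissipation T).trans_lt ENNReal.ofReal_lt_top
  have ha' : CoeffPath T a' := ⟨hs.hermA, hs.zeroA, hs.measA,
    (lintegral_mono fun t => le_self_add).trans_lt hdis⟩
  have hb' : CoeffPath T b' := ⟨hs.hermB, hs.zeroB, hs.measB,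
    (lintegral_mono fun t => le_add_self).trans_lt hdis⟩
  have h' := hs.isWeakSolution hfa₀ hfb₀ hA₀ hB₀ hf₀ hg₀ hT
  obtain ⟨t1, t2⟩ := h.transported hA₀ hB₀ ha₀ hb₀ hfa₀ hfb₀ hf₀ hg₀ ha hb hfa hgb
  obtain ⟨t3, t4⟩ := h'.transported hA₀ hB₀ ha₀ hb₀ hfa₀ hfb₀ hf₀ hg₀ ha' hb'
    (ae_of_all _ fun t => ae_eq_refl _) (ae_of_all _ fun t => ae_eq_refl _)
  have key := Transported.ae_eq P hP hEf hEg h1A h2A t1 t2 t3 t4 ha.fin hb.fin ha'.fin hb'.fin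
    hs.boundA hs.boundB
  refine ⟨ae_cylinder_eq (G := fun t => retrig (a' t)) h.1.aestronglyMeasurable
    h'.1.aestronglyMeasurable ?_, ae_cylinder_eq (G := fun t => retrig (b' t))
    h.2.1.aestronglyMeasurable h'.2.1.aestronglyMeasurable ?_⟩
  · filter_upwards [key, hfa] with t ht hft
    rwa [← ht.1]
  · filter_upwards [key, hgb] with t ht hgt
    rwa [← ht.2]

lemma fluct_coeff {u : ℝ → ℝ} (hu : Integrable u torus) (hA : wienerNorm 0 (fluct u) < ⊤) :
    fourierC (fluct u) 0 = 0 ∧ wnorm 0 (fourierC (fluct u)) = wienerNorm 0 (fluct u) ∧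
      fluct u =ᵐ[torus] retrig (fourierC (fluct u)) := by
  have hi : Integrable (fluct u) torus := hu.sub (integrable_const _)
  have hw : wnorm 0 (fourierC (fluct u)) = wienerNorm 0 (fluct u) := by
    rw [wienerNorm, if_pos ⟨hi, mean_fluct hu⟩, wnorm]
    exact tsum_congr fun k => by simp
  refine ⟨by simp [fourierC_zero, mean_fluct hu], hw, ae_eq_retrig hi (fun _ => rfl) (hw ▸ hA)⟩

end ThinFilm

end

theorem theorem1 (P : ThinFilm.Params) (hP : P.Pos)
    (f₀ g₀ : ℝ → ℝ)
    (hf₀ : MeasureTheory.Integrable f₀ ThinFilm.torus)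
    (hg₀ : MeasureTheory.Integrable g₀ ThinFilm.torus)
    (hfA : ThinFilm.wienerNorm 0 (ThinFilm.fluct f₀) < ⊤)
    (hgA : ThinFilm.wienerNorm 0 (ThinFilm.fluct g₀) < ⊤)
    (mf mg E₀ : ℝ)
    (hmf : mf = ThinFilm.mean f₀) (hmg : mg = ThinFilm.mean g₀)
    (hE₀ : E₀ = ThinFilm.energy 0 (ThinFilm.fluct f₀) (ThinFilm.fluct g₀))
    (hsize : E₀ < min mf mg)
    (hσ1A : 0 < P.σ1A mf mg E₀) (hσ2A : 0 < P.σ2A mf mg E₀)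
    (hσ1b : 0 < P.σ1b mf mg E₀) (hσ2b : 0 < P.σ2b mf mg E₀) :
    (∃ f g : ℝ → ℝ → ℝ,
      (∀ T : ℝ, 0 < T →
        ThinFilm.IsWeakSolution P mf mg (ThinFilm.fluct f₀) (ThinFilm.fluct g₀) T f g ∧
        ThinFilm.HasRegularity T f ∧ ThinFilm.HasRegularity T g) ∧
      (∀ T : ℝ, 0 ≤ T →
        MeasureTheory.eLpNorm (f T) ⊤ ThinFilm.torus
            + MeasureTheory.eLpNorm (g T) ⊤ ThinFilm.torus
          ≤ ENNReal.ofReal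
              (E₀ * Real.exp (-(P.δA mf mg E₀ + P.δb mf mg E₀) * T)))) ∧
    (∀ T : ℝ, 0 < T → ∀ f g f' g' : ℝ → ℝ → ℝ,
      ThinFilm.IsWeakSolution P mf mg (ThinFilm.fluct f₀) (ThinFilm.fluct g₀) T f g →
      ThinFilm.IsWeakSolution P mf mg (ThinFilm.fluct f₀) (ThinFilm.fluct g₀) T f' g' →
      ThinFilm.MemBochner 1 T (ThinFilm.wienerNorm 4) f →
      ThinFilm.MemBochner 1 T (ThinFilm.wienerNorm 4) g →
      ThinFilm.MemBochner 1 T (ThinFilm.wienerNorm 4) f' →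
      ThinFilm.MemBochner 1 T (ThinFilm.wienerNorm 4) g' →
      (fun p : ℝ × ℝ => f p.1 p.2) =ᵐ[ThinFilm.cylinder T] (fun p : ℝ × ℝ => f' p.1 p.2) ∧
      (fun p : ℝ × ℝ => g p.1 p.2) =ᵐ[ThinFilm.cylinder T] (fun p : ℝ × ℝ => g' p.1 p.2)) := by
  obtain ⟨ha₀, hwa, hfa⟩ := ThinFilm.fluct_coeff hf₀ hfA
  obtain ⟨hb₀, hwb, hgb⟩ := ThinFilm.fluct_coeff hg₀ hgA
  have hA₀ := ThinFilm.herm_fourierC (ThinFilm.fluct f₀)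
  have hB₀ := ThinFilm.herm_fourierC (ThinFilm.fluct g₀)
  have hfa₀ := hwa ▸ hfA
  have hfb₀ := hwb ▸ hgA
  have hE : 0 ≤ E₀ := by
    rw [hE₀]; exact add_nonneg ENNReal.toReal_nonneg ENNReal.toReal_nonneg
  have hEw : ThinFilm.wnorm 0 (ThinFilm.fourierC (ThinFilm.fluct f₀))
      + ThinFilm.wnorm 0 (ThinFilm.fourierC (ThinFilm.fluct g₀)) ≤ ENNReal.ofReal E₀ := by
    rw [hE₀, ThinFilm.energy, ENNReal.ofReal_add ENNReal.toReal_nonneg ENNReal.toReal_nonneg,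
      ENNReal.ofReal_toReal hfA.ne, ENNReal.ofReal_toReal hgA.ne, hwa, hwb]
  have hEf : E₀ ≤ mf := hsize.le.trans (min_le_left _ _)
  have hEg : E₀ ≤ mg := hsize.le.trans (min_le_right _ _)
  lift E₀ to ℝ≥0 using hE with E
  obtain ⟨a, b, h⟩ := ThinFilm.exists_modeSolution P hP ((NNReal.coe_nonneg E).trans hEf)
    ((NNReal.coe_nonneg E).trans hEg) hσ1A hσ2A hσ1b hσ2b hA₀ hB₀ ha₀ hb₀
    (NNReal.coe_nonneg E) hEw
  have hdis := fun T => (h.dissipation T).trans_lt ENNReal.ofReal_lt_top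
  refine ⟨⟨fun t => ThinFilm.retrig (a t), fun t => ThinFilm.retrig (b t), fun T hT =>
    ⟨h.isWeakSolution hfa₀ hfb₀ hA₀ hB₀ hfa hgb hT,
      ThinFilm.hasRegularity_retrig h.hermA h.measA h.zeroA h.boundA
        ((lintegral_mono fun t => le_self_add).trans_lt (hdis T)),
      ThinFilm.hasRegularity_retrig h.hermB h.measB h.zeroB h.boundB
        ((lintegral_mono fun t => le_add_self).trans_lt (hdis T))⟩,
    fun T hT => h.eLpNorm_le hT⟩, ?_⟩
  intro T hT f g f' g' hs hs' hf4 hg4 hf4' hg4'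
  have h1 := hs.ae_eq_modeSolution hP hT hEf hEg hσ1A hσ2A hf4 hg4 hA₀ hB₀ ha₀ hb₀ hfa₀ hfb₀ hfa hgb h
  have h2 := hs'.ae_eq_modeSolution hP hT hEf hEg hσ1A hσ2A hf4' hg4' hA₀ hB₀ ha₀ hb₀ hfa₀ hfb₀ hfa
    hgb h
  exact ⟨h1.1.trans h2.1.symm, h1.2.trans h2.2.symm⟩
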